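/- **Notation.** $\Delta$ is the open unit disc in $\mathbb C$, $b\Delta$ the unit circle. For an integer $k\ge 0$ and $0<\alpha<1$, $\mathcal C^{k,\alpha}$ is the space of real functions of class $C^{k,\alpha}$ on $b\Delta$ with the norm $\sum_{j\le k}\|f^{(j)}\|_\infty+\sup_{\zeta\ne\eta}|f^{(k)}(\zeta)-f^{(k)}(\eta)|/|\zeta-\eta|^\alpha$ (derivatives with respect to the angle), $\mathcal C^{k,\alpha}_{\mathbb C}=\mathcal C^{k,\alpha}+i\,\mathcal C^{k,\alpha}$ with the norm $\|\mathrm{Re} f\|+\|\mathrm{Im} f\|$, and $\mathcal A^{k,\alpha}\subset\mathcal C^{k,\alpha}_{\mathbb C}$ is the subspace of traces of functions continuous on $\overline\Delta$ and holomorphic on $\Delta$. The space $(1-\zeta)\mathcal A^{k,\alpha}$ carries the norm $\|(1-\zeta)\tilde f\|=\|\tilde f\|_{\mathcal C^{k,\alpha}_{\mathbb C}}$, and $Y=\mathcal C^{k,\alpha}\times(1-\zeta)\mathcal A^{k,\alpha}\times(1-\zeta)\mathcal A^{k,\alpha}$ carries the sum of the three norms. **Model.** Let $d,k_0$ be integers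 with $d/2\le k_0\le d-1$ and let $$P(z,\bar z)=\sum_{j=d-k_0}^{k_0}\alpha_j z^j\bar z^{d-j},\qquad \alpha_j=\overline{\alpha_{d-j}},\quad \alpha_{k_0}\neq0,$$ be subharmonic, with $P_{z\bar z}(z)\ne0$ for all $z\neq 0$. Put $\rho(z,w)=-\mathrm{Re}\,w+P(z,\bar z)$. Let $f_0=(h_0,g_0)$, where $h_0(\zeta)=1-\zeta$ and $g_0$ is the holomorphic polynomial with $g_0(1)=0$ and $\mathrm{Re}\,g_0(\zeta)=P(1-\zeta,1-\bar\zeta)$ on $b\Delta$. Let $\delta>0$ be such that $f_0(\overline\Delta)\subset(\delta\Delta)^2$. **Perturbations.** $X$ is the affine space of all functions $r(z,w)=\rho(z,w)+\theta(z,\mathrm{Im}\,w)$ on $\overline{\delta\Delta}^2$, with $\theta$ real valued on $\overline{\delta\Delta}\times[-\delta,\delta]$ of the form $$\theta(z,y)=\sum_{i+j=d+1}z^i\bar z^j r_{ij0}(z)+\sum_{l=1}^{d-1}\ \sum_{i+j=d-l}z^i\bar z^j y^l\, r_{ijl}(z,y)+\theta_1(y),$$ where $r_{ij0}\in C^{k+3}(\overline{\delta\Delta},\mathbb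 C)$, $r_{ijl}\in C^{k+3}(\overline{\delta\Delta}\times[-\delta,\delta],\mathbb C)$, $\theta_1\in C^{k+3}([-\delta,\delta],\mathbb R)$ and $\theta_1(y)=O(y^2)$ as $y\to0$. Its topology and differentiable structure are those given by the norm of $\theta$ which is the infimum, over all such representations of $\theta$, of the largest of the $C^{k+3}$ norms of the coefficients $r_{ijl}$ and of $\theta_1$. **Discs.** For $r\in X$, $\mathcal S^r_0$ is the set of pairs $(c,f)$ such that $f\in(\mathcal A^{k,\alpha})^2$, $f(b\Delta)\subset\{p\in(\delta\Delta)^2: r(p)=0\}$, $f(1)=0$, $c:b\Delta\to\mathbb R\setminus\{0\}$ is continuous, and both components of $\zeta^{k_0}c(\zeta)\,\big(\tfrac{\partial r}{\partial z},\tfrac{\partial r}{\partial w}\big)(f(\zeta))$, $\zeta\in b\Delta$, belong to $\mathcal A^{k,\alpha}$ (lifts of $k_0$-stationary discs attached to $\{r=0\}$ and tied to the origin). **Theorem.** For every integer $k\ge0$ and every $0<\alpha<1$ there are an open neighborhood $V$ of $\rho$ in $X$, an open neighborhood $U$ of $0$ in $\mathbb R^{4k_0-d+3}$, a number $\eta>0$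 and a map $\mathcal F:V\times U\to Y$ of class $C^1$ such that 1. $\mathcal F(\rho,0)=(1,f_0)$; 2. for every $r\in V$, the map $\mathcal F(r,\cdot)$ is a bijection from $U$ onto $\{(c,f)\in Y:\ (c,f)\in\mathcal S^r_0,\ \|(c,f)-(1,f_0)\|_Y<\eta\}$. -/

import Mathlib

noncomputable section

namespace KStat

/-! ### Hölder spaces on the unit circle -/

/-- The `j`-th derivative `u^{(j)}` of a function on the unit circle with respect to the
angle, at `e^{iθ}`. -/
def circDeriv (j : ℕ) (u : Circle → ℝ) (θ : ℝ) : ℝ :=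
  iteratedDeriv j (fun t : ℝ => u (Circle.exp t)) θ

/-- The distance `|e^{is} - e^{it}|`. -/
def chord (p : ℝ × ℝ) : ℝ := ‖(Circle.exp p.1 : ℂ) - (Circle.exp p.2 : ℂ)‖

/-- `u` is of class `C^{k,α}` on the unit circle. -/
def IsHolder (k : ℕ) (α : ℝ) (u : Circle → ℝ) : Prop :=
  ContDiff ℝ k (fun t : ℝ => u (Circle.exp t)) ∧
    ∃ C : ℝ, ∀ p : ℝ × ℝ, |circDeriv k u p.1 - circDeriv k u p.2| ≤ C * chord p ^ α

/-- `∑_{j ≤ k} sup |u^{(j)}| + sup |u^{(k)}(ζ) - u^{(k)}(η)| / |ζ - η|^α`. -/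
def holderNorm (k : ℕ) (α : ℝ) (u : Circle → ℝ) : ℝ :=
  (∑ j ∈ Finset.range (k + 1), ⨆ θ : ℝ, |circDeriv j u θ|) +
    ⨆ p : ℝ × ℝ, |circDeriv k u p.1 - circDeriv k u p.2| / chord p ^ α

theorem circDeriv_add {k : ℕ} {α : ℝ} {u v : Circle → ℝ} (hu : IsHolder k α u)
    (hv : IsHolder k α v) {j : ℕ} (hj : j ≤ k) (θ : ℝ) :
    circDeriv j (u + v) θ = circDeriv j u θ + circDeriv j v θ := by
  have hj' : (j : WithTop ℕ∞) ≤ k := by exact_mod_cast hj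
  exact iteratedDeriv_fun_add (hu.1.of_le hj').contDiffAt (hv.1.of_le hj').contDiffAt

theorem circDeriv_smul (c : ℝ) (u : Circle → ℝ) (j : ℕ) (θ : ℝ) :
    circDeriv j (c • u) θ = c * circDeriv j u θ := by
  unfold circDeriv
  simp only [Pi.smul_apply, smul_eq_mul]
  exact iteratedDeriv_const_mul_field c _

theorem chord_rpow_nonneg (α : ℝ) (p : ℝ × ℝ) : 0 ≤ chord p ^ α :=
  Real.rpow_nonneg (norm_nonneg _) α

theorem IsHolder.add {k : ℕ} {α : ℝ} {u v : Circle → ℝ} (hu : IsHolder k α u)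
    (hv : IsHolder k α v) : IsHolder k α (u + v) := by
  obtain ⟨C, hC⟩ := hu.2
  obtain ⟨D, hD⟩ := hv.2
  refine ⟨hu.1.add hv.1, C + D, fun p => ?_⟩
  rw [circDeriv_add hu hv le_rfl, circDeriv_add hu hv le_rfl, add_mul]
  refine le_trans ?_ (add_le_add (hC p) (hD p))
  rw [add_sub_add_comm]
  exact abs_add_le _ _

theorem IsHolder.smul {k : ℕ} {α : ℝ} {u : Circle → ℝ} (c : ℝ) (hu : IsHolder k α u) :
    IsHolder k α (c • u) := by
  obtain ⟨C, hC⟩ := hu.2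
  refine ⟨contDiff_const.mul hu.1, |c| * C, fun p => ?_⟩
  rw [circDeriv_smul, circDeriv_smul, ← mul_sub, abs_mul, mul_assoc]
  exact mul_le_mul_of_nonneg_left (hC p) (abs_nonneg c)

theorem isHolder_const (k : ℕ) (α : ℝ) (c : ℝ) : IsHolder k α (fun _ => c) := by
  refine ⟨contDiff_const, 0, fun p => ?_⟩
  simp [circDeriv, iteratedDeriv_const]

theorem IsHolder.bddAbove_deriv {k : ℕ} {α : ℝ} {u : Circle → ℝ} (hu : IsHolder k α u)
    {j : ℕ} (hj : j ≤ k) : BddAbove (Set.range fun θ : ℝ => |circDeriv j u θ|) := by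
  have hj' : (j : WithTop ℕ∞) ≤ k := by exact_mod_cast hj
  have hper : Function.Periodic (circDeriv j u) (2 * Real.pi) := by
    intro θ
    have h := congrFun (iteratedDeriv_comp_add_const j (fun t : ℝ => u (Circle.exp t))
      (2 * Real.pi)) θ
    simp only [Circle.exp_add_two_pi] at h
    exact h.symm
  have hb := (hper.compact_of_continuous Real.two_pi_pos.ne'
    (hu.1.continuous_iteratedDeriv j hj')).isBounded
  obtain ⟨C, hC⟩ := hb.exists_norm_le
  refine ⟨C, ?_⟩
  rintro _ ⟨θ, rfl⟩
  exact hC _ ⟨θ, rfl⟩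

theorem IsHolder.bddAbove_quot {k : ℕ} {α : ℝ} {u : Circle → ℝ} (hu : IsHolder k α u) :
    BddAbove (Set.range fun p : ℝ × ℝ =>
      |circDeriv k u p.1 - circDeriv k u p.2| / chord p ^ α) := by
  obtain ⟨C, hC⟩ := hu.2
  refine ⟨max C 0, ?_⟩
  rintro _ ⟨p, rfl⟩
  exact div_le_of_le_mul₀ (chord_rpow_nonneg α p) (le_max_right _ _)
    ((hC p).trans (mul_le_mul_of_nonneg_right (le_max_left _ _) (chord_rpow_nonneg α p)))

theorem holderNorm_nonneg (k : ℕ) (α : ℝ) (u : Circle → ℝ) : 0 ≤ holderNorm k α u :=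
  add_nonneg (Finset.sum_nonneg fun _ _ => Real.iSup_nonneg fun _ => abs_nonneg _)
    (Real.iSup_nonneg fun p => div_nonneg (abs_nonneg _) (chord_rpow_nonneg α p))

theorem holderNorm_smul (k : ℕ) (α : ℝ) (c : ℝ) (u : Circle → ℝ) :
    holderNorm k α (c • u) = |c| * holderNorm k α u := by
  unfold holderNorm
  simp only [circDeriv_smul, ← mul_sub, abs_mul, mul_div_assoc]
  rw [mul_add, Finset.mul_sum, Real.mul_iSup_of_nonneg (abs_nonneg c)]
  simp only [Real.mul_iSup_of_nonneg (abs_nonneg c)]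

theorem holderNorm_add_le {k : ℕ} {α : ℝ} {u v : Circle → ℝ} (hu : IsHolder k α u)
    (hv : IsHolder k α v) : holderNorm k α (u + v) ≤ holderNorm k α u + holderNorm k α v := by
  unfold holderNorm
  rw [add_add_add_comm, ← Finset.sum_add_distrib]
  refine add_le_add (Finset.sum_le_sum fun j hj => ?_) (ciSup_le fun p => ?_)
  · have hj' : j ≤ k := Nat.lt_succ_iff.1 (Finset.mem_range.1 hj)
    refine ciSup_le fun θ => ?_
    rw [circDeriv_add hu hv hj']
    exact (abs_add_le _ _).trans (add_le_add (le_ciSup (hu.bddAbove_deriv hj') θ)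
      (le_ciSup (hv.bddAbove_deriv hj') θ))
  · rw [circDeriv_add hu hv le_rfl, circDeriv_add hu hv le_rfl, add_sub_add_comm]
    refine le_trans (div_le_div_of_nonneg_right (abs_add_le _ _) (chord_rpow_nonneg α p)) ?_
    rw [add_div]
    exact add_le_add (le_ciSup hu.bddAbove_quot p) (le_ciSup hv.bddAbove_quot p)

theorem abs_le_holderNorm {k : ℕ} {α : ℝ} {u : Circle → ℝ} (hu : IsHolder k α u) (ζ : Circle) :
    |u ζ| ≤ holderNorm k α u := by
  have h1 : |u ζ| ≤ ⨆ θ : ℝ, |circDeriv 0 u θ| := by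
    have h := le_ciSup (hu.bddAbove_deriv (Nat.zero_le k)) (Complex.arg (ζ : ℂ))
    simpa [circDeriv] using h
  have h2 : (⨆ θ : ℝ, |circDeriv 0 u θ|) ≤
      ∑ j ∈ Finset.range (k + 1), ⨆ θ : ℝ, |circDeriv j u θ| :=
    Finset.single_le_sum (f := fun j => ⨆ θ : ℝ, |circDeriv j u θ|)
      (fun _ _ => Real.iSup_nonneg fun _ => abs_nonneg _) (Finset.mem_range.2 (Nat.succ_pos k))
  have h3 : (0 : ℝ) ≤ ⨆ p : ℝ × ℝ, |circDeriv k u p.1 - circDeriv k u p.2| / chord p ^ α :=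
    Real.iSup_nonneg fun p => div_nonneg (abs_nonneg _) (chord_rpow_nonneg α p)
  unfold holderNorm
  linarith

/-- The real vector space of real functions of class `C^{k,α}` on the circle. -/
def holderSubmodule (k : ℕ) (α : ℝ) : Submodule ℝ (Circle → ℝ) where
  carrier := {u | IsHolder k α u}
  add_mem' := fun hu hv => hu.add hv
  zero_mem' := isHolder_const k α 0
  smul_mem' := fun c _ hu => hu.smul c

/-- The normed space `C^{k,α}` of real functions on the circle. -/
def HolderC (k : ℕ) (α : ℝ) : Type := ↥(holderSubmodule k α)

namespace HolderC

variable {k : ℕ} {α : ℝ}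

instance : AddCommGroup (HolderC k α) := inferInstanceAs (AddCommGroup ↥(holderSubmodule k α))
instance : Module ℝ (HolderC k α) := inferInstanceAs (Module ℝ ↥(holderSubmodule k α))
instance : CoeFun (HolderC k α) (fun _ => Circle → ℝ) := ⟨fun u => Subtype.val u⟩
instance : Norm (HolderC k α) := ⟨fun u => holderNorm k α u⟩

theorem core (k : ℕ) (α : ℝ) : NormedSpace.Core ℝ (HolderC k α) where
  norm_nonneg u := holderNorm_nonneg k α u
  norm_smul c u := holderNorm_smul k α c u
  norm_triangle u v := holderNorm_add_le u.2 v.2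
  norm_eq_zero_iff u := by
    constructor
    · intro h
      apply Subtype.ext
      funext ζ
      have h1 := abs_le_holderNorm u.2 ζ
      have h2 : holderNorm k α u = 0 := h
      rw [h2] at h1
      exact abs_nonpos_iff.1 h1
    · rintro rfl
      have h := holderNorm_smul k α 0 (0 : Circle → ℝ)
      simp only [zero_smul, abs_zero, zero_mul] at h
      exact h

instance : NormedAddCommGroup (HolderC k α) := NormedAddCommGroup.ofCore (core k α)
instance : NormedSpace ℝ (HolderC k α) := NormedSpace.ofCore (core k α)

/-- The constant function `1`. -/
def one (k : ℕ) (α : ℝ) : HolderC k α := ⟨fun _ => 1, isHolder_const k α 1⟩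

end HolderC

/-- `u = Re u + i Im u` belongs to `C^{k,α}_ℂ`, and is the trace of a function which is
continuous on the closed unit disc and holomorphic on the open one: `u ∈ A^{k,α}`. -/
def IsDisc (k : ℕ) (α : ℝ) (u : Circle → ℂ) : Prop :=
  IsHolder k α (fun ζ => (u ζ).re) ∧ IsHolder k α (fun ζ => (u ζ).im) ∧
    ∃ G : ℂ → ℂ, DiffContOnCl ℂ G (Metric.ball 0 1) ∧ ∀ ζ : Circle, G ζ = u ζ

/-- The real vector space `A^{k,α}`. -/
def discSubmodule (k : ℕ) (α : ℝ) : Submodule ℝ (Circle → ℂ) where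
  carrier := {u | IsDisc k α u}
  add_mem' := by
    rintro u v ⟨hu, hu', G, hG, hG'⟩ ⟨hv, hv', H, hH, hH'⟩
    exact ⟨hu.add hv, hu'.add hv', G + H, hG.add hH, fun ζ => by simp [hG', hH']⟩
  zero_mem' := ⟨isHolder_const k α 0, isHolder_const k α 0, 0, diffContOnCl_const, fun _ => rfl⟩
  smul_mem' := by
    rintro c u ⟨hu, hu', G, hG, hG'⟩
    refine ⟨?_, ?_, (c : ℂ) • G, hG.const_smul (c : ℂ), fun ζ => by simp [hG']⟩
    · convert hu.smul c using 1
      ext ζ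
      simp
    · convert hu'.smul c using 1
      ext ζ
      simp

/-- The space `A^{k,α}` of holomorphic discs, with the norm
`‖Re u‖_{C^{k,α}} + ‖Im u‖_{C^{k,α}}`. -/
def Disc (k : ℕ) (α : ℝ) : Type := ↥(discSubmodule k α)

namespace Disc

variable {k : ℕ} {α : ℝ}

instance : AddCommGroup (Disc k α) := inferInstanceAs (AddCommGroup ↥(discSubmodule k α))
instance : Module ℝ (Disc k α) := inferInstanceAs (Module ℝ ↥(discSubmodule k α))
instance : CoeFun (Disc k α) (fun _ => Circle → ℂ) := ⟨fun u => Subtype.val u⟩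
instance : Norm (Disc k α) :=
  ⟨fun u => holderNorm k α (fun ζ => (u ζ).re) + holderNorm k α (fun ζ => (u ζ).im)⟩

theorem core (k : ℕ) (α : ℝ) : NormedSpace.Core ℝ (Disc k α) where
  norm_nonneg u := add_nonneg (holderNorm_nonneg _ _ _) (holderNorm_nonneg _ _ _)
  norm_smul c u := by
    have h1 : (fun ζ => ((c • u : Disc k α) ζ).re) = c • (fun ζ => (u ζ).re) := by
      funext ζ
      exact Complex.smul_re c (u ζ)
    have h2 : (fun ζ => ((c • u : Disc k α) ζ).im) = c • (fun ζ => (u ζ).im) := by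
      funext ζ
      exact Complex.smul_im c (u ζ)
    change holderNorm k α (fun ζ => ((c • u : Disc k α) ζ).re) +
      holderNorm k α (fun ζ => ((c • u : Disc k α) ζ).im) = |c| * (_ + _)
    rw [h1, h2, holderNorm_smul, holderNorm_smul, mul_add]
  norm_triangle u v := by
    have h1 := holderNorm_add_le u.2.1 v.2.1
    have h2 := holderNorm_add_le u.2.2.1 v.2.2.1
    have h := add_le_add h1 h2
    rw [add_add_add_comm] at h
    exact h
  norm_eq_zero_iff u := by
    constructor
    · intro h
      apply Subtype.ext
      funext ζ
      have h1 := abs_le_holderNorm u.2.1 ζ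
      have h2 := abs_le_holderNorm u.2.2.1 ζ
      have h3 : holderNorm k α (fun ζ => (u ζ).re) + holderNorm k α (fun ζ => (u ζ).im) = 0 := h
      have h4 := holderNorm_nonneg k α (fun ζ => (u ζ).re)
      have h5 := holderNorm_nonneg k α (fun ζ => (u ζ).im)
      refine Complex.ext (abs_nonpos_iff.1 (h1.trans ?_)) (abs_nonpos_iff.1 (h2.trans ?_))
      · linarith
      · linarith
    · rintro rfl
      have h := holderNorm_smul k α 0 (0 : Circle → ℝ)
      simp only [zero_smul, abs_zero, zero_mul] at h
      change holderNorm k α 0 + holderNorm k α 0 = 0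
      rw [h, add_zero]

instance : NormedAddCommGroup (Disc k α) := NormedAddCommGroup.ofCore (core k α)
instance : NormedSpace ℝ (Disc k α) := NormedSpace.ofCore (core k α)

end Disc

/-- The space `(1 - ζ) A^{k,α}`. Its element `f = (1 - ζ) f̃` is stored as `f̃ ∈ A^{k,α}`,
and its norm is, by definition, that of `f̃`; the function `f` itself is `TiedDisc.toFun`. -/
def TiedDisc (k : ℕ) (α : ℝ) : Type := Disc k α

namespace TiedDisc

variable {k : ℕ} {α : ℝ}

instance : NormedAddCommGroup (TiedDisc k α) := inferInstanceAs (NormedAddCommGroup (Disc k α))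
instance : NormedSpace ℝ (TiedDisc k α) := inferInstanceAs (NormedSpace ℝ (Disc k α))

/-- The factor `f̃ ∈ A^{k,α}` of `f = (1 - ζ) f̃`. -/
def factor (f : TiedDisc k α) : Disc k α := f

/-- The function `f = (1 - ζ) f̃` on the circle. -/
def toFun (f : TiedDisc k α) (ζ : Circle) : ℂ := (1 - (ζ : ℂ)) * f.factor ζ

end TiedDisc

/-- The space `Y = C^{k,α} × (1 - ζ) A^{k,α} × (1 - ζ) A^{k,α}` of triples `(c, h, g)`. -/
abbrev Y (k : ℕ) (α : ℝ) : Type := HolderC k α × TiedDisc k α × TiedDisc k α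

/-- The norm `‖c‖ + ‖h‖ + ‖g‖` of `Y` (equivalent to the product norm). -/
def normY {k : ℕ} {α : ℝ} (y : Y k α) : ℝ := ‖y.1‖ + ‖y.2.1‖ + ‖y.2.2‖

namespace TiedDisc

/-- The function `f` determines the factor `f̃`. -/
theorem toFun_injective {k : ℕ} {α : ℝ} :
    Function.Injective (toFun : TiedDisc k α → Circle → ℂ) := by
  intro f g hfg
  obtain ⟨F, hF, hF'⟩ := f.2.2.2
  obtain ⟨G, hG, hG'⟩ := g.2.2.2
  have hcl : ∀ H : ℂ → ℂ, DiffContOnCl ℂ H (Metric.ball 0 1) →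
      Continuous fun t : ℝ => H (Circle.exp t) := by
    intro H hH
    have h1 := hH.continuousOn
    rw [closure_ball (0 : ℂ) one_ne_zero] at h1
    refine h1.comp_continuous (by fun_prop) fun t => ?_
    simp
  have hcont := (hcl F hF).sub (hcl G hG)
  have key : ∀ t : ℝ, F (Circle.exp t) - G (Circle.exp t) = 0 := by
    have hd : Dense {t : ℝ | (Circle.exp t : ℂ) ≠ 1} := by
      have hc : Set.Countable {t : ℝ | (Circle.exp t : ℂ) = 1} := by
        have : {t : ℝ | (Circle.exp t : ℂ) = 1} ⊆ Set.range fun n : ℤ => (n : ℝ) * (2 * Real.pi) := by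
          intro t ht
          have h1 : Circle.exp t = Circle.exp 0 := by
            apply Circle.ext
            simpa using ht
          obtain ⟨m, hm⟩ := Circle.exp_eq_exp.1 h1
          exact ⟨m, by simp [hm]⟩
        exact (Set.countable_range _).mono this
      have h2 := hc.dense_compl ℝ
      exact h2
    intro t
    have hz : Set.EqOn (fun t : ℝ => F (Circle.exp t) - G (Circle.exp t)) (fun _ => 0)
        {t : ℝ | (Circle.exp t : ℂ) ≠ 1} := by
      intro s hs
      have h1 := congrFun hfg (Circle.exp s)
      have h2 : (1 - (Circle.exp s : ℂ)) ≠ 0 := sub_ne_zero.2 (Ne.symm hs)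
      have h3 : f.factor (Circle.exp s) = g.factor (Circle.exp s) := mul_left_cancel₀ h2 h1
      show F (Circle.exp s) - G (Circle.exp s) = 0
      rw [hF', hG', sub_eq_zero]
      exact h3
    exact congrFun (Continuous.ext_on hd hcont continuous_const hz) t
  apply Subtype.ext
  funext ζ
  have h1 := key (Complex.arg (ζ : ℂ))
  rw [Circle.exp_arg, hF', hG'] at h1
  exact sub_eq_zero.1 h1

end TiedDisc

/-! ### Polynomials as discs -/

/-- The derivative of `p(e^{iθ})` with respect to `θ` is `(iζp')(e^{iθ})`. -/
def angularDeriv (p : Polynomial ℂ) : Polynomial ℂ :=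
  Polynomial.C Complex.I * Polynomial.X * Polynomial.derivative p

theorem hasDerivAt_poly_exp (p : Polynomial ℂ) (t : ℝ) :
    HasDerivAt (fun t : ℝ => p.eval (Circle.exp t : ℂ))
      ((angularDeriv p).eval (Circle.exp t : ℂ)) t := by
  have h1 : HasDerivAt (fun t : ℝ => ((Circle.exp t : Circle) : ℂ))
      (Complex.exp (t * Complex.I) * Complex.I) t := by
    simp only [Circle.coe_exp]
    have h2 : HasDerivAt (fun z : ℂ => Complex.exp (z * Complex.I))
        (Complex.exp (t * Complex.I) * (1 * Complex.I)) (t : ℂ) :=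
      ((hasDerivAt_id (t : ℂ)).mul_const Complex.I).cexp
    rw [one_mul] at h2
    exact h2.comp_ofReal
  have h3 := (p.hasDerivAt (Circle.exp t : ℂ)).comp t h1
  refine h3.congr_deriv ?_
  simp only [angularDeriv, Polynomial.eval_mul, Polynomial.eval_C, Polynomial.eval_X,
    Circle.coe_exp]
  ring

theorem circDeriv_poly (L : ℂ →L[ℝ] ℝ) (p : Polynomial ℂ) (j : ℕ) :
    circDeriv j (fun ζ => L (p.eval (ζ : ℂ))) =
      fun t => L ((angularDeriv^[j] p).eval (Circle.exp t : ℂ)) := by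
  induction j generalizing p with
  | zero => rfl
  | succ j ih =>
    have h : deriv (fun t : ℝ => L (p.eval (Circle.exp t : ℂ))) =
        fun t : ℝ => L ((angularDeriv p).eval (Circle.exp t : ℂ)) := by
      funext t
      exact (L.hasFDerivAt.comp_hasDerivAt t (hasDerivAt_poly_exp p t)).deriv
    funext t
    have h2 := congrFun (ih (angularDeriv p)) t
    unfold circDeriv at h2 ⊢
    rw [iteratedDeriv_succ', h, h2]
    rfl

theorem poly_lipschitz (p : Polynomial ℂ) : ∃ C : ℝ, 0 ≤ C ∧ ∀ ζ η : ℂ, ‖ζ‖ ≤ 1 → ‖η‖ ≤ 1 →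
    ‖p.eval ζ - p.eval η‖ ≤ C * ‖ζ - η‖ := by
  obtain ⟨C, hC⟩ := (isCompact_closedBall (0 : ℂ) 1).exists_bound_of_continuousOn
    (f := fun z => (Polynomial.derivative p).eval z) (by fun_prop)
  have hC0 : 0 ≤ C := (norm_nonneg _).trans (hC 0 (by simp))
  refine ⟨C, hC0, fun ζ η hζ hη => ?_⟩
  refine (convex_closedBall (0 : ℂ) 1).norm_image_sub_le_of_norm_deriv_le
    (f := fun z => p.eval z) (fun z _ => p.differentiableAt) (fun z hz => ?_)
    (by simpa using hη) (by simpa using hζ)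
  rw [Polynomial.deriv]
  exact hC z hz

theorem isHolder_poly (k : ℕ) {α : ℝ} (hα : α ≤ 1) (L : ℂ →L[ℝ] ℝ)
    (p : Polynomial ℂ) : IsHolder k α (fun ζ => L (p.eval (ζ : ℂ))) := by
  constructor
  · have h : ContDiff ℝ k fun t : ℝ => (Circle.exp t : ℂ) := by
      simp only [Circle.coe_exp]
      exact (Complex.ofRealCLM.contDiff.mul contDiff_const).cexp
    have h2 : ContDiff ℝ k (fun z : ℂ => p.eval z) := by
      simp only [Polynomial.eval_eq_sum_range]
      fun_prop
    exact L.contDiff.comp (h2.comp h)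
  · obtain ⟨C, hC0, hC⟩ := poly_lipschitz (angularDeriv^[k] p)
    refine ⟨‖L‖ * (C * 2 ^ (1 - α)), fun q => ?_⟩
    rw [circDeriv_poly]
    have h1 := hC (Circle.exp q.1) (Circle.exp q.2) (by simp) (by simp)
    have h2 : chord q ≤ 2 := by
      refine (norm_sub_le _ _).trans ?_
      simp only [Circle.norm_coe]
      norm_num
    have h0 : 0 ≤ chord q := norm_nonneg _
    have h3 : chord q ≤ 2 ^ (1 - α) * chord q ^ α := by
      rcases h0.eq_or_lt with h | h
      · rw [← h]
        positivity
      · calc chord q = chord q ^ (1 - α) * chord q ^ α := by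
              rw [← Real.rpow_add h]
              simp
          _ ≤ 2 ^ (1 - α) * chord q ^ α :=
              mul_le_mul_of_nonneg_right (Real.rpow_le_rpow h0 h2 (by linarith))
                (chord_rpow_nonneg α q)
    rw [← map_sub, ← Real.norm_eq_abs]
    refine (L.le_opNorm _).trans ?_
    rw [mul_assoc, mul_assoc]
    refine mul_le_mul_of_nonneg_left (h1.trans ?_) (norm_nonneg _)
    exact mul_le_mul_of_nonneg_left h3 hC0

theorem isDisc_poly (k : ℕ) {α : ℝ} (hα : α ≤ 1) (p : Polynomial ℂ) :
    IsDisc k α (fun ζ => p.eval (ζ : ℂ)) :=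
  ⟨isHolder_poly k hα Complex.reCLM p, isHolder_poly k hα Complex.imCLM p,
    fun z => p.eval z, (p.differentiable).diffContOnCl, fun _ => rfl⟩

/-- A polynomial as an element of `A^{k,α}`. -/
def Disc.ofPoly (k : ℕ) {α : ℝ} (hα : α ≤ 1) (p : Polynomial ℂ) : Disc k α :=
  ⟨fun ζ => p.eval (ζ : ℂ), isDisc_poly k hα p⟩

/-- The element `(1 - ζ) p(ζ)` of `(1 - ζ) A^{k,α}`. -/
def TiedDisc.ofPoly (k : ℕ) {α : ℝ} (hα : α ≤ 1) (p : Polynomial ℂ) : TiedDisc k α :=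
  Disc.ofPoly k hα p

/-! ### Spaces of functions of class `C^m` on compact domains -/

/-- A compact set on which derivatives of all orders make sense up to the boundary. -/
structure CompactDomain (E : Type) [NormedAddCommGroup E] [NormedSpace ℝ E] where
  /-- the underlying set -/
  carrier : Set E
  isCompact : IsCompact carrier
  uniqueDiff : UniqueDiffOn ℝ carrier

/-- The closed disc `|z| ≤ δ`. -/
def closedDisc {δ : ℝ} (hδ : 0 < δ) : CompactDomain ℂ where
  carrier := Metric.closedBall 0 δ
  isCompact := isCompact_closedBall 0 δ
  uniqueDiff := uniqueDiffOn_convex (convex_closedBall 0 δ)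
    ⟨0, Metric.ball_subset_interior_closedBall (Metric.mem_ball_self hδ)⟩

/-- The interval `[-δ, δ]`. -/
def interval {δ : ℝ} (hδ : 0 < δ) : CompactDomain ℝ where
  carrier := Set.Icc (-δ) δ
  isCompact := isCompact_Icc
  uniqueDiff := uniqueDiffOn_Icc (by linarith)

/-- The product of the closed disc `|z| ≤ δ` and the interval `[-δ, δ]`. -/
def discInterval {δ : ℝ} (hδ : 0 < δ) : CompactDomain (ℂ × ℝ) where
  carrier := (closedDisc hδ).carrier ×ˢ (interval hδ).carrier
  isCompact := (closedDisc hδ).isCompact.prod (interval hδ).isCompact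
  uniqueDiff := (closedDisc hδ).uniqueDiff.prod (interval hδ).uniqueDiff

section CM

variable {E F : Type} [NormedAddCommGroup E] [NormedSpace ℝ E] [NormedAddCommGroup F]
  [NormedSpace ℝ F]

/-- The functions of class `C^m` on `K`, up to the boundary. A function on `K` is
represented by its extension by zero off `K`. -/
def cmSubmodule (m : ℕ) (K : CompactDomain E) (F : Type) [NormedAddCommGroup F]
    [NormedSpace ℝ F] : Submodule ℝ (E → F) where
  carrier := {f | ContDiffOn ℝ m f K.carrier ∧ ∀ x ∉ K.carrier, f x = 0}
  add_mem' := fun hf hg => ⟨hf.1.add hg.1, fun x hx => by simp [hf.2 x hx, hg.2 x hx]⟩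
  zero_mem' := ⟨contDiffOn_const, fun _ _ => rfl⟩
  smul_mem' := fun c f hf => ⟨contDiffOn_const.smul hf.1, fun x hx => by simp [hf.2 x hx]⟩

/-- The space `C^m(K, F)`. -/
def CM (m : ℕ) (K : CompactDomain E) (F : Type) [NormedAddCommGroup F]
    [NormedSpace ℝ F] : Type := ↥(cmSubmodule m K F)

namespace CM

variable {m : ℕ} {K : CompactDomain E}

instance : AddCommGroup (CM m K F) := inferInstanceAs (AddCommGroup ↥(cmSubmodule m K F))
instance : Module ℝ (CM m K F) := inferInstanceAs (Module ℝ ↥(cmSubmodule m K F))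
instance : CoeFun (CM m K F) (fun _ => E → F) := ⟨fun f => Subtype.val f⟩

instance : CompactSpace K.carrier := isCompact_iff_compactSpace.1 K.isCompact

theorem natCast_le (j : Fin (m + 1)) : ((j : ℕ) : WithTop ℕ∞) ≤ m := by
  exact_mod_cast Nat.lt_succ_iff.1 j.2

/-- The derivatives of orders `0, …, m` of an element of `C^m(K, F)`, as continuous
functions on `K`. -/
def derivs (m : ℕ) (K : CompactDomain E) (F : Type) [NormedAddCommGroup F]
    [NormedSpace ℝ F] :
    CM m K F →ₗ[ℝ] ((j : Fin (m + 1)) → C(K.carrier, E [×(j : ℕ)]→L[ℝ] F)) where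
  toFun f j := ⟨fun x => iteratedFDerivWithin ℝ j f K.carrier x,
    continuousOn_iff_continuous_domRestrict.1
      (f.2.1.continuousOn_iteratedFDerivWithin (natCast_le j) K.uniqueDiff)⟩
  map_add' f g := by
    funext j
    ext1 x
    exact iteratedFDerivWithin_add_apply ((f.2.1.of_le (natCast_le j)) x x.2)
      ((g.2.1.of_le (natCast_le j)) x x.2) K.uniqueDiff x.2
  map_smul' c f := by
    funext j
    ext1 x
    exact iteratedFDerivWithin_const_smul_apply ((f.2.1.of_le (natCast_le j)) x x.2)
      K.uniqueDiff x.2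

theorem derivs_zero_norm (f : CM m K F) (x : K.carrier) : ‖derivs m K F f 0 x‖ = ‖f x‖ := by
  change ‖iteratedFDerivWithin ℝ 0 f K.carrier x‖ = ‖f x‖
  rw [norm_iteratedFDerivWithin_zero]

theorem derivs_injective : Function.Injective (derivs m K F) := by
  rw [injective_iff_map_eq_zero]
  intro f hf
  apply Subtype.ext
  funext x
  by_cases hx : x ∈ K.carrier
  · have h := derivs_zero_norm f ⟨x, hx⟩
    rw [hf] at h
    exact norm_eq_zero.1 (h.symm.trans norm_zero)
  · exact f.2.2 x hx

/-- The norm is `max_{j ≤ m} sup_K ‖D^j f‖`. -/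
instance : NormedAddCommGroup (CM m K F) :=
  NormedAddCommGroup.induced _ _ (derivs m K F) derivs_injective

instance : NormedSpace ℝ (CM m K F) := NormedSpace.induced ℝ (CM m K F) _ (derivs m K F)

theorem norm_apply_le (f : CM m K F) (x : E) : ‖f x‖ ≤ ‖f‖ := by
  by_cases hx : x ∈ K.carrier
  · rw [← derivs_zero_norm f ⟨x, hx⟩]
    exact ((derivs m K F f 0).norm_coe_le_norm ⟨x, hx⟩).trans (norm_le_pi_norm (derivs m K F f) 0)
  · rw [f.2.2 x hx, norm_zero]
    exact norm_nonneg _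

/-- Evaluation at a point. -/
def evalL (m : ℕ) (K : CompactDomain E) (F : Type) [NormedAddCommGroup F]
    [NormedSpace ℝ F] (x : E) : CM m K F →L[ℝ] F :=
  LinearMap.mkContinuous
    { toFun := fun f => f x
      map_add' := fun _ _ => rfl
      map_smul' := fun _ _ => rfl } 1 fun f => (norm_apply_le f x).trans (one_mul _).ge

end CM

end CM

/-! ### Model hypersurfaces -/

/-- The Wirtinger derivative `∂f/∂v = (D f(v) - i D f(iv)) / 2` at `p` in the direction `v`. -/
def wirtinger {E : Type} [NormedAddCommGroup E] [NormedSpace ℂ E] [NormedSpace ℝ E]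
    (f : E → ℂ) (p v : E) : ℂ :=
  (fderiv ℝ f p v - Complex.I * fderiv ℝ f p (Complex.I • v)) / 2

/-- The Wirtinger derivative `∂f/∂v̄ = (D f(v) + i D f(iv)) / 2` at `p` in the direction `v`. -/
def wirtingerBar {E : Type} [NormedAddCommGroup E] [NormedSpace ℂ E] [NormedSpace ℝ E]
    (f : E → ℂ) (p v : E) : ℂ :=
  (fderiv ℝ f p v + Complex.I * fderiv ℝ f p (Complex.I • v)) / 2

/-- A function on the plane is subharmonic if it is upper semicontinuous and has the
sub-mean value property on all circles. -/
def IsSubharmonic (u : ℂ → ℝ) : Prop :=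
  UpperSemicontinuous u ∧ ∀ (z : ℂ) (R : ℝ), 0 < R → u z ≤ Real.circleAverage u z R

/-- The polynomial `P(z, z̄) = ∑_{j = d - k₀}^{k₀} α_j z^j z̄^{d - j}`. -/
def modelPoly (d k₀ : ℕ) (a : ℕ → ℂ) (z : ℂ) : ℂ :=
  ∑ j ∈ Finset.Icc (d - k₀) k₀, a j * z ^ j * (starRingEnd ℂ z) ^ (d - j)

/-- The assumptions on `P`: it is real valued and homogeneous of degree `d` with
`α_{k₀} ≠ 0`, `d / 2 ≤ k₀ ≤ d - 1`, it is subharmonic, and `P_{z z̄}` has no zero outside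
the origin. -/
structure IsModel (d k₀ : ℕ) (a : ℕ → ℂ) : Prop where
  half_le : d ≤ 2 * k₀
  lt : k₀ < d
  symm : ∀ j ∈ Finset.Icc (d - k₀) k₀, a j = starRingEnd ℂ (a (d - j))
  ne_zero : a k₀ ≠ 0
  subharmonic : IsSubharmonic fun z => (modelPoly d k₀ a z).re
  levi : ∀ z : ℂ,
    wirtingerBar (fun z => wirtinger (modelPoly d k₀ a) z 1) z 1 = 0 → z = 0

/-- `ρ(z, w) = - Re w + P(z, z̄)`. -/
def rho (d k₀ : ℕ) (a : ℕ → ℂ) (p : ℂ × ℂ) : ℝ := -p.2.re + (modelPoly d k₀ a p.1).re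

/-! ### The space of perturbations -/

/-- The indices `(i, j)` with `i + j = d + 1`. -/
abbrev Index0 (d : ℕ) : Type := 
  ↥((Finset.range (d + 2) ×ˢ Finset.range (d + 2)).filter fun q : ℕ × ℕ => q.1 + q.2 = d + 1)

/-- The indices `(i, j, l)` with `1 ≤ l ≤ d - 1` and `i + j = d - l`. -/
abbrev Index1 (d : ℕ) : Type :=
  ↥((Finset.range (d + 1) ×ˢ Finset.range (d + 1) ×ˢ Finset.Icc 1 (d - 1)).filter
    fun q : ℕ × ℕ × ℕ => q.1 + q.2.1 + q.2.2 = d)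

/-- The families of coefficients `(r_{ij0})`, `(r_{ijl})`, `θ₁` of class `C^m`. -/
abbrev Coeffs (d m : ℕ) {δ : ℝ} (hδ : 0 < δ) : Type :=
  (Index0 d → CM m (closedDisc hδ) ℂ) × (Index1 d → CM m (discInterval hδ) ℂ) ×
    CM m (interval hδ) ℝ

/-- The value at `(z, y)` of
`∑_{i+j=d+1} z^i z̄^j r_{ij0}(z) + ∑_{l=1}^{d-1} ∑_{i+j=d-l} z^i z̄^j y^l r_{ijl}(z, y) + θ₁(y)`. -/
def theta {d m : ℕ} {δ : ℝ} {hδ : 0 < δ} (e : Coeffs d m hδ) (p : ℂ × ℝ) : ℂ :=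
  (∑ q : Index0 d, p.1 ^ q.1.1 * (starRingEnd ℂ p.1) ^ q.1.2 * e.1 q p.1) +
    (∑ q : Index1 d, p.1 ^ q.1.1 * (starRingEnd ℂ p.1) ^ q.1.2.1 * (p.2 : ℂ) ^ q.1.2.2 *
      e.2.1 q p) + (e.2.2 p.2 : ℂ)

theorem theta_add {d m : ℕ} {δ : ℝ} {hδ : 0 < δ} (e f : Coeffs d m hδ) (p : ℂ × ℝ) :
    theta (e + f) p = theta e p + theta f p := by
  have h0 : ∀ q z, (e + f).1 q z = e.1 q z + f.1 q z := fun _ _ => rfl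
  have h1 : ∀ q z, (e + f).2.1 q z = e.2.1 q z + f.2.1 q z := fun _ _ => rfl
  have h2 : ∀ y, (e + f).2.2 y = e.2.2 y + f.2.2 y := fun _ => rfl
  simp only [theta, h0, h1, h2, mul_add, Finset.sum_add_distrib, Complex.ofReal_add]
  ring

theorem theta_smul {d m : ℕ} {δ : ℝ} {hδ : 0 < δ} (c : ℝ) (e : Coeffs d m hδ) (p : ℂ × ℝ) :
    theta (c • e) p = c * theta e p := by
  have h0 : ∀ q z, (c • e).1 q z = c * e.1 q z := fun _ _ => Complex.real_smul
  have h1 : ∀ q z, (c • e).2.1 q z = c * e.2.1 q z := fun _ _ => Complex.real_smul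
  have h2 : ∀ y, (c • e).2.2 y = c * e.2.2 y := fun _ => rfl
  simp only [theta, h0, h1, h2, mul_add, Finset.mul_sum, Complex.ofReal_mul]
  congr 2
  · exact Finset.sum_congr rfl fun _ _ => by ring
  · exact Finset.sum_congr rfl fun _ _ => by ring

theorem continuous_theta {d m : ℕ} {δ : ℝ} {hδ : 0 < δ} (p : ℂ × ℝ) :
    Continuous fun e : Coeffs d m hδ => theta e p := by
  have h0 : ∀ q : Index0 d, Continuous fun e : Coeffs d m hδ => e.1 q p.1 := fun q =>
    (CM.evalL m (closedDisc hδ) ℂ p.1).continuous.comp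
      ((continuous_apply q).comp continuous_fst)
  have h1 : ∀ q : Index1 d, Continuous fun e : Coeffs d m hδ => e.2.1 q p := fun q =>
    (CM.evalL m (discInterval hδ) ℂ p).continuous.comp
      ((continuous_apply q).comp (continuous_fst.comp continuous_snd))
  have h2 : Continuous fun e : Coeffs d m hδ => e.2.2 p.2 :=
    (CM.evalL m (interval hδ) ℝ p.2).continuous.comp (continuous_snd.comp continuous_snd)
  unfold theta
  exact ((continuous_finsetSum _ fun q _ => continuous_const.mul (h0 q)).add
    (continuous_finsetSum _ fun q _ => continuous_const.mul (h1 q))).add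
      (Complex.continuous_ofReal.comp h2)

/-- The admissible families of coefficients: `θ₁(y) = O(y²)`, and `θ` is real valued. -/
def admissible (d m : ℕ) {δ : ℝ} (hδ : 0 < δ) : Submodule ℝ (Coeffs d m hδ) where
  carrier := {e | (e.2.2 : ℝ → ℝ) =O[nhds 0] (fun y : ℝ => y ^ 2) ∧
    ∀ p ∈ (discInterval hδ).carrier, (theta e p).im = 0}
  add_mem' := fun {e f} he hf => ⟨he.1.add hf.1, fun p hp => by
    rw [theta_add, Complex.add_im, he.2 p hp, hf.2 p hp, add_zero]⟩
  zero_mem' := ⟨Asymptotics.isBigO_zero _ _, fun p _ => by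
    have h := theta_smul 0 (0 : Coeffs d m hδ) p
    rw [smul_zero] at h
    rw [h]
    simp⟩
  smul_mem' := fun c e he => ⟨he.1.const_smul_left c, fun p hp => by
    rw [theta_smul, Complex.im_ofReal_mul, he.2 p hp, mul_zero]⟩

open Classical in
/-- The function `θ` on `{|z| ≤ δ} × [-δ, δ]` (extended by zero) given by an admissible
family of coefficients. -/
def thetaFun (d m : ℕ) {δ : ℝ} (hδ : 0 < δ) : ↥(admissible d m hδ) →ₗ[ℝ] (ℂ × ℝ → ℝ) where
  toFun e p := if p ∈ (discInterval hδ).carrier then (theta e.1 p).re else 0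
  map_add' e f := by
    funext p
    by_cases hp : p ∈ (discInterval hδ).carrier
    · simp [hp, theta_add]
    · simp [hp]
  map_smul' c e := by
    funext p
    by_cases hp : p ∈ (discInterval hδ).carrier
    · simp [hp, theta_smul]
    · simp [hp]

instance isClosed_ker_thetaFun (d m : ℕ) {δ : ℝ} (hδ : 0 < δ) :
    IsClosed ((LinearMap.ker (thetaFun d m hδ) : Submodule ℝ ↥(admissible d m hδ)) :
      Set ↥(admissible d m hδ)) := by
  have h : ((LinearMap.ker (thetaFun d m hδ) : Submodule ℝ ↥(admissible d m hδ)) :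
      Set ↥(admissible d m hδ)) = ⋂ p : ℂ × ℝ, {e | thetaFun d m hδ e p = 0} := by
    ext e
    simp only [SetLike.mem_coe, LinearMap.mem_ker, Set.mem_iInter, Set.mem_ofPred_eq]
    exact funext_iff
  rw [h]
  refine isClosed_iInter fun p => isClosed_eq ?_ continuous_const
  by_cases hp : p ∈ (discInterval hδ).carrier
  · simp only [thetaFun, LinearMap.coe_mk, AddHom.coe_mk, hp, if_true]
    exact Complex.continuous_re.comp ((continuous_theta p).comp continuous_subtype_val)
  · simp only [thetaFun, LinearMap.coe_mk, AddHom.coe_mk, hp, if_false]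
    exact continuous_const

/-- The space of the perturbations `θ`. Two families of coefficients which give the same
function `θ` are identified, and the norm of `θ` is the infimum of the norms of the families of
coefficients which give `θ`. The affine space `X` is `ρ + Perturbation`. -/
def Perturbation (d m : ℕ) {δ : ℝ} (hδ : 0 < δ) : Type :=
  ↥(admissible d m hδ) ⧸ LinearMap.ker (thetaFun d m hδ)

namespace Perturbation

variable {d m : ℕ} {δ : ℝ} {hδ : 0 < δ}

instance : NormedAddCommGroup (Perturbation d m hδ) :=
  inferInstanceAs (NormedAddCommGroup (↥(admissible d m hδ) ⧸ LinearMap.ker (thetaFun d m hδ)))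
instance : NormedSpace ℝ (Perturbation d m hδ) :=
  inferInstanceAs (NormedSpace ℝ (↥(admissible d m hδ) ⧸ LinearMap.ker (thetaFun d m hδ)))

/-- The function `θ(z, y)`. -/
def toFun (x : Perturbation d m hδ) : ℂ × ℝ → ℝ :=
  (LinearMap.ker (thetaFun d m hδ)).liftQ (thetaFun d m hδ) le_rfl x

end Perturbation

/-- The defining function `r(z, w) = ρ(z, w) + θ(z, Im w)`. -/
def defFun {d m : ℕ} {δ : ℝ} {hδ : 0 < δ} (k₀ : ℕ) (a : ℕ → ℂ) (x : Perturbation d m hδ)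
    (p : ℂ × ℂ) : ℝ :=
  rho d k₀ a p + x.toFun (p.1, p.2.im)

/-! ### Lifts of `k₀`-stationary discs -/

/-- The open bidisc `{|z| < δ, |w| < δ}`. -/
def bidisc (δ : ℝ) : Set (ℂ × ℂ) := Metric.ball 0 δ ×ˢ Metric.ball 0 δ

/-- `(c, f)`, with `f = (h, g)`, is a lift of a `k₀`-stationary disc attached to the hypersurface
`{p ∈ Ω | r p = 0}`: the components of `f` belong to `A^{k,α}`, `f` maps the circle into the
hypersurface, `c` is continuous without zeros, and the two components of
`ζ^{k₀} c(ζ) ∂r(f(ζ))` extend as elements of `A^{k,α}`. -/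
structure IsStationaryLift (k : ℕ) (α : ℝ) (k₀ : ℕ) (Ω : Set (ℂ × ℂ)) (r : ℂ × ℂ → ℝ)
    (c : Circle → ℝ) (f : Circle → ℂ × ℂ) : Prop where
  disc_fst : IsDisc k α fun ζ => (f ζ).1
  disc_snd : IsDisc k α fun ζ => (f ζ).2
  attached : ∀ ζ, f ζ ∈ Ω ∧ r (f ζ) = 0
  continuous : Continuous c
  ne_zero : ∀ ζ, c ζ ≠ 0
  extend_fst : IsDisc k α fun ζ =>
    (ζ : ℂ) ^ k₀ * (c ζ : ℂ) * wirtinger (fun p => (r p : ℂ)) (f ζ) (1, 0)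
  extend_snd : IsDisc k α fun ζ =>
    (ζ : ℂ) ^ k₀ * (c ζ : ℂ) * wirtinger (fun p => (r p : ℂ)) (f ζ) (0, 1)

/-- The disc `f = (h, g)` of an element `(c, h, g)` of `Y`. -/
def discOf {k : ℕ} {α : ℝ} (y : Y k α) (ζ : Circle) : ℂ × ℂ := (y.2.1.toFun ζ, y.2.2.toFun ζ)

/-- The elements `(c, h, g)` of `Y` which are lifts of `k₀`-stationary discs attached to
`{p ∈ Ω | r p = 0}` and tied to the origin, that is, with `f(1) = 0`. -/
def tiedLifts (k : ℕ) (α : ℝ) (k₀ : ℕ) (Ω : Set (ℂ × ℂ)) (r : ℂ × ℂ → ℝ) : Set (Y k α) :=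
  {y | IsStationaryLift k α k₀ Ω r y.1 (discOf y) ∧ discOf y 1 = 0}

/-! ### The initial disc -/

/-- The coefficients of the expansion of `P(1 - ζ, 1 - ζ̄)` on the circle, which is
`∑_j ∑_{m ≤ d} b_{jm} ζ^{m - (d - j)}`. -/
def coeffB (d : ℕ) (a : ℕ → ℂ) (j m : ℕ) : ℂ := a j * (d.choose m : ℂ) * (-1) ^ (m + (d - j))

/-- The holomorphic polynomial `g₀` with `g₀(1) = 0` and `Re g₀(ζ) = P(1 - ζ, 1 - ζ̄)` on the
circle. -/
def gZero (d k₀ : ℕ) (a : ℕ → ℂ) (ζ : ℂ) : ℂ :=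
  2 * ∑ j ∈ Finset.Icc (d - k₀) k₀, ∑ m ∈ Finset.Ioc (d - j) d,
    coeffB d a j m * (ζ ^ (m - (d - j)) - 1)

/-- The polynomial `g₀(ζ) / (1 - ζ)`. -/
def gZeroFactor (d k₀ : ℕ) (a : ℕ → ℂ) : Polynomial ℂ :=
  -2 * ∑ j ∈ Finset.Icc (d - k₀) k₀, ∑ m ∈ Finset.Ioc (d - j) d,
    Polynomial.C (coeffB d a j m) * ∑ i ∈ Finset.range (m - (d - j)), Polynomial.X ^ i

theorem gZeroFactor_spec (d k₀ : ℕ) (a : ℕ → ℂ) (ζ : ℂ) :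
    (1 - ζ) * (gZeroFactor d k₀ a).eval ζ = gZero d k₀ a ζ := by
  simp only [gZeroFactor, gZero, Polynomial.eval_mul, Polynomial.eval_finsetSum,
    Polynomial.eval_C, Polynomial.eval_pow, Polynomial.eval_X, Polynomial.eval_neg,
    Polynomial.eval_ofNat, Finset.mul_sum (Finset.Icc (d - k₀) k₀)]
  refine Finset.sum_congr rfl fun j _ => ?_
  simp only [Finset.mul_sum (Finset.Ioc (d - j) d)]
  refine Finset.sum_congr rfl fun m _ => ?_
  rw [← geom_sum_mul]
  ring

/-- The lift `(1, f₀)`, `f₀(ζ) = (1 - ζ, g₀(ζ))`. -/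
def baseLift (d k₀ : ℕ) (a : ℕ → ℂ) (k : ℕ) {α : ℝ} (hα : α ≤ 1) : Y k α :=
  (HolderC.one k α, TiedDisc.ofPoly k hα 1, TiedDisc.ofPoly k hα (gZeroFactor d k₀ a))

/-- `Re g₀(ζ) = P(1 - ζ, 1 - ζ̄)` on the circle: the disc `f₀` is attached to `{ρ = 0}`. -/
theorem gZero_re {d k₀ : ℕ} {a : ℕ → ℂ} (h : IsModel d k₀ a) (ζ : Circle) :
    (gZero d k₀ a ζ).re = (modelPoly d k₀ a (1 - ζ)).re := by
  have hlt := h.lt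
  -- the terms of the double sum
  set T : Circle → ℕ × ℕ → ℝ := fun ζ q =>
    (coeffB d a q.1 q.2 * (ζ : ℂ) ^ ((q.2 : ℤ) - ((d : ℤ) - q.1))).re with hT
  set I : Finset (ℕ × ℕ) := Finset.Icc (d - k₀) k₀ ×ˢ Finset.range (d + 1) with hI
  have hne : ∀ ζ : Circle, (ζ : ℂ) ≠ 0 := fun ζ => Circle.coe_ne_zero ζ
  -- the polynomial as a sum
  have hP : ∀ ζ : Circle, (modelPoly d k₀ a (1 - ζ)).re = ∑ q ∈ I, T ζ q := by
    intro ζ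
    rw [hI, Finset.sum_product, hT, modelPoly, Complex.re_sum]
    refine Finset.sum_congr rfl fun j hj => ?_
    rw [Finset.mem_Icc] at hj
    rw [← Complex.re_sum]
    congr 1
    have hj' : j ≤ d := by omega
    have hc : starRingEnd ℂ (1 - (ζ : ℂ)) = -(1 - (ζ : ℂ)) * (ζ : ℂ)⁻¹ := by
      rw [map_sub, map_one, ← Circle.coe_inv_eq_conj, Circle.coe_inv]
      field_simp [hne ζ]
      ring
    rw [hc, mul_pow, neg_pow, inv_pow]
    have e1 : a j * (1 - (ζ : ℂ)) ^ j * ((-1) ^ (d - j) * (1 - (ζ : ℂ)) ^ (d - j) *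
        ((ζ : ℂ) ^ (d - j))⁻¹) = a j * (-1) ^ (d - j) * ((ζ : ℂ) ^ (d - j))⁻¹ *
          (-(ζ : ℂ) + 1) ^ d := by
      rw [show (-(ζ : ℂ) + 1) ^ d = (1 - (ζ : ℂ)) ^ j * (1 - (ζ : ℂ)) ^ (d - j) by
        rw [← pow_add, Nat.add_sub_cancel' hj']
        ring]
      ring
    rw [e1, add_pow, Finset.mul_sum]
    refine Finset.sum_congr rfl fun m _ => ?_
    rw [zpow_sub₀ (hne ζ), show ((d : ℤ) - j) = ((d - j : ℕ) : ℤ) by omega, zpow_natCast,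
      zpow_natCast, coeffB, pow_add, neg_pow, one_pow]
    ring
  -- the symmetry
  have hsymm : ∀ ζ : Circle, ∀ q ∈ I, T ζ (d - q.1, d - q.2) = T ζ q := by
    intro ζ q hq
    rw [hI, Finset.mem_product, Finset.mem_Icc, Finset.mem_range] at hq
    have h1 : q.1 ≤ d := by omega
    have h2 : q.2 ≤ d := by omega
    have hs := h.symm q.1 (Finset.mem_Icc.2 hq.1)
    have e1 : starRingEnd ℂ (coeffB d a q.1 q.2 * (ζ : ℂ) ^ ((q.2 : ℤ) - ((d : ℤ) - q.1))) =
        coeffB d a (d - q.1) (d - q.2) *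
          (ζ : ℂ) ^ (((d - q.2 : ℕ) : ℤ) - ((d : ℤ) - ((d - q.1 : ℕ) : ℤ))) := by
      have e2 : starRingEnd ℂ ((ζ : ℂ) ^ ((q.2 : ℤ) - ((d : ℤ) - q.1))) =
          (ζ : ℂ) ^ (((d - q.2 : ℕ) : ℤ) - ((d : ℤ) - ((d - q.1 : ℕ) : ℤ))) := by
        rw [map_zpow₀, ← Circle.coe_inv_eq_conj, Circle.coe_inv, inv_zpow', Nat.cast_sub h1,
          Nat.cast_sub h2]
        congr 1
        ring
      have e3 : ((-1 : ℂ)) ^ (q.2 + (d - q.1)) = (-1) ^ (d - q.2 + (d - (d - q.1))) := by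
        have h3 : q.2 + (d - q.1) + (d - q.2 + (d - (d - q.1))) = 2 * d := by omega
        have h4 : ((-1 : ℂ)) ^ (q.2 + (d - q.1)) * (-1) ^ (d - q.2 + (d - (d - q.1))) = 1 := by
          rw [← pow_add, h3, pow_mul]
          simp
        rcases neg_one_pow_eq_or ℂ (q.2 + (d - q.1)) with h5 | h5 <;>
          rcases neg_one_pow_eq_or ℂ (d - q.2 + (d - (d - q.1))) with h6 | h6 <;>
          rw [h5, h6] at h4 <;> rw [h5, h6] <;> norm_num at h4
      rw [map_mul, e2, coeffB, coeffB, map_mul, map_mul, hs, Complex.conj_conj, map_natCast,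
        map_pow, map_neg, map_one, e3, Nat.choose_symm h2]
    simp only [hT]
    rw [← e1, Complex.conj_re]
  have hmem : ∀ q ∈ I, (d - q.1, d - q.2) ∈ I := by
    intro q hq
    rw [hI, Finset.mem_product, Finset.mem_Icc, Finset.mem_range] at hq ⊢
    have := h.half_le
    simp only
    omega
  set A : Finset (ℕ × ℕ) := I.filter fun q => d - q.1 < q.2
  set B : Finset (ℕ × ℕ) := I.filter fun q => q.2 < d - q.1
  set Z : Finset (ℕ × ℕ) := I.filter fun q => q.2 = d - q.1
  have hsplit : ∀ ζ : Circle, ∑ q ∈ I, T ζ q =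
      ∑ q ∈ A, T ζ q + (∑ q ∈ B, T ζ q + ∑ q ∈ Z, T ζ q) := by
    intro ζ
    simp only [A, B, Z, Finset.sum_filter, ← Finset.sum_add_distrib]
    refine Finset.sum_congr rfl fun q _ => ?_
    rcases lt_trichotomy q.2 (d - q.1) with h1 | h1 | h1
    · simp [h1, h1.ne, h1.not_gt]
    · simp [h1]
    · simp [h1, h1.ne', h1.not_gt]
  have hBA : ∀ ζ : Circle, ∑ q ∈ B, T ζ q = ∑ q ∈ A, T ζ q := by
    intro ζ
    refine Finset.sum_nbij' (fun q => (d - q.1, d - q.2)) (fun q => (d - q.1, d - q.2))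
      ?_ ?_ ?_ ?_ ?_
    · intro q hq
      rw [Finset.mem_filter] at hq ⊢
      refine ⟨hmem q hq.1, ?_⟩
      have h1 := hq.1
      rw [hI, Finset.mem_product, Finset.mem_Icc, Finset.mem_range] at h1
      have := hq.2
      simp only
      omega
    · intro q hq
      rw [Finset.mem_filter] at hq ⊢
      refine ⟨hmem q hq.1, ?_⟩
      have h1 := hq.1
      rw [hI, Finset.mem_product, Finset.mem_Icc, Finset.mem_range] at h1
      have := hq.2
      simp only
      omega
    · intro q hq
      have h1 := (Finset.mem_filter.1 hq).1
      rw [hI, Finset.mem_product, Finset.mem_Icc, Finset.mem_range] at h1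
      ext <;> simp only <;> omega
    · intro q hq
      have h1 := (Finset.mem_filter.1 hq).1
      rw [hI, Finset.mem_product, Finset.mem_Icc, Finset.mem_range] at h1
      ext <;> simp only <;> omega
    · intro q hq
      exact (hsymm ζ q (Finset.mem_filter.1 hq).1).symm
  have hZ : ∑ q ∈ Z, T ζ q = ∑ q ∈ Z, T 1 q := by
    refine Finset.sum_congr rfl fun q hq => ?_
    have h1 := Finset.mem_filter.1 hq
    have h2 := h1.1
    rw [hI, Finset.mem_product, Finset.mem_Icc, Finset.mem_range] at h2
    have h3 : (q.2 : ℤ) - ((d : ℤ) - q.1) = 0 := by omega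
    simp only [hT, h3, zpow_zero]
  have hone : ∑ q ∈ I, T 1 q = 0 := by
    rw [← hP 1, modelPoly]
    simp only [Circle.coe_one, sub_self]
    rw [Finset.sum_eq_zero, Complex.zero_re]
    intro j hj
    rw [Finset.mem_Icc] at hj
    rw [zero_pow (by omega)]
    ring
  have hg : (gZero d k₀ a ζ).re = 2 * (∑ q ∈ A, T ζ q - ∑ q ∈ A, T 1 q) := by
    rw [gZero, ← Finset.sum_sub_distrib, Finset.sum_filter, hI, Finset.sum_product,
      show (2 : ℂ) = ((2 : ℝ) : ℂ) by norm_num, Complex.re_ofReal_mul, Complex.re_sum]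
    congr 1
    refine Finset.sum_congr rfl fun j hj => ?_
    rw [Finset.mem_Icc] at hj
    rw [← Finset.sum_filter, Complex.re_sum]
    refine Finset.sum_congr ?_ fun m hm => ?_
    · ext m
      simp only [Finset.mem_Ioc, Finset.mem_filter, Finset.mem_range]
      omega
    · rw [Finset.mem_filter] at hm
      have hm2 : d - j < m := hm.2
      have h3 : (m : ℤ) - ((d : ℤ) - j) = ((m - (d - j) : ℕ) : ℤ) := by omega
      simp only [hT, h3, zpow_natCast, Circle.coe_one, one_pow]
      rw [← Complex.sub_re, mul_sub]
  have e1 := hsplit ζ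
  have e2 := hsplit 1
  rw [hBA] at e1 e2
  rw [hP ζ, hg]
  linarith

end KStat

end

open KStat

set_option linter.unusedSectionVars false

noncomputable section

namespace KStat

open Real Filter Topology

/-! ### Hölder spaces of vector valued periodic functions -/

/-- An admissible Hölder exponent. -/
class Exponent (α : ℝ) : Prop where
  pos : 0 < α
  lt_one : α < 1

theorem chord_exists_rep (s t : ℝ) : ∃ n : ℤ, |s - (t + n * (2 * π))| ≤ π ∧
    |s - (t + n * (2 * π))| ≤ π / 2 * chord (s, t) := by
  refine ⟨round ((s - t) / (2 * π)), ?_⟩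
  set n := round ((s - t) / (2 * π))
  set x := s - (t + n * (2 * π)) with hx
  have h2 : (0 : ℝ) < 2 * π := Real.two_pi_pos
  have h1 : |x| ≤ π := by
    have h := abs_sub_round ((s - t) / (2 * π))
    have e : x = ((s - t) / (2 * π) - n) * (2 * π) := by
      field_simp
      rw [hx]
      ring
    rw [e, abs_mul, abs_of_pos h2]
    nlinarith
  have h3 : chord (s, t) = ‖Complex.exp (Complex.I * x) - 1‖ := by
    have e1 : Complex.exp (Complex.I * s) = Complex.exp (Complex.I * x) *
        Complex.exp (Complex.I * t) := by
      rw [← Complex.exp_add]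
      have : Complex.I * s = Complex.I * x + Complex.I * t + n * (2 * π * Complex.I) := by
        rw [hx]
        push_cast
        ring
      rw [this, Complex.exp_add _ (n * (2 * π * Complex.I)), Complex.exp_int_mul_two_pi_mul_I,
        mul_one]
    simp only [chord, Circle.coe_exp]
    rw [mul_comm (s : ℂ), mul_comm (t : ℂ), e1, ← sub_one_mul, norm_mul,
      mul_comm Complex.I (t : ℂ), Complex.norm_exp_ofReal_mul_I, mul_one]
  refine ⟨h1, ?_⟩
  rw [h3, Complex.norm_exp_I_mul_ofReal_sub_one, Real.norm_eq_abs, abs_mul,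
    abs_of_pos (by norm_num : (0 : ℝ) < 2)]
  have h4 : 2 / π * |x / 2| ≤ |Real.sin (x / 2)| := by
    refine Real.mul_abs_le_abs_sin ?_
    rw [abs_div, abs_of_pos (by norm_num : (0 : ℝ) < 2)]
    linarith
  rw [abs_div, abs_of_pos (by norm_num : (0 : ℝ) < 2)] at h4
  have h5 := mul_le_mul_of_nonneg_left h4 Real.pi_pos.le
  have e : π * (2 / π * (|x| / 2)) = |x| := by
    field_simp
  rw [e] at h5
  linarith

theorem chord_le_two (p : ℝ × ℝ) : chord p ≤ 2 := by
  refine (norm_sub_le _ _).trans ?_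
  simp only [Circle.norm_coe]
  norm_num

theorem chord_nonneg (p : ℝ × ℝ) : 0 ≤ chord p := norm_nonneg _

/-- A periodic function is Hölder continuous as soon as it is so for nearby points. -/
theorem holder_of_periodic {F : Type*} [NormedAddCommGroup F] {u : ℝ → F}
    (hu : Function.Periodic u (2 * π)) {α : ℝ} (h0 : 0 ≤ α) (h1 : α ≤ 1) {C : ℝ} (hC : 0 ≤ C)
    (h : ∀ s t, |s - t| ≤ π → ‖u s - u t‖ ≤ C * |s - t| ^ α) (s t : ℝ) :
    ‖u s - u t‖ ≤ C * 2 * chord (s, t) ^ α := by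
  obtain ⟨n, hn, hn'⟩ := chord_exists_rep s t
  have h2 : u (t + n * (2 * π)) = u t := hu.int_mul n t
  rw [← h2]
  refine (h _ _ hn).trans ?_
  rw [mul_assoc]
  refine mul_le_mul_of_nonneg_left ?_ hC
  refine (Real.rpow_le_rpow (abs_nonneg _) hn' h0).trans ?_
  rw [Real.mul_rpow (by positivity) (chord_nonneg _)]
  refine mul_le_mul_of_nonneg_right ?_ (chord_rpow_nonneg _ _)
  have h3 : (π / 2) ^ α ≤ (2 : ℝ) ^ α := Real.rpow_le_rpow (by positivity)
    (by linarith [Real.pi_le_four]) h0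
  refine h3.trans ?_
  calc (2 : ℝ) ^ α ≤ 2 ^ (1 : ℝ) := Real.rpow_le_rpow_of_exponent_le (by norm_num) h1
    _ = 2 := Real.rpow_one 2

section Functions

variable {F G H : Type*} [NormedAddCommGroup F] [NormedSpace ℝ F] [NormedAddCommGroup G]
  [NormedSpace ℝ G] [NormedAddCommGroup H] [NormedSpace ℝ H]

/-- The supremum of the norm of a function. -/
def supN (u : ℝ → F) : ℝ := ⨆ t, ‖u t‖

/-- The Hölder seminorm with respect to the chordal distance. -/
def holN (α : ℝ) (u : ℝ → F) : ℝ := ⨆ p : ℝ × ℝ, ‖u p.1 - u p.2‖ / chord p ^ α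

theorem supN_nonneg (u : ℝ → F) : 0 ≤ supN u := Real.iSup_nonneg fun _ => norm_nonneg _

theorem holN_nonneg (α : ℝ) (u : ℝ → F) : 0 ≤ holN α u :=
  Real.iSup_nonneg fun p => div_nonneg (norm_nonneg _) (chord_rpow_nonneg α p)

theorem supN_le {u : ℝ → F} {C : ℝ} (h : ∀ t, ‖u t‖ ≤ C) : supN u ≤ C := ciSup_le h

theorem holN_le {α : ℝ} {u : ℝ → F} {C : ℝ} (hC : 0 ≤ C)
    (h : ∀ s t, ‖u s - u t‖ ≤ C * chord (s, t) ^ α) : holN α u ≤ C :=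
  ciSup_le fun p => div_le_of_le_mul₀ (chord_rpow_nonneg α p) hC (h p.1 p.2)

/-- Periodic functions of class `C^{k,α}`. -/
def IsHol : ℕ → ℝ → (ℝ → F) → Prop
  | 0, α, u => Function.Periodic u (2 * π) ∧ Continuous u ∧
      ∃ C, ∀ s t, ‖u s - u t‖ ≤ C * chord (s, t) ^ α
  | k + 1, α, u => Function.Periodic u (2 * π) ∧ Differentiable ℝ u ∧ IsHol k α (deriv u)

/-- The norm of `C^{k,α}`. -/
def hnorm : ℕ → ℝ → (ℝ → F) → ℝ
  | 0, α, u => supN u + holN α u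
  | k + 1, α, u => supN u + hnorm k α (deriv u)

theorem periodic_deriv {u : ℝ → F} (h : Function.Periodic u (2 * π)) :
    Function.Periodic (deriv u) (2 * π) := by
  intro t
  have h1 : (fun x => u (x + 2 * π)) = u := funext h
  have h2 := deriv_comp_add_const u (2 * π) t
  rw [h1] at h2
  exact h2.symm

namespace IsHol

variable {k : ℕ} {α : ℝ} {u v : ℝ → F}

theorem periodic (hu : IsHol k α u) : Function.Periodic u (2 * π) := by
  cases k <;> exact hu.1

theorem continuous (hu : IsHol k α u) : Continuous u := by
  cases k with
  | zero => exact hu.2.1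
  | succ k => exact hu.2.1.continuous

theorem bddAbove (hu : IsHol k α u) : BddAbove (Set.range fun t => ‖u t‖) := by
  obtain ⟨C, hC⟩ := (hu.periodic.compact_of_continuous Real.two_pi_pos.ne'
    hu.continuous).isBounded.exists_norm_le
  refine ⟨C, ?_⟩
  rintro _ ⟨t, rfl⟩
  exact hC _ ⟨t, rfl⟩

theorem norm_le_supN (hu : IsHol k α u) (t : ℝ) : ‖u t‖ ≤ supN u := le_ciSup hu.bddAbove t

theorem bddAbove_quot (hu : IsHol 0 α u) :
    BddAbove (Set.range fun p : ℝ × ℝ => ‖u p.1 - u p.2‖ / chord p ^ α) := by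
  obtain ⟨C, hC⟩ := hu.2.2
  refine ⟨max C 0, ?_⟩
  rintro _ ⟨p, rfl⟩
  exact div_le_of_le_mul₀ (chord_rpow_nonneg α p) (le_max_right _ _)
    ((hC _ _).trans (mul_le_mul_of_nonneg_right (le_max_left _ _) (chord_rpow_nonneg α p)))

theorem norm_sub_le_holN (hu : IsHol 0 α u) (s t : ℝ) :
    ‖u s - u t‖ ≤ holN α u * chord (s, t) ^ α := by
  rcases (chord_rpow_nonneg α (s, t)).eq_or_lt with h | h
  · obtain ⟨C, hC⟩ := hu.2.2
    have h1 := hC s t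
    rw [← h, mul_zero] at h1 ⊢
    exact h1
  · have h1 := le_ciSup hu.bddAbove_quot (s, t)
    exact (div_le_iff₀ h).1 h1

theorem isHol_deriv (hu : IsHol (k + 1) α u) : IsHol k α (deriv u) := hu.2.2

theorem add (hu : IsHol k α u) (hv : IsHol k α v) : IsHol k α (u + v) := by
  induction k generalizing u v with
  | zero =>
    obtain ⟨C, hC⟩ := hu.2.2
    obtain ⟨D, hD⟩ := hv.2.2
    refine ⟨hu.1.add hv.1, hu.2.1.add hv.2.1, C + D, fun s t => ?_⟩
    rw [Pi.add_apply, Pi.add_apply, add_sub_add_comm, add_mul]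
    exact (norm_add_le _ _).trans (add_le_add (hC s t) (hD s t))
  | succ k ih =>
    refine ⟨hu.1.add hv.1, hu.2.1.add hv.2.1, ?_⟩
    have : deriv (u + v) = deriv u + deriv v :=
      funext fun t => deriv_add (hu.2.1 t) (hv.2.1 t)
    rw [this]
    exact ih hu.2.2 hv.2.2

theorem clm (L : F →L[ℝ] G) (hu : IsHol k α u) : IsHol k α (fun t => L (u t)) := by
  induction k generalizing u with
  | zero =>
    refine ⟨hu.1.comp L, L.continuous.comp hu.2.1, ‖L‖ * holN α u, fun s t => ?_⟩
    rw [← map_sub, mul_assoc]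
    exact L.le_opNorm_of_le (hu.norm_sub_le_holN s t)
  | succ k ih =>
    refine ⟨hu.1.comp L, L.differentiable.comp hu.2.1, ?_⟩
    have : deriv (fun t => L (u t)) = fun t => L (deriv u t) :=
      funext fun t => (L.hasFDerivAt.comp_hasDerivAt t (hu.2.1 t).hasDerivAt).deriv
    rw [this]
    exact ih hu.2.2

theorem const (c : F) : IsHol k α (fun _ => c) := by
  induction k generalizing c with
  | zero => exact ⟨fun _ => rfl, continuous_const, 0, fun s t => by simp⟩
  | succ k ih =>
    refine ⟨fun _ => rfl, differentiable_const c, ?_⟩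
    rw [show deriv (fun _ : ℝ => c) = fun _ => 0 from funext fun t => deriv_const t c]
    exact ih 0

theorem smul (c : ℝ) (hu : IsHol k α u) : IsHol k α (c • u) :=
  hu.clm (c • ContinuousLinearMap.id ℝ F)

end IsHol

theorem hnorm_nonneg (k : ℕ) (α : ℝ) (u : ℝ → F) : 0 ≤ hnorm k α u := by
  induction k generalizing u with
  | zero => exact add_nonneg (supN_nonneg u) (holN_nonneg α u)
  | succ k ih => exact add_nonneg (supN_nonneg u) (ih _)

theorem supN_le_hnorm (k : ℕ) (α : ℝ) (u : ℝ → F) : supN u ≤ hnorm k α u := by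
  cases k with
  | zero => exact le_add_of_nonneg_right (holN_nonneg α u)
  | succ k => exact le_add_of_nonneg_right (hnorm_nonneg k α _)

theorem supN_add_le {k : ℕ} {α : ℝ} {u v : ℝ → F} (hu : IsHol k α u) (hv : IsHol k α v) :
    supN (u + v) ≤ supN u + supN v :=
  supN_le fun t => (norm_add_le _ _).trans (add_le_add (hu.norm_le_supN t) (hv.norm_le_supN t))

theorem hnorm_add_le {k : ℕ} {α : ℝ} {u v : ℝ → F} (hu : IsHol k α u) (hv : IsHol k α v) :
    hnorm k α (u + v) ≤ hnorm k α u + hnorm k α v := by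
  induction k generalizing u v with
  | zero =>
    have h1 := supN_add_le hu hv
    have h2 : holN α (u + v) ≤ holN α u + holN α v := by
      refine holN_le (add_nonneg (holN_nonneg α u) (holN_nonneg α v)) fun s t => ?_
      rw [Pi.add_apply, Pi.add_apply, add_sub_add_comm, add_mul]
      exact (norm_add_le _ _).trans
        (add_le_add (hu.norm_sub_le_holN s t) (hv.norm_sub_le_holN s t))
    simp only [hnorm]
    linarith
  | succ k ih =>
    have : deriv (u + v) = deriv u + deriv v :=
      funext fun t => deriv_add (hu.2.1 t) (hv.2.1 t)
    have h1 := supN_add_le hu hv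
    have h2 := ih hu.2.2 hv.2.2
    simp only [hnorm]
    rw [this]
    linarith

theorem hnorm_clm_le {k : ℕ} {α : ℝ} {u : ℝ → F} (L : F →L[ℝ] G) (hu : IsHol k α u) :
    hnorm k α (fun t => L (u t)) ≤ ‖L‖ * hnorm k α u := by
  have h0 : supN (fun t => L (u t)) ≤ ‖L‖ * supN u :=
    supN_le fun t => L.le_opNorm_of_le (hu.norm_le_supN t)
  induction k generalizing u with
  | zero =>
    have h2 : holN α (fun t => L (u t)) ≤ ‖L‖ * holN α u := by
      refine holN_le (mul_nonneg (norm_nonneg _) (holN_nonneg α u)) fun s t => ?_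
      rw [← map_sub, mul_assoc]
      exact L.le_opNorm_of_le (hu.norm_sub_le_holN s t)
    simp only [hnorm]
    linarith
  | succ k ih =>
    have : deriv (fun t => L (u t)) = fun t => L (deriv u t) :=
      funext fun t => (L.hasFDerivAt.comp_hasDerivAt t (hu.2.1 t).hasDerivAt).deriv
    have h2 := ih hu.2.2 (supN_le fun t => L.le_opNorm_of_le (hu.isHol_deriv.norm_le_supN t))
    simp only [hnorm]
    rw [this]
    linarith

theorem hnorm_smul {k : ℕ} {α : ℝ} {u : ℝ → F} (c : ℝ) (hu : IsHol k α u) :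
    hnorm k α (c • u) = |c| * hnorm k α u := by
  have key : ∀ (c : ℝ) (u : ℝ → F), IsHol k α u → hnorm k α (c • u) ≤ |c| * hnorm k α u := by
    intro c u hu
    refine (hnorm_clm_le (c • ContinuousLinearMap.id ℝ F) hu).trans
      (mul_le_mul_of_nonneg_right ?_ (hnorm_nonneg k α u))
    rw [norm_smul]
    exact mul_le_of_le_one_right (norm_nonneg _) ContinuousLinearMap.norm_id_le
  refine le_antisymm (key c u hu) ?_
  rcases eq_or_ne c 0 with rfl | hc
  · rw [abs_zero, zero_mul]
    exact hnorm_nonneg _ _ _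
  · have h := key c⁻¹ (c • u) (hu.smul c)
    rw [smul_smul, inv_mul_cancel₀ hc, one_smul, abs_inv] at h
    have hc' : 0 < |c| := abs_pos.2 hc
    calc |c| * hnorm k α u ≤ |c| * (|c|⁻¹ * hnorm k α (c • u)) :=
          mul_le_mul_of_nonneg_left h hc'.le
      _ = hnorm k α (c • u) := by
          rw [← mul_assoc, mul_inv_cancel₀ hc'.ne', one_mul]

theorem IsHol.of_hasDerivAt {k : ℕ} {α : ℝ} {u u' : ℝ → F}
    (hp : Function.Periodic u (2 * π)) (h : ∀ t, HasDerivAt u (u' t) t) (hu' : IsHol k α u') :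
    IsHol (k + 1) α u := by
  refine ⟨hp, fun t => (h t).differentiableAt, ?_⟩
  rwa [show deriv u = u' from funext fun t => (h t).deriv]

theorem abs_le_pi_mul_rpow {α : ℝ} [Exponent α] {x : ℝ} (hx : |x| ≤ π) :
    |x| ≤ π * |x| ^ α := by
  rcases (abs_nonneg x).eq_or_lt with h | h
  · rw [← h]
    exact mul_nonneg Real.pi_pos.le (Real.rpow_nonneg le_rfl _)
  · have h1 : |x| ^ (1 - α) ≤ π ^ (1 - α) :=
      Real.rpow_le_rpow h.le hx (sub_nonneg.2 (Exponent.lt_one (α := α)).le)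
    have h2 : π ^ (1 - α) ≤ π ^ (1 : ℝ) :=
      Real.rpow_le_rpow_of_exponent_le (by linarith [Real.pi_gt_three])
        (by linarith [Exponent.pos (α := α)])
    rw [Real.rpow_one] at h2
    calc |x| = |x| ^ (1 - α) * |x| ^ α := by
          rw [← Real.rpow_add h]
          simp
      _ ≤ π * |x| ^ α :=
          mul_le_mul_of_nonneg_right (h1.trans h2) (Real.rpow_nonneg h.le _)

theorem holder_of_deriv_le {α : ℝ} [Exponent α] {u : ℝ → F}
    (hp : Function.Periodic u (2 * π)) (hu : Differentiable ℝ u) {C : ℝ}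
    (hC : ∀ t, ‖deriv u t‖ ≤ C) (s t : ℝ) : ‖u s - u t‖ ≤ C * 7 * chord (s, t) ^ α := by
  have hC0 : 0 ≤ C := (norm_nonneg _).trans (hC 0)
  have h := holder_of_periodic (α := α) hp (Exponent.pos).le (Exponent.lt_one).le
    (C := C * π) (by positivity) (fun s t hst => by
      have h1 := convex_univ.norm_image_sub_le_of_norm_deriv_le
        (fun x _ => hu x) (fun x _ => hC x) (Set.mem_univ t) (Set.mem_univ s)
      rw [mul_assoc]
      exact h1.trans (mul_le_mul_of_nonneg_left (abs_le_pi_mul_rpow hst) hC0)) s t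
  refine h.trans (mul_le_mul_of_nonneg_right ?_ (chord_rpow_nonneg _ _))
  rw [mul_assoc]
  exact mul_le_mul_of_nonneg_left (by linarith [Real.pi_lt_d2]) hC0

theorem IsHol.of_succ {k : ℕ} {α : ℝ} [Exponent α] {u : ℝ → F} (hu : IsHol (k + 1) α u) :
    IsHol k α u := by
  induction k generalizing u with
  | zero =>
    exact ⟨hu.1, hu.2.1.continuous, _,
      holder_of_deriv_le hu.1 hu.2.1 fun t => hu.isHol_deriv.norm_le_supN t⟩
  | succ k ih => exact ⟨hu.1, hu.2.1, ih hu.2.2⟩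

theorem hnorm_le_succ {k : ℕ} {α : ℝ} [Exponent α] {u : ℝ → F} (hu : IsHol (k + 1) α u) :
    hnorm k α u ≤ 7 * hnorm (k + 1) α u := by
  induction k generalizing u with
  | zero =>
    have h1 : holN α u ≤ supN (deriv u) * 7 :=
      holN_le (mul_nonneg (supN_nonneg _) (by norm_num))
        (holder_of_deriv_le hu.1 hu.2.1 fun t => hu.isHol_deriv.norm_le_supN t)
    have h2 := holN_nonneg α (deriv u)
    have h3 := supN_nonneg u
    simp only [hnorm]
    linarith
  | succ k ih =>
    have h1 := ih hu.2.2
    have h3 := supN_nonneg u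
    rw [hnorm.eq_2 (k := k), hnorm.eq_2 (k := k + 1)]
    linarith

theorem IsHol.bilin {k : ℕ} {α : ℝ} [Exponent α] (B : F →L[ℝ] G →L[ℝ] H) {u : ℝ → F}
    {v : ℝ → G} (hu : IsHol k α u) (hv : IsHol k α v) :
    IsHol k α (fun t => B (u t) (v t)) ∧
      hnorm k α (fun t => B (u t) (v t)) ≤ 15 ^ k * ‖B‖ * hnorm k α u * hnorm k α v := by
  have hB : 0 ≤ ‖B‖ := norm_nonneg B
  have hper : Function.Periodic (fun t => B (u t) (v t)) (2 * π) := fun t => by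
    simp only [hu.periodic t, hv.periodic t]
  have hsup : supN (fun t => B (u t) (v t)) ≤ ‖B‖ * supN u * supN v := supN_le fun t =>
    (B.le_opNorm₂ _ _).trans (mul_le_mul (mul_le_mul_of_nonneg_left (hu.norm_le_supN t) hB)
      (hv.norm_le_supN t) (norm_nonneg _) (mul_nonneg hB (supN_nonneg u)))
  induction k generalizing u v with
  | zero =>
    have h1 : ∀ s t, ‖B (u s) (v s) - B (u t) (v t)‖ ≤
        (‖B‖ * (holN α u * supN v + supN u * holN α v)) * chord (s, t) ^ α := by
      intro s t
      have e : B (u s) (v s) - B (u t) (v t) = B (u s - u t) (v s) + B (u t) (v s - v t) := by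
        simp
      rw [e]
      have h2 : ‖B (u s - u t) (v s)‖ ≤ ‖B‖ * (holN α u * chord (s, t) ^ α) * supN v :=
        (B.le_opNorm₂ _ _).trans (mul_le_mul (mul_le_mul_of_nonneg_left
          (hu.norm_sub_le_holN s t) hB) (hv.norm_le_supN s) (norm_nonneg _)
          (mul_nonneg hB (mul_nonneg (holN_nonneg _ _) (chord_rpow_nonneg _ _))))
      have h3 : ‖B (u t) (v s - v t)‖ ≤ ‖B‖ * supN u * (holN α v * chord (s, t) ^ α) :=
        (B.le_opNorm₂ _ _).trans (mul_le_mul (mul_le_mul_of_nonneg_left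
          (hu.norm_le_supN t) hB) (hv.norm_sub_le_holN s t) (norm_nonneg _)
          (mul_nonneg hB (supN_nonneg u)))
      refine (norm_add_le _ _).trans ((add_le_add h2 h3).trans (le_of_eq ?_))
      ring
    have h5 : 0 ≤ ‖B‖ * (holN α u * supN v + supN u * holN α v) :=
      mul_nonneg hB (add_nonneg (mul_nonneg (holN_nonneg _ _) (supN_nonneg _))
        (mul_nonneg (supN_nonneg _) (holN_nonneg _ _)))
    refine ⟨⟨hper, by have := hu.continuous; have := hv.continuous; fun_prop, _, h1⟩, ?_⟩
    have h4 := holN_le h5 h1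
    have h6 : 0 ≤ ‖B‖ * (holN α u * holN α v) :=
      mul_nonneg hB (mul_nonneg (holN_nonneg _ _) (holN_nonneg _ _))
    simp only [hnorm, pow_zero, one_mul]
    nlinarith
  | succ k ih =>
    have hd : ∀ t, HasDerivAt (fun t => B (u t) (v t)) (B (u t) (deriv v t) +
        B (deriv u t) (v t)) t := fun t =>
      B.hasDerivAt_of_bilinear (fun _ => (hu.2.1 t).hasDerivAt) fun _ => (hv.2.1 t).hasDerivAt
    have hu1 := hu.of_succ
    have hv1 := hv.of_succ
    have e : ∀ {u : ℝ → F} {v : ℝ → G}, IsHol k α u → IsHol k α v →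
        Function.Periodic (fun t => B (u t) (v t)) (2 * π) := fun hu hv t => by
      simp only [hu.periodic t, hv.periodic t]
    have e' : ∀ {u : ℝ → F} {v : ℝ → G}, IsHol k α u → IsHol k α v →
        supN (fun t => B (u t) (v t)) ≤ ‖B‖ * supN u * supN v := fun hu hv => supN_le fun t =>
      (B.le_opNorm₂ _ _).trans (mul_le_mul (mul_le_mul_of_nonneg_left (hu.norm_le_supN t) hB)
        (hv.norm_le_supN t) (norm_nonneg _) (mul_nonneg hB (supN_nonneg _)))
    obtain ⟨i1, n1⟩ := ih hu1 hv.2.2 (e hu1 hv.2.2) (e' hu1 hv.2.2)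
    obtain ⟨i2, n2⟩ := ih hu.2.2 hv1 (e hu.2.2 hv1) (e' hu.2.2 hv1)
    refine ⟨IsHol.of_hasDerivAt hper hd (i1.add i2), ?_⟩
    have n3 := hnorm_add_le i1 i2
    have n4 := hnorm_le_succ hu
    have n5 := hnorm_le_succ hv
    have ed : deriv (fun t => B (u t) (v t)) = (fun t => B (u t) (deriv v t)) +
        fun t => B (deriv u t) (v t) := funext fun t => (hd t).deriv
    rw [hnorm.eq_2, ed]
    have a0 := hnorm_nonneg (k + 1) α u
    have b0 := hnorm_nonneg (k + 1) α v
    have a1 : hnorm k α (deriv u) + supN u = hnorm (k + 1) α u := by rw [hnorm.eq_2, add_comm]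
    have b1 : hnorm k α (deriv v) + supN v = hnorm (k + 1) α v := by rw [hnorm.eq_2, add_comm]
    have a2 := supN_nonneg u
    have b2 := supN_nonneg v
    have a3 := hnorm_nonneg k α (deriv u)
    have b3 := hnorm_nonneg k α (deriv v)
    have a4 := hnorm_nonneg k α u
    have b4 := hnorm_nonneg k α v
    set U := hnorm (k + 1) α u
    set V := hnorm (k + 1) α v
    have p1 : (1 : ℝ) ≤ 15 ^ k := one_le_pow₀ (by norm_num)
    have m1 : hnorm k α u * hnorm k α (deriv v) ≤ 7 * U * V :=
      mul_le_mul n4 (by linarith) b3 (by linarith)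
    have m2 : hnorm k α (deriv u) * hnorm k α v ≤ U * (7 * V) :=
      mul_le_mul (by linarith) n5 b4 a0
    have m3 : supN u * supN v ≤ U * V := mul_le_mul (by linarith) (by linarith) b2 a0
    have q : 0 ≤ 15 ^ k * ‖B‖ := by positivity
    have q1 := mul_le_mul_of_nonneg_left m1 q
    have q2 := mul_le_mul_of_nonneg_left m2 q
    have q3 := mul_le_mul_of_nonneg_left m3 hB
    have q4 : ‖B‖ * (U * V) ≤ 15 ^ k * ‖B‖ * (U * V) := by
      have : 0 ≤ ‖B‖ * (U * V) := by positivity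
      nlinarith
    calc supN (fun t => B (u t) (v t)) + hnorm k α ((fun t => B (u t) (deriv v t)) +
          fun t => B (deriv u t) (v t))
        ≤ ‖B‖ * (supN u * supN v) + (15 ^ k * ‖B‖ * (hnorm k α u * hnorm k α (deriv v)) +
            15 ^ k * ‖B‖ * (hnorm k α (deriv u) * hnorm k α v)) := by
          rw [← mul_assoc ‖B‖, ← mul_assoc (15 ^ k * ‖B‖), ← mul_assoc (15 ^ k * ‖B‖)]
          linarith
      _ ≤ 15 ^ k * ‖B‖ * (U * V) + (15 ^ k * ‖B‖ * (7 * U * V) + 15 ^ k * ‖B‖ * (U * (7 * V))) := by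
          linarith
      _ = 15 ^ (k + 1) * ‖B‖ * U * V := by
          rw [pow_succ]
          ring

end Functions

end KStat

end

noncomputable section

namespace KStat

open Real Filter Topology

section Bundled

variable {F G H : Type*} [NormedAddCommGroup F] [NormedSpace ℝ F] [NormedAddCommGroup G]
  [NormedSpace ℝ G] [NormedAddCommGroup H] [NormedSpace ℝ H] {k : ℕ} {α : ℝ}

/-- The vector space of `2π`-periodic functions of class `C^{k,α}`. -/
def holSubmodule (k : ℕ) (α : ℝ) (F : Type*) [NormedAddCommGroup F] [NormedSpace ℝ F] :
    Submodule ℝ (ℝ → F) where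
  carrier := {u | IsHol k α u}
  add_mem' := fun hu hv => hu.add hv
  zero_mem' := IsHol.const 0
  smul_mem' := fun c _ hu => hu.smul c

/-- The normed space of `2π`-periodic functions of class `C^{k,α}`. -/
def Hol (k : ℕ) (α : ℝ) (F : Type*) [NormedAddCommGroup F] [NormedSpace ℝ F] : Type _ :=
  ↥(holSubmodule k α F)

namespace Hol

instance : AddCommGroup (Hol k α F) := inferInstanceAs (AddCommGroup ↥(holSubmodule k α F))
instance : Module ℝ (Hol k α F) := inferInstanceAs (Module ℝ ↥(holSubmodule k α F))

/-- The underlying function. -/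
def toFun (u : Hol k α F) : ℝ → F := u.1

instance : CoeFun (Hol k α F) (fun _ => ℝ → F) := ⟨toFun⟩
instance : Norm (Hol k α F) := ⟨fun u => 15 ^ k * hnorm k α u⟩

/-- A periodic function of class `C^{k,α}` as an element of the space. -/
def mk (u : ℝ → F) (hu : IsHol k α u) : Hol k α F := ⟨u, hu⟩

@[simp] theorem mk_apply (u : ℝ → F) (hu : IsHol k α u) (t : ℝ) : mk u hu t = u t := rfl

theorem isHol (u : Hol k α F) : IsHol k α u := u.2

@[ext] theorem ext {u v : Hol k α F} (h : ∀ t, u t = v t) : u = v := Subtype.ext (funext h)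

@[simp] theorem add_apply (u v : Hol k α F) (t : ℝ) : (u + v) t = u t + v t := rfl
@[simp] theorem neg_apply (u : Hol k α F) (t : ℝ) : (-u) t = -u t := rfl
@[simp] theorem sub_apply (u v : Hol k α F) (t : ℝ) : (u - v) t = u t - v t := rfl
@[simp] theorem smul_apply (c : ℝ) (u : Hol k α F) (t : ℝ) : (c • u) t = c • u t := rfl
@[simp] theorem zero_apply (t : ℝ) : (0 : Hol k α F) t = 0 := rfl

theorem norm_def (u : Hol k α F) : ‖u‖ = 15 ^ k * hnorm k α u := rfl

theorem hnorm_le_norm (u : Hol k α F) : hnorm k α u ≤ ‖u‖ := by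
  have h1 : (1 : ℝ) ≤ 15 ^ k := one_le_pow₀ (by norm_num)
  exact le_mul_of_one_le_left (hnorm_nonneg k α _) h1

theorem norm_apply_le (u : Hol k α F) (t : ℝ) : ‖u t‖ ≤ ‖u‖ :=
  (u.isHol.norm_le_supN t).trans ((supN_le_hnorm k α _).trans (hnorm_le_norm u))

theorem core (k : ℕ) (α : ℝ) (F : Type*) [NormedAddCommGroup F] [NormedSpace ℝ F] :
    NormedSpace.Core ℝ (Hol k α F) where
  norm_nonneg u := mul_nonneg (by positivity) (hnorm_nonneg k α u)
  norm_smul c u := by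
    rw [norm_def, norm_def, Real.norm_eq_abs, mul_left_comm]
    exact congrArg _ (hnorm_smul c u.isHol)
  norm_triangle u v := by
    rw [norm_def, norm_def, norm_def, ← mul_add]
    exact mul_le_mul_of_nonneg_left (hnorm_add_le u.isHol v.isHol) (by positivity)
  norm_eq_zero_iff u := by
    constructor
    · intro h
      ext t
      have h1 := norm_apply_le u t
      rw [h] at h1
      exact norm_le_zero_iff.1 h1
    · rintro rfl
      have h := hnorm_smul (k := k) (α := α) (0 : ℝ) (IsHol.const (0 : F))
      simp only [zero_smul, abs_zero, zero_mul] at h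
      rw [norm_def]
      have h2 : hnorm k α ((0 : Hol k α F) : ℝ → F) = 0 := h
      rw [h2, mul_zero]

instance : NormedAddCommGroup (Hol k α F) := NormedAddCommGroup.ofCore (core k α F)
instance : NormedSpace ℝ (Hol k α F) := NormedSpace.ofCore (core k α F)

/-- Evaluation at a point. -/
def evalL (t : ℝ) : Hol k α F →L[ℝ] F :=
  LinearMap.mkContinuous
    { toFun := fun u => u t
      map_add' := fun _ _ => rfl
      map_smul' := fun _ _ => rfl } 1 fun u => (norm_apply_le u t).trans (one_mul _).ge

@[simp] theorem evalL_apply (t : ℝ) (u : Hol k α F) : evalL t u = u t := rfl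

/-- Composition with a continuous linear map. -/
def mapL (L : F →L[ℝ] G) : Hol k α F →L[ℝ] Hol k α G :=
  LinearMap.mkContinuous
    { toFun := fun u => mk (fun t => L (u t)) (u.isHol.clm L)
      map_add' := fun u v => by ext t; simp
      map_smul' := fun c u => by ext t; simp } ‖L‖ fun u => by
    have h := mul_le_mul_of_nonneg_left (hnorm_clm_le L u.isHol) (by positivity : (0 : ℝ) ≤ 15 ^ k)
    rw [mul_left_comm] at h
    exact h

@[simp] theorem mapL_apply (L : F →L[ℝ] G) (u : Hol k α F) (t : ℝ) : mapL L u t = L (u t) := rfl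

/-- The bilinear map `(u, v) ↦ B(u, v)`. -/
def bilinL [Exponent α] (B : F →L[ℝ] G →L[ℝ] H) : Hol k α F →L[ℝ] Hol k α G →L[ℝ] Hol k α H :=
  LinearMap.mkContinuous₂
    (LinearMap.mk₂ ℝ (fun u v => mk (fun t => B (u t) (v t)) (u.isHol.bilin B v.isHol).1)
      (fun u v w => by ext t; simp) (fun c u v => by ext t; simp)
      (fun u v w => by ext t; simp) (fun c u v => by ext t; simp)) ‖B‖ fun u v => by
    have h := mul_le_mul_of_nonneg_left (u.isHol.bilin B v.isHol).2 (by positivity : (0 : ℝ) ≤ 15 ^ k)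
    refine h.trans (le_of_eq ?_)
    rw [norm_def, norm_def]
    ring

@[simp] theorem bilinL_apply [Exponent α] (B : F →L[ℝ] G →L[ℝ] H) (u : Hol k α F)
    (v : Hol k α G) (t : ℝ) : bilinL B u v t = B (u t) (v t) := rfl

theorem norm_bilinL_le [Exponent α] (B : F →L[ℝ] G →L[ℝ] H) (u : Hol k α F) (v : Hol k α G) :
    ‖bilinL B u v‖ ≤ ‖B‖ * ‖u‖ * ‖v‖ := by
  have h := mul_le_mul_of_nonneg_left (u.isHol.bilin B v.isHol).2 (by positivity : (0 : ℝ) ≤ 15 ^ k)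
  refine h.trans (le_of_eq ?_)
  rw [norm_def, norm_def]
  ring

/-- The constant functions. -/
def const (c : F) : Hol k α F := mk (fun _ => c) (IsHol.const c)

@[simp] theorem const_apply (c : F) (t : ℝ) : (const c : Hol k α F) t = c := rfl

/-- The derivative. -/
def D : Hol (k + 1) α F →L[ℝ] Hol k α F :=
  LinearMap.mkContinuous
    { toFun := fun u => mk (deriv u) u.isHol.isHol_deriv
      map_add' := fun u v => by
        ext t
        exact deriv_add (u.isHol.2.1 t) (v.isHol.2.1 t)
      map_smul' := fun c u => by
        ext t
        exact deriv_const_smul c (u.isHol.2.1 t) } 1 fun u => by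
    rw [one_mul, norm_def]
    have h1 : hnorm k α (deriv u) ≤ hnorm (k + 1) α u :=
      le_add_of_nonneg_left (supN_nonneg _)
    exact mul_le_mul (pow_le_pow_right₀ (by norm_num) (Nat.le_succ k)) h1 (hnorm_nonneg _ _ _)
      (by positivity)

theorem D_apply (u : Hol (k + 1) α F) (t : ℝ) : D u t = deriv u t := rfl

theorem hasDerivAt (u : Hol (k + 1) α F) (t : ℝ) : HasDerivAt u (D u t) t :=
  (u.isHol.2.1 t).hasDerivAt

/-- The inclusion of `C^{k+1,α}` into `C^{k,α}`. -/
def J [Exponent α] : Hol (k + 1) α F →L[ℝ] Hol k α F :=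
  LinearMap.mkContinuous
    { toFun := fun u => mk u u.isHol.of_succ
      map_add' := fun _ _ => rfl
      map_smul' := fun _ _ => rfl } 1 fun u => by
    rw [one_mul, norm_def, norm_def, pow_succ, mul_assoc]
    have h1 := hnorm_le_succ u.isHol
    have h2 := hnorm_nonneg (k + 1) α u
    exact mul_le_mul_of_nonneg_left (h1.trans (by linarith)) (by positivity)

@[simp] theorem J_apply [Exponent α] (u : Hol (k + 1) α F) (t : ℝ) : J u t = u t := rfl

theorem norm_succ_le [Exponent α] (u : Hol (k + 1) α F) : ‖u‖ ≤ 15 * (‖J u‖ + ‖D u‖) := by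
  have h1 : hnorm (k + 1) α u ≤ hnorm k α (J u) + hnorm k α (D u) :=
    add_le_add (supN_le_hnorm k α _) le_rfl
  have h2 := mul_le_mul_of_nonneg_left h1 (by positivity : (0 : ℝ) ≤ 15 ^ (k + 1))
  refine h2.trans (le_of_eq ?_)
  rw [norm_def, norm_def, pow_succ]
  ring

/-- An element of `C^{k+1,α}` from its derivative. -/
def ofDeriv [Exponent α] (u u' : Hol k α F) (h : ∀ t, HasDerivAt u (u' t) t) :
    Hol (k + 1) α F := mk u (IsHol.of_hasDerivAt u.isHol.periodic h u'.2)

theorem J_ofDeriv [Exponent α] (u u' : Hol k α F) (h : ∀ t, HasDerivAt u (u' t) t) :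
    J (ofDeriv u u' h) = u := rfl

theorem D_ofDeriv [Exponent α] (u u' : Hol k α F) (h : ∀ t, HasDerivAt u (u' t) t) :
    D (ofDeriv u u' h) = u' := by
  ext t
  exact (h t).deriv

theorem isInducing_JD [Exponent α] :
    IsInducing fun u : Hol (k + 1) α F => ((J u, D u) : Hol k α F × Hol k α F) := by
  have h : AntilipschitzWith 30 ((J.prod D : Hol (k + 1) α F →L[ℝ] Hol k α F × Hol k α F)) :=
    ContinuousLinearMap.antilipschitz_of_bound _ fun u => by
      have h1 := norm_succ_le u
      have h2 : ‖J u‖ ≤ ‖(J u, D u)‖ := norm_fst_le (J u, D u)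
      have h3 : ‖D u‖ ≤ ‖(J u, D u)‖ := norm_snd_le (J u, D u)
      change ‖u‖ ≤ 30 * ‖(J u, D u)‖
      linarith
  exact (h.isUniformInducing (J.prod D).uniformContinuous).isInducing

theorem norm_zero_le {u : Hol 0 α F} {C : ℝ} (hC : 0 ≤ C) (h0 : ∀ t, ‖u t‖ ≤ C)
    (h1 : ∀ s t, ‖u s - u t‖ ≤ C * chord (s, t) ^ α) : ‖u‖ ≤ C + C := by
  rw [norm_def, pow_zero, one_mul]
  exact add_le_add (supN_le h0) (holN_le hC h1)

theorem norm_sub_apply_le (u : Hol 0 α F) (s t : ℝ) :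
    ‖u s - u t‖ ≤ ‖u‖ * chord (s, t) ^ α := by
  refine (u.isHol.norm_sub_le_holN s t).trans (mul_le_mul_of_nonneg_right ?_ (chord_rpow_nonneg _ _))
  rw [norm_def, pow_zero, one_mul]
  exact le_add_of_nonneg_left (supN_nonneg _)

instance [Exponent α] [CompleteSpace F] : CompleteSpace (Hol k α F) := by
  induction k with
  | zero =>
    refine Metric.complete_of_cauchySeq_tendsto fun u hu => ?_
    have h1 : ∀ t, ∃ l, Tendsto (fun n => u n t) atTop (𝓝 l) := fun t =>
      cauchySeq_tendsto_of_complete (hu.map (evalL t).uniformContinuous)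
    choose v hv using h1
    have key : ∀ ε > 0, ∃ N, ∀ n ≥ N, (∀ t, ‖u n t - v t‖ ≤ ε) ∧
        ∀ s t, ‖(u n s - v s) - (u n t - v t)‖ ≤ ε * chord (s, t) ^ α := by
      intro ε hε
      obtain ⟨N, hN⟩ := Metric.cauchySeq_iff.1 hu ε hε
      refine ⟨N, fun n hn => ⟨fun t => ?_, fun s t => ?_⟩⟩
      · refine le_of_tendsto ((tendsto_const_nhds.sub (hv t)).norm) ?_
        filter_upwards [eventually_ge_atTop N] with m hm
        have h2 := hN n hn m hm
        rw [dist_eq_norm] at h2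
        exact (norm_apply_le (u n - u m) t).trans h2.le
      · refine le_of_tendsto (((tendsto_const_nhds.sub (hv s)).sub
          (tendsto_const_nhds.sub (hv t))).norm) ?_
        filter_upwards [eventually_ge_atTop N] with m hm
        have h2 := hN n hn m hm
        rw [dist_eq_norm] at h2
        exact (norm_sub_apply_le (u n - u m) s t).trans
          (mul_le_mul_of_nonneg_right h2.le (chord_rpow_nonneg _ _))
    have hunif : TendstoUniformly (fun n => ((u n : Hol 0 α F) : ℝ → F)) v atTop := by
      rw [Metric.tendstoUniformly_iff]
      intro ε hε
      obtain ⟨N, hN⟩ := key (ε / 2) (half_pos hε)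
      filter_upwards [eventually_ge_atTop N] with n hn t
      rw [dist_comm, dist_eq_norm]
      exact ((hN n hn).1 t).trans_lt (half_lt_self hε)
    have hvcont : Continuous v := hunif.continuous (Frequently.of_forall fun n => (u n).2.continuous)
    have hvper : Function.Periodic v (2 * π) := fun t =>
      tendsto_nhds_unique (hv (t + 2 * π)) (by simpa only [(u _).isHol.periodic t] using hv t)
    obtain ⟨N, hN⟩ := key 1 one_pos
    have hvh : IsHol 0 α v := by
      refine ⟨hvper, hvcont, ‖u N‖ + 1, fun s t => ?_⟩
      have h2 := (hN N le_rfl).2 s t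
      have h3 := norm_sub_apply_le (u N) s t
      have e : v s - v t = (u N s - u N t) - ((u N s - v s) - (u N t - v t)) := by abel
      rw [e, add_mul]
      exact (norm_sub_le _ _).trans (add_le_add h3 h2)
    refine ⟨mk v hvh, ?_⟩
    rw [Metric.tendsto_atTop]
    intro ε hε
    obtain ⟨N, hN⟩ := key (ε / 3) (by positivity)
    refine ⟨N, fun n hn => ?_⟩
    rw [dist_eq_norm]
    have h5 : ‖u n - mk v hvh‖ ≤ ε / 3 + ε / 3 :=
      norm_zero_le (by positivity) (hN n hn).1 (hN n hn).2
    linarith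
  | succ k ih =>
    refine Metric.complete_of_cauchySeq_tendsto fun u hu => ?_
    obtain ⟨v, hv⟩ := cauchySeq_tendsto_of_complete
      ((J : Hol (k + 1) α F →L[ℝ] Hol k α F).uniformContinuous.comp_cauchySeq hu)
    obtain ⟨w, hw⟩ := cauchySeq_tendsto_of_complete
      ((D : Hol (k + 1) α F →L[ℝ] Hol k α F).uniformContinuous.comp_cauchySeq hu)
    have hd : ∀ t, HasDerivAt v (w t) t := by
      refine hasDerivAt_of_tendstoUniformly (l := atTop)
        (f := fun n t => u n t) (f' := fun n t => D (u n) t) ?_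
        (Eventually.of_forall fun n t => hasDerivAt (u n) t) ?_
      · rw [Metric.tendstoUniformly_iff]
        intro ε hε
        filter_upwards [Metric.tendsto_nhds.1 hw ε hε] with n hn t
        rw [dist_comm, dist_eq_norm]
        rw [dist_eq_norm] at hn
        exact (norm_apply_le (D (u n) - w) t).trans_lt hn
      · intro t
        exact ((evalL t).continuous.tendsto _).comp hv
    refine ⟨ofDeriv v w hd, ?_⟩
    rw [isInducing_JD.tendsto_nhds_iff]
    exact hv.prodMk_nhds (by rw [D_ofDeriv]; exact hw)

/-- The product of `C^{k,α}` functions. -/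
instance [Exponent α] : Mul (Hol k α ℂ) :=
  ⟨fun u v => bilinL (ContinuousLinearMap.mul ℝ ℂ) u v⟩

@[simp] theorem mul_apply [Exponent α] (u v : Hol k α ℂ) (t : ℝ) : (u * v) t = u t * v t := rfl

instance : One (Hol k α ℂ) := ⟨const 1⟩

@[simp] theorem one_apply (t : ℝ) : (1 : Hol k α ℂ) t = 1 := rfl

instance [Exponent α] : NormedCommRing (Hol k α ℂ) where
  __ := (inferInstance : NormedAddCommGroup (Hol k α ℂ))
  mul_assoc u v w := by ext t; simp [mul_assoc]
  one_mul u := by ext t; simp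
  mul_one u := by ext t; simp
  left_distrib u v w := by ext t; simp [mul_add]
  right_distrib u v w := by ext t; simp [add_mul]
  zero_mul u := by ext t; simp
  mul_zero u := by ext t; simp
  mul_comm u v := by ext t; simp [mul_comm]
  norm_mul_le u v := by
    refine (norm_bilinL_le _ u v).trans ?_
    have h : ‖ContinuousLinearMap.mul ℝ ℂ‖ ≤ 1 := ContinuousLinearMap.opNorm_mul_le ℝ ℂ
    calc _ ≤ 1 * ‖u‖ * ‖v‖ := by gcongr
      _ = ‖u‖ * ‖v‖ := by rw [one_mul]

instance [Exponent α] : NormedAlgebra ℝ (Hol k α ℂ) where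
  __ := Algebra.ofModule (fun r u v => by ext t; simp [mul_assoc])
    (fun r u v => by ext t; simp [mul_left_comm])
  norm_smul_le r u := (norm_smul r u).le

/-- Evaluation at a point, as a ring homomorphism. -/
def evalR [Exponent α] (t : ℝ) : Hol k α ℂ →+* ℂ where
  toFun u := u t
  map_one' := rfl
  map_mul' u v := mul_apply u v t
  map_zero' := rfl
  map_add' _ _ := rfl

@[simp] theorem pow_apply [Exponent α] (u : Hol k α ℂ) (n : ℕ) (t : ℝ) : (u ^ n) t = u t ^ n :=
  map_pow (evalR t) u n

@[simp] theorem sum_apply {ι : Type*} (s : Finset ι) (u : ι → Hol k α F) (t : ℝ) :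
    (∑ i ∈ s, u i) t = ∑ i ∈ s, u i t :=
  map_sum (evalL t) u s

end Hol

theorem isHol_of_contDiff [Exponent α] {u : ℝ → F} (hp : Function.Periodic u (2 * π))
    (hu : ContDiff ℝ (k + 1 : ℕ) u) : IsHol k α u := by
  induction k generalizing u with
  | zero =>
    have hd : Continuous (deriv u) := hu.continuous_deriv (by norm_num)
    obtain ⟨C, hC⟩ := ((periodic_deriv hp).compact_of_continuous Real.two_pi_pos.ne'
      hd).isBounded.exists_norm_le
    exact ⟨hp, hu.continuous, _, holder_of_deriv_le hp
      (hu.differentiable (by norm_num)) fun t => hC _ ⟨t, rfl⟩⟩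
  | succ k ih =>
    refine ⟨hp, hu.differentiable (by simp), ih (periodic_deriv hp) ?_⟩
    have h : ContDiff ℝ (((k + 1 : ℕ) : WithTop ℕ∞) + 1) u := by exact_mod_cast hu
    exact (contDiff_succ_iff_deriv.1 h).2.2

end Bundled

end KStat

end

noncomputable section

namespace KStat

open Real Filter Topology

/-! ### Superposition operators -/

section CMaps

variable {E F G : Type} [NormedAddCommGroup E] [NormedSpace ℝ E] [NormedAddCommGroup F]
  [NormedSpace ℝ F] [NormedAddCommGroup G] [NormedSpace ℝ G] {m : ℕ} {K : CompactDomain E}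

namespace CM

theorem norm_eq_derivs (f : CM m K F) : ‖f‖ = ‖derivs m K F f‖ := rfl

theorem norm_iteratedFDerivWithin_le (f : CM m K F) {j : ℕ} (hj : j ≤ m) {x : E}
    (hx : x ∈ K.carrier) : ‖iteratedFDerivWithin ℝ j f K.carrier x‖ ≤ ‖f‖ :=
  ((derivs m K F f ⟨j, Nat.lt_succ_iff.2 hj⟩).norm_coe_le_norm ⟨x, hx⟩).trans
    (norm_le_pi_norm (derivs m K F f) ⟨j, Nat.lt_succ_iff.2 hj⟩)

theorem norm_le_of_iteratedFDerivWithin {f : CM m K F} {C : ℝ} (hC : 0 ≤ C)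
    (h : ∀ j ≤ m, ∀ x ∈ K.carrier, ‖iteratedFDerivWithin ℝ j f K.carrier x‖ ≤ C) : ‖f‖ ≤ C := by
  rw [norm_eq_derivs, pi_norm_le_iff_of_nonneg hC]
  intro j
  rw [ContinuousMap.norm_le _ hC]
  exact fun x => h j (Nat.lt_succ_iff.1 j.2) x x.2

theorem contDiffOn (f : CM m K F) : ContDiffOn ℝ m f K.carrier := f.2.1

open Classical in
/-- The derivative of a function of class `C^{m+1}`. -/
def D : CM (m + 1) K F →L[ℝ] CM m K (E →L[ℝ] F) :=
  LinearMap.mkContinuous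
    { toFun := fun f => ⟨fun x => if x ∈ K.carrier then fderivWithin ℝ f K.carrier x else 0,
        (f.contDiffOn.fderivWithin (m := m) K.uniqueDiff (by norm_cast)).congr
          fun x hx => if_pos hx, fun x hx => if_neg hx⟩
      map_add' := fun f g => by
        apply Subtype.ext
        funext x
        by_cases hx : x ∈ K.carrier
        · have h1 := (f.contDiffOn.differentiableOn (by simp)) x hx
          have h2 := (g.contDiffOn.differentiableOn (by simp)) x hx
          have h3 := fderivWithin_add (K.uniqueDiff x hx) h1 h2
          change (if x ∈ K.carrier then fderivWithin ℝ (f + g : E → F) K.carrier x else 0) =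
            (if x ∈ K.carrier then fderivWithin ℝ f K.carrier x else 0) +
            (if x ∈ K.carrier then fderivWithin ℝ g K.carrier x else 0)
          simp only [hx, if_true]
          exact h3
        · change (if x ∈ K.carrier then fderivWithin ℝ (f + g : E → F) K.carrier x else 0) =
            (if x ∈ K.carrier then fderivWithin ℝ f K.carrier x else 0) +
            (if x ∈ K.carrier then fderivWithin ℝ g K.carrier x else 0)
          simp only [hx, if_false, add_zero]
      map_smul' := fun c f => by
        apply Subtype.ext
        funext x
        by_cases hx : x ∈ K.carrier
        · have h1 := (f.contDiffOn.differentiableOn (by simp)) x hx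
          have h3 := fderivWithin_const_smul (K.uniqueDiff x hx) h1 c
          change (if x ∈ K.carrier then fderivWithin ℝ (c • f : E → F) K.carrier x else 0) =
            c • (if x ∈ K.carrier then fderivWithin ℝ f K.carrier x else 0)
          simp only [hx, if_true]
          exact h3
        · change (if x ∈ K.carrier then fderivWithin ℝ (c • f : E → F) K.carrier x else 0) =
            c • (if x ∈ K.carrier then fderivWithin ℝ f K.carrier x else 0)
          simp only [hx, if_false, smul_zero] } 1 fun f => by
    rw [one_mul]
    refine norm_le_of_iteratedFDerivWithin (norm_nonneg _) fun j hj x hx => ?_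
    have h1 : iteratedFDerivWithin ℝ j
        (fun x => if x ∈ K.carrier then fderivWithin ℝ f K.carrier x else 0) K.carrier x =
        iteratedFDerivWithin ℝ j (fderivWithin ℝ f K.carrier) K.carrier x :=
      iteratedFDerivWithin_congr (fun y hy => if_pos hy) hx j
    change ‖iteratedFDerivWithin ℝ j
        (fun x => if x ∈ K.carrier then fderivWithin ℝ f K.carrier x else 0) K.carrier x‖ ≤ _
    rw [h1, norm_iteratedFDerivWithin_fderivWithin K.uniqueDiff hx]
    exact norm_iteratedFDerivWithin_le f (Nat.succ_le_succ hj) hx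

theorem D_apply (f : CM (m + 1) K F) {x : E} (hx : x ∈ K.carrier) :
    D f x = fderivWithin ℝ f K.carrier x := by
  classical
  exact if_pos hx

theorem hasFDerivWithinAt (f : CM (m + 1) K F) {x : E} (hx : x ∈ K.carrier) :
    HasFDerivWithinAt f (D f x) K.carrier x := by
  rw [D_apply f hx]
  exact ((f.contDiffOn.differentiableOn (by simp)) x hx).hasFDerivWithinAt

/-- The inclusion of `C^{m+1}` into `C^m`. -/
def J : CM (m + 1) K F →L[ℝ] CM m K F :=
  LinearMap.mkContinuous
    { toFun := fun f => ⟨f, f.contDiffOn.of_le (by exact_mod_cast Nat.le_succ m), f.2.2⟩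
      map_add' := fun _ _ => rfl
      map_smul' := fun _ _ => rfl } 1 fun f => by
    rw [one_mul]
    exact norm_le_of_iteratedFDerivWithin (norm_nonneg _) fun j hj x hx =>
      norm_iteratedFDerivWithin_le f (Nat.le_succ_of_le hj) hx

@[simp] theorem J_apply (f : CM (m + 1) K F) (x : E) : J f x = f x := rfl

@[simp] theorem sub_apply (f g : CM m K F) (x : E) : (f - g) x = f x - g x := rfl
end CM

variable {k : ℕ} {α : ℝ}

theorem CM.norm_sub_le (hK : Convex ℝ K.carrier) (f : CM (m + 1) K F) {x y : E}
    (hx : x ∈ K.carrier) (hy : y ∈ K.carrier) : ‖f x - f y‖ ≤ ‖f‖ * ‖x - y‖ :=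
  hK.norm_image_sub_le_of_norm_hasFDerivWithin_le (fun z hz => f.hasFDerivWithinAt hz)
    (fun z hz => by
      have h := CM.norm_iteratedFDerivWithin_le f (Nat.succ_le_succ (Nat.zero_le m)) hz
      rw [← norm_iteratedFDerivWithin_fderivWithin K.uniqueDiff hz,
        norm_iteratedFDerivWithin_zero] at h
      rwa [CM.D_apply f hz]) hy hx

theorem CM.hasDerivAt_comp (f : CM (m + 1) K F) {p : ℝ → E} {p' : E} {t : ℝ}
    (hp : ∀ t, p t ∈ K.carrier) (h : HasDerivAt p p' t) :
    HasDerivAt (fun t => f (p t)) (D f (p t) p') t := by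
  rw [← hasDerivWithinAt_univ]
  exact (f.hasFDerivWithinAt (hp t)).comp_hasDerivWithinAt t h.hasDerivWithinAt
    fun s _ => hp s

theorem IsHol.superpose (hK : Convex ℝ K.carrier) [Exponent α] (f : CM (k + 1) K F) {p : ℝ → E}
    (hp : IsHol k α p) (hpK : ∀ t, p t ∈ K.carrier) : IsHol k α (fun t => f (p t)) := by
  induction k generalizing F with
  | zero =>
    refine ⟨hp.1.comp f, ?_, ‖f‖ * holN α p, fun s t => ?_⟩
    · exact f.contDiffOn.continuousOn.comp_continuous hp.2.1 hpK
    · refine (f.norm_sub_le hK (hpK s) (hpK t)).trans ?_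
      rw [mul_assoc]
      exact mul_le_mul_of_nonneg_left (hp.norm_sub_le_holN s t) (norm_nonneg _)
  | succ k ih =>
    refine IsHol.of_hasDerivAt (hp.1.comp f)
      (fun t => f.hasDerivAt_comp hpK (hp.2.1 t).hasDerivAt) ?_
    exact (IsHol.bilin (ContinuousLinearMap.id ℝ (E →L[ℝ] F)) (ih (CM.D f) hp.of_succ)
      hp.isHol_deriv).1

namespace Hol

/-- The pointwise application of linear maps. -/
def appL [Exponent α] : Hol k α (E →L[ℝ] F) →L[ℝ] Hol k α E →L[ℝ] Hol k α F :=
  bilinL (ContinuousLinearMap.id ℝ (E →L[ℝ] F))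

@[simp] theorem appL_apply [Exponent α] (u : Hol k α (E →L[ℝ] F)) (v : Hol k α E) (t : ℝ) :
    appL u v t = u t (v t) := rfl

open Classical in
/-- The superposition `χ ∘ p`. -/
def comp (χ : CM (k + 1) K F) (p : Hol k α E) : Hol k α F :=
  if h : IsHol k α (fun t => χ (p t)) then mk _ h else 0

/-- The curves with values in `K`. -/
def curvesIn (k : ℕ) (α : ℝ) (K : CompactDomain E) : Set (Hol k α E) :=
  {p | ∀ t, p t ∈ K.carrier}

variable [Exponent α]

theorem comp_apply (hK : Convex ℝ K.carrier) (χ : CM (k + 1) K F) {p : Hol k α E}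
    (hp : p ∈ curvesIn k α K) (t : ℝ) : comp χ p t = χ (p t) := by
  have h : IsHol k α (fun t => χ (p t)) := p.2.superpose hK χ hp
  rw [comp, dif_pos h]
  rfl

theorem convex_curvesIn (hK : Convex ℝ K.carrier) : Convex ℝ (curvesIn k α K) :=
  fun _ hp _ hq _ _ ha hb hab t => hK (hp t) (hq t) ha hb hab

theorem D_comp (hK : Convex ℝ K.carrier) (χ : CM (k + 2) K F) {p : Hol (k + 1) α E}
    (hp : p ∈ curvesIn (k + 1) α K) :
    D (comp χ p) = appL (comp (CM.D χ) (J p)) (D p) := by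
  ext t
  rw [appL_apply, comp_apply hK _ (p := J p) hp, D_apply]
  have h : (comp χ p : ℝ → F) = fun t => χ (p t) := funext (comp_apply hK χ hp)
  rw [h]
  exact (χ.hasDerivAt_comp hp (hasDerivAt p t)).deriv

theorem J_comp (hK : Convex ℝ K.carrier) (χ : CM (k + 2) K F) {p : Hol (k + 1) α E}
    (hp : p ∈ curvesIn (k + 1) α K) : J (comp χ p) = comp (CM.J χ) (J p) := by
  ext t
  rw [J_apply, comp_apply hK _ hp, comp_apply hK _ (p := J p) hp]
  rfl

theorem continuousOn_comp_zero (hK : Convex ℝ K.carrier) :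
    ContinuousOn (fun x : CM 1 K F × Hol 0 α E => comp x.1 x.2)
      {x | x.2 ∈ curvesIn 0 α K} := by
  rintro ⟨χ₀, p₀⟩ hp₀
  rw [Metric.continuousWithinAt_iff]
  intro ε hε
  have hA : 0 < ‖p₀‖ + 1 := by positivity
  have hB : 0 < ‖χ₀‖ + 1 := by positivity
  obtain ⟨δ₁, hδ₁, hu⟩ := Metric.uniformContinuousOn_iff.1
    (K.isCompact.uniformContinuousOn_of_continuous (CM.D χ₀).contDiffOn.continuousOn)
    (ε / (8 * (‖p₀‖ + 1))) (by positivity)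
  refine ⟨min (min δ₁ 1) (min (ε / (8 * (‖p₀‖ + 1))) (ε / (8 * (‖χ₀‖ + 1)))), by positivity, ?_⟩
  rintro ⟨χ, p⟩ hp hd
  rw [Prod.dist_eq, max_lt_iff, lt_min_iff, lt_min_iff, lt_min_iff, lt_min_iff, lt_min_iff,
    lt_min_iff, dist_eq_norm, dist_eq_norm] at hd
  obtain ⟨⟨-, hχ, -⟩, ⟨hp1, hp2⟩, -, hp3⟩ := hd
  dsimp only at hχ hp1 hp2 hp3
  have e1 : (‖p₀‖ + 1) * (ε / (8 * (‖p₀‖ + 1))) = ε / 8 := by field_simp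
  have e2 : (‖χ₀‖ + 1) * (ε / (8 * (‖χ₀‖ + 1))) = ε / 8 := by field_simp
  have hpn : ‖p‖ ≤ ‖p₀‖ + 1 := by
    have : p = p₀ + (p - p₀) := by abel
    rw [this]
    exact (norm_add_le _ _).trans (by linarith)
  have hχp : ‖χ₀‖ * ‖p - p₀‖ ≤ ε / 8 := by
    rw [← e2]
    exact mul_le_mul (by linarith) hp3.le (norm_nonneg _) hB.le
  have h1 : ε / (8 * (‖p₀‖ + 1)) ≤ ε / 8 := by
    rw [← e1]
    exact le_mul_of_one_le_left (by positivity) (by linarith [norm_nonneg p₀])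
  rw [dist_eq_norm]
  have hmain : ‖comp χ p - comp χ₀ p₀‖ ≤ ε * (3 / 8) + ε * (3 / 8) := by
    refine norm_zero_le (by positivity) (fun t => ?_) (fun s t => ?_)
    · rw [sub_apply, comp_apply hK _ hp, comp_apply hK _ hp₀]
      have i1 : ‖(χ - χ₀) (p t)‖ ≤ ‖χ - χ₀‖ := CM.norm_apply_le _ _
      have i2 := χ₀.norm_sub_le hK (hp t) (hp₀ t)
      have i3 : ‖p t - p₀ t‖ ≤ ‖p - p₀‖ := norm_apply_le (p - p₀) t
      have i4 := mul_le_mul_of_nonneg_left i3 (norm_nonneg χ₀)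
      have e : χ (p t) - χ₀ (p₀ t) = (χ - χ₀) (p t) + (χ₀ (p t) - χ₀ (p₀ t)) := by
        rw [CM.sub_apply]
        abel
      rw [e]
      refine (norm_add_le _ _).trans ?_
      linarith
    · simp only [sub_apply, comp_apply hK _ hp, comp_apply hK _ hp₀]
      set c := chord (s, t) ^ α with hc
      have hc0 : 0 ≤ c := chord_rpow_nonneg _ _
      set γ : ℝ → E := fun σ => p t + σ • (p s - p t) with hγ
      set γ₀ : ℝ → E := fun σ => p₀ t + σ • (p₀ s - p₀ t) with hγ₀
      have hγK : ∀ σ ∈ Set.Icc (0 : ℝ) 1, γ σ ∈ K.carrier := fun σ hσ =>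
        hK.add_smul_sub_mem (hp t) (hp s) hσ
      have hγ₀K : ∀ σ ∈ Set.Icc (0 : ℝ) 1, γ₀ σ ∈ K.carrier := fun σ hσ =>
        hK.add_smul_sub_mem (hp₀ t) (hp₀ s) hσ
      have hd1 : ∀ (χ : CM 1 K F) (a b : E) (σ : ℝ), σ ∈ Set.Icc (0 : ℝ) 1 →
          (∀ σ ∈ Set.Icc (0 : ℝ) 1, a + σ • b ∈ K.carrier) →
          HasDerivWithinAt (fun σ : ℝ => χ (a + σ • b)) (CM.D χ (a + σ • b) b)
            (Set.Icc 0 1) σ := by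
        intro χ a b σ hσ hab
        have h2 : HasDerivWithinAt (fun σ : ℝ => a + σ • b) b (Set.Icc 0 1) σ := by
          simpa using (((hasDerivAt_id σ).smul_const b).const_add a).hasDerivWithinAt
        exact (χ.hasFDerivWithinAt (hab σ hσ)).comp_hasDerivWithinAt σ h2 hab
      have hbound : ∀ σ ∈ Set.Ico (0 : ℝ) 1,
          ‖CM.D χ (γ σ) (p s - p t) - CM.D χ₀ (γ₀ σ) (p₀ s - p₀ t)‖ ≤ ε * (3 / 8) * c := by
        intro σ hσ
        have hσ' : σ ∈ Set.Icc (0 : ℝ) 1 := ⟨hσ.1, hσ.2.le⟩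
        have e : CM.D χ (γ σ) (p s - p t) - CM.D χ₀ (γ₀ σ) (p₀ s - p₀ t) =
            CM.D (χ - χ₀) (γ σ) (p s - p t) + (CM.D χ₀ (γ σ) - CM.D χ₀ (γ₀ σ)) (p s - p t) +
              CM.D χ₀ (γ₀ σ) ((p - p₀) s - (p - p₀) t) := by
          have e0 : CM.D (χ - χ₀) (γ σ) = CM.D χ (γ σ) - CM.D χ₀ (γ σ) := by
            rw [map_sub]
            rfl
          rw [e0, sub_apply, sub_apply]
          simp only [_root_.sub_apply, map_sub]
          abel
        have j0 : ‖p s - p t‖ ≤ (‖p₀‖ + 1) * c :=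
          (norm_sub_apply_le p s t).trans (mul_le_mul_of_nonneg_right hpn hc0)
        have j1 : ‖CM.D (χ - χ₀) (γ σ)‖ ≤ ‖χ - χ₀‖ := (CM.norm_apply_le _ _).trans
          ((CM.D.le_of_opNorm_le (LinearMap.mkContinuous_norm_le _ zero_le_one _) _).trans
            (one_mul _).le)
        have j2 : ‖CM.D χ₀ (γ σ) - CM.D χ₀ (γ₀ σ)‖ ≤ ε / (8 * (‖p₀‖ + 1)) := by
          rw [← dist_eq_norm]
          refine (hu _ (hγK σ hσ') _ (hγ₀K σ hσ') ?_).le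
          rw [dist_eq_norm]
          have e3 : γ σ - γ₀ σ = (1 - σ) • ((p - p₀) t) + σ • ((p - p₀) s) := by
            simp only [hγ, hγ₀, sub_apply]
            module
          rw [e3]
          have l1 : ‖(1 - σ) • ((p - p₀) t)‖ ≤ (1 - σ) * ‖p - p₀‖ := by
            rw [norm_smul, Real.norm_of_nonneg (by linarith [hσ.2])]
            exact mul_le_mul_of_nonneg_left (norm_apply_le _ _) (by linarith [hσ.2])
          have l2 : ‖σ • ((p - p₀) s)‖ ≤ σ * ‖p - p₀‖ := by
            rw [norm_smul, Real.norm_of_nonneg hσ.1]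
            exact mul_le_mul_of_nonneg_left (norm_apply_le _ _) hσ.1
          refine (norm_add_le _ _).trans_lt ?_
          linarith
        have j3 : ‖CM.D χ₀ (γ₀ σ)‖ ≤ ‖χ₀‖ := (CM.norm_apply_le _ _).trans
          ((CM.D.le_of_opNorm_le (LinearMap.mkContinuous_norm_le _ zero_le_one _) _).trans
            (one_mul _).le)
        have j4 := norm_sub_apply_le (p - p₀) s t
        have k1 : ‖CM.D (χ - χ₀) (γ σ) (p s - p t)‖ ≤ ε / 8 * c := by
          refine (ContinuousLinearMap.le_of_opNorm_le_of_le _ (j1.trans hχ.le) j0).trans ?_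
          rw [← e1]
          linarith
        have k2 : ‖(CM.D χ₀ (γ σ) - CM.D χ₀ (γ₀ σ)) (p s - p t)‖ ≤ ε / 8 * c := by
          refine (ContinuousLinearMap.le_of_opNorm_le_of_le _ j2 j0).trans ?_
          rw [← e1]
          linarith
        have k3 : ‖CM.D χ₀ (γ₀ σ) ((p - p₀) s - (p - p₀) t)‖ ≤ ε / 8 * c := by
          refine (ContinuousLinearMap.le_of_opNorm_le_of_le _ j3 j4).trans ?_
          rw [← mul_assoc]
          exact mul_le_mul_of_nonneg_right hχp hc0
        rw [e]
        refine (norm_add₃_le).trans ?_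
        linarith
      have hmv := norm_image_sub_le_of_norm_deriv_le_segment_01'
        (f := fun σ => χ (γ σ) - χ₀ (γ₀ σ))
        (f' := fun σ => CM.D χ (γ σ) (p s - p t) - CM.D χ₀ (γ₀ σ) (p₀ s - p₀ t))
        (fun σ hσ => (hd1 χ _ _ σ hσ hγK).sub (hd1 χ₀ _ _ σ hσ hγ₀K)) hbound
      simp only [hγ, hγ₀, one_smul, zero_smul, add_zero, add_sub_cancel] at hmv
      exact hmv
  linarith

/-- Superposition is jointly continuous. -/
theorem continuousOn_comp (hK : Convex ℝ K.carrier) :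
    ContinuousOn (fun x : CM (k + 1) K F × Hol k α E => comp x.1 x.2)
      {x | x.2 ∈ curvesIn k α K} := by
  induction k generalizing F with
  | zero => exact continuousOn_comp_zero hK
  | succ k ih =>
    rw [isInducing_JD.continuousOn_iff]
    have h1 : ContinuousOn (fun x : CM (k + 2) K F × Hol (k + 1) α E => comp (CM.J x.1) (J x.2))
        {x | x.2 ∈ curvesIn (k + 1) α K} :=
      (ih (F := F)).comp (by fun_prop :
        Continuous fun x : CM (k + 2) K F × Hol (k + 1) α E => (CM.J x.1, J x.2)).continuousOn
        fun x hx => hx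
    have h2 : ContinuousOn (fun x : CM (k + 2) K F × Hol (k + 1) α E => comp (CM.D x.1) (J x.2))
        {x | x.2 ∈ curvesIn (k + 1) α K} :=
      (ih (F := E →L[ℝ] F)).comp (by fun_prop :
        Continuous fun x : CM (k + 2) K F × Hol (k + 1) α E => (CM.D x.1, J x.2)).continuousOn
        fun x hx => hx
    have h3 : ContinuousOn (fun x : CM (k + 2) K F × Hol (k + 1) α E => D x.2)
        {x | x.2 ∈ curvesIn (k + 1) α K} := (by fun_prop : Continuous _).continuousOn
    have h4 : ContinuousOn (fun x : CM (k + 2) K F × Hol (k + 1) α E =>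
        appL (comp (CM.D x.1) (J x.2)) (D x.2))
        {x | x.2 ∈ curvesIn (k + 1) α K} :=
      (appL.continuous.comp_continuousOn h2).clm_apply h3
    refine (h1.prodMk h4).congr fun x hx => ?_
    exact Prod.ext (J_comp hK x.1 hx) (D_comp hK x.1 hx)

end Hol

end CMaps

end KStat

end

noncomputable section

namespace KStat

open Real Filter Topology

/-! ### Continuous differentiability of superposition operators -/

section General

variable {X Z : Type*} [NormedAddCommGroup X] [NormedSpace ℝ X] [NormedAddCommGroup Z]
  [NormedSpace ℝ Z]

/-- A function which is strictly differentiable at all points of an open set is `C¹` on it. -/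
theorem contDiffOn_one_of_hasStrictFDerivAt {f : X → Z} {s : Set X} (hs : IsOpen s)
    (h : ∀ x ∈ s, ∃ f' : X →L[ℝ] Z, HasStrictFDerivAt f f' x) : ContDiffOn ℝ 1 f s := by
  have h1 : ContDiffOn ℝ (0 + 1) f s := by
    rw [contDiffOn_succ_iff_fderiv_of_isOpen hs]
    refine ⟨fun x hx => (h x hx).choose_spec.differentiableAt.differentiableWithinAt, by simp, ?_⟩
    rw [contDiffOn_zero]
    intro x hx
    refine ContinuousAt.continuousWithinAt ?_
    obtain ⟨f', hf'⟩ := h x hx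
    rw [Metric.continuousAt_iff']
    intro ε hε
    have hε2 : (0 : NNReal) < ⟨ε / 2, (half_pos hε).le⟩ := half_pos hε
    obtain ⟨t, ht, happ⟩ := hf'.approximates_deriv_on_nhds (Or.inr hε2)
    filter_upwards [eventually_mem_nhds_iff.2 ht, hs.mem_nhds hx] with y hy hys
    obtain ⟨g', hg'⟩ := h y hys
    rw [hf'.hasFDerivAt.fderiv, hg'.hasFDerivAt.fderiv, dist_eq_norm]
    have h2 := (hg'.hasFDerivAt.sub f'.hasFDerivAt).le_of_lipschitzOn hy
      (ApproximatesLinearOn.approximatesLinearOn_iff_lipschitzOnWith.1 happ)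
    exact h2.trans_lt (half_lt_self hε)
  rwa [zero_add] at h1

theorem intervalIntegrable_slice {g : X × ℝ → Z} {x : X}
    (hg : ∀ σ ∈ Set.Icc (0 : ℝ) 1, ContinuousAt g (x, σ)) :
    IntervalIntegrable (fun σ => g (x, σ)) MeasureTheory.volume 0 1 := by
  refine ContinuousOn.intervalIntegrable fun σ hσ => ?_
  rw [Set.uIcc_of_le zero_le_one] at hσ
  exact (ContinuousAt.comp (f := fun σ : ℝ => (x, σ)) (hg σ hσ)
    (by fun_prop)).continuousWithinAt

theorem continuousAt_fderiv_inl {f : X × ℝ → Z} {p : X × ℝ} (hf : ContDiffAt ℝ 1 f p) :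
    ContinuousAt (fun p => (fderiv ℝ f p).comp (ContinuousLinearMap.inl ℝ X ℝ)) p :=
  (hf.continuousAt_fderiv one_ne_zero).clm_comp continuousAt_const

/-- Integrals depending on a parameter. -/
theorem contDiffOn_one_integral [CompleteSpace Z] {f : X × ℝ → Z} {s : Set X} (hs : IsOpen s)
    (hf : ∀ x ∈ s, ∀ σ ∈ Set.Icc (0 : ℝ) 1, ContDiffAt ℝ 1 f (x, σ)) :
    ContDiffOn ℝ 1 (fun x => ∫ σ in (0 : ℝ)..1, f (x, σ)) s := by
  refine contDiffOn_one_of_hasStrictFDerivAt hs fun x₀ hx₀ => ?_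
  obtain ⟨f', hf'⟩ : ∃ f' : X × ℝ → X →L[ℝ] Z,
      f' = fun p => (fderiv ℝ f p).comp (ContinuousLinearMap.inl ℝ X ℝ) := ⟨_, rfl⟩
  have hf'c : ∀ x ∈ s, ∀ σ ∈ Set.Icc (0 : ℝ) 1, ContinuousAt f' (x, σ) := fun x hx σ hσ =>
    hf' ▸ continuousAt_fderiv_inl (hf x hx σ hσ)
  refine ⟨∫ σ in (0 : ℝ)..1, f' (x₀, σ), ?_⟩
  rw [hasStrictFDerivAt_iff_isLittleO, Asymptotics.isLittleO_iff]
  intro ε hε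
  have h1 : ∀ᶠ x in 𝓝 x₀, ∀ σ ∈ Set.Icc (0 : ℝ) 1, ‖f' (x, σ) - f' (x₀, σ)‖ < ε := by
    refine isCompact_Icc.eventually_forall_of_forall_eventually fun σ hσ => ?_
    have c2 : ContinuousAt (fun z : X × ℝ => f' (x₀, z.2)) (x₀, σ) :=
      ContinuousAt.comp (g := f') (f := fun z : X × ℝ => (x₀, z.2)) (hf'c x₀ hx₀ σ hσ)
        (by fun_prop)
    have h2 : ContinuousAt (fun z : X × ℝ => ‖f' z - f' (x₀, z.2)‖) (x₀, σ) :=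
      ((hf'c x₀ hx₀ σ hσ).sub c2).norm
    refine h2.eventually_lt continuousAt_const ?_
    simpa using hε
  obtain ⟨r, hr, hball⟩ := Metric.eventually_nhds_iff_ball.1 (h1.and (hs.mem_nhds hx₀))
  filter_upwards [prod_mem_nhds (Metric.ball_mem_nhds x₀ hr) (Metric.ball_mem_nhds x₀ hr)] with p hp
  have hc : ∀ x ∈ Metric.ball x₀ r, ∀ σ ∈ Set.Icc (0 : ℝ) 1, ContinuousAt f (x, σ) :=
    fun x hx σ hσ => (hf x (hball x hx).2 σ hσ).continuousAt
  have i1 := intervalIntegrable_slice (hc p.1 hp.1)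
  have i2 := intervalIntegrable_slice (hc p.2 hp.2)
  have i3 := intervalIntegrable_slice (hf'c x₀ hx₀)
  have e : (∫ σ in (0 : ℝ)..1, f (p.1, σ)) - (∫ σ in (0 : ℝ)..1, f (p.2, σ)) -
      (∫ σ in (0 : ℝ)..1, f' (x₀, σ)) (p.1 - p.2) =
      ∫ σ in (0 : ℝ)..1, (f (p.1, σ) - f (p.2, σ) - f' (x₀, σ) (p.1 - p.2)) := by
    rw [intervalIntegral.integral_sub (i1.sub i2), intervalIntegral.integral_sub i1 i2,
      ContinuousLinearMap.intervalIntegral_apply i3]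
    have i4 : ContinuousOn (fun σ => f' (x₀, σ) (p.1 - p.2)) (Set.uIcc 0 1) := by
      intro σ hσ
      rw [Set.uIcc_of_le zero_le_one] at hσ
      have c2 : ContinuousAt (fun σ : ℝ => f' (x₀, σ)) σ :=
        ContinuousAt.comp (g := f') (f := fun σ : ℝ => (x₀, σ)) (hf'c x₀ hx₀ σ hσ) (by fun_prop)
      exact (c2.clm_apply continuousAt_const).continuousWithinAt
    exact i4.intervalIntegrable
  rw [e]
  refine (intervalIntegral.norm_integral_le_of_norm_le_const (C := ε * ‖p.1 - p.2‖)
    fun σ hσ => ?_).trans (by simp)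
  rw [Set.uIoc_of_le zero_le_one] at hσ
  have hσ' : σ ∈ Set.Icc (0 : ℝ) 1 := ⟨hσ.1.le, hσ.2⟩
  refine Convex.norm_image_sub_le_of_norm_hasFDerivWithin_le' (f := fun x => f (x, σ))
    (f' := fun x => f' (x, σ)) (s := Metric.ball x₀ r) (fun x hx => ?_)
    (fun x hx => ((hball x hx).1 σ hσ').le) (convex_ball _ _) hp.2 hp.1
  have h3 := HasFDerivAt.comp (g := f) (f := fun x : X => (x, σ)) x
    ((hf x (hball x hx).2 σ hσ').differentiableAt one_ne_zero).hasFDerivAt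
    (hasFDerivAt_prodMk_left (𝕜 := ℝ) x σ)
  rw [hf']
  exact h3.hasFDerivWithinAt

end General

section CMaps

variable {E F : Type} [NormedAddCommGroup E] [NormedSpace ℝ E] [NormedAddCommGroup F]
  [NormedSpace ℝ F] {K : CompactDomain E} {k : ℕ} {α : ℝ} [Exponent α]

namespace Hol

/-- The curves with values in the interior of `K`. -/
def curvesInt (k : ℕ) (α : ℝ) (K : CompactDomain E) : Set (Hol k α E) :=
  {p | ∀ t, p t ∈ interior K.carrier}

theorem curvesInt_subset : curvesInt k α K ⊆ curvesIn k α K := fun _ hp t => interior_subset (hp t)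

theorem isOpen_setOf_forall_mem {U : Set E} (hU : IsOpen U) :
    IsOpen {p : Hol k α E | ∀ t, p t ∈ U} := by
  rw [Metric.isOpen_iff]
  intro p hp
  have hc : IsCompact (Set.range p) :=
    p.2.periodic.compact_of_continuous Real.two_pi_pos.ne' p.2.continuous
  obtain ⟨δ, hδ, h⟩ := hc.exists_thickening_subset_open hU (Set.range_subset_iff.2 hp)
  refine ⟨δ, hδ, fun q hq t => h ?_⟩
  rw [Metric.mem_thickening_iff]
  refine ⟨p t, ⟨t, rfl⟩, ?_⟩
  rw [dist_eq_norm]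
  rw [mem_ball_iff_norm] at hq
  exact (norm_apply_le (q - p) t).trans_lt hq

theorem isOpen_curvesInt : IsOpen (curvesInt k α K) := isOpen_setOf_forall_mem isOpen_interior

theorem norm_appL_le (u : Hol k α (E →L[ℝ] F)) (v : Hol k α E) : ‖appL u v‖ ≤ ‖u‖ * ‖v‖ := by
  refine (norm_bilinL_le _ u v).trans ?_
  have h : ‖ContinuousLinearMap.id ℝ (E →L[ℝ] F)‖ ≤ 1 := ContinuousLinearMap.norm_id_le
  calc _ ≤ 1 * ‖u‖ * ‖v‖ := by gcongr
    _ = ‖u‖ * ‖v‖ := by rw [one_mul]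

theorem comp_add (hK : Convex ℝ K.carrier) (χ ψ : CM (k + 1) K F) {p : Hol k α E}
    (hp : p ∈ curvesIn k α K) : comp (χ + ψ) p = comp χ p + comp ψ p := by
  ext t
  rw [add_apply, comp_apply hK _ hp, comp_apply hK _ hp, comp_apply hK _ hp]
  rfl

theorem comp_smul (hK : Convex ℝ K.carrier) (c : ℝ) (χ : CM (k + 1) K F) {p : Hol k α E}
    (hp : p ∈ curvesIn k α K) : comp (c • χ) p = c • comp χ p := by
  ext t
  rw [smul_apply, comp_apply hK _ hp, comp_apply hK _ hp]
  rfl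

theorem comp_sub (hK : Convex ℝ K.carrier) (χ ψ : CM (k + 1) K F) {p : Hol k α E}
    (hp : p ∈ curvesIn k α K) : comp (χ - ψ) p = comp χ p - comp ψ p := by
  ext t
  rw [sub_apply, comp_apply hK _ hp, comp_apply hK _ hp, comp_apply hK _ hp]
  rfl

/-- Superposition, as a linear map in the outer function. -/
def compL (hK : Convex ℝ K.carrier) (p : Hol k α E) (hp : p ∈ curvesIn k α K) :
    CM (k + 1) K F →L[ℝ] Hol k α F where
  toFun χ := comp χ p
  map_add' χ ψ := comp_add hK χ ψ hp
  map_smul' c χ := comp_smul hK c χ hp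
  cont := by
    have h : Continuous fun χ : CM (k + 1) K F => comp χ p :=
      (continuousOn_comp hK).comp_continuous (f := fun χ : CM (k + 1) K F => (χ, p))
        (by fun_prop) fun _ => hp
    exact h

variable [CompleteSpace F]

/-- The mean `∫₀¹ Dχ ∘ (p + σ (q - p)) dσ`. -/
def meanD (χ : CM (k + 2) K F) (p q : Hol k α E) : Hol k α (E →L[ℝ] F) :=
  ∫ σ in (0 : ℝ)..1, comp (CM.D χ) (p + σ • (q - p))

theorem continuousOn_meanD (hK : Convex ℝ K.carrier) (χ : CM (k + 1) K F) {p q : Hol k α E}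
    (hp : p ∈ curvesIn k α K) (hq : q ∈ curvesIn k α K) :
    ContinuousOn (fun σ : ℝ => comp χ (p + σ • (q - p))) (Set.Icc 0 1) :=
  (continuousOn_comp hK).comp (f := fun σ : ℝ => (χ, p + σ • (q - p)))
    (by fun_prop) fun _ hσ => (convex_curvesIn hK).add_smul_sub_mem hp hq hσ

theorem intervalIntegrable_meanD (hK : Convex ℝ K.carrier) (χ : CM (k + 1) K F)
    {p q : Hol k α E} (hp : p ∈ curvesIn k α K) (hq : q ∈ curvesIn k α K) :
    IntervalIntegrable (fun σ : ℝ => comp χ (p + σ • (q - p))) MeasureTheory.volume 0 1 := by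
  refine ContinuousOn.intervalIntegrable ?_
  rw [Set.uIcc_of_le zero_le_one]
  exact continuousOn_meanD hK χ hp hq

theorem meanD_apply_sub (hK : Convex ℝ K.carrier) (χ : CM (k + 2) K F) {p q : Hol k α E}
    (hp : p ∈ curvesIn k α K) (hq : q ∈ curvesIn k α K) :
    appL (meanD χ p q) (q - p) = comp (CM.J χ) q - comp (CM.J χ) p := by
  ext t
  set L : Hol k α (E →L[ℝ] F) →L[ℝ] F :=
    (ContinuousLinearMap.apply ℝ F ((q - p) t)).comp (evalL t)
  have h1 := L.intervalIntegral_comp_comm (intervalIntegrable_meanD hK (CM.D χ) hp hq)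
  have h2 : appL (meanD χ p q) (q - p) t = L (meanD χ p q) := rfl
  rw [h2, meanD, ← h1, sub_apply, comp_apply hK _ hq, comp_apply hK _ hp, CM.J_apply, CM.J_apply]
  have hmem : ∀ σ ∈ Set.Icc (0 : ℝ) 1, p t + σ • (q t - p t) ∈ K.carrier := fun σ hσ =>
    hK.add_smul_sub_mem (hp t) (hq t) hσ
  have h4 : ∀ σ ∈ Set.Icc (0 : ℝ) 1, HasDerivWithinAt (fun σ : ℝ => χ (p t + σ • (q t - p t)))
      (L (comp (CM.D χ) (p + σ • (q - p)))) (Set.Icc 0 1) σ := by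
    intro σ hσ
    have h5 : HasDerivWithinAt (fun σ : ℝ => p t + σ • (q t - p t)) (q t - p t)
        (Set.Icc 0 1) σ := by
      simpa using (((hasDerivAt_id σ).smul_const (q t - p t)).const_add (p t)).hasDerivWithinAt
    have h6 := (χ.hasFDerivWithinAt (hmem σ hσ)).comp_hasDerivWithinAt σ h5 hmem
    have h7 : L (comp (CM.D χ) (p + σ • (q - p))) =
        CM.D χ (p t + σ • (q t - p t)) (q t - p t) := by
      change comp (CM.D χ) (p + σ • (q - p)) t ((q - p) t) = _
      rw [comp_apply hK _ ((convex_curvesIn hK).add_smul_sub_mem hp hq hσ)]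
      rfl
    rw [h7]
    exact h6
  have h8 := intervalIntegral.integral_eq_sub_of_hasDerivAt_of_le zero_le_one
    (fun σ hσ => (h4 σ hσ).continuousWithinAt)
    (fun σ hσ => (h4 σ ⟨hσ.1.le, hσ.2.le⟩).hasDerivAt (Icc_mem_nhds hσ.1 hσ.2))
    (ContinuousOn.intervalIntegrable (by
      rw [Set.uIcc_of_le zero_le_one]
      exact L.continuous.comp_continuousOn (continuousOn_meanD hK (CM.D χ) hp hq)))
  rw [h8]
  simp

theorem norm_meanD_sub_le (hK : Convex ℝ K.carrier) (χ : CM (k + 2) K F) {p q : Hol k α E}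
    (hp : p ∈ curvesIn k α K) (hq : q ∈ curvesIn k α K) (A : Hol k α (E →L[ℝ] F)) {ε : ℝ}
    (h : ∀ σ ∈ Set.Icc (0 : ℝ) 1, ‖comp (CM.D χ) (p + σ • (q - p)) - A‖ ≤ ε) :
    ‖meanD χ p q - A‖ ≤ ε := by
  have e : meanD χ p q - A = ∫ σ in (0 : ℝ)..1, (comp (CM.D χ) (p + σ • (q - p)) - A) := by
    rw [intervalIntegral.integral_sub (intervalIntegrable_meanD hK _ hp hq)
      intervalIntegrable_const, intervalIntegral.integral_const]
    simp [meanD]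
  rw [e]
  refine (intervalIntegral.norm_integral_le_of_norm_le_const (C := ε) fun σ hσ => ?_).trans
    (by simp)
  rw [Set.uIoc_of_le zero_le_one] at hσ
  exact h σ ⟨hσ.1.le, hσ.2⟩

theorem hasStrictFDerivAt_comp (hK : Convex ℝ K.carrier) (χ₀ : CM (k + 2) K F) {p₀ : Hol k α E}
    (hp₀ : p₀ ∈ curvesInt k α K) :
    HasStrictFDerivAt (fun x : CM (k + 2) K F × Hol k α E => comp (CM.J x.1) x.2)
      (((compL hK p₀ (curvesInt_subset hp₀)).comp CM.J).coprod (appL (comp (CM.D χ₀) p₀)))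
      (χ₀, p₀) := by
  have hp₀' := curvesInt_subset hp₀
  have hcont : ∀ χ : CM (k + 2) K F,
      ContinuousAt (fun x : CM (k + 2) K F × Hol k α E => comp (CM.D x.1) x.2) (χ, p₀) := by
    intro χ
    have h1 : ContinuousOn (fun x : CM (k + 2) K F × Hol k α E => comp (CM.D x.1) x.2)
        {x | x.2 ∈ curvesIn k α K} :=
      (continuousOn_comp (F := E →L[ℝ] F) hK).comp (by fun_prop :
        Continuous fun x : CM (k + 2) K F × Hol k α E => (CM.D x.1, x.2)).continuousOn
        fun x hx => hx
    refine h1.continuousAt ?_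
    have h2 : {x : CM (k + 2) K F × Hol k α E | x.2 ∈ curvesInt k α K} ∈ 𝓝 (χ, p₀) :=
      (isOpen_curvesInt.preimage continuous_snd).mem_nhds hp₀
    exact Filter.mem_of_superset h2 fun x hx => curvesInt_subset hx
  rw [hasStrictFDerivAt_iff_isLittleO, Asymptotics.isLittleO_iff]
  intro ε hε
  -- continuity at `(χ₀, p₀)` and at `(0, p₀)`
  obtain ⟨r₁, hr₁, hb₁⟩ := Metric.continuousAt_iff.1 (hcont χ₀) (ε / 2) (half_pos hε)
  obtain ⟨r₂, hr₂, hb₂⟩ := Metric.continuousAt_iff.1 (hcont 0) 1 one_pos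
  obtain ⟨r₃, hr₃, hb₃⟩ := Metric.isOpen_iff.1 (isOpen_curvesInt (k := k) (α := α) (K := K)) p₀ hp₀
  have hlin : ∀ (χ : CM (k + 2) K F) (p : Hol k α E), ‖p - p₀‖ < r₂ → p ∈ curvesIn k α K →
      ‖comp (CM.D χ) p‖ ≤ 2 / r₂ * ‖χ‖ := by
    intro χ p hp hpK
    rcases eq_or_ne χ 0 with rfl | hχ
    · have : comp (CM.D (0 : CM (k + 2) K F)) p = 0 := by
        have := comp_smul hK 0 (CM.D (0 : CM (k + 2) K F)) hpK
        rw [zero_smul, zero_smul] at this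
        rw [map_zero, this]
      rw [this, norm_zero, norm_zero, mul_zero]
    · have hχ' : 0 < ‖χ‖ := norm_pos_iff.2 hχ
      set c : ℝ := r₂ / (2 * ‖χ‖) with hc
      have hc0 : 0 < c := by positivity
      have h1 := @hb₂ (c • χ, p) (by
        rw [Prod.dist_eq, max_lt_iff, dist_eq_norm, dist_eq_norm, sub_zero]
        refine ⟨?_, hp⟩
        rw [norm_smul, Real.norm_of_nonneg hc0.le, hc]
        have : r₂ / (2 * ‖χ‖) * ‖χ‖ = r₂ / 2 := by field_simp
        rw [this]
        exact half_lt_self hr₂)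
      have h0 : comp (CM.D (0 : CM (k + 2) K F)) p₀ = 0 := by
        have := comp_smul hK 0 (CM.D (0 : CM (k + 2) K F)) hp₀'
        rw [zero_smul, zero_smul] at this
        rw [map_zero, this]
      simp only [h0, dist_zero_right] at h1
      rw [map_smul, comp_smul hK _ _ hpK, norm_smul, Real.norm_of_nonneg hc0.le] at h1
      have e : 2 / r₂ * ‖χ‖ = 1 / c := by
        rw [hc]
        field_simp
      rw [e, le_div_iff₀ hc0]
      linarith
  set r : ℝ := min (min r₁ r₂) (min r₃ (ε * r₂ / 4)) with hr
  have hr0 : 0 < r := by positivity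
  filter_upwards [prod_mem_nhds (Metric.ball_mem_nhds (χ₀, p₀) hr0)
    (Metric.ball_mem_nhds (χ₀, p₀) hr0)] with x hx
  obtain ⟨⟨χ₂, p₂⟩, χ₁, p₁⟩ := x
  have hx1 : dist χ₂ χ₀ < r ∧ dist p₂ p₀ < r := by
    have := hx.1
    rw [Metric.mem_ball, Prod.dist_eq, max_lt_iff] at this
    exact this
  have hx2 : dist χ₁ χ₀ < r ∧ dist p₁ p₀ < r := by
    have := hx.2
    rw [Metric.mem_ball, Prod.dist_eq, max_lt_iff] at this
    exact this
  have l1 : r ≤ r₁ := (min_le_left _ _).trans (min_le_left _ _)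
  have l2 : r ≤ r₂ := (min_le_left _ _).trans (min_le_right _ _)
  have l3 : r ≤ r₃ := (min_le_right _ _).trans (min_le_left _ _)
  have l4 : r ≤ ε * r₂ / 4 := (min_le_right _ _).trans (min_le_right _ _)
  have hp₂ : p₂ ∈ curvesIn k α K := curvesInt_subset (hb₃ (Metric.mem_ball.2 (hx1.2.trans_le l3)))
  have hp₁ : p₁ ∈ curvesIn k α K := curvesInt_subset (hb₃ (Metric.mem_ball.2 (hx2.2.trans_le l3)))
  have m1 : ‖meanD (χ₂ - χ₁) p₀ p₂‖ ≤ 2 / r₂ * ‖χ₂ - χ₁‖ := by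
    rw [← sub_zero (meanD (χ₂ - χ₁) p₀ p₂)]
    refine norm_meanD_sub_le hK _ hp₀' hp₂ 0 fun σ hσ => ?_
    rw [sub_zero]
    refine hlin _ _ ?_ ((convex_curvesIn hK).add_smul_sub_mem hp₀' hp₂ hσ)
    have := (convex_ball p₀ r).add_smul_sub_mem (Metric.mem_ball_self hr0)
      (Metric.mem_ball.2 hx1.2) hσ
    rw [← dist_eq_norm]
    exact (Metric.mem_ball.1 this).trans_le l2
  have m2 : ‖meanD χ₁ p₁ p₂ - comp (CM.D χ₀) p₀‖ ≤ ε / 2 := by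
    refine norm_meanD_sub_le hK _ hp₁ hp₂ _ fun σ hσ => ?_
    have := (convex_ball p₀ r).add_smul_sub_mem (Metric.mem_ball.2 hx2.2)
      (Metric.mem_ball.2 hx1.2) hσ
    rw [← dist_eq_norm]
    refine (@hb₁ (χ₁, p₁ + σ • (p₂ - p₁)) ?_).le
    rw [Prod.dist_eq, max_lt_iff]
    exact ⟨hx2.1.trans_le l1, (Metric.mem_ball.1 this).trans_le l1⟩
  have e : comp (CM.J χ₂) p₂ - comp (CM.J χ₁) p₁ -
      (((compL hK p₀ hp₀').comp CM.J).coprod (appL (comp (CM.D χ₀) p₀)))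
        ((χ₂, p₂) - (χ₁, p₁)) =
      appL (meanD (χ₂ - χ₁) p₀ p₂) (p₂ - p₀) +
        appL (meanD χ₁ p₁ p₂ - comp (CM.D χ₀) p₀) (p₂ - p₁) := by
    have e1 : (((compL hK p₀ hp₀').comp CM.J).coprod (appL (comp (CM.D χ₀) p₀)))
        ((χ₂, p₂) - (χ₁, p₁)) = comp (CM.J (χ₂ - χ₁)) p₀ +
          appL (comp (CM.D χ₀) p₀) (p₂ - p₁) := rfl
    rw [e1, map_sub appL, _root_.sub_apply, meanD_apply_sub hK _ hp₀' hp₂,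
      meanD_apply_sub hK _ hp₁ hp₂, map_sub CM.J, comp_sub hK _ _ hp₂]
    abel
  change ‖comp (CM.J χ₂) p₂ - comp (CM.J χ₁) p₁ - _‖ ≤ _
  rw [e]
  have n1 : ‖χ₂ - χ₁‖ ≤ ‖((χ₂, p₂) - (χ₁, p₁) : CM (k + 2) K F × Hol k α E)‖ :=
    norm_fst_le ((χ₂, p₂) - (χ₁, p₁) : CM (k + 2) K F × Hol k α E)
  have n2 : ‖p₂ - p₁‖ ≤ ‖((χ₂, p₂) - (χ₁, p₁) : CM (k + 2) K F × Hol k α E)‖ :=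
    norm_snd_le ((χ₂, p₂) - (χ₁, p₁) : CM (k + 2) K F × Hol k α E)
  have n3 : ‖p₂ - p₀‖ ≤ ε * r₂ / 4 := by
    rw [← dist_eq_norm]
    exact hx1.2.le.trans l4
  have b1 : ‖appL (meanD (χ₂ - χ₁) p₀ p₂) (p₂ - p₀)‖ ≤ ε / 2 * ‖χ₂ - χ₁‖ := by
    refine (norm_appL_le _ _).trans ?_
    calc _ ≤ (2 / r₂ * ‖χ₂ - χ₁‖) * (ε * r₂ / 4) :=
          mul_le_mul m1 n3 (norm_nonneg _) (by positivity)
      _ = ε / 2 * ‖χ₂ - χ₁‖ := by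
          field_simp
          ring
  have b2 : ‖appL (meanD χ₁ p₁ p₂ - comp (CM.D χ₀) p₀) (p₂ - p₁)‖ ≤ ε / 2 * ‖p₂ - p₁‖ :=
    (norm_appL_le _ _).trans (mul_le_mul_of_nonneg_right m2 (norm_nonneg _))
  refine (norm_add_le _ _).trans ?_
  have b3 := mul_le_mul_of_nonneg_left n1 (half_pos hε).le
  have b4 := mul_le_mul_of_nonneg_left n2 (half_pos hε).le
  linarith

/-- Superposition is of class `C¹`. -/
theorem contDiffOn_comp (hK : Convex ℝ K.carrier) :
    ContDiffOn ℝ 1 (fun x : CM (k + 2) K F × Hol k α E => comp (CM.J x.1) x.2)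
      {x | x.2 ∈ curvesInt k α K} :=
  contDiffOn_one_of_hasStrictFDerivAt (isOpen_curvesInt.preimage continuous_snd)
    fun x hx => ⟨_, hasStrictFDerivAt_comp hK x.1 hx⟩

/-- The function `∫₀¹ Dχ(σ p) dσ`. -/
def quot (χ : CM (k + 3) K F) (p : Hol k α E) : Hol k α (E →L[ℝ] F) :=
  ∫ σ in (0 : ℝ)..1, comp (CM.J (CM.D χ)) (σ • p)

theorem contDiffOn_quot (hK : Convex ℝ K.carrier) (h0 : 0 ∈ interior K.carrier) :
    ContDiffOn ℝ 1 (fun x : CM (k + 3) K F × Hol k α E => quot x.1 x.2)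
      {x | x.2 ∈ curvesInt k α K} := by
  refine contDiffOn_one_integral
    (f := fun x : (CM (k + 3) K F × Hol k α E) × ℝ => comp (CM.J (CM.D x.1.1)) (x.2 • x.1.2))
    (isOpen_curvesInt.preimage continuous_snd) fun x hx σ hσ => ?_
  have hmem : σ • x.2 ∈ curvesInt k α K := fun t => by
    have := hK.interior.add_smul_sub_mem h0 (hx t) hσ
    simpa using this
  have h1 : ContDiffAt ℝ 1 (fun x : CM (k + 2) K (E →L[ℝ] F) × Hol k α E => comp (CM.J x.1) x.2)
      (CM.D x.1, σ • x.2) :=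
    (contDiffOn_comp hK).contDiffAt ((isOpen_curvesInt.preimage continuous_snd).mem_nhds hmem)
  exact h1.comp (f := fun x : (CM (k + 3) K F × Hol k α E) × ℝ => (CM.D x.1.1, x.2 • x.1.2))
    (x, σ) (by fun_prop)

theorem quot_apply (hK : Convex ℝ K.carrier) (h0 : 0 ∈ interior K.carrier) (χ : CM (k + 3) K F)
    {p : Hol k α E} (hp : p ∈ curvesIn k α K) (t : ℝ) : quot χ p t (p t) = χ (p t) - χ 0 := by
  have h1 : (0 : Hol k α E) ∈ curvesIn k α K := fun t => interior_subset h0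
  have h2 : meanD (CM.J χ) 0 p = quot χ p := by
    have h3 : CM.D (CM.J χ) = CM.J (CM.D χ) := rfl
    simp only [meanD, quot, zero_add, sub_zero, h3]
  have h4 := meanD_apply_sub hK (CM.J χ) h1 hp
  rw [h2, sub_zero] at h4
  have h5 := congrArg (evalL t) h4
  simp only [evalL_apply, appL_apply, sub_apply, comp_apply hK _ hp, comp_apply hK _ h1] at h5
  exact h5

end Hol

end CMaps

end KStat

end

noncomputable section

namespace KStat

open Real Filter Topology ComplexConjugate

/-- The exponential `e^{int}`. -/
def ex (n : ℤ) (t : ℝ) : ℂ := Complex.exp (n * t * Complex.I)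

theorem ex_zero (t : ℝ) : ex 0 t = 1 := by simp [ex]

theorem ex_at_zero (n : ℤ) : ex n 0 = 1 := by simp [ex]

theorem ex_add (m n : ℤ) (t : ℝ) : ex (m + n) t = ex m t * ex n t := by
  rw [ex, ex, ex, ← Complex.exp_add]; push_cast; ring_nf

theorem norm_ex (n : ℤ) (t : ℝ) : ‖ex n t‖ = 1 := by
  rw [ex, show (n : ℂ) * t * Complex.I = ((n * t : ℝ) : ℂ) * Complex.I by push_cast; ring]
  exact Complex.norm_exp_ofReal_mul_I _

theorem ex_ne_zero (n : ℤ) (t : ℝ) : ex n t ≠ 0 := Complex.exp_ne_zero _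

theorem conj_ex (n : ℤ) (t : ℝ) : conj (ex n t) = ex (-n) t := by
  rw [ex, ex, ← Complex.exp_conj]
  congr 1
  simp

theorem ex_neg_mul (n : ℤ) (t : ℝ) : ex (-n) t * ex n t = 1 := by
  rw [← ex_add, neg_add_cancel, ex_zero]

theorem ex_mul_neg (n : ℤ) (t : ℝ) : ex n t * ex (-n) t = 1 := by
  rw [← ex_add, add_neg_cancel, ex_zero]

theorem ex_eq_zpow (n : ℤ) (t : ℝ) : ex n t = (Circle.exp t : ℂ) ^ n := by
  rw [ex, Circle.coe_exp, ← Complex.exp_int_mul]; congr 1; ring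

theorem ex_natCast (n : ℕ) (t : ℝ) : ex n t = (Circle.exp t : ℂ) ^ n := by
  rw [ex_eq_zpow, zpow_natCast]

theorem ex_pow (n : ℕ) (t : ℝ) : ex 1 t ^ n = ex n t := by
  rw [ex_natCast, ex_eq_zpow, zpow_one]

theorem ex_shift (n : ℤ) (s t : ℝ) : ex n (s + t) = ex n s * ex n t := by
  rw [ex, ex, ex, ← Complex.exp_add]; push_cast; ring_nf

theorem contDiff_ex (n : ℤ) {m : WithTop ℕ∞} : ContDiff ℝ m (ex n) := by
  unfold ex
  have h : ContDiff ℝ m (fun t : ℝ => (t : ℂ)) := Complex.ofRealCLM.contDiff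
  exact ((contDiff_const.mul h).mul contDiff_const).cexp

theorem continuous_ex (n : ℤ) : Continuous (ex n) := (contDiff_ex (m := 0) n).continuous

theorem hasDerivAt_ex (n : ℤ) (t : ℝ) : HasDerivAt (ex n) (Complex.I * n * ex n t) t := by
  have h2 : HasDerivAt (fun z : ℂ => Complex.exp (n * z * Complex.I))
      (Complex.exp (n * t * Complex.I) * (n * 1 * Complex.I)) (t : ℂ) :=
    (((hasDerivAt_id (t : ℂ)).const_mul (n : ℂ)).mul_const Complex.I).cexp
  refine h2.comp_ofReal.congr_deriv ?_
  rw [ex]; ring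

theorem periodic_ex (n : ℤ) : Function.Periodic (ex n) (2 * π) := by
  intro t
  rw [ex_eq_zpow, ex_eq_zpow, Circle.exp_add_two_pi]

/-- The `n`-th Fourier coefficient. -/
def fc (u : ℝ → ℂ) (n : ℤ) : ℂ := (2 * π : ℂ)⁻¹ * ∫ t in (0 : ℝ)..2 * π, ex (-n) t * u t

section Fc

variable {u v : ℝ → ℂ}

theorem intervalIntegrable_ex_mul (hu : Continuous u) (n : ℤ) (a b : ℝ) :
    IntervalIntegrable (fun t => ex n t * u t) MeasureTheory.volume a b :=
  ((continuous_ex n).mul hu).intervalIntegrable a b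

theorem fc_add (hu : Continuous u) (hv : Continuous v) (n : ℤ) :
    fc (fun t => u t + v t) n = fc u n + fc v n := by
  simp only [fc, mul_add]
  rw [intervalIntegral.integral_add (intervalIntegrable_ex_mul hu _ _ _)
    (intervalIntegrable_ex_mul hv _ _ _), mul_add]

theorem fc_sub (hu : Continuous u) (hv : Continuous v) (n : ℤ) :
    fc (fun t => u t - v t) n = fc u n - fc v n := by
  simp only [fc, mul_sub]
  rw [intervalIntegral.integral_sub (intervalIntegrable_ex_mul hu _ _ _)
    (intervalIntegrable_ex_mul hv _ _ _), mul_sub]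

theorem fc_const_mul (c : ℂ) (u : ℝ → ℂ) (n : ℤ) : fc (fun t => c * u t) n = c * fc u n := by
  simp only [fc, mul_left_comm _ c]
  rw [intervalIntegral.integral_const_mul]; ring

theorem fc_neg (u : ℝ → ℂ) (n : ℤ) : fc (fun t => -u t) n = -fc u n := by
  simpa using fc_const_mul (-1) u n

theorem fc_zero (n : ℤ) : fc (fun _ => 0) n = 0 := by simp [fc]

theorem fc_ex_mul (m : ℤ) (u : ℝ → ℂ) (n : ℤ) : fc (fun t => ex m t * u t) n = fc u (n - m) := by
  simp only [fc, ← mul_assoc, ← ex_add]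
  congr 4
  ring_nf

theorem fc_conj (u : ℝ → ℂ) (n : ℤ) : fc (fun t => conj (u t)) n = conj (fc u (-n)) := by
  simp only [fc, map_mul, map_inv₀, ← intervalIntegral.intervalIntegral_conj, conj_ex, neg_neg,
    Complex.conj_ofReal, Complex.conj_ofNat]

theorem norm_fc_le {C : ℝ} (h : ∀ t, ‖u t‖ ≤ C) (n : ℤ) : ‖fc u n‖ ≤ C := by
  have h1 : ‖∫ t in (0 : ℝ)..2 * π, ex (-n) t * u t‖ ≤ C * |2 * π - 0| :=
    intervalIntegral.norm_integral_le_of_norm_le_const fun t _ => by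
      rw [norm_mul, norm_ex, one_mul]; exact h t
  rw [sub_zero, abs_of_pos two_pi_pos] at h1
  have h2 : ‖(2 * π : ℂ)⁻¹‖ = (2 * π)⁻¹ := by
    rw [norm_inv]
    congr 1
    rw [show (2 * π : ℂ) = ((2 * π : ℝ) : ℂ) by push_cast; rfl, Complex.norm_real, norm_eq_abs,
      abs_of_pos two_pi_pos]
  rw [fc, norm_mul, h2]
  refine (mul_le_mul_of_nonneg_left h1 (inv_nonneg.2 two_pi_pos.le)).trans (le_of_eq ?_)
  field_simp

theorem fc_ex (m n : ℤ) : fc (ex m) n = if n = m then 1 else 0 := by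
  have h1 : fc (ex m) n = fc (fun _ => 1) (n - m) := by
    rw [← fc_ex_mul]; simp
  rw [h1]
  have hpi : (2 * π : ℂ) ≠ 0 := by exact_mod_cast two_pi_pos.ne'
  split_ifs with h
  · simp only [fc, h, sub_self, neg_zero, ex_zero, mul_one, intervalIntegral.integral_const, sub_zero, Complex.real_smul]
    push_cast
    field_simp
  · have hk : n - m ≠ 0 := sub_ne_zero.2 h
    generalize n - m = k at hk
    have hk' : (Complex.I * ((-k : ℤ) : ℂ)) ≠ 0 := by
      simp [Complex.I_ne_zero, hk]
    have h2 : ∫ t in (0 : ℝ)..2 * π, ex (-k) t = 0 := by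
      have h3 : ∀ t, HasDerivAt (fun t => (Complex.I * ((-k : ℤ) : ℂ))⁻¹ * ex (-k) t)
          (ex (-k) t) t := by
        intro t
        refine ((hasDerivAt_ex (-k) t).const_mul _).congr_deriv ?_
        rw [← mul_assoc, inv_mul_cancel₀ hk', one_mul]
      rw [intervalIntegral.integral_eq_sub_of_hasDerivAt (fun t _ => h3 t)
        ((continuous_ex _).intervalIntegrable _ _)]
      have := periodic_ex (-k) 0
      rw [zero_add] at this
      rw [this, sub_self]
    simp [fc, h2]

theorem fc_deriv {u' : ℝ → ℂ} (hp : Function.Periodic u (2 * π))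
    (h : ∀ t, HasDerivAt u (u' t) t) (h' : Continuous u') (n : ℤ) :
    fc u' n = Complex.I * n * fc u n := by
  have hu : Continuous u := continuous_iff_continuousAt.2 fun t => (h t).continuousAt
  have h1 := intervalIntegral.integral_mul_deriv_eq_deriv_mul (a := 0) (b := 2 * π)
    (u := ex (-n)) (v := u) (u' := fun t => Complex.I * ((-n : ℤ) : ℂ) * ex (-n) t) (v' := u')
    (fun t _ => hasDerivAt_ex (-n) t) (fun t _ => h t)
    ((continuous_const.mul (continuous_ex _)).intervalIntegrable _ _)
    (h'.intervalIntegrable _ _)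
  have e1 := periodic_ex (-n) 0
  have e2 := hp 0
  rw [zero_add] at e1 e2
  rw [e1, e2, sub_self, zero_sub] at h1
  simp only [mul_assoc] at h1
  rw [intervalIntegral.integral_const_mul, intervalIntegral.integral_const_mul] at h1
  rw [fc, fc, h1]
  push_cast
  ring

theorem fourier_eq_ex (n : ℤ) (t : ℝ) :
    fourier n (t : AddCircle (2 * π)) = ex n t := by
  rw [fourier_coe_apply, ex]
  congr 1
  have hpi : (2 * π : ℂ) ≠ 0 := by exact_mod_cast two_pi_pos.ne'
  push_cast
  field_simp

theorem fourierCoeffOn_eq_fc (u : ℝ → ℂ) (n : ℤ) : fourierCoeffOn two_pi_pos u n = fc u n := by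
  rw [fourierCoeffOn_eq_integral, fc, sub_zero]
  simp only [fourier_eq_ex, smul_eq_mul]
  rw [Complex.real_smul]
  congr 1
  push_cast
  rw [one_div]

theorem fc_tendsto_zero (hu : Continuous u) : Tendsto (fc u) cofinite (𝓝 0) := by
  have hL : MeasureTheory.MemLp u 2 (MeasureTheory.volume.restrict (Set.Ioc 0 (2 * π))) := by
    have : MeasureTheory.IsFiniteMeasure
        (MeasureTheory.volume.restrict (Set.Ioc 0 (2 * π))) := ⟨by simp [ENNReal.mul_lt_top]⟩
    obtain ⟨C, hC⟩ := (isCompact_Icc (a := (0 : ℝ)) (b := 2 * π)).exists_bound_of_continuousOn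
      hu.continuousOn
    refine MeasureTheory.MemLp.of_bound hu.aestronglyMeasurable C ?_
    filter_upwards [MeasureTheory.ae_restrict_mem measurableSet_Ioc] with t ht
    exact hC t ⟨ht.1.le, ht.2⟩
  have h1 := (hasSum_sq_fourierCoeffOn two_pi_pos hL).summable.tendsto_cofinite_zero
  rw [tendsto_zero_iff_norm_tendsto_zero]
  have h2 := (continuous_sqrt.tendsto 0).comp h1
  rw [sqrt_zero] at h2
  refine h2.congr fun n => ?_
  simp only [Function.comp, fourierCoeffOn_eq_fc]
  exact sqrt_sq (norm_nonneg _)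

/-- A continuous periodic function is determined by its Fourier coefficients. -/
theorem eq_zero_of_fc (hp : Function.Periodic u (2 * π)) (hu : Continuous u)
    (h : ∀ n, fc u n = 0) (t : ℝ) : u t = 0 := by
  have : Fact (0 < 2 * π) := ⟨two_pi_pos⟩
  let g : C(AddCircle (2 * π), ℂ) := ⟨hp.lift, continuous_quot_lift _ hu⟩
  have hg : ∀ n, fourierCoeff g n = 0 := by
    intro n
    rw [fourierCoeff_eq_intervalIntegral g n 0, zero_add]
    have h1 := h n
    rw [fc] at h1
    have hpi : (2 * π : ℂ) ≠ 0 := by exact_mod_cast two_pi_pos.ne'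
    have h2 := (mul_eq_zero.1 h1).resolve_left (inv_ne_zero hpi)
    have h3 : ∀ x : ℝ, g (x : AddCircle (2 * π)) = u x := fun x => hp.lift_coe x
    simp only [fourier_eq_ex, smul_eq_mul, h3]
    rw [h2, smul_zero]
  have hs : Summable (fourierCoeff g) := by
    rw [show fourierCoeff (g : AddCircle (2 * π) → ℂ) = fun _ => 0 from funext hg]
    exact summable_zero
  have h1 := has_pointwise_sum_fourier_series_of_summable hs (t : AddCircle (2 * π))
  simp only [hg, zero_smul] at h1
  have h2 := h1.unique hasSum_zero
  exact (hp.lift_coe t).symm.trans h2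

theorem eq_of_fc (hp : Function.Periodic u (2 * π)) (hu : Continuous u)
    (hq : Function.Periodic v (2 * π)) (hv : Continuous v) (h : ∀ n, fc u n = fc v n) : u = v := by
  funext t
  refine sub_eq_zero.1 (eq_zero_of_fc (u := fun t => u t - v t) (fun t => ?_) (hu.sub hv)
    (fun n => ?_) t)
  · simp only [hp t, hq t]
  · rw [fc_sub hu hv, h, sub_self]

theorem fc_tendsto {ι : Type*} {l : Filter ι} {U : ι → ℝ → ℂ} (hU : ∀ i, Continuous (U i))
    (hu : Continuous u) {C : ι → ℝ} (hC : Tendsto C l (𝓝 0)) (h : ∀ i t, ‖U i t - u t‖ ≤ C i)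
    (n : ℤ) : Tendsto (fun i => fc (U i) n) l (𝓝 (fc u n)) := by
  rw [tendsto_iff_norm_sub_tendsto_zero]
  refine squeeze_zero (fun _ => norm_nonneg _) (fun i => ?_) hC
  rw [← fc_sub (hU i) hu]
  exact norm_fc_le (h i) n

/-- The negative Fourier coefficients of the boundary values of a holomorphic function vanish. -/
theorem fc_eq_zero_of_diffContOnCl {G : ℂ → ℂ} (hG : DiffContOnCl ℂ G (Metric.ball 0 1))
    {n : ℤ} (hn : n < 0) : fc (fun t => G (Circle.exp t)) n = 0 := by
  obtain ⟨m, rfl⟩ : ∃ m : ℕ, n = -((m : ℤ) + 1) := ⟨(-n - 1).toNat, by omega⟩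
  have h1 : DiffContOnCl ℂ (fun z : ℂ => z ^ m • G z) (Metric.ball 0 1) :=
    (Differentiable.diffContOnCl (by fun_prop : Differentiable ℂ fun z : ℂ => z ^ m)).smul hG
  have h2 := h1.circleIntegral_eq_zero zero_le_one
  rw [circleIntegral] at h2
  rw [fc]
  have h3 : ∀ t : ℝ, deriv (circleMap 0 1) t • (circleMap 0 1 t ^ m • G (circleMap 0 1 t)) =
      Complex.I * (ex (-(-((m : ℤ) + 1))) t * G (Circle.exp t)) := by
    intro t
    have h4 : circleMap 0 1 t = (Circle.exp t : ℂ) := by simp [circleMap]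
    rw [deriv_circleMap, h4, neg_neg, ex_add, ex_natCast, ex_eq_zpow, zpow_one, smul_eq_mul,
      smul_eq_mul]
    ring
  simp only [h3] at h2
  rw [intervalIntegral.integral_const_mul] at h2
  rw [(mul_eq_zero.1 h2).resolve_left Complex.I_ne_zero, mul_zero]

/-- A uniform limit on the circle of polynomials is the trace of a holomorphic function. -/
theorem exists_diffContOnCl {p : ℕ → Polynomial ℂ} {u : ℝ → ℂ} {C : ℕ → ℝ}
    (hC : Tendsto C atTop (𝓝 0))
    (h : ∀ N t, ‖(p N).eval (Circle.exp t : ℂ) - u t‖ ≤ C N) :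
    ∃ G : ℂ → ℂ, DiffContOnCl ℂ G (Metric.ball 0 1) ∧ ∀ t : ℝ, G (Circle.exp t) = u t := by
  have hmax : ∀ M N, ∀ z ∈ Metric.closedBall (0 : ℂ) 1,
      ‖(p M).eval z - (p N).eval z‖ ≤ C M + C N := by
    intro M N z hz
    refine Complex.norm_le_of_forall_mem_frontier_norm_le (U := Metric.ball (0 : ℂ) 1)
      (f := fun z => (p M).eval z - (p N).eval z) Metric.isBounded_ball
      (((p M).differentiable.sub (p N).differentiable).diffContOnCl) ?_
      (by rwa [closure_ball (0 : ℂ) one_ne_zero])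
    intro w hw
    rw [frontier_ball (0 : ℂ) one_ne_zero, mem_sphere_zero_iff_norm] at hw
    have hw' : w = (Circle.exp (Complex.arg w) : ℂ) := by
      rw [Circle.coe_exp]
      conv_lhs => rw [← Complex.norm_mul_exp_arg_mul_I w, hw]
      simp
    rw [hw']
    set t := Complex.arg w
    calc _ = ‖((p M).eval (Circle.exp t : ℂ) - u t) - ((p N).eval (Circle.exp t : ℂ) - u t)‖ := by
          congr 1; ring
      _ ≤ _ := (norm_sub_le _ _).trans (add_le_add (h M t) (h N t))
  have hcau : ∀ z ∈ Metric.closedBall (0 : ℂ) 1, CauchySeq fun N => (p N).eval z := by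
    intro z hz
    rw [Metric.cauchySeq_iff]
    intro ε hε
    obtain ⟨N, hN⟩ := eventually_atTop.1 (hC.eventually (gt_mem_nhds (half_pos hε)))
    refine ⟨N, fun m hm n hn => ?_⟩
    rw [dist_eq_norm]
    linarith [hmax m n z hz, hN m hm, hN n hn]
  choose! G hG using fun z hz => cauchySeq_tendsto_of_complete (hcau z hz)
  have hle : ∀ N, ∀ z ∈ Metric.closedBall (0 : ℂ) 1, ‖(p N).eval z - G z‖ ≤ C N := by
    intro N z hz
    have h1 : Tendsto (fun M => ‖(p N).eval z - (p M).eval z‖) atTop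
        (𝓝 ‖(p N).eval z - G z‖) := (tendsto_const_nhds.sub (hG z hz)).norm
    have h2 : Tendsto (fun M => C N + C M) atTop (𝓝 (C N + 0)) := tendsto_const_nhds.add hC
    rw [add_zero] at h2
    exact le_of_tendsto_of_tendsto' h1 h2 fun M => hmax N M z hz
  have hunif : TendstoUniformlyOn (fun N z => (p N).eval z) G atTop
      (Metric.closedBall (0 : ℂ) 1) := by
    rw [Metric.tendstoUniformlyOn_iff]
    intro ε hε
    filter_upwards [hC.eventually (gt_mem_nhds hε)] with N hN z hz
    rw [dist_comm, dist_eq_norm]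
    exact (hle N z hz).trans_lt hN
  refine ⟨G, ⟨?_, ?_⟩, fun t => ?_⟩
  · have h1 : TendstoLocallyUniformlyOn (fun N z => (p N).eval z) G atTop (Metric.ball (0 : ℂ) 1) :=
      (hunif.mono Metric.ball_subset_closedBall).tendstoLocallyUniformlyOn
    exact h1.differentiableOn (Eventually.of_forall fun N => (p N).differentiable.differentiableOn)
      Metric.isOpen_ball
  · rw [closure_ball (0 : ℂ) one_ne_zero]
    exact hunif.continuousOn (Frequently.of_forall fun N => (p N).continuous.continuousOn)
  · have hz : (Circle.exp t : ℂ) ∈ Metric.closedBall (0 : ℂ) 1 := by simp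
    refine tendsto_nhds_unique (hG _ hz) ?_
    rw [tendsto_iff_norm_sub_tendsto_zero]
    exact squeeze_zero (fun _ => norm_nonneg _) (fun N => h N t) hC

/-- Riemann–Lebesgue: coefficients which are constant on the negative integers vanish there. -/
theorem fc_eq_zero_of_const (hu : Continuous u) (h : ∀ n < (0 : ℤ), fc u n = fc u (n - 1)) {n : ℤ}
    (hn : n < 0) : fc u n = 0 := by
  have h1 : ∀ m : ℕ, fc u (n - m) = fc u n := by
    intro m
    induction m with
    | zero => simp
    | succ m ih =>
      rw [← ih, h (n - m) (by omega)]
      congr 1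
      push_cast
      ring
  have h2 : Tendsto (fun m : ℕ => fc u (n - m)) atTop (𝓝 0) := by
    rw [← Nat.cofinite_eq_atTop]
    refine (fc_tendsto_zero hu).comp (Function.Injective.tendsto_cofinite ?_)
    intro a b hab
    simpa using hab
  simp only [h1] at h2
  exact tendsto_nhds_unique tendsto_const_nhds h2

end Fc

end KStat

end

noncomputable section

namespace KStat

open Real Filter Topology ComplexConjugate

theorem chord_le_abs (s t : ℝ) : chord (s, t) ≤ |s - t| := by
  have h1 : (Circle.exp s : ℂ) - (Circle.exp t : ℂ) =
      (Circle.exp t : ℂ) * (Complex.exp (Complex.I * ((s - t : ℝ) : ℂ)) - 1) := by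
    rw [Circle.coe_exp, Circle.coe_exp, mul_sub, ← Complex.exp_add, mul_one]
    congr 2
    push_cast
    ring
  rw [chord, h1, norm_mul, Circle.norm_coe, one_mul]
  exact (Real.norm_exp_I_mul_ofReal_sub_one_le).trans (le_of_eq (norm_eq_abs _))

/-- The Cauchy kernel. -/
def cker (r s : ℝ) : ℂ := (1 - r * ex 1 s)⁻¹

section Kernel

variable {r : ℝ}

theorem one_sub_le_norm (h0 : 0 ≤ r) (s : ℝ) : 1 - r ≤ ‖1 - r * ex 1 s‖ := by
  have h1 := norm_sub_norm_le (1 : ℂ) (r * ex 1 s)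
  rw [norm_mul, norm_ex, norm_one, Complex.norm_real, norm_eq_abs, abs_of_nonneg h0, mul_one] at h1
  exact h1

theorem one_sub_ne_zero (h0 : 0 ≤ r) (h1 : r < 1) (s : ℝ) : (1 - r * ex 1 s : ℂ) ≠ 0 :=
  norm_pos_iff.1 ((sub_pos.2 h1).trans_le (one_sub_le_norm h0 s))

theorem continuous_cker (h0 : 0 ≤ r) (h1 : r < 1) : Continuous (cker r) :=
  (continuous_const.sub (continuous_const.mul (continuous_ex 1))).inv₀ (one_sub_ne_zero h0 h1)

theorem periodic_cker (r : ℝ) : Function.Periodic (cker r) (2 * π) := fun s => by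
  rw [cker, cker, periodic_ex]

theorem norm_cker_le (h0 : 0 ≤ r) (h1 : r < 1) (s : ℝ) : ‖cker r s‖ ≤ (1 - r)⁻¹ := by
  rw [cker, norm_inv]
  exact inv_anti₀ (sub_pos.2 h1) (one_sub_le_norm h0 s)

theorem norm_cker_neg (r s : ℝ) : ‖cker r (-s)‖ = ‖cker r s‖ := by
  have h : ex 1 (-s) = conj (ex 1 s) := by
    rw [conj_ex, ex, ex]; push_cast; ring_nf
  rw [cker, cker, norm_inv, norm_inv, h, ← Complex.norm_conj]
  simp

theorem sq_norm_one_sub (r s : ℝ) : ‖1 - r * ex 1 s‖ ^ 2 = (1 - r) ^ 2 + 2 * r * (1 - cos s) := by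
  have h : ex 1 s = Complex.cos s + Complex.sin s * Complex.I := by
    rw [ex, Int.cast_one, one_mul, Complex.exp_mul_I]
  rw [← Complex.normSq_eq_norm_sq, Complex.normSq_apply, h, ← Complex.ofReal_cos,
    ← Complex.ofReal_sin]
  simp only [Complex.sub_re, Complex.one_re, Complex.add_re,
    Complex.ofReal_re, Complex.mul_re, Complex.I_re, mul_zero, Complex.ofReal_im, Complex.I_im,
    mul_one, sub_self, add_zero, Complex.sub_im, Complex.one_im, Complex.add_im, Complex.mul_im, zero_add, zero_sub]
  linear_combination r ^ 2 * sin_sq_add_cos_sq s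

theorem sq_div_five_le (h0 : 1 / 2 ≤ r) {s : ℝ} (hs : |s| ≤ π) :
    s ^ 2 / 5 ≤ ‖1 - r * ex 1 s‖ ^ 2 := by
  rw [sq_norm_one_sub]
  have h1 := cos_le_one_sub_mul_cos_sq hs
  have h2 : 1 / 5 ≤ 2 / π ^ 2 := by
    rw [div_le_div_iff₀ (by norm_num) (by positivity)]
    nlinarith [pi_lt_d2, pi_pos]
  have h3 : s ^ 2 / 5 ≤ 1 - cos s := by nlinarith [sq_nonneg s]
  nlinarith [sq_nonneg (1 - r), sq_nonneg s]

theorem cker_geom (h0 : 0 ≤ r) (h1 : r < 1) (s : ℝ) (N : ℕ) :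
    cker r s = ∑ m ∈ Finset.range N, (r : ℂ) ^ m * ex m s + (r : ℂ) ^ N * ex N s * cker r s := by
  have h2 := one_sub_ne_zero h0 h1 s
  have h3 := mul_neg_geom_sum ((r : ℂ) * ex 1 s) N
  have h4 : ∀ m : ℕ, ((r : ℂ) * ex 1 s) ^ m = (r : ℂ) ^ m * ex m s := fun m => by
    rw [mul_pow, ex_pow]
  simp only [h4] at h3
  rw [cker]
  field_simp
  linear_combination -h3

theorem cker_sub_radius {r' : ℝ} (h0 : 0 ≤ r) (hr : r ≤ r') (h1 : r' < 1) (hd : r' - r ≤ 1 - r')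
    (s : ℝ) : ‖cker r' s - cker r s‖ ≤ 2 * (r' - r) * ‖cker r s‖ ^ 2 := by
  have n1 := one_sub_ne_zero h0 (hr.trans_lt h1) s
  have n2 := one_sub_ne_zero (h0.trans hr) h1 s
  have h2 : cker r' s - cker r s = (r' - r : ℝ) * ex 1 s * cker r' s * cker r s := by
    rw [cker, cker, eq_comm, mul_assoc, ← mul_inv, ← div_eq_mul_inv, div_eq_iff (mul_ne_zero n2 n1),
      sub_mul, inv_mul_cancel_left₀ n2, mul_comm (1 - r' * ex 1 s : ℂ), inv_mul_cancel_left₀ n1]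
    push_cast
    ring
  have h3 : ‖cker r' s‖ ≤ 2 * ‖cker r s‖ := by
    rw [cker, cker, norm_inv, norm_inv]
    have h4 : ‖1 - r * ex 1 s‖ ≤ 2 * ‖1 - r' * ex 1 s‖ := by
      have h5 : (1 - r * ex 1 s : ℂ) = (1 - r' * ex 1 s) + (r' - r : ℝ) * ex 1 s := by
        push_cast; ring
      have h6 := norm_add_le (1 - r' * ex 1 s) ((r' - r : ℝ) * ex 1 s)
      rw [← h5, norm_mul, norm_ex, mul_one, Complex.norm_real, norm_eq_abs,
        abs_of_nonneg (sub_nonneg.2 hr)] at h6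
      have h7 := one_sub_le_norm (h0.trans hr) s
      linarith
    rw [inv_le_comm₀ (norm_pos_iff.2 n2) (by have := norm_pos_iff.2 n1; positivity), mul_inv,
      inv_inv]
    linarith
  rw [h2, norm_mul, norm_mul, norm_mul, norm_ex, Complex.norm_real, norm_eq_abs,
    abs_of_nonneg (sub_nonneg.2 hr), mul_one]
  have h8 := norm_nonneg (cker r s)
  have h9 := sub_nonneg.2 hr
  calc (r' - r) * ‖cker r' s‖ * ‖cker r s‖ ≤ (r' - r) * (2 * ‖cker r s‖) * ‖cker r s‖ := by gcongr
    _ = _ := by ring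

theorem norm_ex_sub_le (s t : ℝ) : ‖ex 1 s - ex 1 t‖ ≤ |s - t| := by
  have := chord_le_abs s t
  rwa [chord, ← zpow_one (Circle.exp s : ℂ), ← zpow_one (Circle.exp t : ℂ), ← ex_eq_zpow,
    ← ex_eq_zpow] at this

theorem cker_sub_shift {h : ℝ} (h0 : 0 ≤ r) (h1 : r < 1) (hd : |h| ≤ 1 - r)
    (s : ℝ) : ‖cker r (s + h) - cker r s‖ ≤ 2 * |h| * ‖cker r s‖ ^ 2 := by
  have n1 := one_sub_ne_zero h0 h1 s
  have n2 := one_sub_ne_zero h0 h1 (s + h)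
  have h2 : cker r (s + h) - cker r s =
      r * (ex 1 (s + h) - ex 1 s) * cker r (s + h) * cker r s := by
    rw [cker, cker]
    field_simp
    ring
  have e1 : ‖(r : ℂ) * (ex 1 (s + h) - ex 1 s)‖ ≤ |h| := by
    rw [norm_mul, Complex.norm_real, norm_eq_abs, abs_of_nonneg h0]
    have := norm_ex_sub_le (s + h) s
    rw [add_sub_cancel_left] at this
    nlinarith [norm_nonneg (ex 1 (s + h) - ex 1 s), abs_nonneg h]
  have h3 : ‖cker r (s + h)‖ ≤ 2 * ‖cker r s‖ := by
    rw [cker, cker, norm_inv, norm_inv]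
    have h4 : ‖1 - r * ex 1 s‖ ≤ 2 * ‖1 - r * ex 1 (s + h)‖ := by
      have h5 : (1 - r * ex 1 s : ℂ) = (1 - r * ex 1 (s + h)) + r * (ex 1 (s + h) - ex 1 s) := by
        ring
      have h6 := norm_add_le (1 - r * ex 1 (s + h)) (r * (ex 1 (s + h) - ex 1 s))
      rw [← h5] at h6
      have h7 := one_sub_le_norm h0 (s + h)
      linarith
    rw [inv_le_comm₀ (norm_pos_iff.2 n2) (by have := norm_pos_iff.2 n1; positivity), mul_inv,
      inv_inv]
    linarith
  rw [h2, norm_mul, norm_mul]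
  have h8 := norm_nonneg (cker r s)
  calc _ ≤ |h| * (2 * ‖cker r s‖) * ‖cker r s‖ := by gcongr
    _ = _ := by ring

theorem continuous_abs_rpow {α : ℝ} (hα : 0 < α) : Continuous fun s : ℝ => |s| ^ α :=
  continuous_abs.rpow_const fun _ => Or.inr hα.le

theorem integral_half_cker_le {α : ℝ} [Exponent α] (h0 : 1 / 2 ≤ r) (h1 : r < 1) :
    ∫ s in (0 : ℝ)..π, |s| ^ α * ‖cker r s‖ ^ 2 ≤ (1 + 5 / (1 - α)) * (1 - r) ^ (α - 1) := by
  have hα := Exponent.pos (α := α)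
  have hα1 := Exponent.lt_one (α := α)
  have hr0 : 0 ≤ r := by linarith
  have hρ : 0 < 1 - r := sub_pos.2 h1
  have hρπ : 1 - r ≤ π := by linarith [pi_gt_three]
  have hc : Continuous fun s : ℝ => |s| ^ α * ‖cker r s‖ ^ 2 :=
    (continuous_abs_rpow hα).mul ((continuous_cker hr0 h1).norm.pow 2)
  rw [← intervalIntegral.integral_add_adjacent_intervals (hc.intervalIntegrable 0 (1 - r))
    (hc.intervalIntegrable (1 - r) π)]
  have b1 : ∫ s in (0 : ℝ)..(1 - r), |s| ^ α * ‖cker r s‖ ^ 2 ≤ (1 - r) ^ (α - 1) := by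
    have h2 : ∫ s in (0 : ℝ)..(1 - r), |s| ^ α * ‖cker r s‖ ^ 2 ≤
        ∫ _s in (0 : ℝ)..(1 - r), (1 - r) ^ α * ((1 - r)⁻¹) ^ 2 := by
      refine intervalIntegral.integral_mono_on hρ.le (hc.intervalIntegrable _ _)
        (continuous_const.intervalIntegrable _ _) fun s hs => ?_
      have := norm_cker_le hr0 h1 s
      have h3 : |s| ^ α ≤ (1 - r) ^ α :=
        rpow_le_rpow (abs_nonneg _) (by rw [abs_of_nonneg hs.1]; exact hs.2) hα.le
      gcongr
    refine h2.trans (le_of_eq ?_)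
    rw [intervalIntegral.integral_const, smul_eq_mul, sub_zero, rpow_sub hρ, rpow_one]
    field_simp
  have b2 : ∫ s in (1 - r)..π, |s| ^ α * ‖cker r s‖ ^ 2 ≤
      5 / (1 - α) * (1 - r) ^ (α - 1) := by
    have hnot : (0 : ℝ) ∉ Set.uIcc (1 - r) π := by
      rw [Set.uIcc_of_le hρπ]; exact fun h => absurd h.1 (not_le.2 hρ)
    have h2 : ∫ s in (1 - r)..π, |s| ^ α * ‖cker r s‖ ^ 2 ≤
        ∫ s in (1 - r)..π, 5 * s ^ (α - 2) := by
      refine intervalIntegral.integral_mono_on hρπ (hc.intervalIntegrable _ _) ?_ fun s hs => ?_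
      · exact (intervalIntegral.intervalIntegrable_rpow (Or.inr hnot)).const_mul 5
      have hs0 : 0 < s := hρ.trans_le hs.1
      have h4 := sq_div_five_le h0 (s := s) (by rw [abs_of_pos hs0]; exact hs.2)
      rw [abs_of_pos hs0, cker, norm_inv, inv_pow, rpow_sub hs0]
      have h5 : (‖1 - r * ex 1 s‖ ^ 2)⁻¹ ≤ (s ^ 2 / 5)⁻¹ := inv_anti₀ (by positivity) h4
      calc s ^ α * (‖1 - r * ex 1 s‖ ^ 2)⁻¹ ≤ s ^ α * (s ^ 2 / 5)⁻¹ := by gcongr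
        _ = _ := by
          rw [show (2 : ℝ) = ((2 : ℕ) : ℝ) by norm_num, rpow_natCast]
          field_simp
    refine h2.trans ?_
    rw [intervalIntegral.integral_const_mul, integral_rpow (Or.inr ⟨by linarith, hnot⟩)]
    have h6 : (0 : ℝ) ≤ π ^ (α - 1) := rpow_nonneg pi_pos.le _
    rw [show α - 2 + 1 = -(1 - α) by ring, show α - 1 = -(1 - α) by ring] at *
    rw [div_neg, ← neg_div, neg_sub, mul_div_assoc', div_mul_eq_mul_div]
    gcongr
    linarith
  linarith

theorem integral_cker_le {α : ℝ} [Exponent α] (h0 : 1 / 2 ≤ r) (h1 : r < 1) :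
    ∫ s in (-π)..π, |s| ^ α * ‖cker r s‖ ^ 2 ≤
      2 * (1 + 5 / (1 - α)) * (1 - r) ^ (α - 1) := by
  have hα := Exponent.pos (α := α)
  have hr0 : 0 ≤ r := by linarith
  have hc : Continuous fun s : ℝ => |s| ^ α * ‖cker r s‖ ^ 2 :=
    (continuous_abs_rpow hα).mul ((continuous_cker hr0 h1).norm.pow 2)
  rw [← intervalIntegral.integral_add_adjacent_intervals (hc.intervalIntegrable (-π) 0)
    (hc.intervalIntegrable 0 π)]
  have h2 := intervalIntegral.integral_comp_neg (fun s : ℝ => |s| ^ α * ‖cker r s‖ ^ 2)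
    (a := 0) (b := π)
  simp only [abs_neg, norm_cker_neg, neg_zero] at h2
  rw [← h2]
  linarith [integral_half_cker_le (α := α) h0 h1]

end Kernel

theorem integral_mul_sub {f k₁ k₂ : ℝ → ℂ} (hf : Continuous f) (h₁ : Continuous k₁)
    (h₂ : Continuous k₂) (a b : ℝ) : ∫ s in a..b, f s * (k₁ s - k₂ s) =
      (∫ s in a..b, f s * k₁ s) - ∫ s in a..b, f s * k₂ s := by
  simp only [mul_sub]
  exact intervalIntegral.integral_sub ((hf.mul h₁).intervalIntegrable _ _)
    ((hf.mul h₂).intervalIntegrable _ _)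

/-- The Cauchy transform, at radius `r`. -/
def cauchyT (u : ℝ → ℂ) (r t : ℝ) : ℂ := (2 * π : ℂ)⁻¹ * ∫ s in (-π)..π, u (t - s) * cker r s

section Transform

variable {u : ℝ → ℂ} {r : ℝ}

theorem norm_inv_two_pi_mul_le {z : ℂ} {B : ℝ} (hz : ‖z‖ ≤ B) : ‖(2 * π : ℂ)⁻¹ * z‖ ≤ B := by
  have h2 : ‖(2 * π : ℂ)⁻¹‖ = (2 * π)⁻¹ := by
    rw [norm_inv]
    congr 1
    rw [show (2 * π : ℂ) = ((2 * π : ℝ) : ℂ) by push_cast; rfl, Complex.norm_real, norm_eq_abs,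
      abs_of_pos two_pi_pos]
  rw [norm_mul, h2]
  have h3 : (2 * π)⁻¹ ≤ 1 := inv_le_one_of_one_le₀ (by linarith [pi_gt_three])
  have h4 : 0 ≤ (2 * π)⁻¹ := inv_nonneg.2 two_pi_pos.le
  nlinarith [norm_nonneg z]

theorem norm_mean_le {f : ℝ → ℂ} {C : ℝ} (h : ∀ s, ‖f s‖ ≤ C) :
    ‖(2 * π : ℂ)⁻¹ * ∫ s in (-π)..π, f s‖ ≤ C := by
  have h1 : ‖∫ s in (-π)..π, f s‖ ≤ C * |π - -π| :=
    intervalIntegral.norm_integral_le_of_norm_le_const fun t _ => h t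
  have h2 : ‖(2 * π : ℂ)⁻¹‖ = (2 * π)⁻¹ := by
    rw [norm_inv]
    congr 1
    rw [show (2 * π : ℂ) = ((2 * π : ℝ) : ℂ) by push_cast; rfl, Complex.norm_real, norm_eq_abs,
      abs_of_pos two_pi_pos]
  rw [sub_neg_eq_add, ← two_mul, abs_of_pos two_pi_pos] at h1
  rw [norm_mul, h2]
  refine (mul_le_mul_of_nonneg_left h1 (inv_nonneg.2 two_pi_pos.le)).trans (le_of_eq ?_)
  field_simp

theorem mean_ex (hp : Function.Periodic u (2 * π)) (m : ℤ) (t : ℝ) :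
    (2 * π : ℂ)⁻¹ * ∫ s in (-π)..π, u (t - s) * ex m s = ex m t * fc u m := by
  have h1 : ∀ s, u (t - s) * ex m s = ex m t * (ex (-m) (t - s) * u (t - s)) := by
    intro s
    have h2 : ex m s * ex m (t - s) = ex m t := by rw [← ex_shift]; congr 1; ring
    calc u (t - s) * ex m s = ex m s * (ex m (t - s) * ex (-m) (t - s)) * u (t - s) := by
          rw [ex_mul_neg]; ring
      _ = (ex m s * ex m (t - s)) * (ex (-m) (t - s) * u (t - s)) := by ring
      _ = _ := by rw [h2]
  simp only [h1]
  rw [intervalIntegral.integral_const_mul,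
    intervalIntegral.integral_comp_sub_left (fun x => ex (-m) x * u x) t]
  have h3 : Function.Periodic (fun x => ex (-m) x * u x) (2 * π) := fun x => by
    simp only [periodic_ex (-m) x, hp x]
  have h4 := h3.intervalIntegral_add_eq (t - π) 0
  rw [show t - π + 2 * π = t - -π by ring, zero_add] at h4
  rw [h4, fc]
  ring

theorem cauchyT_approx (hp : Function.Periodic u (2 * π)) (hu : Continuous u) (h0 : 0 ≤ r)
    (h1 : r < 1) {S : ℝ} (hS : ∀ t, ‖u t‖ ≤ S) (N : ℕ) (t : ℝ) :
    ‖∑ m ∈ Finset.range N, (r : ℂ) ^ m * (ex m t * fc u m) - cauchyT u r t‖ ≤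
      S * (1 - r)⁻¹ * r ^ N := by
  have hut : Continuous fun s => u (t - s) := hu.comp (by fun_prop)
  have hS0 : 0 ≤ S := (norm_nonneg _).trans (hS 0)
  have e1 : cauchyT u r t = ∑ m ∈ Finset.range N, (r : ℂ) ^ m * (ex m t * fc u m) +
      (2 * π : ℂ)⁻¹ * ∫ s in (-π)..π, u (t - s) * ((r : ℂ) ^ N * ex N s * cker r s) := by
    rw [cauchyT]
    have e2 : ∀ s, u (t - s) * cker r s = ∑ m ∈ Finset.range N,
        (r : ℂ) ^ m * (u (t - s) * ex m s) + u (t - s) * ((r : ℂ) ^ N * ex N s * cker r s) := by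
      intro s
      conv_lhs => rw [cker_geom h0 h1 s N, mul_add, Finset.mul_sum]
      congr 1
      exact Finset.sum_congr rfl fun m _ => by ring
    simp only [e2]
    have i1 : ∀ m : ℕ, Continuous fun s => (r : ℂ) ^ m * (u (t - s) * ex m s) := fun m =>
      continuous_const.mul (hut.mul (continuous_ex m))
    have i2 : Continuous fun s => u (t - s) * ((r : ℂ) ^ N * ex N s * cker r s) :=
      hut.mul ((continuous_const.mul (continuous_ex N)).mul (continuous_cker h0 h1))
    rw [intervalIntegral.integral_add
      ((continuous_finsetSum _ fun m _ => i1 m).intervalIntegrable _ _)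
      (i2.intervalIntegrable _ _), intervalIntegral.integral_finsetSum
      fun m _ => (i1 m).intervalIntegrable _ _, mul_add, Finset.mul_sum]
    · congr 1
      refine Finset.sum_congr rfl fun m _ => ?_
      rw [intervalIntegral.integral_const_mul, mul_left_comm, mean_ex hp]
  rw [e1, sub_add_cancel_left, norm_neg]
  refine norm_mean_le fun s => ?_
  rw [norm_mul, norm_mul, norm_mul, norm_ex, norm_pow, Complex.norm_real, norm_eq_abs,
    abs_of_nonneg h0, mul_one]
  have h2 := norm_cker_le h0 h1 s
  calc ‖u (t - s)‖ * (r ^ N * ‖cker r s‖) ≤ S * (r ^ N * (1 - r)⁻¹) := by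
        gcongr
        exact hS _
    _ = _ := by ring

theorem tendsto_error (S : ℝ) (h0 : 0 ≤ r) (h1 : r < 1) :
    Tendsto (fun N : ℕ => S * (1 - r)⁻¹ * r ^ N) atTop (𝓝 0) := by
  simpa using (tendsto_pow_atTop_nhds_zero_of_lt_one h0 h1).const_mul (S * (1 - r)⁻¹)

theorem mean_cker (h0 : 0 ≤ r) (h1 : r < 1) : (2 * π : ℂ)⁻¹ * ∫ s in (-π)..π, cker r s = 1 := by
  have h2 := fun N => cauchyT_approx (u := ex 0) (periodic_ex 0) (continuous_ex 0) h0 h1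
    (fun t => (norm_ex 0 t).le) (N + 1) 0
  have h3 : ∀ N : ℕ, ∑ m ∈ Finset.range (N + 1), (r : ℂ) ^ m * (ex m 0 * fc (ex 0) m) = 1 := by
    intro N
    rw [Finset.sum_range_succ', Finset.sum_eq_zero]
    · simp [fc_ex, ex_at_zero]
    · intro m _
      rw [fc_ex, if_neg (by omega)]
      simp
  have h4 : cauchyT (ex 0) r 0 = (2 * π : ℂ)⁻¹ * ∫ s in (-π)..π, cker r s := by
    rw [cauchyT]
    simp [ex_zero]
  rw [← h4]
  simp only [h3] at h2
  have h5 : ‖1 - cauchyT (ex 0) r 0‖ ≤ 0 :=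
    ge_of_tendsto' ((tendsto_error 1 h0 h1).comp (tendsto_add_atTop_nat 1)) h2
  exact (sub_eq_zero.1 (norm_le_zero_iff.1 h5)).symm

variable {α : ℝ} [Exponent α] {C : ℝ}

/-- The constant of the kernel estimates. -/
def kernelConst (α : ℝ) : ℝ := 4 * (1 + 5 / (1 - α))

theorem kernelConst_pos (α : ℝ) [Exponent α] : 0 < kernelConst α := by
  have := sub_pos.2 (Exponent.lt_one (α := α))
  unfold kernelConst
  positivity

theorem norm_mean_kernel_le (hu : Continuous u) (hC : 0 ≤ C)
    (hH : ∀ s t, ‖u s - u t‖ ≤ C * |s - t| ^ α) (h0 : 1 / 2 ≤ r) (h1 : r < 1) {k : ℝ → ℂ}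
    (hk : Continuous k) {B : ℝ} (hB : 0 ≤ B) (hkB : ∀ s, ‖k s‖ ≤ 2 * B * ‖cker r s‖ ^ 2)
    (hk0 : ∫ s in (-π)..π, k s = 0) (t : ℝ) :
    ‖(2 * π : ℂ)⁻¹ * ∫ s in (-π)..π, u (t - s) * k s‖ ≤
      C * kernelConst α * (B * (1 - r) ^ (α - 1)) := by
  have hα := Exponent.pos (α := α)
  have hr0 : 0 ≤ r := by linarith
  have hut : Continuous fun s => u (t - s) := hu.comp (by fun_prop)
  have e1 : ∫ s in (-π)..π, u (t - s) * k s = ∫ s in (-π)..π, (u (t - s) - u t) * k s := by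
    have h2 := integral_mul_sub hk hut (continuous_const (y := u t)) (-π) π
    rw [intervalIntegral.integral_mul_const, hk0, zero_mul, sub_zero] at h2
    simp only [mul_comm (k _)] at h2
    exact h2.symm
  rw [e1]
  refine norm_inv_two_pi_mul_le ?_
  have hc : Continuous fun s : ℝ => |s| ^ α * ‖cker r s‖ ^ 2 :=
    (continuous_abs_rpow hα).mul ((continuous_cker hr0 h1).norm.pow 2)
  have h2 : ‖∫ s in (-π)..π, (u (t - s) - u t) * k s‖ ≤
      ∫ s in (-π)..π, 2 * C * B * (|s| ^ α * ‖cker r s‖ ^ 2) := by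
    refine intervalIntegral.norm_integral_le_of_norm_le (by linarith [pi_pos])
      (Eventually.of_forall fun s _ => ?_) ((continuous_const.mul hc).intervalIntegrable _ _)
    rw [norm_mul]
    have h3 := hH (t - s) t
    rw [show t - s - t = -s by ring, abs_neg] at h3
    calc _ ≤ (C * |s| ^ α) * (2 * B * ‖cker r s‖ ^ 2) := mul_le_mul h3 (hkB s) (norm_nonneg _)
          (mul_nonneg hC (rpow_nonneg (abs_nonneg _) _))
      _ = _ := by ring
  rw [intervalIntegral.integral_const_mul] at h2
  have h4 := integral_cker_le (α := α) h0 h1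
  refine h2.trans ((mul_le_mul_of_nonneg_left h4 (by positivity)).trans (le_of_eq ?_))
  rw [kernelConst]
  ring

theorem cauchyT_sub_radius (hu : Continuous u) (hC : 0 ≤ C)
    (hH : ∀ s t, ‖u s - u t‖ ≤ C * |s - t| ^ α) {r' : ℝ} (h0 : 1 / 2 ≤ r) (hr : r ≤ r')
    (h1 : r' < 1) (hd : r' - r ≤ 1 - r') (t : ℝ) :
    ‖cauchyT u r' t - cauchyT u r t‖ ≤
      C * kernelConst α * ((r' - r) * (1 - r) ^ (α - 1)) := by
  have hr0 : 0 ≤ r := by linarith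
  have hut : Continuous fun s => u (t - s) := hu.comp (by fun_prop)
  have c1 := continuous_cker hr0 (hr.trans_lt h1)
  have c2 := continuous_cker (hr0.trans hr) h1
  have e1 : cauchyT u r' t - cauchyT u r t =
      (2 * π : ℂ)⁻¹ * ∫ s in (-π)..π, u (t - s) * (cker r' s - cker r s) := by
    rw [integral_mul_sub hut c2 c1, mul_sub]
    rfl
  rw [e1]
  refine norm_mean_kernel_le hu hC hH h0 (hr.trans_lt h1) (c2.sub c1) (sub_nonneg.2 hr)
    (cker_sub_radius hr0 hr h1 hd) ?_ t
  refine (intervalIntegral.integral_sub (c2.intervalIntegrable _ _)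
    (c1.intervalIntegrable _ _)).trans ?_
  have hpi : (2 * π : ℂ)⁻¹ ≠ 0 := inv_ne_zero (by exact_mod_cast two_pi_pos.ne')
  refine mul_left_cancel₀ hpi ?_
  rw [mul_sub, mul_zero, mean_cker hr0 (hr.trans_lt h1), mean_cker (hr0.trans hr) h1, sub_self]

theorem cauchyT_sub_shift (hp : Function.Periodic u (2 * π)) (hu : Continuous u) (hC : 0 ≤ C)
    (hH : ∀ s t, ‖u s - u t‖ ≤ C * |s - t| ^ α) (h0 : 1 / 2 ≤ r) (h1 : r < 1) {t t' : ℝ}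
    (hd : |t' - t| ≤ 1 - r) :
    ‖cauchyT u r t' - cauchyT u r t‖ ≤
      C * kernelConst α * (|t' - t| * (1 - r) ^ (α - 1)) := by
  have hr0 : 0 ≤ r := by linarith
  have hut : Continuous fun s => u (t - s) := hu.comp (by fun_prop)
  have c1 := continuous_cker hr0 h1
  have c2 : Continuous fun s => cker r (s + (t' - t)) := c1.comp (by fun_prop)
  have shift : ∀ f : ℝ → ℂ, Function.Periodic f (2 * π) →
      ∫ s in (-π)..π, f (s + (t' - t)) = ∫ s in (-π)..π, f s := by
    intro f hf
    rw [intervalIntegral.integral_comp_add_right]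
    have h4 := hf.intervalIntegral_add_eq (-π + (t' - t)) (-π)
    rwa [show -π + (t' - t) + 2 * π = π + (t' - t) by ring, show -π + 2 * π = π by ring] at h4
  have e1 : cauchyT u r t' - cauchyT u r t =
      (2 * π : ℂ)⁻¹ * ∫ s in (-π)..π, u (t - s) * (cker r (s + (t' - t)) - cker r s) := by
    rw [integral_mul_sub hut c2 c1, mul_sub, cauchyT, cauchyT]
    congr 2
    rw [← shift (fun s => u (t' - s) * cker r s)]
    · refine intervalIntegral.integral_congr fun s _ => ?_
      rw [show t' - (s + (t' - t)) = t - s by ring]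
    · intro s
      simp only
      rw [periodic_cker, show t' - (s + 2 * π) = t' - s - 2 * π by ring, hp.sub_eq]
  rw [e1]
  refine norm_mean_kernel_le hu hC hH h0 h1 (c2.sub c1) (abs_nonneg _)
    (cker_sub_shift hr0 h1 hd) ?_ t
  refine (intervalIntegral.integral_sub (c2.intervalIntegrable _ _)
    (c1.intervalIntegrable _ _)).trans ?_
  rw [shift _ (periodic_cker r), sub_self]

end Transform

end KStat

end

noncomputable section

namespace KStat

open Real Filter Topology ComplexConjugate

theorem continuous_of_approx {U : ℕ → ℝ → ℂ} {u : ℝ → ℂ} (hU : ∀ i, Continuous (U i)) {C : ℕ → ℝ}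
    (hC : Tendsto C atTop (𝓝 0)) (h : ∀ i t, ‖U i t - u t‖ ≤ C i) : Continuous u := by
  have hu : TendstoUniformly U u atTop := by
    rw [Metric.tendstoUniformly_iff]
    intro ε hε
    filter_upwards [hC.eventually (gt_mem_nhds hε)] with N hN t
    rw [dist_comm, dist_eq_norm]
    exact (h N t).trans_lt hN
  exact hu.continuous (Frequently.of_forall hU)

theorem continuous_poly (p : Polynomial ℂ) :
    Continuous fun t : ℝ => p.eval (Circle.exp t : ℂ) := by fun_prop

theorem fc_poly (p : Polynomial ℂ) (n : ℤ) :
    fc (fun t => p.eval (Circle.exp t : ℂ)) n = if 0 ≤ n then p.coeff n.toNat else 0 := by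
  induction p using Polynomial.induction_on' with
  | add p q hp hq =>
    simp only [Polynomial.eval_add]
    rw [fc_add (continuous_poly p) (continuous_poly q), hp, hq]
    split_ifs
    · rw [Polynomial.coeff_add]
    · rw [add_zero]
  | monomial m c =>
    simp only [Polynomial.eval_monomial, ← ex_natCast]
    rw [fc_const_mul, fc_ex]
    by_cases h : n = m
    · subst h
      simp
    · rw [if_neg h, mul_zero]
      split_ifs with h0
      · rw [Polynomial.coeff_monomial, if_neg (by omega)]
      · rfl

/-- The Taylor polynomial of the Cauchy transform. -/
def taylorPoly (u : ℝ → ℂ) (r : ℝ) (N : ℕ) : Polynomial ℂ :=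
  ∑ m ∈ Finset.range N, Polynomial.C ((r : ℂ) ^ m * fc u m) * Polynomial.X ^ m

theorem eval_taylorPoly (u : ℝ → ℂ) (r : ℝ) (N : ℕ) (t : ℝ) :
    (taylorPoly u r N).eval (Circle.exp t : ℂ) =
      ∑ m ∈ Finset.range N, (r : ℂ) ^ m * (ex m t * fc u m) := by
  rw [taylorPoly, Polynomial.eval_finsetSum]
  refine Finset.sum_congr rfl fun m _ => ?_
  rw [Polynomial.eval_mul, Polynomial.eval_C, Polynomial.eval_pow, Polynomial.eval_X, ex_natCast]
  ring

theorem coeff_taylorPoly (u : ℝ → ℂ) (r : ℝ) {N m : ℕ} (h : m < N) :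
    (taylorPoly u r N).coeff m = (r : ℂ) ^ m * fc u m := by
  rw [taylorPoly, Polynomial.finsetSum_coeff]
  simp only [Polynomial.coeff_C_mul_X_pow]
  simp [h]

theorem periodic_cauchyT {u : ℝ → ℂ} (hp : Function.Periodic u (2 * π)) (r : ℝ) :
    Function.Periodic (cauchyT u r) (2 * π) := by
  intro t
  have h : ∀ s, u (t + 2 * π - s) = u (t - s) := fun s => by
    rw [show t + 2 * π - s = t - s + 2 * π by ring, hp]
  simp only [cauchyT, h]

section

variable {u : ℝ → ℂ} (hp : Function.Periodic u (2 * π)) (hu : Continuous u) {r : ℝ} (h0 : 0 ≤ r)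
  (h1 : r < 1) {S : ℝ} (hS : ∀ t, ‖u t‖ ≤ S)

include hp hu h0 h1 hS

theorem taylorPoly_approx (N : ℕ) (t : ℝ) :
    ‖(taylorPoly u r N).eval (Circle.exp t : ℂ) - cauchyT u r t‖ ≤ S * (1 - r)⁻¹ * r ^ N := by
  rw [eval_taylorPoly]
  exact cauchyT_approx hp hu h0 h1 hS N t

theorem continuous_cauchyT : Continuous (cauchyT u r) :=
  continuous_of_approx (fun N => continuous_poly (taylorPoly u r N)) (tendsto_error S h0 h1)
    (taylorPoly_approx hp hu h0 h1 hS)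

theorem fc_cauchyT (n : ℤ) :
    fc (cauchyT u r) n = if 0 ≤ n then (r : ℂ) ^ n.toNat * fc u n else 0 := by
  refine tendsto_nhds_unique (fc_tendsto (fun N => continuous_poly (taylorPoly u r N))
    (continuous_cauchyT hp hu h0 h1 hS) (tendsto_error S h0 h1)
    (taylorPoly_approx hp hu h0 h1 hS) n) ?_
  refine tendsto_const_nhds.congr' ?_
  filter_upwards [eventually_gt_atTop n.toNat] with N hN
  rw [fc_poly]
  split_ifs with h
  · rw [coeff_taylorPoly _ _ hN, Int.toNat_of_nonneg h]
  · rfl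

end

/-- `v` is the holomorphic projection of `u`. -/
def IsSzego (u v : ℝ → ℂ) : Prop :=
  (∀ n : ℤ, fc v n = if 0 ≤ n then fc u n else 0) ∧
    ∃ G : ℂ → ℂ, DiffContOnCl ℂ G (Metric.ball 0 1) ∧ ∀ t : ℝ, G (Circle.exp t) = v t

theorem exists_szego_zero (α : ℝ) [Exponent α] :
    ∃ K, 0 ≤ K ∧ ∀ u : Hol 0 α ℂ, ∃ v : Hol 0 α ℂ, ‖v‖ ≤ K * ‖u‖ ∧ IsSzego u v := by
  have hα := Exponent.pos (α := α)
  have hα1 := Exponent.lt_one (α := α)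
  set q : ℝ := (1 / 2) ^ α with hq
  have hq0 : 0 < q := by positivity
  have hq1 : q < 1 := rpow_lt_one (by norm_num) (by norm_num) hα
  have hqn : ∀ n : ℕ, q ^ n = ((1 / 2 : ℝ) ^ n) ^ α := fun n => by
    rw [hq, ← rpow_natCast, ← rpow_natCast, ← rpow_mul (by norm_num), ← rpow_mul (by norm_num),
      mul_comm]
  have hκ := kernelConst_pos α
  set κ := kernelConst α with hκdef
  obtain ⟨E, hE⟩ : ∃ E, E = κ / (1 - q) := ⟨_, rfl⟩
  have hE0 : 0 ≤ E := by rw [hE]; exact div_nonneg hκ.le (sub_nonneg.2 hq1.le)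
  obtain ⟨K, hK⟩ : ∃ K, K = 8 * E + κ + 8 := ⟨_, rfl⟩
  have hK0 : 0 ≤ K := by rw [hK]; positivity
  refine ⟨2 * K + 2 * K, by positivity, fun u => ?_⟩
  have hp := u.isHol.periodic
  have hu := u.isHol.continuous
  have hS : ∀ t, ‖u t‖ ≤ ‖u‖ := u.norm_apply_le
  obtain ⟨C, hC⟩ : ∃ C, C = ‖u‖ := ⟨_, rfl⟩
  have hC0 : 0 ≤ C := by rw [hC]; exact norm_nonneg u
  rw [← hC] at hS ⊢
  have hH : ∀ s t, ‖u s - u t‖ ≤ C * |s - t| ^ α := fun s t => by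
    have h1 := u.norm_sub_apply_le s t
    rw [← hC] at h1
    exact h1.trans (mul_le_mul_of_nonneg_left
      (rpow_le_rpow (chord_nonneg _) (chord_le_abs s t) hα.le) hC0)
  obtain ⟨R, hR⟩ : ∃ R : ℕ → ℝ, R = fun j => 1 - (1 / 2) ^ (j + 1) := ⟨_, rfl⟩
  have hρ : ∀ j, 1 - R j = (1 / 2) ^ (j + 1) := fun j => by rw [hR]; ring
  have hρ0 : ∀ j, (0 : ℝ) < (1 / 2) ^ (j + 1) := fun j => by positivity
  have hρ1 : ∀ j, (1 / 2 : ℝ) ^ (j + 1) ≤ 1 / 2 := fun j => by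
    rw [pow_succ]
    have : (1 / 2 : ℝ) ^ j ≤ 1 := pow_le_one₀ (by norm_num) (by norm_num)
    linarith
  have hR1 : ∀ j, R j < 1 := fun j => by linarith [hρ j, hρ0 j]
  have hRh : ∀ j, 1 / 2 ≤ R j := fun j => by linarith [hρ j, hρ1 j]
  have hR0 : ∀ j, 0 ≤ R j := fun j => by linarith [hRh j]
  have hρα : ∀ j, (1 - R j) ^ α ≤ q ^ j := fun j => by
    rw [hρ, hqn]
    refine rpow_le_rpow (hρ0 j).le ?_ hα.le
    rw [pow_succ]
    linarith [pow_pos (by norm_num : (0 : ℝ) < 1 / 2) j]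
  obtain ⟨F, hF⟩ : ∃ F : ℕ → ℝ → ℂ, F = fun j => cauchyT u (R j) := ⟨_, rfl⟩
  have hstep : ∀ t j, dist (F j t) (F (j + 1) t) ≤ C * κ * q ^ j := by
    intro t j
    rw [dist_comm, dist_eq_norm, hF]
    have hd : R (j + 1) - R j = 1 - R (j + 1) := by
      have h1 := hρ j
      have h2 := hρ (j + 1)
      rw [pow_succ] at h2
      linarith
    have hle : R j ≤ R (j + 1) := by linarith [hR1 (j + 1)]
    refine (cauchyT_sub_radius hu hC0 hH (hRh j) hle (hR1 _) hd.le t).trans ?_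
    refine mul_le_mul_of_nonneg_left ?_ (by positivity)
    refine le_trans ?_ (hρα j)
    have h3 : (0 : ℝ) < 1 - R j := sub_pos.2 (hR1 j)
    calc (R (j + 1) - R j) * (1 - R j) ^ (α - 1) ≤ (1 - R j) * (1 - R j) ^ (α - 1) := by
          gcongr
          linarith [hR1 (j + 1)]
      _ = (1 - R j) ^ α := by
        rw [rpow_sub h3, rpow_one]
        field_simp
  choose v hv using fun t => cauchySeq_tendsto_of_complete
    (cauchySeq_of_le_geometric q (C * κ) hq1 (hstep t))
  have hlim : ∀ j t, ‖F j t - v t‖ ≤ C * E * q ^ j := by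
    intro j t
    rw [← dist_eq_norm]
    refine (dist_le_of_le_geometric_of_tendsto q (C * κ) hq1 (hstep t) (hv t) j).trans (le_of_eq ?_)
    rw [hE]
    ring
  have hq_lim : Tendsto (fun j : ℕ => C * E * q ^ j) atTop (𝓝 0) := by
    simpa using (tendsto_pow_atTop_nhds_zero_of_lt_one hq0.le hq1).const_mul (C * E)
  have hFc : ∀ j, Continuous (F j) := fun j => by
    rw [hF]; exact continuous_cauchyT hp hu (hR0 j) (hR1 j) hS
  have hvc : Continuous v := continuous_of_approx hFc hq_lim hlim
  have hvp : Function.Periodic v (2 * π) := fun t => by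
    refine tendsto_nhds_unique (hv (t + 2 * π)) ?_
    have h1 : ∀ j, F j (t + 2 * π) = F j t := fun j => by
      rw [hF]; exact periodic_cauchyT hp (R j) t
    simp only [h1]
    exact hv t
  have hvb : ∀ t, ‖v t‖ ≤ C * (2 + E) := by
    intro t
    have h1 := hlim 0 t
    rw [pow_zero, mul_one] at h1
    have h2 : ‖F 0 t‖ ≤ C * 2 := by
      rw [hF]
      refine norm_mean_le fun s => ?_
      rw [norm_mul]
      have h3 := norm_cker_le (hR0 0) (hR1 0) s
      rw [hρ 0] at h3
      norm_num at h3
      exact mul_le_mul (hS _) h3 (norm_nonneg _) hC0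
    have h3 := norm_sub_norm_le (v t) (F 0 t)
    rw [norm_sub_rev] at h3
    linarith
  have hvh : ∀ s t, ‖v s - v t‖ ≤ K * C * |s - t| ^ α := by
    intro s t
    rcases eq_or_ne s t with rfl | hst
    · simp [zero_rpow hα.ne']
    have hpos : 0 < |s - t| := abs_pos.2 (sub_ne_zero.2 hst)
    by_cases hb : |s - t| ≤ 1 / 2
    · obtain ⟨n, hn1, hn2⟩ := exists_nat_pow_near_of_lt_one (x := 2 * |s - t|) (y := (1 / 2 : ℝ))
        (by positivity) (by linarith) (by norm_num) (by norm_num)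
      have hle : |s - t| ≤ 1 - R n := by rw [hρ, pow_succ]; linarith
      have h1 := cauchyT_sub_shift hp hu hC0 hH (hRh n) (hR1 n) (t := t) (t' := s) hle
      rw [← hκdef] at h1
      have h2 := hlim n s
      have h3 := hlim n t
      have h4 : q ^ n ≤ 4 * |s - t| ^ α := by
        rw [hqn]
        have h5 : (1 / 2 : ℝ) ^ n ≤ 4 * |s - t| := by rw [pow_succ] at hn1; linarith
        refine (rpow_le_rpow (by positivity) h5 hα.le).trans ?_
        rw [mul_rpow (by norm_num) hpos.le]
        refine mul_le_mul_of_nonneg_right ?_ (by positivity)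
        calc (4 : ℝ) ^ α ≤ 4 ^ (1 : ℝ) := rpow_le_rpow_of_exponent_le (by norm_num) hα1.le
          _ = 4 := rpow_one 4
      have h5 : |s - t| * (1 - R n) ^ (α - 1) ≤ |s - t| ^ α := by
        have h6 : (1 - R n) ^ (α - 1) ≤ |s - t| ^ (α - 1) :=
          rpow_le_rpow_of_nonpos hpos hle (by linarith)
        calc _ ≤ |s - t| * |s - t| ^ (α - 1) := by gcongr
          _ = _ := by
            rw [rpow_sub hpos, rpow_one]
            field_simp
      have e1 : v s - v t = -(F n s - v s) + (F n t - v t) + (F n s - F n t) := by ring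
      rw [e1]
      refine (norm_add₃_le).trans ?_
      rw [norm_neg]
      have h6 : ‖F n s - F n t‖ ≤ C * κ * |s - t| ^ α := by
        rw [hF]
        exact h1.trans (mul_le_mul_of_nonneg_left h5 (by positivity))
      have h7 : C * E * q ^ n ≤ C * E * (4 * |s - t| ^ α) :=
        mul_le_mul_of_nonneg_left h4 (by positivity)
      have h8 : 0 ≤ C * |s - t| ^ α := by positivity
      rw [hK]
      nlinarith
    · have h1 : 1 / 2 ≤ |s - t| ^ α := by
        have h2 : (1 / 2 : ℝ) ^ α ≤ |s - t| ^ α :=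
          rpow_le_rpow (by norm_num) (not_le.1 hb).le hα.le
        have h3 : (1 / 2 : ℝ) ^ (1 : ℝ) ≤ (1 / 2) ^ α :=
          rpow_le_rpow_of_exponent_ge (by norm_num) (by norm_num) hα1.le
        rw [rpow_one] at h3
        linarith
      have h2 := norm_sub_le (v s) (v t)
      have h3 : K * C * (1 / 2) ≤ K * C * |s - t| ^ α := mul_le_mul_of_nonneg_left h1 (by positivity)
      rw [hK] at h3 ⊢
      nlinarith [hvb s, hvb t, mul_nonneg hC0 hE0, mul_nonneg hC0 hκ.le]
  have hvchord : ∀ s t, ‖v s - v t‖ ≤ K * C * 2 * chord (s, t) ^ α :=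
    holder_of_periodic hvp hα.le hα1.le (by positivity) fun s t _ => hvh s t
  refine ⟨Hol.mk v ⟨hvp, hvc, K * C * 2, hvchord⟩, ?_, ?_, ?_⟩
  · have h1 := Hol.norm_zero_le (u := Hol.mk v ⟨hvp, hvc, K * C * 2, hvchord⟩)
      (C := K * C * 2) (by positivity) (fun t => ?_) hvchord
    · refine h1.trans (le_of_eq (by ring))
    · refine (hvb t).trans ?_
      rw [hK]
      nlinarith [mul_nonneg hC0 hE0, mul_nonneg hC0 hκ.le]
  · intro n
    have h1 := fc_tendsto hFc hvc hq_lim hlim n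
    refine tendsto_nhds_unique h1 ?_
    have h2 : ∀ j, fc (F j) n = if 0 ≤ n then (R j : ℂ) ^ n.toNat * fc u n else 0 := fun j => by
      rw [hF]; exact fc_cauchyT hp hu (hR0 j) (hR1 j) hS n
    simp only [h2]
    split_ifs with h
    · have h3 : Tendsto R atTop (𝓝 1) := by
        rw [hR]
        have h4 : Tendsto (fun j : ℕ => (1 / 2 : ℝ) ^ (j + 1)) atTop (𝓝 0) :=
          (tendsto_pow_atTop_nhds_zero_of_lt_one (by norm_num) (by norm_num)).comp
            (tendsto_add_atTop_nat 1)
        simpa using h4.const_sub 1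
      have h5 : Tendsto (fun j => (R j : ℂ) ^ n.toNat * fc u n) atTop
          (𝓝 (((1 : ℝ) : ℂ) ^ n.toNat * fc u n)) :=
        (((Complex.continuous_ofReal.tendsto 1).comp h3).pow _).mul_const _
      simpa using h5
    · exact tendsto_const_nhds
  · have h1 : ∀ j, ∃ N : ℕ, C * (1 - R j)⁻¹ * R j ^ N ≤ (1 / 2) ^ j := fun j =>
      (((tendsto_error C (hR0 j) (hR1 j)).eventually (gt_mem_nhds (by positivity))).exists).imp
        fun _ h => h.le
    choose N hN using h1
    refine exists_diffContOnCl (p := fun j => taylorPoly u (R j) (N j))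
      (C := fun j => (1 / 2) ^ j + C * E * q ^ j) ?_ fun j t => ?_
    · simpa using (tendsto_pow_atTop_nhds_zero_of_lt_one (by norm_num : (0 : ℝ) ≤ 1 / 2)
        (by norm_num)).add hq_lim
    · have h2 := taylorPoly_approx hp hu (hR0 j) (hR1 j) hS (N j) t
      have h3 := hlim j t
      have h4 := norm_add_le ((taylorPoly u (R j) (N j)).eval (Circle.exp t : ℂ) - F j t)
        (F j t - v t)
      rw [sub_add_sub_cancel] at h4
      refine h4.trans (add_le_add ?_ h3)
      rw [hF]
      exact h2.trans (hN j)

theorem exists_szego (k : ℕ) (α : ℝ) [Exponent α] :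
    ∃ K, 0 ≤ K ∧ ∀ u : Hol k α ℂ, ∃ v : Hol k α ℂ, ‖v‖ ≤ K * ‖u‖ ∧ IsSzego u v := by
  induction k with
  | zero => exact exists_szego_zero α
  | succ k ih =>
    obtain ⟨K, hK, ih⟩ := ih
    refine ⟨15 * (K * ‖(Hol.J : Hol (k + 1) α ℂ →L[ℝ] Hol k α ℂ)‖ +
      K * ‖(Hol.D : Hol (k + 1) α ℂ →L[ℝ] Hol k α ℂ)‖), by positivity, fun u => ?_⟩
    obtain ⟨v, hv, hvS, G, hG, hGv⟩ := ih (Hol.J u)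
    obtain ⟨w, hw, hwS, -⟩ := ih (Hol.D u)
    have hfcD : ∀ n, fc (Hol.D u) n = Complex.I * n * fc u n :=
      fc_deriv u.isHol.periodic u.hasDerivAt (Hol.D u).isHol.continuous
    have hwc := w.isHol.continuous
    have hwint : ∫ s in (0 : ℝ)..2 * π, w s = 0 := by
      have h1 := hwS 0
      rw [if_pos le_rfl, hfcD, Int.cast_zero, mul_zero, zero_mul, fc] at h1
      simp only [neg_zero, ex_zero, one_mul] at h1
      exact (mul_eq_zero.1 h1).resolve_left (inv_ne_zero (by exact_mod_cast two_pi_pos.ne'))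
    obtain ⟨W, hW⟩ : ∃ W : ℝ → ℂ, W = fun t => ∫ s in (0 : ℝ)..t, w s := ⟨_, rfl⟩
    have hWd : ∀ t, HasDerivAt W (w t) t := fun t => by
      rw [hW]
      exact intervalIntegral.integral_hasDerivAt_right (hwc.intervalIntegrable _ _)
        hwc.stronglyMeasurable.stronglyMeasurableAtFilter hwc.continuousAt
    have hWp : Function.Periodic W (2 * π) := fun t => by
      rw [hW]
      have h1 := intervalIntegral.integral_add_adjacent_intervals
        (hwc.intervalIntegrable (μ := MeasureTheory.volume) 0 t)
        (hwc.intervalIntegrable t (t + 2 * π))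
      have h2 := w.isHol.periodic.intervalIntegral_add_eq t 0
      rw [zero_add, hwint] at h2
      rw [h2, add_zero] at h1
      exact h1.symm
    have hWc : Continuous W := continuous_iff_continuousAt.2 fun t => (hWd t).continuousAt
    obtain ⟨c, hc⟩ : ∃ c, c = fc v 0 - fc W 0 := ⟨_, rfl⟩
    have heq : (fun t => W t + c * ex 0 t) = v := by
      refine eq_of_fc (fun t => ?_) (hWc.add (continuous_const.mul (continuous_ex 0)))
        v.isHol.periodic v.isHol.continuous fun n => ?_
      · simp only [hWp t, ex_zero]
      · rw [fc_add (v := fun t => c * ex 0 t) hWc (continuous_const.mul (continuous_ex 0)), fc_const_mul, fc_ex]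
        by_cases hn : n = 0
        · rw [hn, if_pos rfl, hc]
          ring
        · rw [if_neg hn, mul_zero, add_zero]
          have h1 := fc_deriv hWp hWd hwc n
          rw [hwS, hfcD] at h1
          have hne : Complex.I * (n : ℂ) ≠ 0 := mul_ne_zero Complex.I_ne_zero (by exact_mod_cast hn)
          refine mul_left_cancel₀ hne ?_
          rw [← h1, hvS]
          split_ifs
          · rfl
          · rw [mul_zero]
    have hvd : ∀ t, HasDerivAt v (w t) t := fun t => by
      rw [← heq]
      simp only [ex_zero, mul_one]
      exact (hWd t).add_const c
    refine ⟨Hol.ofDeriv v w hvd, ?_, ?_, G, hG, hGv⟩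
    · refine (Hol.norm_succ_le _).trans ?_
      rw [Hol.J_ofDeriv, Hol.D_ofDeriv, mul_assoc, add_mul]
      have h1 := (Hol.J : Hol (k + 1) α ℂ →L[ℝ] Hol k α ℂ).le_opNorm u
      have h2 := (Hol.D : Hol (k + 1) α ℂ →L[ℝ] Hol k α ℂ).le_opNorm u
      have h3 := mul_le_mul_of_nonneg_left h1 hK
      have h4 := mul_le_mul_of_nonneg_left h2 hK
      rw [mul_assoc, mul_assoc]
      linarith
    · exact hvS

namespace Hol

variable {k : ℕ} {α : ℝ} [Exponent α]

theorem eq_of_fc {u v : Hol k α ℂ} (h : ∀ n, fc u n = fc v n) : u = v :=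
  Subtype.ext (KStat.eq_of_fc u.isHol.periodic u.isHol.continuous v.isHol.periodic v.isHol.continuous h)

theorem fc_add (u v : Hol k α ℂ) (n : ℤ) : fc (u + v : Hol k α ℂ) n = fc u n + fc v n :=
  KStat.fc_add u.isHol.continuous v.isHol.continuous n

theorem fc_sub (u v : Hol k α ℂ) (n : ℤ) : fc (u - v : Hol k α ℂ) n = fc u n - fc v n :=
  KStat.fc_sub u.isHol.continuous v.isHol.continuous n

theorem fc_smul (c : ℝ) (u : Hol k α ℂ) (n : ℤ) : fc (c • u : Hol k α ℂ) n = c * fc u n := by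
  rw [← fc_const_mul]
  congr 1

/-- The holomorphic projection of `C^{k,α}`. -/
def szego : Hol k α ℂ →L[ℝ] Hol k α ℂ :=
  LinearMap.mkContinuous
    { toFun := fun u => ((exists_szego k α).choose_spec.2 u).choose
      map_add' := fun u v => by
        refine eq_of_fc fun n => ?_
        rw [fc_add, ((exists_szego k α).choose_spec.2 _).choose_spec.2.1,
          ((exists_szego k α).choose_spec.2 u).choose_spec.2.1,
          ((exists_szego k α).choose_spec.2 v).choose_spec.2.1, fc_add]
        split_ifs <;> simp
      map_smul' := fun c u => by
        refine eq_of_fc fun n => ?_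
        rw [RingHom.id_apply, fc_smul, ((exists_szego k α).choose_spec.2 _).choose_spec.2.1,
          ((exists_szego k α).choose_spec.2 u).choose_spec.2.1, fc_smul]
        split_ifs <;> simp }
    (exists_szego k α).choose fun u => ((exists_szego k α).choose_spec.2 u).choose_spec.1

theorem isSzego (u : Hol k α ℂ) : IsSzego u (szego u) :=
  ((exists_szego k α).choose_spec.2 u).choose_spec.2

theorem fc_szego (u : Hol k α ℂ) (n : ℤ) : fc (szego u) n = if 0 ≤ n then fc u n else 0 :=
  (isSzego u).1 n

theorem exists_extension (u : Hol k α ℂ) :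
    ∃ G : ℂ → ℂ, DiffContOnCl ℂ G (Metric.ball 0 1) ∧ ∀ t : ℝ, G (Circle.exp t) = szego u t :=
  (isSzego u).2

/-- The elements of `C^{k,α}` without negative Fourier coefficients. -/
def IsHolo (u : Hol k α ℂ) : Prop := ∀ n < (0 : ℤ), fc u n = 0

theorem isHolo_szego (u : Hol k α ℂ) : IsHolo (szego u) := fun n hn => by
  rw [fc_szego, if_neg (not_le.2 hn)]

theorem szego_eq_self_iff {u : Hol k α ℂ} : szego u = u ↔ IsHolo u := by
  constructor
  · intro h
    rw [← h]
    exact isHolo_szego u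
  · intro h
    refine eq_of_fc fun n => ?_
    rw [fc_szego]
    split_ifs with hn
    · rfl
    · exact (h n (not_le.1 hn)).symm

theorem isHolo_iff {u : Hol k α ℂ} : IsHolo u ↔
    ∃ G : ℂ → ℂ, DiffContOnCl ℂ G (Metric.ball 0 1) ∧ ∀ t : ℝ, G (Circle.exp t) = u t := by
  constructor
  · intro h
    have h1 := exists_extension u
    rwa [szego_eq_self_iff.2 h] at h1
  · rintro ⟨G, hG, hGu⟩ n hn
    rw [← fc_eq_zero_of_diffContOnCl hG hn]
    simp only [hGu]

end Hol

end KStat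

end

noncomputable section

namespace KStat

open Real Filter Topology

theorem totallyBounded_of_map {E : Type*} [PseudoMetricSpace E] {s : Set E}
    (h : ∀ ε > 0, ∃ (Z : Type) (_ : PseudoMetricSpace Z) (S : E → Z) (η : ℝ), 0 < η ∧
      TotallyBounded (S '' s) ∧ ∀ u ∈ s, ∀ v ∈ s, dist (S u) (S v) < η → dist u v < ε) :
    TotallyBounded s := by
  rw [Metric.totallyBounded_iff]
  intro ε hε
  obtain ⟨Z, _, S, η, hη, hS, hd⟩ := h ε hε
  obtain ⟨t, hts, htf, hcov⟩ := Metric.finite_approx_of_totallyBounded hS η hη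
  obtain ⟨t', ht's, ht'f, hcov⟩ := (Set.exists_subset_image_finite_and
    (p := fun t => S '' s ⊆ ⋃ y ∈ t, Metric.ball y η)).1 ⟨t, hts, htf, hcov⟩
  refine ⟨t', ht'f, fun u hu => ?_⟩
  obtain ⟨_, ⟨v, hv, rfl⟩, huv⟩ := Set.mem_iUnion₂.1 (hcov (Set.mem_image_of_mem S hu))
  exact Set.mem_iUnion₂.2 ⟨v, hv, hd u hu v (ht's hv) huv⟩

theorem totallyBounded_prod {E F : Type*} [PseudoMetricSpace E] [PseudoMetricSpace F] {s : Set E}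
    {t : Set F} (hs : TotallyBounded s) (ht : TotallyBounded t) : TotallyBounded (s ×ˢ t) := by
  rw [Metric.totallyBounded_iff] at *
  intro ε hε
  obtain ⟨a, ha, hsa⟩ := hs ε hε
  obtain ⟨b, hb, htb⟩ := ht ε hε
  refine ⟨a ×ˢ b, ha.prod hb, fun p hp => ?_⟩
  obtain ⟨x, hx, hpx⟩ := Set.mem_iUnion₂.1 (hsa hp.1)
  obtain ⟨y, hy, hpy⟩ := Set.mem_iUnion₂.1 (htb hp.2)
  refine Set.mem_iUnion₂.2 ⟨(x, y), ⟨hx, hy⟩, ?_⟩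
  rw [Metric.mem_ball, Prod.dist_eq]
  exact max_lt hpx hpy

section Incl

variable {F : Type} [NormedAddCommGroup F] [NormedSpace ℝ F] {k : ℕ} {α β : ℝ} [Exponent α]
  [Exponent β]

theorem chord_rpow_le (h : α ≤ β) (p : ℝ × ℝ) : chord p ^ β ≤ 2 * chord p ^ α := by
  have hα := Exponent.pos (α := α)
  have hβ := Exponent.lt_one (α := β)
  have h1 : chord p ^ β = chord p ^ (β - α) * chord p ^ α := by
    rw [← rpow_add_of_nonneg (chord_nonneg p) (sub_nonneg.2 h) hα.le, sub_add_cancel]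
  rw [h1]
  refine mul_le_mul_of_nonneg_right ?_ (chord_rpow_nonneg _ _)
  calc chord p ^ (β - α) ≤ 2 ^ (β - α) :=
        rpow_le_rpow (chord_nonneg p) (chord_le_two p) (sub_nonneg.2 h)
    _ ≤ 2 ^ (1 : ℝ) := rpow_le_rpow_of_exponent_le (by norm_num) (by linarith)
    _ = 2 := rpow_one 2

theorem IsHol.mono (h : α ≤ β) {u : ℝ → F} (hu : IsHol k β u) :
    IsHol k α u ∧ hnorm k α u ≤ 2 * hnorm k β u := by
  induction k generalizing u with
  | zero =>
    have h1 : ∀ s t, ‖u s - u t‖ ≤ 2 * holN β u * chord (s, t) ^ α := fun s t => by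
      refine (hu.norm_sub_le_holN s t).trans ?_
      have := mul_le_mul_of_nonneg_left (chord_rpow_le h (s, t)) (holN_nonneg β u)
      linarith
    refine ⟨⟨hu.1, hu.2.1, _, h1⟩, ?_⟩
    have h2 := holN_le (mul_nonneg zero_le_two (holN_nonneg β u)) h1
    have h3 := supN_nonneg u
    change supN u + holN α u ≤ 2 * (supN u + holN β u)
    linarith
  | succ k ih =>
    have h1 := ih hu.isHol_deriv
    refine ⟨⟨hu.1, hu.2.1, h1.1⟩, ?_⟩
    have h3 := supN_nonneg u
    change supN u + hnorm k α (deriv u) ≤ 2 * (supN u + hnorm k β (deriv u))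
    linarith [h1.2]

namespace Hol

/-- The inclusion of `C^{k,β}` into `C^{k,α}`, `α ≤ β`. -/
def incl (h : α ≤ β) : Hol k β F →L[ℝ] Hol k α F :=
  LinearMap.mkContinuous
    { toFun := fun u => mk u (u.isHol.mono h).1
      map_add' := fun _ _ => rfl
      map_smul' := fun _ _ => rfl } 2 fun u => by
    have h1 := (u.isHol.mono h).2
    have h2 := mul_le_mul_of_nonneg_left h1 (by positivity : (0 : ℝ) ≤ 15 ^ k)
    rw [mul_left_comm] at h2
    exact h2

@[simp] theorem incl_apply (h : α ≤ β) (u : Hol k β F) (t : ℝ) : incl h u t = u t := rfl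

theorem norm_incl_le_of_sup {R ε : ℝ} (h : α < β) (hR : 0 ≤ R) (hε : 0 < ε) :
    ∃ m > 0, ∀ w : Hol 0 β F, ‖w‖ ≤ R → (∀ t, ‖w t‖ ≤ m) → ‖incl h.le w‖ ≤ ε := by
  have hα := Exponent.pos (α := α)
  obtain ⟨ρ, hρ, hρR⟩ : ∃ ρ > 0, R * ρ ^ (β - α) ≤ ε / 2 := by
    have h1 : Tendsto (fun ρ : ℝ => R * ρ ^ (β - α)) (𝓝[>] 0) (𝓝 0) := by
      have h2 : Tendsto (fun ρ : ℝ => ρ ^ (β - α)) (𝓝 0) (𝓝 ((0 : ℝ) ^ (β - α))) :=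
        (continuousAt_rpow_const 0 (β - α) (Or.inr (sub_pos.2 h).le))
      rw [zero_rpow (sub_pos.2 h).ne'] at h2
      simpa using (h2.mono_left nhdsWithin_le_nhds).const_mul R
    have h3 := (h1.eventually (gt_mem_nhds (half_pos hε))).and self_mem_nhdsWithin
    obtain ⟨ρ, h4, h5⟩ := h3.exists
    exact ⟨ρ, h5, h4.le⟩
  have hρα : 0 < ρ ^ α := rpow_pos_of_pos hρ α
  refine ⟨min (ε / 2) (ε / 4 * ρ ^ α), lt_min (half_pos hε) (by positivity), fun w hw hm => ?_⟩
  refine (norm_zero_le (u := incl h.le w) (half_pos hε).le (fun t => (hm t).trans (min_le_left _ _))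
    fun s t => ?_).trans (add_halves ε).le
  have hχ := chord_nonneg (s, t)
  rcases le_or_gt ρ (chord (s, t)) with hle | hlt
  · have h1 : ρ ^ α ≤ chord (s, t) ^ α := rpow_le_rpow hρ.le hle hα.le
    have h2 := norm_sub_le (w s) (w t)
    have h3 := (hm s).trans (min_le_right _ _)
    have h4 := (hm t).trans (min_le_right _ _)
    have h5 := mul_le_mul_of_nonneg_left h1 (half_pos hε).le
    change ‖w s - w t‖ ≤ _
    linarith
  · have h1 : chord (s, t) ^ β = chord (s, t) ^ (β - α) * chord (s, t) ^ α := by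
      rw [← rpow_add_of_nonneg hχ (sub_nonneg.2 h.le) hα.le, sub_add_cancel]
    have h2 := norm_sub_apply_le w s t
    rw [h1, ← mul_assoc] at h2
    refine h2.trans (mul_le_mul_of_nonneg_right ?_ (chord_rpow_nonneg _ _))
    refine le_trans ?_ hρR
    exact mul_le_mul hw (rpow_le_rpow hχ hlt.le (sub_nonneg.2 h.le)) (rpow_nonneg hχ _) hR

theorem totallyBounded_incl [ProperSpace F] (h : α < β) (R : ℝ) :
    TotallyBounded ((incl h.le : Hol k β F → Hol k α F) '' Metric.closedBall 0 R) := by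
  have hβ := Exponent.pos (α := β)
  have hβ1 := Exponent.lt_one (α := β)
  induction k generalizing R with
  | zero =>
    rcases lt_or_ge R 0 with hR | hR
    · rw [Metric.closedBall_eq_empty.2 hR, Set.image_empty]
      exact totallyBounded_empty
    refine totallyBounded_of_map fun ε hε => ?_
    obtain ⟨m, hm, hsup⟩ := norm_incl_le_of_sup (F := F) h (add_nonneg hR hR) (half_pos hε)
    obtain ⟨r, hr, hrR⟩ : ∃ r > 0, (R + R) * r ^ β ≤ m / 2 := by
      have h2 : Tendsto (fun ρ : ℝ => ρ ^ β) (𝓝 0) (𝓝 ((0 : ℝ) ^ β)) :=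
        (continuousAt_rpow_const 0 β (Or.inr hβ.le))
      rw [zero_rpow hβ.ne'] at h2
      have h1 := (h2.mono_left (nhdsWithin_le_nhds (s := Set.Ioi 0))).const_mul (R + R)
      rw [mul_zero] at h1
      obtain ⟨r, h4, h5⟩ :=
        ((h1.eventually (gt_mem_nhds (half_pos hm))).and self_mem_nhdsWithin).exists
      exact ⟨r, h5, h4.le⟩
    obtain ⟨τ, -, hτf, hcov⟩ := (isCompact_Icc (a := (0 : ℝ)) (b := 2 * π)).finite_cover_balls hr
    have := hτf.fintype
    refine ⟨τ → F, inferInstance, fun u t => u t, m / 2, half_pos hm, ?_, ?_⟩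
    · refine (isCompact_closedBall (0 : τ → F) R).totallyBounded.subset ?_
      rintro _ ⟨_, ⟨u, hu, rfl⟩, rfl⟩
      rw [mem_closedBall_zero_iff] at hu ⊢
      exact (pi_norm_le_iff_of_nonneg hR).2 fun t => (norm_apply_le u t).trans hu
    · rintro _ ⟨u, hu, rfl⟩ _ ⟨v, hv, rfl⟩ huv
      rw [mem_closedBall_zero_iff] at hu hv
      rw [dist_eq_norm, ← map_sub]
      have hw : ‖u - v‖ ≤ R + R := (norm_sub_le u v).trans (add_le_add hu hv)
      refine (hsup (u - v) hw fun t => ?_).trans_lt (half_lt_self hε)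
      obtain ⟨t', ht', hper⟩ := (u - v).isHol.periodic.exists_mem_Ico₀ two_pi_pos t
      rw [hper]
      obtain ⟨p, hp, htp⟩ := Set.mem_iUnion₂.1 (hcov ⟨ht'.1, ht'.2.le⟩)
      have h1 : ‖(u - v) p‖ < m / 2 := by
        have h2 := (dist_pi_lt_iff (half_pos hm)).1 huv ⟨p, hp⟩
        rwa [dist_eq_norm] at h2
      have h2 : ‖(u - v) t' - (u - v) p‖ ≤ m / 2 := by
        refine (norm_sub_apply_le (u - v) t' p).trans (le_trans ?_ hrR)
        refine mul_le_mul hw ?_ (chord_rpow_nonneg _ _) (add_nonneg hR hR)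
        refine rpow_le_rpow (chord_nonneg _) ((chord_le_abs _ _).trans ?_) hβ.le
        rw [← Real.dist_eq]
        exact htp.le
      have h3 := norm_add_le ((u - v) t' - (u - v) p) ((u - v) p)
      rw [sub_add_cancel] at h3
      linarith
  | succ k ih =>
    refine totallyBounded_of_map fun ε hε => ?_
    obtain ⟨N, hN⟩ : ∃ N, ∀ u : Hol (k + 1) β F, u ∈ Metric.closedBall 0 R →
        J u ∈ Metric.closedBall 0 N ∧ D u ∈ Metric.closedBall 0 N := by
      obtain ⟨a, ha⟩ : ∃ a, a = ‖(J : Hol (k + 1) β F →L[ℝ] Hol k β F)‖ := ⟨_, rfl⟩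
      obtain ⟨b, hb⟩ : ∃ b, b = ‖(D : Hol (k + 1) β F →L[ℝ] Hol k β F)‖ := ⟨_, rfl⟩
      have ha0 : 0 ≤ a := ha ▸ norm_nonneg _
      have hb0 : 0 ≤ b := hb ▸ norm_nonneg _
      refine ⟨(a + b) * R, fun u hu => ?_⟩
      rw [mem_closedBall_zero_iff] at hu ⊢
      rw [mem_closedBall_zero_iff]
      have hR : 0 ≤ R := (norm_nonneg u).trans hu
      have h1 := (J : Hol (k + 1) β F →L[ℝ] Hol k β F).le_opNorm u
      have h2 := (D : Hol (k + 1) β F →L[ℝ] Hol k β F).le_opNorm u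
      rw [← ha] at h1
      rw [← hb] at h2
      constructor <;> nlinarith [norm_nonneg u]
    refine ⟨Hol k α F × Hol k α F, inferInstance, fun u => (J u, D u), ε / 60, by positivity,
      ?_, ?_⟩
    · refine (totallyBounded_prod (ih N) (ih N)).subset ?_
      rintro _ ⟨_, ⟨u, hu, rfl⟩, rfl⟩
      exact ⟨⟨J u, (hN u hu).1, rfl⟩, ⟨D u, (hN u hu).2, rfl⟩⟩
    · intro u _ v _ huv
      rw [Prod.dist_eq, max_lt_iff, dist_eq_norm, dist_eq_norm] at huv
      simp only [← map_sub] at huv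
      rw [dist_eq_norm]
      have h1 := norm_succ_le (u - v)
      linarith [huv.1, huv.2]

theorem incl_mul (h : α ≤ β) (u v : Hol k β ℂ) : incl h (u * v) = incl h u * incl h v := by
  ext t
  rw [mul_apply, incl_apply, incl_apply, incl_apply, mul_apply]

theorem incl_szego (h : α ≤ β) (u : Hol k β ℂ) : incl h (szego u) = szego (incl h u) := by
  refine eq_of_fc fun n => ?_
  rw [fc_szego]
  exact fc_szego u n

end Hol

end Incl

end KStat

end

noncomputable section

namespace KStat

open Real Filter Topology

section InverseFunction

variable {X Y Z : Type*} [NormedAddCommGroup X] [NormedSpace ℝ X] [NormedAddCommGroup Y]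
  [NormedSpace ℝ Y] [CompleteSpace Y] [Nontrivial Y] [NormedAddCommGroup Z] [NormedSpace ℝ Z]

/-- The inverse function theorem with a parameter in a normed space which need not be complete. -/
theorem exists_partial_inverse {Φ : X × Y → Z} {s : Set (X × Y)} (hs : IsOpen s)
    (hΦ : ContDiffOn ℝ 1 Φ s) {x₀ : X} {y₀ : Y} (h₀ : (x₀, y₀) ∈ s) (A : Y ≃L[ℝ] Z)
    (hA : ∀ y, fderiv ℝ Φ (x₀, y₀) (0, y) = A y) :
    ∃ (U : Set X) (V : Set Z) (B : Set Y) (g : X × Z → Y), IsOpen U ∧ IsOpen V ∧ B ∈ 𝓝 y₀ ∧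
      x₀ ∈ U ∧ Φ (x₀, y₀) ∈ V ∧ (∀ x ∈ U, ∀ y ∈ B, (x, y) ∈ s) ∧
      (∀ x ∈ U, Set.InjOn (fun y => Φ (x, y)) B) ∧
      (∀ x ∈ U, ∀ z ∈ V, g (x, z) ∈ B ∧ Φ (x, g (x, z)) = z) ∧
      ContDiffOn ℝ 1 g (U ×ˢ V) := by
  have hstrict : ∀ a ∈ s, HasStrictFDerivAt Φ (fderiv ℝ Φ a) a := fun a ha =>
    (hΦ.contDiffAt (hs.mem_nhds ha)).hasStrictFDerivAt one_ne_zero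
  have hcont : ContinuousOn Φ s := hΦ.continuousOn
  have hdc : ContinuousOn (fderiv ℝ Φ) s := hΦ.continuousOn_fderiv_of_isOpen hs le_rfl
  have hA' : (fderiv ℝ Φ (x₀, y₀)).comp (ContinuousLinearMap.inr ℝ X Y) = A := by
    ext y
    exact hA y
  have hN : {a | (fderiv ℝ Φ a).comp (ContinuousLinearMap.inr ℝ X Y) ∈
      Set.range ((↑) : (Y ≃L[ℝ] Z) → Y →L[ℝ] Z)} ∈ 𝓝 (x₀, y₀) := by
    have h1 : ContinuousAt (fun a => (fderiv ℝ Φ a).comp (ContinuousLinearMap.inr ℝ X Y))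
        (x₀, y₀) :=
      (hdc.continuousAt (hs.mem_nhds h₀)).clm_comp continuousAt_const
    refine h1.preimage_mem_nhds ?_
    rw [hA']
    exact A.nhds
  obtain ⟨N, hNdef⟩ : ∃ N, N = ‖(A.symm : Z →L[ℝ] Y)‖₊ := ⟨_, rfl⟩
  have hNpos : 0 < N := by
    rw [hNdef]
    exact A.subsingleton_or_nnnorm_symm_pos.resolve_left (not_subsingleton Y)
  obtain ⟨c, hcdef⟩ : ∃ c, c = N⁻¹ / 2 := ⟨_, rfl⟩
  have hNi : 0 < N⁻¹ := inv_pos.2 hNpos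
  have hc0 : 0 < c := by rw [hcdef]; exact half_pos hNi
  have hcN : c < N⁻¹ := by rw [hcdef]; exact NNReal.half_lt_self hNi.ne'
  obtain ⟨t, ht, happ⟩ := (hstrict _ h₀).approximates_deriv_on_nhds (Or.inr hc0)
  obtain ⟨r, hr, hball⟩ := Metric.mem_nhds_iff.1 (inter_mem ht (inter_mem hN (hs.mem_nhds h₀)))
  obtain ⟨ρ, hρ, hρr⟩ : ∃ ρ > 0, ρ < r := exists_between hr
  have hmem : ∀ x ∈ Metric.ball x₀ r, ∀ y ∈ Metric.closedBall y₀ ρ, (x, y) ∈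
      t ∩ ({a | (fderiv ℝ Φ a).comp (ContinuousLinearMap.inr ℝ X Y) ∈
      Set.range ((↑) : (Y ≃L[ℝ] Z) → Y →L[ℝ] Z)} ∩ s) := by
    intro x hx y hy
    refine hball ?_
    rw [Metric.mem_ball, Prod.dist_eq]
    exact max_lt hx ((Metric.mem_closedBall.1 hy).trans_lt hρr)
  have happ' : ∀ x ∈ Metric.ball x₀ r, ApproximatesLinearOn (fun y => Φ (x, y))
      (A : Y →L[ℝ] Z) (Metric.closedBall y₀ ρ) c := by
    intro x hx y hy y' hy'
    have h1 := happ _ (hmem x hx y hy).1 _ (hmem x hx y' hy').1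
    rw [Prod.mk_sub_mk, sub_self, hA, Prod.norm_mk, norm_zero,
      max_eq_right (norm_nonneg _)] at h1
    exact h1
  have hanti : ∀ x ∈ Metric.ball x₀ r, ∀ y ∈ Metric.closedBall y₀ ρ,
      ∀ y' ∈ Metric.closedBall y₀ ρ, dist y y' ≤ (N⁻¹ - c)⁻¹ * dist (Φ (x, y)) (Φ (x, y')) := by
    intro x hx y hy y' hy'
    have h1 := (happ' x hx).antilipschitz (Or.inr (by rw [← hNdef]; exact hcN))
    rw [← hNdef] at h1
    exact h1.le_mul_dist ⟨y, hy⟩ ⟨y', hy'⟩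
  obtain ⟨σ, hσdef⟩ : ∃ σ : ℝ, σ = ((N : ℝ)⁻¹ - c) * ρ / 2 := ⟨_, rfl⟩
  have hσ : 0 < σ := by
    have h1 : (c : ℝ) < (N : ℝ)⁻¹ := by exact_mod_cast hcN
    rw [hσdef]
    exact half_pos (mul_pos (sub_pos.2 h1) hρ)
  obtain ⟨z₀, hz₀⟩ : ∃ z₀, z₀ = Φ (x₀, y₀) := ⟨_, rfl⟩
  have hUnhds : ∀ᶠ x in 𝓝 x₀, Φ (x, y₀) ∈ Metric.ball z₀ σ := by
    have h1 : ContinuousAt (fun x => Φ (x, y₀)) x₀ :=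
      ContinuousAt.comp (f := fun x => (x, y₀)) (hcont.continuousAt (hs.mem_nhds h₀))
        (by fun_prop)
    have h2 := h1.preimage_mem_nhds (Metric.ball_mem_nhds _ hσ)
    rw [hz₀]
    exact h2
  obtain ⟨r', hr', hUb⟩ := Metric.eventually_nhds_iff_ball.1 hUnhds
  have hUr : ∀ x ∈ Metric.ball x₀ (min r r'), x ∈ Metric.ball x₀ r := fun x hx =>
    Metric.ball_subset_ball (min_le_left _ _) hx
  have hex : ∀ x ∈ Metric.ball x₀ (min r r'), ∀ z ∈ Metric.ball z₀ σ,
      ∃ y ∈ Metric.closedBall y₀ ρ, Φ (x, y) = z := by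
    intro x hx z hz
    refine (happ' x (hUr x hx)).surjOn_closedBall_of_nonlinearRightInverse
      A.toNonlinearRightInverse hρ.le subset_rfl ?_
    have h1 := hUb x (Metric.ball_subset_ball (min_le_right _ _) hx)
    have h2 : (A.toNonlinearRightInverse).nnnorm = N := hNdef.symm
    rw [h2, Metric.mem_closedBall]
    rw [Metric.mem_ball] at h1 hz
    rw [dist_comm] at h1
    have h3 := dist_triangle z z₀ (Φ (x, y₀))
    linarith
  choose! G hG using hex
  obtain ⟨g, hg⟩ : ∃ g : X × Z → Y, g = fun p => G p.1 p.2 := ⟨_, rfl⟩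
  have hg1 : ∀ x ∈ Metric.ball x₀ (min r r'), ∀ z ∈ Metric.ball z₀ σ,
      g (x, z) ∈ Metric.closedBall y₀ ρ ∧ Φ (x, g (x, z)) = z := by rw [hg]; exact hG
  have hUV : IsOpen (Metric.ball x₀ (min r r') ×ˢ Metric.ball z₀ σ) :=
    Metric.isOpen_ball.prod Metric.isOpen_ball
  refine ⟨Metric.ball x₀ (min r r'), Metric.ball z₀ σ, Metric.closedBall y₀ ρ, g,
    Metric.isOpen_ball, Metric.isOpen_ball, Metric.closedBall_mem_nhds _ hρ,
    Metric.mem_ball_self (lt_min hr hr'), ?_, fun x hx y hy => (hmem x (hUr x hx) y hy).2.2,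
    fun x hx => (happ' x (hUr x hx)).injOn (Or.inr (by rw [← hNdef]; exact hcN)), hg1, ?_⟩
  · rw [← hz₀]
    exact Metric.mem_ball_self hσ
  have hgc : ∀ p ∈ Metric.ball x₀ (min r r') ×ˢ Metric.ball z₀ σ, ContinuousAt g p := by
    rintro ⟨x₁, z₁⟩ ⟨hx₁, hz₁⟩
    have hy₁ := hg1 x₁ hx₁ z₁ hz₁
    have hs₁ := (hmem x₁ (hUr x₁ hx₁) _ hy₁.1).2.2
    rw [ContinuousAt, tendsto_iff_dist_tendsto_zero]
    have h1 : Tendsto (fun p : X × Z => ((N⁻¹ - c : NNReal)⁻¹ : NNReal) *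
        dist p.2 (Φ (p.1, g (x₁, z₁)))) (𝓝 (x₁, z₁)) (𝓝 0) := by
      have h2 : ContinuousAt (fun p : X × Z => Φ (p.1, g (x₁, z₁))) (x₁, z₁) :=
        ContinuousAt.comp (f := fun p : X × Z => (p.1, g (x₁, z₁)))
          (hcont.continuousAt (hs.mem_nhds hs₁)) (by fun_prop)
      have h3 : Tendsto (fun p : X × Z => dist p.2 (Φ (p.1, g (x₁, z₁)))) (𝓝 (x₁, z₁))
          (𝓝 (dist z₁ (Φ (x₁, g (x₁, z₁))))) :=
        (continuousAt_snd (p := (x₁, z₁))).dist h2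
      rw [hy₁.2, dist_self] at h3
      simpa using h3.const_mul (((N⁻¹ - c : NNReal)⁻¹ : NNReal) : ℝ)
    refine squeeze_zero' (Eventually.of_forall fun _ => dist_nonneg) ?_ h1
    filter_upwards [hUV.mem_nhds ⟨hx₁, hz₁⟩] with p hp
    have hp1 := hg1 p.1 hp.1 p.2 hp.2
    have h2 := hanti p.1 (hUr _ hp.1) _ hp1.1 _ hy₁.1
    rw [hp1.2] at h2
    exact h2
  have hpair : ContDiffOn ℝ 1 (fun p : X × Z => (p.1, g p))
      (Metric.ball x₀ (min r r') ×ˢ Metric.ball z₀ σ) := by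
    refine contDiffOn_one_of_hasStrictFDerivAt hUV ?_
    rintro ⟨x₁, z₁⟩ ⟨hx₁, hz₁⟩
    have hy₁ := hg1 x₁ hx₁ z₁ hz₁
    obtain ⟨-, ⟨A₁, hA₁⟩, hs₁⟩ := hmem x₁ (hUr x₁ hx₁) _ hy₁.1
    have hd := hstrict _ hs₁
    set Φ' := fderiv ℝ Φ (x₁, g (x₁, z₁)) with hΦ'
    obtain ⟨T, hT⟩ : ∃ T, T = (ContinuousLinearEquiv.refl ℝ X).skewProd A₁
      (Φ'.comp (ContinuousLinearMap.inl ℝ X Y)) := ⟨_, rfl⟩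
    have hf : HasStrictFDerivAt (fun a : X × Y => (a.1, Φ a)) (T : X × Y →L[ℝ] X × Z)
        (x₁, g (x₁, z₁)) := by
      have h1 : HasStrictFDerivAt (fun a : X × Y => (a.1, Φ a))
          ((ContinuousLinearMap.fst ℝ X Y).prod Φ') (x₁, g (x₁, z₁)) :=
        hasStrictFDerivAt_fst.prodMk hd
      convert h1 using 1
      ext a
      · simp [hT]
      · simp [hT]
      · simp [hT]
      · have h2 : A₁ a = Φ' (0, a) := by
          have h3 := congrArg (fun L : Y →L[ℝ] Z => L a) hA₁
          exact h3
        simp only [hT, ContinuousLinearMap.coe_comp, Function.comp, ContinuousLinearEquiv.coe_coe,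
          ContinuousLinearMap.inr_apply, ContinuousLinearEquiv.skewProd_apply,
          ContinuousLinearMap.inl_apply, ContinuousLinearMap.prod_apply, h2]
        have h3 : Φ' (0, 0) = 0 := map_zero Φ'
        rw [h3, add_zero]
    have h2 := HasStrictFDerivAt.of_local_left_inverse (f := fun a : X × Y => (a.1, Φ a))
      (g := fun p : X × Z => (p.1, g p)) (a := (x₁, z₁))
      (continuousAt_fst.prodMk (hgc _ ⟨hx₁, hz₁⟩)) hf ?_
    · exact ⟨_, h2⟩
    · filter_upwards [hUV.mem_nhds ⟨hx₁, hz₁⟩] with p hp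
      exact Prod.ext rfl (hg1 p.1 hp.1 p.2 hp.2).2
  exact hpair.snd

end InverseFunction

section Exhaustion

variable {Y : Type*} [NormedAddCommGroup Y] [NormedSpace ℝ Y]

theorem posPart_sq_convex {u v a τ : ℝ} (h0 : 0 ≤ τ) (h1 : τ ≤ 1) (hv : v ≤ a) :
    max (τ * u + (1 - τ) * v - a) 0 ^ 2 ≤ τ * max (u - a) 0 ^ 2 := by
  have h2 : max (τ * u + (1 - τ) * v - a) 0 ≤ τ * max (u - a) 0 := by
    refine max_le ?_ (mul_nonneg h0 (le_max_right _ _))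
    have h3 := mul_le_mul_of_nonneg_left (le_max_left (u - a) 0) h0
    nlinarith
  have h3 : 0 ≤ max (τ * u + (1 - τ) * v - a) 0 := le_max_right _ _
  have h4 : 0 ≤ max (u - a) 0 := le_max_right _ _
  calc _ ≤ (τ * max (u - a) 0) ^ 2 := by gcongr
    _ = τ * (τ * max (u - a) 0 ^ 2) := by ring
    _ ≤ τ * (1 * max (u - a) 0 ^ 2) := by gcongr
    _ = _ := by ring

theorem contDiff_posPart_sq : ContDiff ℝ 1 fun x : ℝ => max x 0 ^ 2 := by
  rw [contDiff_one_iff_deriv]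
  have hd : ∀ x : ℝ, HasDerivAt (fun x : ℝ => max x 0 ^ 2) (2 * max x 0) x := by
    intro x
    rcases lt_trichotomy x 0 with hx | rfl | hx
    · rw [max_eq_right hx.le, mul_zero]
      refine (hasDerivAt_const x (0 : ℝ)).congr_of_eventuallyEq ?_
      filter_upwards [Iio_mem_nhds hx] with y hy
      rw [max_eq_right (le_of_lt hy), zero_pow two_ne_zero]
    · rw [max_self, mul_zero, hasDerivAt_iff_isLittleO_nhds_zero]
      simp only [zero_add, max_self, smul_zero, sub_zero, zero_pow two_ne_zero]
      refine (Asymptotics.IsBigO.of_bound 1 (Eventually.of_forall fun h => ?_)).trans_isLittleO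
        (Asymptotics.isLittleO_pow_id one_lt_two)
      rw [one_mul, norm_pow, norm_pow]
      refine pow_le_pow_left₀ (norm_nonneg _) ?_ 2
      rw [norm_eq_abs, norm_eq_abs, abs_of_nonneg (le_max_right _ _)]
      exact max_le (le_abs_self _) (abs_nonneg _)
    · rw [max_eq_left hx.le]
      have h1 := hasDerivAt_pow 2 x
      simp only [Nat.cast_ofNat, Nat.add_one_sub_one, pow_one] at h1
      refine h1.congr_of_eventuallyEq ?_
      filter_upwards [Ioi_mem_nhds hx] with y hy
      rw [max_eq_left (le_of_lt hy)]
  refine ⟨fun x => (hd x).differentiableAt, ?_⟩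
  rw [show deriv (fun x : ℝ => max x 0 ^ 2) = fun x => 2 * max x 0 from funext fun x => (hd x).deriv]
  fun_prop

/-- A family of convex functions which exhausts the ball `{N < η}` on a totally bounded set. -/
theorem exists_exhaustion (N : Seminorm ℝ Y) (hN : Continuous N)
    (hnorm : ∀ y, ∃ φ : Y →L[ℝ] ℝ, (∀ v, φ v ≤ N v) ∧ φ y = N y) {W : Set Y}
    (hW : TotallyBounded W) {η : ℝ} (hη : 0 < η) :
    ∃ g : Y → ℝ, (∀ y, 0 ≤ g y) ∧ (∀ y, N y ≤ η / 2 → g y = 0) ∧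
      (∀ w z τ, 0 ≤ τ → τ ≤ 1 → N w < η → N z ≤ η / 2 → g (τ • w + (1 - τ) • z) ≤ τ * g w) ∧
      ContDiffOn ℝ 1 g {y | N y < η} ∧
      ∀ M : ℝ, ∃ b < η, ∀ w ∈ W, b < N w → N w < η → M ≤ g w := by
  -- finite families of functionals which almost give the norm on `W`
  have hfin : ∀ ε > 0, ∃ Φ : Finset (Y →L[ℝ] ℝ), (∀ φ ∈ Φ, ∀ v, φ v ≤ N v) ∧
      ∀ w ∈ W, ∃ φ ∈ Φ, N w - ε ≤ φ w := by
    intro ε hε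
    choose φ hφ hφ' using hnorm
    have hcont : ∀ y : Y, {w | N w - ε < φ y w} ∈ 𝓝 y := fun y => by
      refine (isOpen_lt (hN.sub continuous_const) (φ y).continuous).mem_nhds ?_
      change N y - ε < φ y y
      rw [hφ']
      linarith
    obtain ⟨C, hC⟩ : ∃ C : ℝ, 0 < C ∧ ∀ v, N v ≤ C * ‖v‖ := N.bound_of_continuous_normedSpace hN
    have hr : 0 < ε / (2 * C) := div_pos hε (by linarith [hC.1])
    obtain ⟨t, -, htf, hcov⟩ := Metric.finite_approx_of_totallyBounded hW _ hr
    classical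
    refine ⟨htf.toFinset.image φ, fun ψ hψ v => ?_, fun w hw => ?_⟩
    · obtain ⟨y, -, rfl⟩ := Finset.mem_image.1 hψ
      exact hφ y v
    · obtain ⟨y, hy, hwy⟩ := Set.mem_iUnion₂.1 (hcov hw)
      refine ⟨φ y, Finset.mem_image_of_mem _ (htf.mem_toFinset.2 hy), ?_⟩
      rw [Metric.mem_ball, dist_eq_norm] at hwy
      have h1 : N (w - y) ≤ ε / 2 := by
        refine (hC.2 _).trans ?_
        have := mul_le_mul_of_nonneg_left hwy.le hC.1.le
        refine this.trans (le_of_eq ?_)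
        have := hC.1.ne'
        field_simp
      have h2 : φ y w = N y - φ y (y - w) := by rw [map_sub, hφ']; ring
      have h3 := hφ y (y - w)
      have h4 : N (y - w) = N (w - y) := map_sub_rev N y w
      have h5 : N w ≤ N y + N (w - y) := by
        have := map_add_le_add N y (w - y)
        rwa [add_sub_cancel] at this
      linarith
  obtain ⟨a, ha⟩ : ∃ a : ℕ → ℝ, a = fun m => η - η * (1 / 2) ^ (m + 1) := ⟨_, rfl⟩
  obtain ⟨ε, hε⟩ : ∃ ε : ℕ → ℝ, ε = fun m => η * (1 / 2) ^ (m + 3) := ⟨_, rfl⟩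
  have hε0 : ∀ m, 0 < ε m := fun m => by rw [hε]; positivity
  have hstep : ∀ m, a (m + 1) = a m + 2 * ε m := fun m => by rw [ha, hε]; ring
  have ha_mono : Monotone a := monotone_nat_of_le_succ fun m => by linarith [hstep m, hε0 m]
  have ha_lt : ∀ m, a m < η := fun m => by
    rw [ha]
    have : 0 < η * (1 / 2) ^ (m + 1) := by positivity
    simp only
    linarith
  have ha0 : ∀ m, η / 2 ≤ a m := fun m => by
    refine le_trans (le_of_eq ?_) (ha_mono (Nat.zero_le m))
    rw [ha]
    ring
  have ha_lim : Tendsto a atTop (𝓝 η) := by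
    have h1 : Tendsto (fun m : ℕ => (1 / 2 : ℝ) ^ (m + 1)) atTop (𝓝 0) :=
      (tendsto_pow_atTop_nhds_zero_of_lt_one (by norm_num) (by norm_num)).comp
        (tendsto_add_atTop_nat 1)
    rw [ha]
    simpa using (h1.const_mul η).const_sub η
  choose Φ hΦ hΦ' using fun m => hfin (ε m) (hε0 m)
  obtain ⟨T, hT⟩ : ∃ T : ℕ → Y → ℝ, T = fun m y =>
    ((m + 1) / ε m ^ 2) * ∑ φ ∈ Φ m, max (φ y - a m) 0 ^ 2 := ⟨_, rfl⟩
  have hC0 : ∀ m : ℕ, 0 ≤ ((m : ℝ) + 1) / ε m ^ 2 := fun m => by positivity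
  have hT0 : ∀ m y, 0 ≤ T m y := fun m y => by
    rw [hT]
    exact mul_nonneg (hC0 m) (Finset.sum_nonneg fun _ _ => sq_nonneg _)
  have hTz : ∀ m y, N y ≤ a m → T m y = 0 := fun m y hy => by
    rw [hT]
    simp only
    rw [Finset.sum_eq_zero, mul_zero]
    intro φ hφ
    rw [max_eq_right, zero_pow two_ne_zero]
    linarith [hΦ m φ hφ y]
  have hTconv : ∀ m w z τ, 0 ≤ τ → τ ≤ 1 → N z ≤ η / 2 →
      T m (τ • w + (1 - τ) • z) ≤ τ * T m w := by
    intro m w z τ h0 h1 hz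
    rw [hT]
    simp only
    rw [mul_left_comm]
    refine mul_le_mul_of_nonneg_left ?_ (hC0 m)
    rw [Finset.mul_sum]
    refine Finset.sum_le_sum fun φ hφ => ?_
    rw [map_add, map_smul, map_smul, smul_eq_mul, smul_eq_mul]
    exact posPart_sq_convex h0 h1 (by linarith [hΦ m φ hφ z, ha0 m])
  have hTC : ∀ m, ContDiff ℝ 1 (T m) := fun m => by
    rw [hT]
    exact contDiff_const.mul (ContDiff.sum fun φ _ =>
      contDiff_posPart_sq.comp (φ.contDiff.sub contDiff_const))
  have hsupp : ∀ y, N y < η → ∃ K : ℕ, ∀ m ≥ K, N y < a m := fun y hy =>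
    eventually_atTop.1 (ha_lim.eventually (lt_mem_nhds hy))
  have hsum : ∀ y, ∀ K : ℕ, (∀ m ≥ K, N y ≤ a m) →
      ∑' m, T m y = ∑ m ∈ Finset.range K, T m y := fun y K hK =>
    tsum_eq_sum fun m hm => hTz m y (hK m (not_lt.1 fun h => hm (Finset.mem_range.2 h)))
  refine ⟨fun y => ∑' m, T m y, fun y => tsum_nonneg fun m => hT0 m y, fun y hy => ?_, ?_, ?_, ?_⟩
  · simp [fun m => hTz m y (hy.trans (ha0 m))]
  · intro w z τ h0 h1 hw hz
    obtain ⟨K, hK⟩ := hsupp w hw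
    have hv : ∀ m ≥ K, N (τ • w + (1 - τ) • z) ≤ a m := by
      intro m hm
      refine (map_add_le_add N _ _).trans ?_
      rw [map_smul_eq_mul, map_smul_eq_mul, norm_eq_abs, norm_eq_abs, abs_of_nonneg h0,
        abs_of_nonneg (sub_nonneg.2 h1)]
      have h2 := mul_le_mul_of_nonneg_left (hK m hm).le h0
      have h3 := mul_le_mul_of_nonneg_left (hz.trans (ha0 m)) (sub_nonneg.2 h1)
      linarith
    beta_reduce
    rw [hsum w K fun m hm => (hK m hm).le, hsum _ K hv, Finset.mul_sum]
    exact Finset.sum_le_sum fun m _ => hTconv m w z τ h0 h1 hz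
  · intro y hy
    obtain ⟨K, hK⟩ := hsupp y hy
    refine ContDiffAt.contDiffWithinAt ?_
    have h1 : ContDiff ℝ 1 fun y => ∑ m ∈ Finset.range K, T m y :=
      ContDiff.sum fun m _ => hTC m
    refine h1.contDiffAt.congr_of_eventuallyEq ?_
    filter_upwards [(isOpen_lt hN continuous_const).mem_nhds (hK K le_rfl)] with v hv
    exact hsum v K fun m hm => (le_of_lt hv).trans (ha_mono hm)
  · intro M
    obtain ⟨m, hm⟩ := exists_nat_ge M
    refine ⟨a (m + 1), ha_lt _, fun w hw h1 h2 => ?_⟩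
    obtain ⟨K, hK⟩ := hsupp w h2
    have hK' : m < K := by
      by_contra hcon
      have := hK (m + 1) (by omega)
      linarith
    simp only
    rw [hsum w K fun m hm => (hK m hm).le]
    refine le_trans ?_ (Finset.single_le_sum (fun m _ => hT0 m w) (Finset.mem_range.2 hK'))
    obtain ⟨φ, hφ, hφw⟩ := hΦ' m w hw
    rw [hT]
    simp only
    have h3 : ε m ^ 2 ≤ ∑ φ ∈ Φ m, max (φ w - a m) 0 ^ 2 := by
      refine le_trans ?_ (Finset.single_le_sum (f := fun φ : Y →L[ℝ] ℝ => max (φ w - a m) 0 ^ 2)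
        (fun _ _ => sq_nonneg _) hφ)
      refine pow_le_pow_left₀ (hε0 m).le (le_trans ?_ (le_max_left _ _)) 2
      linarith [hstep m]
    have h4 := mul_le_mul_of_nonneg_left h3 (hC0 m)
    have h5 : ((m : ℝ) + 1) / ε m ^ 2 * ε m ^ 2 = m + 1 :=
      div_mul_cancel₀ _ (pow_pos (hε0 m) 2).ne'
    linarith

end Exhaustion

end KStat

end

noncomputable section

namespace KStat

open Real Filter Topology

section Radial

variable {X E : Type*} [NormedAddCommGroup X] [NormedSpace ℝ X] [NormedAddCommGroup E]
  [NormedSpace ℝ E] [FiniteDimensional ℝ E] [Nontrivial E]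

/-- The radial map `t ↦ (1 + γ(x, t)) t` is a diffeomorphism from `S x` onto the whole space if `γ`
is nonnegative, grows along the rays, and blows up at the boundary of `S x`. -/
theorem exists_radial_inverse {O : Set (X × E)} (hO : IsOpen O) {γ : X × E → ℝ}
    (hγ : ContDiffOn ℝ 1 γ O) (hγ0 : ∀ p, 0 ≤ γ p) {V : Set X}
    (hOV : ∀ p ∈ O, p.1 ∈ V) (hzero : ∀ x ∈ V, (x, (0 : E)) ∈ O)
    (hray : ∀ x t τ, (x, t) ∈ O → 0 ≤ τ → τ ≤ 1 → (x, τ • t) ∈ O ∧ γ (x, τ • t) ≤ τ * γ (x, t))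
    (hproper : ∀ x ∈ V, ∀ C : ℝ, ∃ K, IsCompact K ∧ (∀ t ∈ K, (x, t) ∈ O) ∧
      ∀ t, (x, t) ∈ O → ‖(1 + γ (x, t)) • t‖ ≤ C → t ∈ K) :
    ∃ Λ : X × E → E, ContDiffOn ℝ 1 Λ (V ×ˢ Set.univ) ∧ (∀ x ∈ V, Λ (x, 0) = 0) ∧
      ∀ x ∈ V, Set.BijOn (fun s => Λ (x, s)) Set.univ {t | (x, t) ∈ O} := by
  obtain ⟨Θ, hΘ⟩ : ∃ Θ : X × E → E, Θ = fun p => (1 + γ p) • p.2 := ⟨_, rfl⟩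
  have hΘC : ContDiffOn ℝ 1 Θ O := by
    rw [hΘ]
    exact (contDiffOn_const.add hγ).smul contDiff_snd.contDiffOn
  have hpos : ∀ p, 0 < 1 + γ p := fun p => by linarith [hγ0 p]
  -- injectivity
  have hinj' : ∀ x t t', (x, t) ∈ O → Θ (x, t) = Θ (x, t') → 1 + γ (x, t) ≤ 1 + γ (x, t') →
      t = t' := by
    intro x t t' ht h hle
    rw [hΘ] at h
    simp only at h
    obtain ⟨μ, hμ⟩ : ∃ μ, μ = (1 + γ (x, t)) / (1 + γ (x, t')) := ⟨_, rfl⟩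
    have hμ0 : 0 ≤ μ := by rw [hμ]; exact div_nonneg (hpos _).le (hpos _).le
    have hμ1 : μ ≤ 1 := by rw [hμ]; exact (div_le_one (hpos _)).2 hle
    have ht' : t' = μ • t := by
      rw [hμ, div_eq_inv_mul, mul_smul, h, inv_smul_smul₀ (hpos _).ne']
    have h1 := (hray x t μ ht hμ0 hμ1).2
    rw [← ht'] at h1
    have h2 : 1 + γ (x, t) = μ * (1 + γ (x, t')) := by
      rw [hμ, div_mul_cancel₀ _ (hpos _).ne']
    have h3 : μ = 1 := by
      by_contra hne
      have hlt : μ < 1 := lt_of_le_of_ne hμ1 hne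
      have h4 := mul_le_mul_of_nonneg_left h1 hμ0
      have h5 := hγ0 (x, t)
      have h6 : μ * (μ * γ (x, t)) ≤ 1 * (1 * γ (x, t)) := by gcongr
      nlinarith
    rw [ht', h3, one_smul]
  have hinj : ∀ x t t', (x, t) ∈ O → (x, t') ∈ O → Θ (x, t) = Θ (x, t') → t = t' := by
    intro x t t' ht ht' h
    rcases le_total (1 + γ (x, t)) (1 + γ (x, t')) with hle | hle
    · exact hinj' x t t' ht h hle
    · exact (hinj' x t' t ht' h.symm hle).symm
  -- local sections
  have hloc : ∀ p ∈ O, ∃ (W : Set (X × E)) (g : X × E → E), IsOpen W ∧ (p.1, Θ p) ∈ W ∧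
      ContDiffOn ℝ 1 g W ∧ ∀ q ∈ W, (q.1, g q) ∈ O ∧ Θ (q.1, g q) = q.2 := by
    rintro ⟨x₁, t₁⟩ hp
    obtain ⟨ℓ, hℓ⟩ : ∃ ℓ, ℓ = fderiv ℝ γ (x₁, t₁) := ⟨_, rfl⟩
    have hγd : HasFDerivAt γ ℓ (x₁, t₁) := by
      rw [hℓ]
      exact ((hγ.contDiffAt (hO.mem_nhds hp)).differentiableAt one_ne_zero).hasFDerivAt
    have hd : ∀ v, fderiv ℝ Θ (x₁, t₁) (0, v) = (1 + γ (x₁, t₁)) • v + ℓ (0, v) • t₁ := by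
      intro v
      have h1 : HasFDerivAt Θ ((1 + γ (x₁, t₁)) • ContinuousLinearMap.snd ℝ X E +
          ℓ.smulRight t₁) (x₁, t₁) := by
        rw [hΘ]
        exact (hγd.const_add 1).smul hasFDerivAt_snd
      rw [h1.fderiv]
      rfl
    have hnonneg : 0 ≤ ℓ (0, t₁) := by
      have h1 : HasDerivAt (fun τ : ℝ => γ (x₁, τ • t₁)) (ℓ (0, t₁)) 1 := by
        have h2 : HasDerivAt (fun τ : ℝ => (x₁, τ • t₁)) (0, t₁) 1 := by
          have h3 := (hasDerivAt_id (1 : ℝ)).smul_const t₁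
          rw [one_smul] at h3
          exact (hasDerivAt_const (1 : ℝ) x₁).prodMk h3
        have h4 : HasFDerivAt γ ℓ ((fun τ : ℝ => (x₁, τ • t₁)) 1) := by
          simp only [one_smul]
          exact hγd
        exact h4.comp_hasDerivAt 1 h2
      rw [hasDerivAt_iff_tendsto_slope] at h1
      have h2 := h1.mono_left (nhdsWithin_mono (1 : ℝ)
        (fun y (hy : y ∈ Set.Iio (1 : ℝ)) => ne_of_lt hy))
      refine ge_of_tendsto h2 ?_
      have h3 : Set.Ioo (0 : ℝ) 1 ∈ 𝓝[<] (1 : ℝ) := Ioo_mem_nhdsLT one_pos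
      filter_upwards [h3] with τ hτ
      rw [slope_def_field, one_smul]
      have h4 := (hray x₁ t₁ τ hp hτ.1.le hτ.2.le).2
      have h5 : τ * γ (x₁, t₁) ≤ 1 * γ (x₁, t₁) :=
        mul_le_mul_of_nonneg_right hτ.2.le (hγ0 _)
      exact div_nonneg_of_nonpos (by linarith) (by linarith [hτ.2])
    have hker : Function.Injective (((fderiv ℝ Θ (x₁, t₁)).comp
        (ContinuousLinearMap.inr ℝ X E) : E →L[ℝ] E) : E →ₗ[ℝ] E) := by
      rw [injective_iff_map_eq_zero]
      intro v hv
      have h1 : (1 + γ (x₁, t₁)) • v + ℓ (0, v) • t₁ = 0 := by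
        rw [← hd v]
        exact hv
      obtain ⟨μ, hμ⟩ : ∃ μ : ℝ, v = μ • t₁ := by
        refine ⟨-((1 + γ (x₁, t₁))⁻¹ * ℓ (0, v)), ?_⟩
        rw [neg_smul, mul_smul, ← smul_neg, ← eq_neg_of_add_eq_zero_left h1,
          inv_smul_smul₀ (hpos _).ne']
      have h2 : ℓ (0, v) = μ * ℓ (0, t₁) := by
        have h3 : ((0 : X), v) = μ • ((0 : X), t₁) := by
          rw [Prod.smul_mk, smul_zero, hμ]
        rw [h3, map_smul, smul_eq_mul]
      have h3 : (1 + γ (x₁, t₁) + ℓ (0, t₁)) • v = 0 := by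
        rw [h2, mul_comm, mul_smul, ← hμ, ← add_smul] at h1
        exact h1
      exact (smul_eq_zero.1 h3).resolve_left (by linarith [hpos (x₁, t₁)])
    obtain ⟨A, hA⟩ : ∃ A : E ≃L[ℝ] E, ∀ v, fderiv ℝ Θ (x₁, t₁) (0, v) = A v :=
      ⟨(LinearEquiv.ofInjectiveEndo _ hker).toContinuousLinearEquiv, fun v => rfl⟩
    have := FiniteDimensional.complete ℝ E
    obtain ⟨U, V', B, g, hU, hV', -, hxU, hzV, hBO, -, hg, hgC⟩ :=
      exists_partial_inverse hO hΘC hp A hA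
    exact ⟨U ×ˢ V', g, hU.prod hV', ⟨hxU, hzV⟩, hgC, fun q hq =>
      ⟨hBO _ hq.1 _ (hg _ hq.1 _ hq.2).1, (hg _ hq.1 _ hq.2).2⟩⟩
  have hsurj : ∀ x ∈ V, ∀ s : E, ∃ t, (x, t) ∈ O ∧ Θ (x, t) = s := by
    intro x hx
    obtain ⟨S, hS⟩ : ∃ S : Set E, S = (fun t => Θ (x, t)) '' {t | (x, t) ∈ O} := ⟨_, rfl⟩
    have hSo : IsOpen S := by
      rw [isOpen_iff_mem_nhds]
      intro s hs
      rw [hS] at hs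
      obtain ⟨t, ht, rfl⟩ := hs
      obtain ⟨W, g, hW, hpW, -, hg⟩ := hloc (x, t) ht
      have h1 : {s | (x, s) ∈ W} ∈ 𝓝 (Θ (x, t)) :=
        (hW.preimage (by fun_prop : Continuous fun s : E => (x, s))).mem_nhds hpW
      refine Filter.mem_of_superset h1 fun s hs => ?_
      rw [hS]
      exact ⟨g (x, s), (hg _ hs).1, (hg _ hs).2⟩
    have hSc : IsClosed S := by
      refine isClosed_of_closure_subset fun s hs => ?_
      obtain ⟨K, hK, hKO, hKC⟩ := hproper x hx (‖s‖ + 1)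
      have h1 : s ∈ closure (S ∩ Metric.ball 0 (‖s‖ + 1)) := by
        rw [mem_closure_iff_nhds] at hs ⊢
        intro u hu
        have h2 : Metric.ball (0 : E) (‖s‖ + 1) ∈ 𝓝 s :=
          Metric.isOpen_ball.mem_nhds (by simp)
        obtain ⟨y, hy, hyS⟩ := hs _ (inter_mem hu h2)
        exact ⟨y, hy.1, hyS, hy.2⟩
      have h2 : IsCompact ((fun t => Θ (x, t)) '' K) := by
        refine hK.image_of_continuousOn ?_
        refine hΘC.continuousOn.comp (by fun_prop) fun t ht => hKO t ht
      have h3 : S ∩ Metric.ball 0 (‖s‖ + 1) ⊆ (fun t => Θ (x, t)) '' K := by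
        rintro _ ⟨h4, h5⟩
        rw [hS] at h4
        obtain ⟨t, ht, rfl⟩ := h4
        refine ⟨t, hKC t ht ?_, rfl⟩
        rw [mem_ball_zero_iff] at h5
        rw [hΘ] at h5
        exact h5.le
      have h4 := h2.isClosed.closure_subset_iff.2 h3 h1
      rw [hS]
      exact Set.image_mono (fun t ht => hKO t ht) h4
    have hSn : S.Nonempty := ⟨Θ (x, 0), by rw [hS]; exact ⟨0, hzero x hx, rfl⟩⟩
    have hSu : S = Set.univ := (show IsClopen S from ⟨hSc, hSo⟩).eq_univ hSn
    intro s
    have h1 : s ∈ S := by rw [hSu]; trivial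
    rw [hS] at h1
    exact h1
  have hsel : ∀ p : X × E, ∃ t, p.1 ∈ V → (p.1, t) ∈ O ∧ Θ (p.1, t) = p.2 := by
    intro p
    by_cases hp : p.1 ∈ V
    · obtain ⟨t, ht⟩ := hsurj p.1 hp p.2
      exact ⟨t, fun _ => ht⟩
    · exact ⟨0, fun h => absurd h hp⟩
  choose Λ hΛ using hsel
  have huniq : ∀ x t, (x, t) ∈ O → Λ (x, Θ (x, t)) = t := fun x t ht =>
    hinj x _ _ (hΛ (x, Θ (x, t)) (hOV (x, t) ht)).1 ht (hΛ (x, Θ (x, t)) (hOV (x, t) ht)).2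
  refine ⟨Λ, ?_, fun x hx => ?_, fun x hx => ⟨fun s _ => (hΛ (x, s) hx).1, fun s _ s' _ h => ?_,
    fun t ht => ⟨Θ (x, t), trivial, huniq x t ht⟩⟩⟩
  · rintro ⟨x, s⟩ ⟨hx, -⟩
    obtain ⟨W, g, hW, hpW, hgC, hg⟩ := hloc (x, Λ (x, s)) (hΛ (x, s) hx).1
    have hxs : (x, s) ∈ W := by
      have h1 := hpW
      rw [(hΛ (x, s) hx).2] at h1
      exact h1
    refine ((hgC.contDiffAt (hW.mem_nhds hxs)).congr_of_eventuallyEq ?_).contDiffWithinAt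
    filter_upwards [hW.mem_nhds hxs] with q hq
    have h1 := huniq q.1 (g q) (hg q hq).1
    rw [(hg q hq).2] at h1
    exact h1
  · have h1 := huniq x 0 (hzero x hx)
    have h2 : Θ (x, 0) = 0 := by rw [hΘ]; exact smul_zero _
    rwa [h2] at h1
  · have h1 := (hΛ (x, s) hx).2
    have h2 := (hΛ (x, s') hx).2
    simp only at h h1 h2
    rw [← h1, ← h2, h]

end Radial

section Uniformization

variable {X E Y : Type*} [NormedAddCommGroup X] [NormedSpace ℝ X] [NormedAddCommGroup E]
  [NormedSpace ℝ E] [FiniteDimensional ℝ E] [Nontrivial E] [NormedAddCommGroup Y]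
  [NormedSpace ℝ Y]

/-- The parts `N (G (x, t) - G (x₀, 0)) < η` of an immersed family with totally bounded image are
uniformized, in a `C¹` way, by the whole parameter space. -/
theorem exists_uniformization (N : Seminorm ℝ Y) (hN : Continuous N)
    (hnorm : ∀ y, ∃ φ : Y →L[ℝ] ℝ, (∀ v, φ v ≤ N v) ∧ φ y = N y) {c : ℝ}
    (hc : 0 < c) (hle : ∀ y, c * ‖y‖ ≤ N y)
    {G : X × E → Y} {U : Set X} (hU : IsOpen U) {R : ℝ} (hR : 0 < R)
    (hG : ContDiffOn ℝ 1 G (U ×ˢ Metric.ball 0 R)) {x₀ : X} (hx₀ : x₀ ∈ U)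
    (hL : Function.Injective fun t => fderiv ℝ G (x₀, 0) (0, t))
    (hW : TotallyBounded (G '' (U ×ˢ Metric.ball 0 R))) :
    ∃ R' > 0, R' ≤ R ∧ ∃ η₀ > 0, ∀ η > 0, η ≤ η₀ → ∃ (V : Set X) (Λ : X × E → E), IsOpen V ∧
      x₀ ∈ V ∧ V ⊆ U ∧ ContDiffOn ℝ 1 Λ (V ×ˢ Set.univ) ∧ (∀ x ∈ V, Λ (x, 0) = 0) ∧
      ∀ x ∈ V, Set.BijOn (fun s => Λ (x, s)) Set.univ
        {t | t ∈ Metric.ball 0 R' ∧ N (G (x, t) - G (x₀, 0)) < η} := by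
  have hopen : IsOpen (U ×ˢ Metric.ball (0 : E) R) := hU.prod Metric.isOpen_ball
  have hbase : (x₀, (0 : E)) ∈ U ×ˢ Metric.ball (0 : E) R := ⟨hx₀, Metric.mem_ball_self hR⟩
  obtain ⟨L, hLdef⟩ : ∃ L : E →L[ℝ] Y, L = (fderiv ℝ G (x₀, 0)).comp
    (ContinuousLinearMap.inr ℝ X E) := ⟨_, rfl⟩
  obtain ⟨K, hK, hKL⟩ : ∃ K : ℝ, 0 < K ∧ ∀ t, ‖t‖ ≤ K * N (L t) := by
    have h1 : LinearMap.ker (L : E →ₗ[ℝ] Y) = ⊥ := by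
      rw [LinearMap.ker_eq_bot, hLdef]
      exact hL
    obtain ⟨K, hK, h2⟩ := LinearMap.exists_antilipschitzWith (L : E →ₗ[ℝ] Y) h1
    refine ⟨K / c, div_pos hK hc, fun t => ?_⟩
    have h3 := h2.le_mul_dist t 0
    rw [dist_zero_right, map_zero, dist_zero_right] at h3
    refine h3.trans ?_
    rw [div_mul_eq_mul_div, le_div_iff₀ hc, mul_assoc, mul_comm _ c]
    exact mul_le_mul_of_nonneg_left (hle _) K.2
  obtain ⟨C, hC, hNC⟩ := N.bound_of_continuous_normedSpace hN
  obtain ⟨r, hr, hrR, hrU, hstr⟩ : ∃ r > 0, r ≤ R ∧ Metric.ball x₀ r ⊆ U ∧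
      ∀ x ∈ Metric.ball x₀ r, ∀ t ∈ Metric.ball (0 : E) r, ∀ t' ∈ Metric.ball (0 : E) r,
        N (G (x, t) - G (x, t') - L (t - t')) ≤ ‖t - t'‖ / (8 * K) := by
    have h1 : HasStrictFDerivAt G (fderiv ℝ G (x₀, 0)) (x₀, 0) :=
      (hG.contDiffAt (hopen.mem_nhds hbase)).hasStrictFDerivAt one_ne_zero
    have h2 : (0 : ℝ) < 1 / (8 * K * C) := by positivity
    have h3 := h1.isLittleO.def h2
    rw [nhds_prod_eq, ← nhds_prod_eq, Metric.eventually_nhds_iff] at h3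
    obtain ⟨r₁, hr₁, h3⟩ := h3
    obtain ⟨r₂, hr₂, h4⟩ := Metric.isOpen_iff.1 hU x₀ hx₀
    refine ⟨min r₁ (min r₂ R), by positivity, (min_le_right _ _).trans (min_le_right _ _),
      (Metric.ball_subset_ball ((min_le_right _ _).trans (min_le_left _ _))).trans h4,
      fun x hx t ht t' ht' => ?_⟩
    have hx' := (Metric.mem_ball.1 hx).trans_le (min_le_left _ _)
    have ht1 := (Metric.mem_ball.1 ht).trans_le (min_le_left _ _)
    have ht1' := (Metric.mem_ball.1 ht').trans_le (min_le_left _ _)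
    have h5 := @h3 ((x, t), (x, t')) (by
      rw [Prod.dist_eq, Prod.dist_eq, Prod.dist_eq]
      exact max_lt (max_lt hx' ht1) (max_lt hx' ht1'))
    have h6 : fderiv ℝ G (x₀, 0) ((x, t) - (x, t')) = L (t - t') := by
      rw [hLdef, Prod.mk_sub_mk, sub_self]
      rfl
    have h7 : ‖((x, t) : X × E) - (x, t')‖ = ‖t - t'‖ := by
      rw [Prod.mk_sub_mk, sub_self, Prod.norm_mk, norm_zero, max_eq_right (norm_nonneg _)]
    simp only at h5
    rw [h6, h7] at h5
    refine (hNC _).trans ((mul_le_mul_of_nonneg_left h5 hC.le).trans_eq ?_)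
    field_simp
  obtain ⟨y₀, hy₀⟩ : ∃ y₀, y₀ = G (x₀, 0) := ⟨_, rfl⟩
  refine ⟨r, hr, hrR, r / (2 * K), by positivity, fun η hη hη₀ => ?_⟩
  have hηK : K * η ≤ r / 2 := by
    rw [le_div_iff₀ (by positivity)] at hη₀
    linarith
  rw [← hy₀]
  obtain ⟨V, hVdef⟩ : ∃ V : Set X, V = Metric.ball x₀ r ∩
    {x | N (G (x, 0) - y₀) < η / 16} := ⟨_, rfl⟩
  have hcont0 : ContinuousOn (fun x => N (G (x, (0 : E)) - y₀)) (Metric.ball x₀ r) := by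
    refine hN.comp_continuousOn (ContinuousOn.sub ?_ continuousOn_const)
    exact hG.continuousOn.comp (by fun_prop) fun x hx => ⟨hrU hx, Metric.mem_ball_self hR⟩
  have hV : IsOpen V := by
    rw [hVdef]
    exact hcont0.isOpen_inter_preimage Metric.isOpen_ball isOpen_Iio
  have hVU : V ⊆ U := fun x hx => by
    rw [hVdef] at hx
    exact hrU hx.1
  have hxV : x₀ ∈ V := by
    rw [hVdef]
    refine ⟨Metric.mem_ball_self hr, ?_⟩
    rw [Set.mem_ofPred_eq, ← hy₀, sub_self, map_zero]
    positivity
  obtain ⟨O, hOdef⟩ : ∃ O : Set (X × E), O = (V ×ˢ Metric.ball (0 : E) r) ∩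
    {p | N (G p - y₀) < η} := ⟨_, rfl⟩
  have hsub : V ×ˢ Metric.ball (0 : E) r ⊆ U ×ˢ Metric.ball 0 R :=
    Set.prod_mono hVU (Metric.ball_subset_ball hrR)
  have hcontN : ContinuousOn (fun p => N (G p - y₀)) (U ×ˢ Metric.ball (0 : E) R) :=
    hN.comp_continuousOn (hG.continuousOn.sub continuousOn_const)
  have hO : IsOpen O := by
    rw [hOdef]
    exact (hcontN.mono hsub).isOpen_inter_preimage (hV.prod Metric.isOpen_ball) isOpen_Iio
  have hmem : ∀ x t, (x, t) ∈ O ↔ x ∈ V ∧ t ∈ Metric.ball 0 r ∧ N (G (x, t) - y₀) < η := by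
    intro x t
    rw [hOdef]
    exact and_assoc
  -- the size of the parameter
  have hw0 : ∀ x ∈ V, N (G (x, 0) - y₀) < η / 16 := fun x hx => by
    rw [hVdef] at hx
    exact hx.2
  have hVr : ∀ x ∈ V, x ∈ Metric.ball x₀ r := fun x hx => by
    rw [hVdef] at hx
    exact hx.1
  have hsize : ∀ x t, (x, t) ∈ O → ‖t‖ ≤ K * (5 / 4 * η) := by
    intro x t h
    obtain ⟨hx, ht, hlt⟩ := (hmem x t).1 h
    have h1 := hstr x (hVr x hx) t ht 0 (Metric.mem_ball_self hr)
    rw [sub_zero] at h1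
    have h2 : L t = (G (x, t) - y₀) - (G (x, 0) - y₀) - (G (x, t) - G (x, 0) - L t) := by abel
    have h3 : N (L t) ≤ N (G (x, t) - y₀) + N (G (x, 0) - y₀) +
        N (G (x, t) - G (x, 0) - L t) := by
      calc N (L t) = N ((G (x, t) - y₀) - (G (x, 0) - y₀) - (G (x, t) - G (x, 0) - L t)) := by
            rw [← h2]
        _ ≤ _ := (map_sub_le_add N _ _).trans (add_le_add_left (map_sub_le_add N _ _) _)
    have h4 := hKL t
    have h5 : ‖t‖ / (8 * K) ≤ N (L t) / 8 := by
      rw [div_le_div_iff₀ (by positivity) (by norm_num)]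
      linarith
    have h6 := hw0 x hx
    refine h4.trans (mul_le_mul_of_nonneg_left ?_ hK.le)
    linarith
  have hsize' : ∀ x t, (x, t) ∈ O → ‖t‖ / (8 * K) ≤ 5 / 32 * η := by
    intro x t h
    rw [div_le_iff₀ (by positivity)]
    linarith [hsize x t h]
  obtain ⟨g, hg0, hgz, hgc, hgC, hgM⟩ := exists_exhaustion N hN hnorm
    (hW.image (uniformContinuous_id.sub (uniformContinuous_const (b := y₀)))) hη
  have hmaps : ∀ p ∈ O, G p - y₀ ∈ {y | N y < η} := fun p hp => by
    rw [hOdef] at hp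
    exact hp.2
  have hγC : ContDiffOn ℝ 1 (fun p => g (G p - y₀)) O := by
    refine hgC.comp ((hG.mono ?_).sub contDiffOn_const) hmaps
    intro p hp
    rw [hOdef] at hp
    exact hsub hp.1
  obtain ⟨Λ, hΛ, hΛ0, hΛb⟩ := exists_radial_inverse hO hγC (fun p => hg0 _)
    (fun p hp => ((hmem p.1 p.2).1 hp).1)
    (fun x hx => (hmem x 0).2 ⟨hx, Metric.mem_ball_self hr, (hw0 x hx).trans (by linarith)⟩)
    (by
      intro x t τ h hτ0 hτ1
      rcases hτ1.eq_or_lt with rfl | hτ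
      · rw [one_smul, one_mul]
        exact ⟨h, le_rfl⟩
      obtain ⟨hx, ht, hlt⟩ := (hmem x t).1 h
      have hτt : τ • t ∈ Metric.ball (0 : E) r := by
        rw [mem_ball_zero_iff] at ht ⊢
        rw [norm_smul, Real.norm_of_nonneg hτ0]
        exact (mul_le_of_le_one_left (norm_nonneg _) hτ.le).trans_lt ht
      obtain ⟨e, he⟩ : ∃ e : E → Y, e = fun t => G (x, t) - y₀ - L t := ⟨_, rfl⟩
      have hed : ∀ u ∈ Metric.ball (0 : E) r, ∀ v ∈ Metric.ball (0 : E) r,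
          N (e u - e v) ≤ ‖u - v‖ / (8 * K) := by
        intro u hu v hv
        have h1 : e u - e v = G (x, u) - G (x, v) - L (u - v) := by
          rw [he, map_sub]
          beta_reduce
          abel
        rw [h1]
        exact hstr x (hVr x hx) u hu v hv
      have h1τ : 0 < 1 - τ := by linarith
      obtain ⟨z, hz⟩ : ∃ z, z = e t + (1 - τ)⁻¹ • (e (τ • t) - e t) := ⟨_, rfl⟩
      have hw : G (x, τ • t) - y₀ = τ • (G (x, t) - y₀) + (1 - τ) • z := by
        have h1 : G (x, τ • t) - y₀ = e (τ • t) + τ • L t := by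
          rw [he]
          beta_reduce
          rw [map_smul]
          abel
        have h2 : G (x, t) - y₀ = e t + L t := by
          rw [he]
          simp only
          abel
        rw [h1, h2, hz, smul_add, smul_add, smul_inv_smul₀ h1τ.ne', sub_smul, one_smul]
        abel
      have hNz : N z ≤ η / 2 := by
        have h1 := hed t ht 0 (Metric.mem_ball_self hr)
        have h2 := hed (τ • t) hτt t ht
        have h3 : ‖τ • t - t‖ = (1 - τ) * ‖t‖ := by
          rw [← norm_neg, show -(τ • t - t) = (1 - τ) • t by rw [sub_smul, one_smul]; abel,
            norm_smul, Real.norm_of_nonneg h1τ.le]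
        have h4 : N ((1 - τ)⁻¹ • (e (τ • t) - e t)) ≤ ‖t‖ / (8 * K) := by
          rw [map_smul_eq_mul, norm_inv, Real.norm_of_nonneg h1τ.le, inv_mul_le_iff₀ h1τ]
          rw [h3, mul_div_assoc] at h2
          exact h2
        have h5 : N (e 0) ≤ η / 16 := by
          rw [he]
          simp only [map_zero, sub_zero]
          exact (hw0 x hx).le
        have h6 : N (e t) ≤ N (e t - e 0) + N (e 0) := by
          have h7 := map_add_le_add N (e t - e 0) (e 0)
          rwa [sub_add_cancel] at h7
        have h7 := map_add_le_add N (e t) ((1 - τ)⁻¹ • (e (τ • t) - e t))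
        rw [← hz] at h7
        rw [sub_zero] at h1
        have h8 := hsize' x t h
        linarith
      refine ⟨(hmem _ _).2 ⟨hx, hτt, ?_⟩, ?_⟩
      · rw [hw]
        refine (map_add_le_add N _ _).trans_lt ?_
        rw [map_smul_eq_mul, map_smul_eq_mul, Real.norm_of_nonneg hτ0,
          Real.norm_of_nonneg h1τ.le]
        have h1 : (1 - τ) * N z ≤ (1 - τ) * (η / 2) := mul_le_mul_of_nonneg_left hNz h1τ.le
        have h2 : τ * N (G (x, t) - y₀) ≤ τ * η := mul_le_mul_of_nonneg_left hlt.le hτ0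
        nlinarith
      · rw [hw]
        exact hgc _ _ _ hτ0 hτ.le hlt hNz)
    (by
      intro x hx b'
      have hcx : ContinuousOn (fun t : E => N (G (x, t) - y₀)) (Metric.ball 0 r) :=
        hcontN.comp (by fun_prop) fun t ht => hsub ⟨hx, ht⟩
      obtain ⟨m, hm, hmr⟩ : ∃ m > 0, ∀ t ∈ Metric.ball (0 : E) m, N (G (x, t) - y₀) < η / 2 := by
        have h1 := (hcx.continuousAt (Metric.ball_mem_nhds 0 hr)).eventually_lt_const
          (show N (G (x, 0) - y₀) < η / 2 by linarith [hw0 x hx])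
        exact Metric.eventually_nhds_iff_ball.1 h1
      obtain ⟨b, hb, hbM⟩ := hgM (|b'| / m)
      have hsm : Metric.closedBall (0 : E) (K * (5 / 4 * η)) ⊆ Metric.ball 0 r :=
        Metric.closedBall_subset_ball (by nlinarith)
      refine ⟨Metric.closedBall 0 (K * (5 / 4 * η)) ∩
        {t | N (G (x, t) - y₀) ≤ max b (η / 2)}, ?_, fun t ht => (hmem x t).2 ⟨hx, hsm ht.1,
          (show _ ≤ _ from ht.2).trans_lt (max_lt hb (by linarith))⟩, fun t ht hle' => ?_⟩
      · exact (isCompact_closedBall 0 _).of_isClosed_subset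
          ((hcx.mono hsm).preimage_isClosed_of_isClosed Metric.isClosed_closedBall isClosed_Iic)
          Set.inter_subset_left
      · refine ⟨mem_closedBall_zero_iff.2 (hsize x t ht), ?_⟩
        by_contra hcon
        rw [Set.mem_ofPred_eq, not_le, max_lt_iff] at hcon
        obtain ⟨-, ht', hlt⟩ := (hmem x t).1 ht
        have h1 : |b'| / m ≤ g (G (x, t) - y₀) :=
          hbM _ ⟨G (x, t), ⟨(x, t), hsub ⟨hx, ht'⟩, rfl⟩, rfl⟩ hcon.1 hlt
        have h2 : m ≤ ‖t‖ := by
          by_contra h3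
          have h4 := hmr t (mem_ball_zero_iff.2 (not_le.1 h3))
          linarith [hcon.2]
        rw [norm_smul, Real.norm_of_nonneg (by linarith [hg0 (G (x, t) - y₀)])] at hle'
        have h3 : (1 + |b'| / m) * m ≤ (1 + g (G (x, t) - y₀)) * ‖t‖ := by
          gcongr
          linarith [hg0 (G (x, t) - y₀)]
        have h4 : (1 + |b'| / m) * m = m + |b'| := by field_simp
        linarith [le_abs_self b'])
  refine ⟨V, Λ, hV, hxV, hVU, hΛ, hΛ0, fun x hx => ?_⟩
  have h1 : {t | (x, t) ∈ O} = {t | t ∈ Metric.ball 0 r ∧ N (G (x, t) - y₀) < η} := by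
    ext t
    exact (hmem x t).trans (and_iff_right hx)
  rw [← h1]
  exact hΛb x hx

end Uniformization

end KStat

end

noncomputable section

namespace KStat

open Real Filter Topology

section Descent

variable {A X Y Z : Type*} [NormedAddCommGroup A] [NormedSpace ℝ A] [NormedAddCommGroup X]
  [NormedSpace ℝ X] [NormedAddCommGroup Y] [NormedSpace ℝ Y] [NormedAddCommGroup Z]
  [NormedSpace ℝ Z]

/-- A function which is `C¹` upstairs is `C¹` on the quotient. -/
theorem contDiffOn_of_comp_quotient (pr : A →L[ℝ] X) {C : ℝ} (hC : 1 ≤ C)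
    (hpr : ∀ x, ∃ a, pr a = x ∧ ‖a‖ ≤ C * ‖x‖) {O : Set Y} (hO : IsOpen O) {F : X × Y → Z}
    (hF : ContDiffOn ℝ 1 (fun p : A × Y => F (pr p.1, p.2)) (Set.univ ×ˢ O)) :
    ContDiffOn ℝ 1 F (Set.univ ×ˢ O) := by
  obtain ⟨f, hf⟩ : ∃ f : A × Y → Z, f = fun p => F (pr p.1, p.2) := ⟨_, rfl⟩
  have hOA : IsOpen ((Set.univ : Set A) ×ˢ O) := isOpen_univ.prod hO
  have hOX : IsOpen ((Set.univ : Set X) ×ˢ O) := isOpen_univ.prod hO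
  rw [← hf] at hF
  have hstrict : ∀ a y, y ∈ O → HasStrictFDerivAt f (fderiv ℝ f (a, y)) (a, y) := fun a y hy =>
    (hF.contDiffAt (hOA.mem_nhds ⟨trivial, hy⟩)).hasStrictFDerivAt one_ne_zero
  choose σ hσ hσn using hpr
  have hker : ∀ a y, y ∈ O → ∀ b b' v, pr b = pr b' →
      fderiv ℝ f (a, y) (b, v) = fderiv ℝ f (a, y) (b', v) := by
    intro a y hy b b' v hb
    rw [← sub_eq_zero, ← map_sub, Prod.mk_sub_mk, sub_self]
    have h1 : HasDerivAt (fun τ : ℝ => f (a + τ • (b - b'), y))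
        (fderiv ℝ f (a, y) (b - b', 0)) 0 := by
      have h2 : HasDerivAt (fun τ : ℝ => (a + τ • (b - b'), y)) (b - b', 0) 0 := by
        have h3 := ((hasDerivAt_id (0 : ℝ)).smul_const (b - b')).const_add a
        rw [one_smul] at h3
        exact h3.prodMk (hasDerivAt_const 0 y)
      have h4 : HasFDerivAt f (fderiv ℝ f (a, y)) ((fun τ : ℝ => (a + τ • (b - b'), y)) 0) := by
        simp only [zero_smul, add_zero]
        exact (hstrict a y hy).hasFDerivAt
      exact h4.comp_hasDerivAt 0 h2
    have h2 : (fun τ : ℝ => f (a + τ • (b - b'), y)) = fun _ => f (a, y) := by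
      funext τ
      rw [hf]
      simp only [map_add, map_smul, map_sub, hb, sub_self, smul_zero, add_zero]
    rw [h2] at h1
    exact h1.unique (hasDerivAt_const _ _)
  have hadd : ∀ x x', pr (σ (x + x')) = pr (σ x + σ x') := fun x x' => by
    rw [map_add, hσ, hσ, hσ]
  have hsmul : ∀ (c : ℝ) x, pr (σ (c • x)) = pr (c • σ x) := fun c x => by
    rw [map_smul, hσ, hσ]
  have hD : ∀ p ∈ (Set.univ : Set X) ×ˢ O, HasStrictFDerivAt F (fderiv ℝ F p) p := by
    rintro ⟨x, y⟩ ⟨-, hy⟩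
    simp only at hy
    obtain ⟨f', hf'⟩ : ∃ f', f' = fderiv ℝ f (σ x, y) := ⟨_, rfl⟩
    have hk := hker (σ x) y hy
    rw [← hf'] at hk
    obtain ⟨F', hF'⟩ : ∃ F' : X × Y →L[ℝ] Z, ∀ p, F' p = f' (σ p.1, p.2) := by
      refine ⟨LinearMap.mkContinuous
        { toFun := fun p => f' (σ p.1, p.2)
          map_add' := fun p q => ?_
          map_smul' := fun c p => ?_ } (‖f'‖ * C) fun p => ?_, fun p => rfl⟩
      · rw [← map_add, Prod.mk_add_mk]
        exact hk _ _ _ (hadd _ _)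
      · rw [RingHom.id_apply, ← map_smul, Prod.smul_mk]
        exact hk _ _ _ (hsmul _ _)
      · rw [mul_assoc]
        refine (f'.le_opNorm _).trans (mul_le_mul_of_nonneg_left ?_ (norm_nonneg _))
        rw [Prod.norm_mk]
        refine max_le ((hσn _).trans ?_) ?_
        · exact mul_le_mul_of_nonneg_left (norm_fst_le p) (by linarith)
        · refine (norm_snd_le p).trans ?_
          exact le_mul_of_one_le_left (norm_nonneg _) hC
    suffices h : HasStrictFDerivAt F F' (x, y) by
      rw [h.hasFDerivAt.fderiv]
      exact h
    refine HasStrictFDerivAt.of_isLittleO (Asymptotics.IsLittleO.of_bound fun c hc => ?_)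
    have h1 := (hstrict (σ x) y hy).isLittleO.def (div_pos hc (by linarith : (0 : ℝ) < C))
    rw [Metric.eventually_nhds_iff] at h1 ⊢
    obtain ⟨ε, hε, h1⟩ := h1
    refine ⟨ε / (3 * C), by positivity, ?_⟩
    rintro ⟨⟨x₁, y₁⟩, ⟨x₂, y₂⟩⟩ hd
    rw [Prod.dist_eq, Prod.dist_eq, Prod.dist_eq, max_lt_iff, max_lt_iff, max_lt_iff] at hd
    obtain ⟨⟨hx₁, hy₁⟩, hx₂, hy₂⟩ := hd
    simp only at hx₁ hy₁ hx₂ hy₂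
    have hεC : ε / (3 * C) ≤ ε / 3 := by
      apply div_le_div_of_nonneg_left hε.le (by norm_num)
      linarith
    have hεC' : C * (ε / (3 * C)) = ε / 3 := by field_simp
    have ha₂ : ‖σ (x₂ - x)‖ < ε / 3 := by
      refine (hσn _).trans_lt ?_
      rw [← dist_eq_norm, ← hεC']
      exact mul_lt_mul_of_pos_left hx₂ (by linarith)
    have hb : ‖σ (x₁ - x₂)‖ ≤ C * ‖x₁ - x₂‖ := hσn _
    have hb' : ‖σ (x₁ - x₂)‖ < 2 * (ε / 3) := by
      refine hb.trans_lt ?_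
      rw [← hεC', ← dist_eq_norm]
      have := dist_triangle_right x₁ x₂ x
      nlinarith
    have h2 := @h1 ((σ x + σ (x₂ - x) + σ (x₁ - x₂), y₁), (σ x + σ (x₂ - x), y₂)) (by
      rw [Prod.dist_eq, Prod.dist_eq, Prod.dist_eq, max_lt_iff, max_lt_iff, max_lt_iff]
      refine ⟨⟨?_, hy₁.trans_le (hεC.trans (by linarith))⟩, ?_,
        hy₂.trans_le (hεC.trans (by linarith))⟩
      · rw [dist_eq_norm, add_assoc, add_sub_cancel_left]
        exact (norm_add_le _ _).trans_lt (by linarith)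
      · rw [dist_eq_norm, add_sub_cancel_left]
        linarith)
    simp only at h2
    have e1 : f (σ x + σ (x₂ - x) + σ (x₁ - x₂), y₁) = F (x₁, y₁) := by
      rw [hf]
      simp only [map_add, hσ]
      congr 2
      abel
    have e2 : f (σ x + σ (x₂ - x), y₂) = F (x₂, y₂) := by
      rw [hf]
      simp only [map_add, hσ]
      congr 2
      abel
    have e3 : ((σ x + σ (x₂ - x) + σ (x₁ - x₂), y₁) : A × Y) - (σ x + σ (x₂ - x), y₂) =
        (σ (x₁ - x₂), y₁ - y₂) := by
      rw [Prod.mk_sub_mk, add_sub_cancel_left]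
    have e4 : F' ((x₁, y₁) - (x₂, y₂)) = f' (σ (x₁ - x₂), y₁ - y₂) := by
      rw [Prod.mk_sub_mk, hF']
    rw [e1, e2, e3, ← hf', ← e4] at h2
    refine h2.trans ?_
    rw [div_mul_eq_mul_div, div_le_iff₀ (by linarith : (0 : ℝ) < C), mul_assoc]
    refine mul_le_mul_of_nonneg_left ?_ hc.le
    rw [Prod.mk_sub_mk, Prod.norm_mk, Prod.norm_mk, mul_comm]
    refine max_le (hb.trans ?_) ?_
    · exact mul_le_mul_of_nonneg_left (le_max_left _ _) (by linarith)
    · refine (le_max_right ‖x₁ - x₂‖ _).trans ?_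
      exact le_mul_of_one_le_left (le_max_of_le_left (norm_nonneg _)) hC
  exact contDiffOn_one_of_hasStrictFDerivAt hOX fun p hp => ⟨_, hD p hp⟩

end Descent

section Family

variable {X E Y Y' : Type*} [NormedAddCommGroup X] [NormedSpace ℝ X] [NormedAddCommGroup E]
  [NormedSpace ℝ E] [FiniteDimensional ℝ E] [Nontrivial E] [NormedAddCommGroup Y]
  [NormedSpace ℝ Y] [CompleteSpace Y] [Nontrivial Y] [NormedAddCommGroup Y'] [NormedSpace ℝ Y']
  [CompleteSpace Y'] [Nontrivial Y']

/-- The solutions of `Ψ (x, y) ∈ z₀ + range τ` which lie in a small `N`-ball around a solution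
form a family with a fixed parameter space, if the equation can also be solved in a space `Y'`
which embeds compactly into `Y`. -/
theorem exists_family (N : Seminorm ℝ Y) (hN : Continuous N)
    (hnorm : ∀ y, ∃ φ : Y →L[ℝ] ℝ, (∀ v, φ v ≤ N v) ∧ φ y = N y) {c : ℝ} (hc : 0 < c)
    (hle : ∀ y, c * ‖y‖ ≤ N y)
    (ι : Y' →L[ℝ] Y) (hι : Function.Injective ι)
    (hcomp : ∀ R, TotallyBounded (ι '' Metric.closedBall 0 R))
    {Ψ : X × Y → Y} {Ψ' : X × Y' → Y'} {O : Set Y} {O' : Set Y'} (hO : IsOpen O)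
    (hO' : IsOpen O') (hΨ : ContDiffOn ℝ 1 Ψ (Set.univ ×ˢ O))
    (hΨ' : ContDiffOn ℝ 1 Ψ' (Set.univ ×ˢ O')) (hιΨ : ∀ x, ∀ y ∈ O', Ψ (x, ι y) = ι (Ψ' (x, y)))
    {y₀ z₀ : Y'} (hy₀ : y₀ ∈ O') (hy₀O : ι y₀ ∈ O) (hz₀ : Ψ' (0, y₀) = z₀)
    (A : Y ≃L[ℝ] Y) (hA : ∀ v, fderiv ℝ Ψ (0, ι y₀) (0, v) = A v)
    (A' : Y' ≃L[ℝ] Y') (hA' : ∀ v, fderiv ℝ Ψ' (0, y₀) (0, v) = A' v)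
    (τ : E →L[ℝ] Y') (hτ : Function.Injective τ) {S : X → Set Y}
    (hS : ∀ x, ∀ y ∈ O, y ∈ S x ↔ ∃ t, Ψ (x, y) = ι (z₀ + τ t)) :
    ∃ (V : Set X) (η : ℝ) (F : X × E → Y), IsOpen V ∧ 0 ∈ V ∧ 0 < η ∧
      ContDiffOn ℝ 1 F (V ×ˢ Set.univ) ∧ F (0, 0) = ι y₀ ∧
      ∀ x ∈ V, Set.BijOn (fun t => F (x, t)) Set.univ {y | y ∈ S x ∧ N (y - ι y₀) < η} := by
  have hOX : IsOpen ((Set.univ : Set X) ×ˢ O) := isOpen_univ.prod hO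
  have hOX' : IsOpen ((Set.univ : Set X) ×ˢ O') := isOpen_univ.prod hO'
  obtain ⟨U, -, B, -, hU, -, hB, h0U, -, hBO, hinj, -, -⟩ :=
    exists_partial_inverse hOX hΨ (⟨trivial, hy₀O⟩ : (0, ι y₀) ∈ Set.univ ×ˢ O) A hA
  obtain ⟨U', V', B', g, hU', hV', hB', h0U', hzV', hBO', hinj', hg, hgC⟩ :=
    exists_partial_inverse hOX' hΨ' (⟨trivial, hy₀⟩ : (0, y₀) ∈ Set.univ ×ˢ O') A' hA'
  rw [hz₀] at hzV'
  have hg0 : g (0, z₀) = y₀ := by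
    refine hinj' 0 h0U' (hg 0 h0U' z₀ hzV').1 (mem_of_mem_nhds hB') ?_
    exact (hg 0 h0U' z₀ hzV').2.trans hz₀.symm
  obtain ⟨q, hq⟩ : ∃ q : X × E → X × Y', q = fun p => (p.1, z₀ + τ p.2) := ⟨_, rfl⟩
  have hqC : ContDiff ℝ 1 q := by
    rw [hq]
    exact contDiff_fst.prodMk (contDiff_const.add (τ.contDiff.comp contDiff_snd))
  have hq0 : q (0, 0) = (0, z₀) := by
    rw [hq]
    simp
  have hgq : ContDiffOn ℝ 1 (fun p => g (q p)) (q ⁻¹' (U' ×ˢ V')) :=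
    hgC.comp hqC.contDiffOn fun p hp => hp
  have hdom : IsOpen (q ⁻¹' (U' ×ˢ V')) := (hU'.prod hV').preimage hqC.continuous
  have h0dom : ((0 : X), (0 : E)) ∈ q ⁻¹' (U' ×ˢ V') := by
    rw [Set.mem_preimage, hq0]
    exact ⟨h0U', hzV'⟩
  have hcont : ContinuousAt (fun p => g (q p)) (0, 0) :=
    hgq.continuousOn.continuousAt (hdom.mem_nhds h0dom)
  obtain ⟨r, hr, hrs⟩ : ∃ r > 0, ∀ x ∈ Metric.ball (0 : X) r, ∀ t ∈ Metric.ball (0 : E) r,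
      q (x, t) ∈ U' ×ˢ V' ∧ g (q (x, t)) ∈ Metric.ball y₀ 1 ∧ ι (g (q (x, t))) ∈ B ∩ O ∧
        x ∈ U := by
    have h1 : g (q (0, 0)) = y₀ := by rw [hq0, hg0]
    have e1 : ∀ᶠ p in 𝓝 ((0 : X), (0 : E)), p ∈ q ⁻¹' (U' ×ˢ V') := hdom.mem_nhds h0dom
    have e2 : ∀ᶠ p in 𝓝 ((0 : X), (0 : E)), g (q p) ∈ Metric.ball y₀ 1 := by
      refine hcont.preimage_mem_nhds ?_
      rw [h1]
      exact Metric.ball_mem_nhds _ one_pos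
    have e3 : ∀ᶠ p in 𝓝 ((0 : X), (0 : E)), ι (g (q p)) ∈ B ∩ O := by
      refine (ι.continuous.continuousAt.comp hcont).preimage_mem_nhds ?_
      simp only [Function.comp_apply, h1]
      exact inter_mem hB (hO.mem_nhds hy₀O)
    have e4 : ∀ᶠ p in 𝓝 ((0 : X), (0 : E)), p.1 ∈ U :=
      continuous_fst.continuousAt.preimage_mem_nhds (hU.mem_nhds h0U)
    obtain ⟨r, hr, h2⟩ := Metric.eventually_nhds_iff.1 (e1.and (e2.and (e3.and e4)))
    refine ⟨r, hr, fun x hx t ht => @h2 (x, t) ?_⟩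
    rw [Prod.dist_eq]
    exact max_lt hx ht
  obtain ⟨G, hGdef⟩ : ∃ G : X × E → Y, G = fun p => ι (g (q p)) := ⟨_, rfl⟩
  have hsub : Metric.ball (0 : X) r ×ˢ Metric.ball (0 : E) r ⊆ q ⁻¹' (U' ×ˢ V') :=
    fun p hp => (hrs p.1 hp.1 p.2 hp.2).1
  have hGC : ContDiffOn ℝ 1 G (Metric.ball (0 : X) r ×ˢ Metric.ball (0 : E) r) := by
    rw [hGdef]
    exact ι.contDiff.comp_contDiffOn (hgq.mono hsub)
  have hG0 : G (0, 0) = ι y₀ := by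
    rw [hGdef]
    simp only [hq0, hg0]
  have hΨG : ∀ x ∈ Metric.ball (0 : X) r, ∀ t ∈ Metric.ball (0 : E) r,
      Ψ (x, G (x, t)) = ι (z₀ + τ t) := by
    intro x hx t ht
    have h1 := (hrs x hx t ht).1
    have h2 := hg _ h1.1 _ h1.2
    rw [hq] at h1 h2
    rw [hGdef, hq]
    simp only at h1 h2 ⊢
    rw [hιΨ x _ (hBO' _ h1.1 _ h2.1).2, h2.2]
  have hball : (0 : X) ∈ Metric.ball (0 : X) r := Metric.mem_ball_self hr
  have hball' : (0 : E) ∈ Metric.ball (0 : E) r := Metric.mem_ball_self hr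
  have hopen : IsOpen (Metric.ball (0 : X) r ×ˢ Metric.ball (0 : E) r) :=
    Metric.isOpen_ball.prod Metric.isOpen_ball
  have hL : Function.Injective fun t => fderiv ℝ G (0, 0) (0, t) := by
    have h1 : HasFDerivAt G (fderiv ℝ G (0, 0)) (0, 0) :=
      ((hGC.contDiffAt (hopen.mem_nhds ⟨hball, hball'⟩)).differentiableAt one_ne_zero).hasFDerivAt
    have h2 : HasFDerivAt Ψ (fderiv ℝ Ψ (0, ι y₀)) (0, ι y₀) :=
      ((hΨ.contDiffAt (hOX.mem_nhds ⟨trivial, hy₀O⟩)).differentiableAt one_ne_zero).hasFDerivAt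
    have h3 : ∀ t, A (fderiv ℝ G (0, 0) (0, t)) = ι (τ t) := by
      intro t
      have h4 : HasDerivAt (fun σ : ℝ => ((0 : X), σ • t)) (0, t) 0 := by
        have h5 := (hasDerivAt_id (0 : ℝ)).smul_const t
        rw [one_smul] at h5
        exact (hasDerivAt_const (0 : ℝ) (0 : X)).prodMk h5
      have h5 : HasDerivAt (fun σ : ℝ => G (0, σ • t)) (fderiv ℝ G (0, 0) (0, t)) 0 := by
        have h6 : HasFDerivAt G (fderiv ℝ G (0, 0)) ((fun σ : ℝ => ((0 : X), σ • t)) 0) := by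
          simp only [zero_smul]
          exact h1
        exact h6.comp_hasDerivAt 0 h4
      have h6 : HasDerivAt (fun σ : ℝ => Ψ (0, G (0, σ • t)))
          (fderiv ℝ Ψ (0, ι y₀) (0, fderiv ℝ G (0, 0) (0, t))) 0 := by
        have h7 : HasFDerivAt Ψ (fderiv ℝ Ψ (0, ι y₀))
            ((fun σ : ℝ => ((0 : X), G (0, σ • t))) 0) := by
          simp only [zero_smul, hG0]
          exact h2
        exact h7.comp_hasDerivAt 0 ((hasDerivAt_const (0 : ℝ) (0 : X)).prodMk h5)
      have h7 : HasDerivAt (fun σ : ℝ => Ψ (0, G (0, σ • t))) (ι (τ t)) 0 := by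
        have h8 : HasDerivAt (fun σ : ℝ => ι z₀ + σ • ι (τ t)) (ι (τ t)) 0 := by
          have h9 := ((hasDerivAt_id (0 : ℝ)).smul_const (ι (τ t))).const_add (ι z₀)
          rwa [one_smul] at h9
        refine h8.congr_of_eventuallyEq ?_
        have h9 : ∀ᶠ σ : ℝ in 𝓝 0, σ • t ∈ Metric.ball (0 : E) r := by
          have h10 : ContinuousAt (fun σ : ℝ => σ • t) 0 := by fun_prop
          refine h10.preimage_mem_nhds ?_
          simp only [zero_smul]
          exact Metric.ball_mem_nhds _ hr
        filter_upwards [h9] with σ hσ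
        rw [hΨG 0 hball _ hσ, map_add, map_smul, map_smul]
      rw [← hA]
      exact h6.unique h7
    intro t t' h
    refine hτ (hι ?_)
    rw [← h3, ← h3]
    exact congrArg A h
  have hW : TotallyBounded (G '' (Metric.ball (0 : X) r ×ˢ Metric.ball (0 : E) r)) := by
    refine (hcomp (‖y₀‖ + 1)).subset ?_
    rintro _ ⟨p, hp, rfl⟩
    rw [hGdef]
    refine ⟨g (q p), ?_, rfl⟩
    have h1 := (hrs p.1 hp.1 p.2 hp.2).2.1
    rw [mem_closedBall_zero_iff]
    rw [Metric.mem_ball, dist_eq_norm] at h1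
    have h2 := norm_add_le (g (q p) - y₀) y₀
    rw [sub_add_cancel] at h2
    exact h2.trans (by linarith [h1.le])
  obtain ⟨R', hR', hR'r, η₀, hη₀, hunif⟩ := exists_uniformization N hN hnorm hc hle Metric.isOpen_ball
    hr hGC hball hL hW
  -- the choice of the size of the ball
  obtain ⟨K, hK, hKτ⟩ : ∃ K : ℝ, 0 < K ∧ ∀ t, ‖t‖ ≤ K * ‖ι (τ t)‖ := by
    have h1 : LinearMap.ker ((ι.comp τ : E →L[ℝ] Y) : E →ₗ[ℝ] Y) = ⊥ := by
      rw [LinearMap.ker_eq_bot]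
      exact hι.comp hτ
    obtain ⟨K, hK, h2⟩ := LinearMap.exists_antilipschitzWith _ h1
    refine ⟨K, hK, fun t => ?_⟩
    have h3 := h2.le_mul_dist t 0
    rw [dist_zero_right, map_zero, dist_zero_right] at h3
    exact h3
  obtain ⟨r₁, hr₁, hsmall⟩ : ∃ r₁ > 0, ∀ x ∈ Metric.ball (0 : X) r₁,
      ∀ y ∈ Metric.ball (ι y₀) r₁, y ∈ B ∩ O ∧ ‖Ψ (x, y) - ι z₀‖ < R' / K := by
    have hc : ContinuousAt Ψ (0, ι y₀) :=
      hΨ.continuousOn.continuousAt (hOX.mem_nhds ⟨trivial, hy₀O⟩)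
    have hΨ0 : Ψ (0, ι y₀) = ι z₀ := by rw [hιΨ 0 y₀ hy₀, hz₀]
    have e1 : ∀ᶠ p in 𝓝 ((0 : X), ι y₀), p.2 ∈ B ∩ O :=
      continuous_snd.continuousAt.preimage_mem_nhds (inter_mem hB (hO.mem_nhds hy₀O))
    have e2 : ∀ᶠ p in 𝓝 ((0 : X), ι y₀), ‖Ψ p - ι z₀‖ < R' / K := by
      have h1 := hc.preimage_mem_nhds (Metric.ball_mem_nhds _ (div_pos hR' hK))
      rw [hΨ0] at h1
      filter_upwards [h1] with p hp
      rw [← dist_eq_norm]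
      exact hp
    obtain ⟨r₁, hr₁, h2⟩ := Metric.eventually_nhds_iff.1 (e1.and e2)
    refine ⟨r₁, hr₁, fun x hx y hy => @h2 (x, y) ?_⟩
    rw [Prod.dist_eq]
    exact max_lt hx hy
  obtain ⟨V, Λ, hV, h0V, hVr, hΛ, hΛ0, hΛb⟩ := hunif (min η₀ (c * r₁))
    (lt_min hη₀ (mul_pos hc hr₁))
    (min_le_left _ _)
  refine ⟨V ∩ Metric.ball 0 r₁, min η₀ (c * r₁), fun p => G (p.1, Λ p), hV.inter Metric.isOpen_ball,
    ⟨h0V, Metric.mem_ball_self hr₁⟩, lt_min hη₀ (mul_pos hc hr₁), ?_, ?_, ?_⟩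
  · refine hGC.comp (contDiffOn_fst.prodMk (hΛ.mono ?_)) ?_
    · exact Set.prod_mono Set.inter_subset_left le_rfl
    · rintro ⟨x, s⟩ ⟨hx, -⟩
      exact ⟨hVr hx.1, Metric.ball_subset_ball hR'r ((hΛb x hx.1).mapsTo (Set.mem_univ s)).1⟩
  · simp only [hΛ0 0 h0V, hG0]
  · rintro x ⟨hxV, hxr⟩
    have hxr' := hVr hxV
    refine Set.BijOn.comp (g := fun t => G (x, t)) ?_ (hΛb x hxV)
    rw [hG0]
    refine ⟨fun t ht => ⟨?_, ht.2⟩, fun t ht t' ht' h => ?_, fun y hy => ?_⟩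
    · have htr := Metric.ball_subset_ball hR'r ht.1
      have h1 := (hrs x hxr' t htr).2.2.1.2
      refine (hS x _ ?_).2 ⟨t, hΨG x hxr' t htr⟩
      rw [hGdef]
      exact h1
    · have h1 := hΨG x hxr' t (Metric.ball_subset_ball hR'r ht.1)
      have h2 := hΨG x hxr' t' (Metric.ball_subset_ball hR'r ht'.1)
      simp only at h
      rw [h, h2] at h1
      exact (hτ (add_left_cancel (hι h1))).symm
    · have h1 : y ∈ Metric.ball (ι y₀) r₁ := by
        rw [Metric.mem_ball, dist_eq_norm]
        exact lt_of_mul_lt_mul_left ((hle _).trans_lt (hy.2.trans_le (min_le_right _ _))) hc.le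
      obtain ⟨h2, h3⟩ := hsmall x hxr y h1
      obtain ⟨t, ht⟩ := (hS x y h2.2).1 hy.1
      have htR : t ∈ Metric.ball (0 : E) R' := by
        rw [mem_ball_zero_iff]
        refine (hKτ t).trans_lt ?_
        rw [ht, map_add, add_sub_cancel_left] at h3
        rwa [mul_comm, ← lt_div_iff₀ hK]
      have htr := Metric.ball_subset_ball hR'r htR
      have h4 : G (x, t) = y := by
        have h5 := (hrs x hxr' t htr).2.2
        refine hinj x h5.2 ?_ h2.1 ((hΨG x hxr' t htr).trans ht.symm)
        rw [hGdef]
        exact h5.1.1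
      refine ⟨t, ⟨htR, ?_⟩, h4⟩
      rw [h4]
      exact hy.2

end Family

end KStat

end

noncomputable section

namespace KStat

open Real Filter Topology

theorem isHol_iff_contDiff {k : ℕ} {α : ℝ} {v : ℝ → ℝ} (hp : Function.Periodic v (2 * π)) :
    IsHol k α v ↔ ContDiff ℝ k v ∧
      ∃ C : ℝ, ∀ p : ℝ × ℝ, |iteratedDeriv k v p.1 - iteratedDeriv k v p.2| ≤ C * chord p ^ α := by
  induction k generalizing v with
  | zero =>
    simp only [iteratedDeriv_zero, Nat.cast_zero, contDiff_zero]
    exact ⟨fun h => ⟨h.2.1, h.2.2.imp fun C hC p => hC p.1 p.2⟩,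
      fun h => ⟨hp, h.1, h.2.imp fun C hC s t => hC (s, t)⟩⟩
  | succ k ih =>
    have hk : ((k : ℕ) : WithTop ℕ∞) ≠ ⊤ := by simp
    simp only [iteratedDeriv_succ', Nat.cast_add, Nat.cast_one, contDiff_succ_iff_deriv]
    rw [show IsHol (k + 1) α v ↔ Function.Periodic v (2 * π) ∧ Differentiable ℝ v ∧
      IsHol k α (deriv v) from Iff.rfl, ih (periodic_deriv hp)]
    exact ⟨fun h => ⟨⟨h.2.1, fun h' => absurd h' hk, h.2.2.1⟩, h.2.2.2⟩,
      fun h => ⟨hp, h.1.1, h.1.2.2, h.2⟩⟩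

theorem hnorm_eq (k : ℕ) (α : ℝ) (v : ℝ → ℝ) :
    hnorm k α v = (∑ j ∈ Finset.range (k + 1), ⨆ θ : ℝ, |iteratedDeriv j v θ|) +
      ⨆ p : ℝ × ℝ, |iteratedDeriv k v p.1 - iteratedDeriv k v p.2| / chord p ^ α := by
  induction k generalizing v with
  | zero =>
    simp only [zero_add, Finset.sum_range_one, iteratedDeriv_zero]
    rfl
  | succ k ih =>
    rw [Finset.sum_range_succ', add_right_comm]
    simp only [iteratedDeriv_succ', iteratedDeriv_zero]
    rw [← ih (deriv v)]
    exact add_comm _ _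

theorem periodic_arg {F : Type*} {v : ℝ → F} (hp : Function.Periodic v (2 * π)) (t : ℝ) :
    v (Complex.arg (Circle.exp t : ℂ)) = v t := by
  obtain ⟨m, hm⟩ := Circle.exp_eq_exp.1 (Circle.exp_arg (Circle.exp t))
  rw [hm]
  exact (hp.int_mul m) t

theorem periodic_comp_exp {F : Type*} (u : Circle → F) :
    Function.Periodic (fun t : ℝ => u (Circle.exp t)) (2 * π) := fun t => by
  simp only [Circle.exp_add_two_pi]

theorem isHolder_iff {k : ℕ} {α : ℝ} {u : Circle → ℝ} :
    IsHolder k α u ↔ IsHol k α (fun t => u (Circle.exp t)) :=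
  (isHol_iff_contDiff (periodic_comp_exp u)).symm

theorem holderNorm_eq (k : ℕ) (α : ℝ) (u : Circle → ℝ) :
    holderNorm k α u = hnorm k α (fun t => u (Circle.exp t)) :=
  (hnorm_eq k α _).symm

/-- The function on the circle given by a periodic function. -/
def onCircle {F : Type*} (v : ℝ → F) (ζ : Circle) : F := v (Complex.arg (ζ : ℂ))

theorem onCircle_exp {F : Type*} {v : ℝ → F} (hp : Function.Periodic v (2 * π)) :
    (fun t : ℝ => onCircle v (Circle.exp t)) = v := funext fun t => periodic_arg hp t

section Spaces

variable {k : ℕ} {α : ℝ}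

theorem IsHol.isHolder {v : ℝ → ℝ} (hv : IsHol k α v) : IsHolder k α (onCircle v) := by
  rw [isHolder_iff, onCircle_exp hv.periodic]
  exact hv

theorem holderNorm_onCircle {v : ℝ → ℝ} (hv : IsHol k α v) :
    holderNorm k α (onCircle v) = hnorm k α v := by
  rw [holderNorm_eq, onCircle_exp hv.periodic]

/-- The space `C^{k,α}` as a space of functions on the circle. -/
def toHolder : Hol k α ℝ →L[ℝ] HolderC k α :=
  LinearMap.mkContinuous
    { toFun := fun v => ⟨onCircle v, v.isHol.isHolder⟩
      map_add' := fun _ _ => rfl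
      map_smul' := fun _ _ => rfl } 1 fun v => by
    rw [one_mul]
    exact (holderNorm_onCircle v.isHol).trans_le (Hol.hnorm_le_norm v)

theorem norm_toHolder (v : Hol k α ℝ) : ‖toHolder v‖ = hnorm k α v := holderNorm_onCircle v.isHol

theorem toHolder_apply (v : Hol k α ℝ) (t : ℝ) : toHolder v (Circle.exp t) = v t :=
  periodic_arg v.isHol.periodic t

theorem toHolder_surjective (u : HolderC k α) : ∃ v : Hol k α ℝ, toHolder v = u := by
  refine ⟨Hol.mk _ (isHolder_iff.1 u.2), Subtype.ext (funext fun ζ => ?_)⟩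
  change u (Circle.exp (Complex.arg (ζ : ℂ))) = u ζ
  rw [Circle.exp_arg]

variable [Exponent α]

/-- The closed subspace of the functions which extend holomorphically to the disc. -/
def holo (k : ℕ) (α : ℝ) [Exponent α] : Submodule ℝ (Hol k α ℂ) :=
  LinearMap.ker ((Hol.szego - ContinuousLinearMap.id ℝ (Hol k α ℂ) : Hol k α ℂ →L[ℝ] Hol k α ℂ) :
    Hol k α ℂ →ₗ[ℝ] Hol k α ℂ)

theorem mem_holo {u : Hol k α ℂ} : u ∈ holo k α ↔ Hol.IsHolo u := by
  rw [← Hol.szego_eq_self_iff, ← sub_eq_zero]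
  exact Iff.rfl

instance : CompleteSpace (holo k α) := by
  have h : IsClosed (holo k α : Set (Hol k α ℂ)) :=
    (Hol.szego - ContinuousLinearMap.id ℝ (Hol k α ℂ)).isClosed_ker
  exact h.completeSpace_coe

theorem IsHol.re {u : ℝ → ℂ} (hu : IsHol k α u) : IsHol k α (fun t => (u t).re) :=
  hu.clm Complex.reCLM

theorem IsHol.im {u : ℝ → ℂ} (hu : IsHol k α u) : IsHol k α (fun t => (u t).im) :=
  hu.clm Complex.imCLM

theorem isDisc_onCircle {u : Hol k α ℂ} (hu : Hol.IsHolo u) : IsDisc k α (onCircle u) := by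
  obtain ⟨G, hG, hGu⟩ := Hol.isHolo_iff.1 hu
  refine ⟨u.isHol.re.isHolder, u.isHol.im.isHolder, G, hG, fun ζ => ?_⟩
  rw [onCircle, ← hGu, Circle.exp_arg]

theorem IsHol.of_re_im {u : ℝ → ℂ} (h1 : IsHol k α fun t => (u t).re)
    (h2 : IsHol k α fun t => (u t).im) : IsHol k α u := by
  have h3 := (h1.clm Complex.ofRealCLM).add ((h2.clm Complex.ofRealCLM).clm
    (ContinuousLinearMap.mul ℝ ℂ Complex.I))
  convert h3 using 1
  funext t
  simp only [Pi.add_apply, ContinuousLinearMap.mul_apply', Complex.ofRealCLM_apply]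
  rw [mul_comm, Complex.re_add_im]

theorem isDisc_iff {u : Circle → ℂ} : IsDisc k α u ↔
    ∃ v : Hol k α ℂ, Hol.IsHolo v ∧ ∀ t, v t = u (Circle.exp t) := by
  constructor
  · rintro ⟨h1, h2, G, hG, hGu⟩
    refine ⟨Hol.mk (fun t => u (Circle.exp t)) (.of_re_im (isHolder_iff.1 h1) (isHolder_iff.1 h2)),
      Hol.isHolo_iff.2 ⟨G, hG, fun t => hGu _⟩, fun t => rfl⟩
  · rintro ⟨v, hv, hvu⟩
    have h := isDisc_onCircle hv
    have e : onCircle v = u := funext fun ζ => by rw [onCircle, hvu, Circle.exp_arg]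
    rwa [e] at h

theorem hnorm_le_re_im (u : Hol k α ℂ) :
    hnorm k α u ≤ hnorm k α (fun t => (u t).re) + hnorm k α (fun t => (u t).im) := by
  have h1 := hnorm_clm_le Complex.ofRealCLM u.isHol.re
  have h2 := hnorm_clm_le ((ContinuousLinearMap.mul ℝ ℂ Complex.I).comp Complex.ofRealCLM) u.isHol.im
  have h3 := hnorm_add_le (u.isHol.re.clm Complex.ofRealCLM)
    (u.isHol.im.clm ((ContinuousLinearMap.mul ℝ ℂ Complex.I).comp Complex.ofRealCLM))
  have e : ((fun t => Complex.ofRealCLM (u t).re) + fun t =>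
      ((ContinuousLinearMap.mul ℝ ℂ Complex.I).comp Complex.ofRealCLM) (u t).im) = u := by
    funext t
    simp only [Pi.add_apply, ContinuousLinearMap.comp_apply, ContinuousLinearMap.mul_apply',
      Complex.ofRealCLM_apply]
    rw [mul_comm, Complex.re_add_im]
  rw [e] at h3
  have n1 : ‖Complex.ofRealCLM‖ ≤ 1 := ContinuousLinearMap.opNorm_le_bound _ zero_le_one
    fun x => by simp
  have n2 : ‖(ContinuousLinearMap.mul ℝ ℂ Complex.I).comp Complex.ofRealCLM‖ ≤ 1 :=
    ContinuousLinearMap.opNorm_le_bound _ zero_le_one fun x => by simp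
  refine h3.trans (add_le_add (h1.trans ?_) (h2.trans ?_))
  · exact mul_le_of_le_one_left (hnorm_nonneg _ _ _) n1
  · exact mul_le_of_le_one_left (hnorm_nonneg _ _ _) n2

theorem hnorm_re_le (u : Hol k α ℂ) : hnorm k α (fun t => (u t).re) ≤ hnorm k α u := by
  refine (hnorm_clm_le Complex.reCLM u.isHol).trans ?_
  exact mul_le_of_le_one_left (hnorm_nonneg _ _ _) (ContinuousLinearMap.opNorm_le_bound _ zero_le_one
    fun x => by simpa using Complex.abs_re_le_norm x)

theorem hnorm_im_le (u : Hol k α ℂ) : hnorm k α (fun t => (u t).im) ≤ hnorm k α u := by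
  refine (hnorm_clm_le Complex.imCLM u.isHol).trans ?_
  exact mul_le_of_le_one_left (hnorm_nonneg _ _ _) (ContinuousLinearMap.opNorm_le_bound _ zero_le_one
    fun x => by simpa using Complex.abs_im_le_norm x)

/-- An element of `A^{k,α}` as a function on the circle. -/
def discOnCircle (u : holo k α) : Disc k α := ⟨onCircle u.1, isDisc_onCircle (mem_holo.1 u.2)⟩

theorem norm_discOnCircle (u : holo k α) : ‖discOnCircle u‖ =
      hnorm k α (fun t => (u.1 t).re) + hnorm k α (fun t => (u.1 t).im) := by
  rw [← holderNorm_onCircle u.1.isHol.re, ← holderNorm_onCircle u.1.isHol.im]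
  rfl

/-- The space `A^{k,α}` as a space of functions on the circle. -/
def toTied : holo k α →L[ℝ] TiedDisc k α :=
  LinearMap.mkContinuous
    { toFun := discOnCircle
      map_add' := fun _ _ => rfl
      map_smul' := fun _ _ => rfl } 2 fun u => by
    refine (norm_discOnCircle u).trans_le ?_
    have h1 := hnorm_re_le u.1
    have h2 := hnorm_im_le u.1
    have h3 := Hol.hnorm_le_norm u.1
    have h4 : ‖u‖ = ‖u.1‖ := rfl
    linarith

theorem hnorm_le_norm_toTied (u : holo k α) : hnorm k α u.1 ≤ ‖toTied u‖ :=
  (hnorm_le_re_im u.1).trans_eq (norm_discOnCircle u).symm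

theorem toTied_factor (u : holo k α) (t : ℝ) : (toTied u).factor (Circle.exp t) = u.1 t :=
  periodic_arg u.1.isHol.periodic t

theorem toTied_surjective (f : TiedDisc k α) : ∃ u : holo k α, toTied u = f := by
  obtain ⟨v, hv, hvf⟩ := isDisc_iff.1 f.2
  refine ⟨⟨v, mem_holo.2 hv⟩, Subtype.ext (funext fun ζ => ?_)⟩
  change v (Complex.arg (ζ : ℂ)) = f.1 ζ
  rw [hvf, Circle.exp_arg]

/-- The space `Y` as a space of periodic functions. -/
abbrev Vec (k : ℕ) (α : ℝ) [Exponent α] : Type := Hol k α ℝ × holo k α × holo k α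

/-- The identification of `Vec` with `Y`. -/
def toY : Vec k α →L[ℝ] Y k α := toHolder.prodMap (toTied.prodMap toTied)

theorem toY_apply (y : Vec k α) : toY y = (toHolder y.1, toTied y.2.1, toTied y.2.2) := rfl

theorem toY_surjective (y : Y k α) : ∃ v : Vec k α, toY v = y := by
  obtain ⟨c, hc⟩ := toHolder_surjective y.1
  obtain ⟨h, hh⟩ := toTied_surjective y.2.1
  obtain ⟨g, hg⟩ := toTied_surjective y.2.2
  exact ⟨(c, h, g), by rw [toY_apply, hc, hh, hg]⟩

/-- The norm of `Y` on `Vec`. -/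
def normVec (k : ℕ) (α : ℝ) [Exponent α] : Seminorm ℝ (Vec k α) :=
  ((normSeminorm ℝ (HolderC k α)).comp ((toHolder : Hol k α ℝ →L[ℝ] HolderC k α).comp
      (ContinuousLinearMap.fst ℝ _ _) : Vec k α →L[ℝ] HolderC k α).toLinearMap +
    (normSeminorm ℝ (TiedDisc k α)).comp ((toTied : holo k α →L[ℝ] TiedDisc k α).comp
      ((ContinuousLinearMap.fst ℝ _ _).comp (ContinuousLinearMap.snd ℝ _ _)) :
        Vec k α →L[ℝ] TiedDisc k α).toLinearMap) +
    (normSeminorm ℝ (TiedDisc k α)).comp ((toTied : holo k α →L[ℝ] TiedDisc k α).comp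
      ((ContinuousLinearMap.snd ℝ _ _).comp (ContinuousLinearMap.snd ℝ _ _)) :
        Vec k α →L[ℝ] TiedDisc k α).toLinearMap

theorem normVec_apply (y : Vec k α) : normVec k α y = normY (toY y) := rfl

theorem continuous_normVec : Continuous (normVec k α) := by
  have h : Continuous fun y : Vec k α => ‖(toY y).1‖ + ‖(toY y).2.1‖ + ‖(toY y).2.2‖ := by
    have := (toY : Vec k α →L[ℝ] Y k α).continuous
    fun_prop
  exact h

theorem exists_norming (y : Vec k α) :
    ∃ φ : Vec k α →L[ℝ] ℝ, (∀ v, φ v ≤ normVec k α v) ∧ φ y = normVec k α y := by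
  obtain ⟨a, ha, ha'⟩ := exists_dual_vector'' ℝ (toY y).1
  obtain ⟨b, hb, hb'⟩ := exists_dual_vector'' ℝ (toY y).2.1
  obtain ⟨c, hc, hc'⟩ := exists_dual_vector'' ℝ (toY y).2.2
  have key : ∀ {E : Type} [NormedAddCommGroup E] [NormedSpace ℝ E] (f : StrongDual ℝ E),
      ‖f‖ ≤ 1 → ∀ x, f x ≤ ‖x‖ := by
    intro E _ _ f hf x
    refine (le_abs_self _).trans ((f.le_opNorm x).trans ?_)
    exact mul_le_of_le_one_left (norm_nonneg _) hf
  refine ⟨(a.comp (ContinuousLinearMap.fst ℝ _ _) +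
    b.comp ((ContinuousLinearMap.fst ℝ _ _).comp (ContinuousLinearMap.snd ℝ _ _)) +
    c.comp ((ContinuousLinearMap.snd ℝ _ _).comp (ContinuousLinearMap.snd ℝ _ _))).comp toY,
    fun v => ?_, ?_⟩
  · exact add_le_add (add_le_add (key a ha _) (key b hb _)) (key c hc _)
  · rw [normVec_apply, normY, ← show a (toY y).1 = ‖(toY y).1‖ from ha',
      ← show b (toY y).2.1 = ‖(toY y).2.1‖ from hb', ← show c (toY y).2.2 = ‖(toY y).2.2‖ from hc']
    rfl

theorem norm_le_normVec (y : Vec k α) : (15 ^ k : ℝ)⁻¹ * ‖y‖ ≤ normVec k α y := by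
  have h0 : (0 : ℝ) < 15 ^ k := by positivity
  rw [inv_mul_le_iff₀ h0]
  have h1 : ‖y.1‖ = 15 ^ k * ‖(toY y).1‖ := by
    rw [Hol.norm_def, toY_apply, norm_toHolder]
  have h2 : ‖y.2.1‖ ≤ 15 ^ k * ‖(toY y).2.1‖ :=
    mul_le_mul_of_nonneg_left (hnorm_le_norm_toTied y.2.1) h0.le
  have h3 : ‖y.2.2‖ ≤ 15 ^ k * ‖(toY y).2.2‖ :=
    mul_le_mul_of_nonneg_left (hnorm_le_norm_toTied y.2.2) h0.le
  have n1 := norm_nonneg (toY y).1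
  have n2 := norm_nonneg (toY y).2.1
  have n3 := norm_nonneg (toY y).2.2
  rw [Prod.norm_def, Prod.norm_def, normVec_apply, normY, mul_add, mul_add]
  have m1 := mul_nonneg h0.le n1
  have m2 := mul_nonneg h0.le n2
  have m3 := mul_nonneg h0.le n3
  refine max_le ?_ (max_le ?_ ?_) <;> linarith

theorem toY_injective : Function.Injective (toY : Vec k α → Y k α) := by
  rw [injective_iff_map_eq_zero]
  intro y hy
  have h1 := norm_le_normVec y
  rw [normVec_apply, hy] at h1
  have h2 : normY (0 : Y k α) = 0 := by simp [normY]
  rw [h2, inv_mul_le_iff₀ (by positivity), mul_zero] at h1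
  exact norm_le_zero_iff.1 h1

end Spaces

section Inclusion

variable {k : ℕ} {α β : ℝ} [Exponent α] [Exponent β]

theorem incl_mem_holo (h : α ≤ β) {u : Hol k β ℂ} (hu : u ∈ holo k β) : Hol.incl h u ∈ holo k α :=
  mem_holo.2 fun n hn => mem_holo.1 hu n hn

/-- The inclusion of `A^{k,β}` into `A^{k,α}`. -/
def inclHolo (h : α ≤ β) : holo k β →L[ℝ] holo k α :=
  ((Hol.incl h).comp (holo k β).subtypeL).codRestrict (holo k α) fun u => incl_mem_holo h u.2

/-- The inclusion between the spaces `Vec`. -/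
def inclVec (h : α ≤ β) : Vec k β →L[ℝ] Vec k α :=
  (Hol.incl h).prodMap ((inclHolo h).prodMap (inclHolo h))

theorem inclVec_injective (h : α ≤ β) : Function.Injective (inclVec h : Vec k β → Vec k α) := by
  have h1 : ∀ {F : Type} [NormedAddCommGroup F] [NormedSpace ℝ F],
      Function.Injective (Hol.incl h : Hol k β F → Hol k α F) := by
    intro F _ _ u v huv
    ext t
    exact congrArg (fun w : Hol k α F => w t) huv
  have h2 : Function.Injective (inclHolo h : holo k β → holo k α) := fun u v huv =>
    Subtype.ext (h1 (congrArg Subtype.val huv))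
  exact Function.Injective.prodMap h1 (h2.prodMap h2)

theorem totallyBounded_inclHolo (h : α < β) (R : ℝ) :
    TotallyBounded ((inclHolo h.le : holo k β → holo k α) '' Metric.closedBall 0 R) := by
  have h1 := totallyBounded_preimage (f := (Subtype.val : holo k α → Hol k α ℂ))
    isUniformEmbedding_subtype_val.isUniformInducing
    (Hol.totallyBounded_incl (k := k) (F := ℂ) h R)
  refine h1.subset ?_
  rintro _ ⟨u, hu, rfl⟩
  refine ⟨u.1, ?_, rfl⟩
  rw [mem_closedBall_zero_iff] at hu ⊢
  exact hu

theorem totallyBounded_inclVec (h : α < β) (R : ℝ) :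
    TotallyBounded ((inclVec h.le : Vec k β → Vec k α) '' Metric.closedBall 0 R) := by
  refine (totallyBounded_prod (Hol.totallyBounded_incl (F := ℝ) h R)
    (totallyBounded_prod (totallyBounded_inclHolo h R) (totallyBounded_inclHolo h R))).subset ?_
  rintro _ ⟨y, hy, rfl⟩
  rw [mem_closedBall_zero_iff, Prod.norm_def, Prod.norm_def, max_le_iff, max_le_iff] at hy
  exact ⟨⟨y.1, mem_closedBall_zero_iff.2 hy.1, rfl⟩, ⟨y.2.1, mem_closedBall_zero_iff.2 hy.2.1, rfl⟩,
    ⟨y.2.2, mem_closedBall_zero_iff.2 hy.2.2, rfl⟩⟩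

end Inclusion

end KStat

end

noncomputable section

namespace KStat

open Real Filter Topology ComplexConjugate

/-- `f` is real differentiable at `p`, with `∂f/∂z = a` and `∂f/∂w = b`. -/
def HasWirtinger (f : ℂ × ℂ → ℂ) (p : ℂ × ℂ) (a b : ℂ) : Prop :=
  DifferentiableAt ℝ f p ∧ wirtinger f p (1, 0) = a ∧ wirtinger f p (0, 1) = b

namespace HasWirtinger

variable {f g : ℂ × ℂ → ℂ} {p : ℂ × ℂ} {a b a' b' : ℂ}

theorem of_hasFDerivAt {L : ℂ × ℂ →L[ℝ] ℂ} (h : HasFDerivAt f L p)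
    (ha : (L (1, 0) - Complex.I * L (Complex.I, 0)) / 2 = a)
    (hb : (L (0, 1) - Complex.I * L (0, Complex.I)) / 2 = b) : HasWirtinger f p a b := by
  rw [← ha, ← hb]
  refine ⟨h.differentiableAt, ?_, ?_⟩ <;> rw [wirtinger, h.fderiv, Prod.smul_mk] <;>
    simp only [smul_eq_mul, mul_one, mul_zero]

theorem cast (h : HasWirtinger f p a b) (ha : a = a') (hb : b = b') : HasWirtinger f p a' b' :=
  ha ▸ hb ▸ h

theorem congr (h : HasWirtinger f p a b) (hg : g =ᶠ[𝓝 p] f) : HasWirtinger g p a b := by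
  obtain ⟨h1, h2, h3⟩ := h
  refine ⟨h1.congr_of_eventuallyEq hg, ?_, ?_⟩
  · rw [← h2, wirtinger, wirtinger, hg.fderiv_eq]
  · rw [← h3, wirtinger, wirtinger, hg.fderiv_eq]

theorem const (c : ℂ) : HasWirtinger (fun _ => c) p 0 0 :=
  of_hasFDerivAt (hasFDerivAt_const (𝕜 := ℝ) c p) (by simp) (by simp)

theorem add (hf : HasWirtinger f p a b) (hg : HasWirtinger g p a' b') :
    HasWirtinger (fun q => f q + g q) p (a + a') (b + b') := by
  rw [← hf.2.1, ← hf.2.2, ← hg.2.1, ← hg.2.2]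
  refine of_hasFDerivAt (hf.1.hasFDerivAt.add hg.1.hasFDerivAt) ?_ ?_ <;> simp [wirtinger] <;> ring

theorem mul (hf : HasWirtinger f p a b) (hg : HasWirtinger g p a' b') :
    HasWirtinger (fun q => f q * g q) p (a * g p + f p * a') (b * g p + f p * b') := by
  rw [← hf.2.1, ← hf.2.2, ← hg.2.1, ← hg.2.2]
  refine of_hasFDerivAt (hf.1.hasFDerivAt.mul hg.1.hasFDerivAt) ?_ ?_ <;> simp [wirtinger] <;> ring

theorem sum {ι : Type*} {s : Finset ι} {F : ι → ℂ × ℂ → ℂ} {A B : ι → ℂ}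
    (h : ∀ i ∈ s, HasWirtinger (F i) p (A i) (B i)) :
    HasWirtinger (fun q => ∑ i ∈ s, F i q) p (∑ i ∈ s, A i) (∑ i ∈ s, B i) := by
  classical
  induction s using Finset.induction_on with
  | empty => simpa using const 0
  | insert i s hi ih =>
    simp only [Finset.sum_insert hi]
    exact (h i (Finset.mem_insert_self i s)).add
      (ih fun j hj => h j (Finset.mem_insert_of_mem hj))

theorem pow (hf : HasWirtinger f p a b) (n : ℕ) :
    HasWirtinger (fun q => f q ^ n) p (n * f p ^ (n - 1) * a) (n * f p ^ (n - 1) * b) := by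
  induction n with
  | zero => simpa using const 1
  | succ n ih =>
    have h := ih.mul hf
    simp only [← pow_succ] at h
    have e : ∀ c : ℂ, (n : ℂ) * f p ^ (n - 1) * c * f p + f p ^ n * c =
        (n + 1 : ℕ) * f p ^ (n + 1 - 1) * c := by
      intro c
      rcases n with _ | n
      · simp
      · simp only [Nat.add_sub_cancel]
        push_cast
        ring
    rwa [e, e] at h

theorem fst : HasWirtinger (fun q => q.1) p 1 0 :=
  of_hasFDerivAt (hasFDerivAt_fst (𝕜 := ℝ) (p := p)) (by simp [Complex.I_mul_I]) (by simp)

theorem conj_fst : HasWirtinger (fun q => conj q.1) p 0 0 :=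
  of_hasFDerivAt (Complex.conjCLE.toContinuousLinearMap.hasFDerivAt.comp p
    (hasFDerivAt_fst (𝕜 := ℝ) (p := p))) (by simp) (by simp)

theorem im_snd : HasWirtinger (fun q => (q.2.im : ℂ)) p 0 (-(Complex.I / 2)) :=
  of_hasFDerivAt ((Complex.ofRealCLM.comp Complex.imCLM).hasFDerivAt.comp p
    (hasFDerivAt_snd (𝕜 := ℝ) (p := p))) (by simp) (by simp [neg_div])

theorem re_snd : HasWirtinger (fun q => (q.2.re : ℂ)) p 0 (1 / 2) :=
  of_hasFDerivAt ((Complex.ofRealCLM.comp Complex.reCLM).hasFDerivAt.comp p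
    (hasFDerivAt_snd (𝕜 := ℝ) (p := p))) (by simp) (by simp)

end HasWirtinger

/-- The Wirtinger derivative in `z` of a linear map. -/
def wirtZ : (ℂ →L[ℝ] ℂ) →L[ℝ] ℂ :=
  (1 / 2 : ℝ) • (ContinuousLinearMap.apply ℝ ℂ (1 : ℂ) -
    (ContinuousLinearMap.mul ℝ ℂ Complex.I).comp (ContinuousLinearMap.apply ℝ ℂ Complex.I))

theorem wirtZ_apply (A : ℂ →L[ℝ] ℂ) : wirtZ A = (A 1 - Complex.I * A Complex.I) / 2 := by
  simp only [wirtZ, _root_.smul_apply, _root_.sub_apply,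
    ContinuousLinearMap.comp_apply, ContinuousLinearMap.apply_apply, ContinuousLinearMap.mul_apply',
    Complex.real_smul]
  push_cast
  ring

/-- The restriction of linear maps to the first factor. -/
def restrFst : (ℂ × ℝ →L[ℝ] ℂ) →L[ℝ] (ℂ →L[ℝ] ℂ) :=
  (ContinuousLinearMap.compL ℝ ℂ (ℂ × ℝ) ℂ).flip (ContinuousLinearMap.inl ℝ ℂ ℝ)

theorem restrFst_apply (A : ℂ × ℝ →L[ℝ] ℂ) (z : ℂ) : restrFst A z = A (z, 0) := rfl

/-- The derivative of a linear map in the direction of the second factor. -/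
def derivY : (ℂ × ℝ →L[ℝ] ℂ) →L[ℝ] ℂ := ContinuousLinearMap.apply ℝ ℂ ((0, 1) : ℂ × ℝ)

theorem derivY_apply (A : ℂ × ℝ →L[ℝ] ℂ) : derivY A = A (0, 1) := rfl

/-- The complex number `A 1`. -/
def derivOne : (ℝ →L[ℝ] ℝ) →L[ℝ] ℂ :=
  Complex.ofRealCLM.comp (ContinuousLinearMap.apply ℝ ℝ (1 : ℝ))

theorem derivOne_apply (A : ℝ →L[ℝ] ℝ) : derivOne A = (A 1 : ℝ) := rfl

theorem CM.hasFDerivAt {E F : Type} [NormedAddCommGroup E] [NormedSpace ℝ E]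
    [NormedAddCommGroup F] [NormedSpace ℝ F] {m : ℕ} {K : CompactDomain E} (f : CM (m + 1) K F)
    {x : E} (hx : x ∈ interior K.carrier) : HasFDerivAt f (CM.D f x) x :=
  (f.hasFDerivWithinAt (interior_subset hx)).hasFDerivAt (mem_interior_iff_mem_nhds.1 hx)

section Theta

variable {d m : ℕ} {δ : ℝ} {hδ : 0 < δ}

theorem convex_closedDisc : Convex ℝ (closedDisc hδ).carrier := convex_closedBall 0 δ

theorem convex_interval : Convex ℝ (interval hδ).carrier := convex_Icc _ _

theorem convex_discInterval : Convex ℝ (discInterval hδ).carrier :=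
  convex_closedDisc.prod convex_interval

theorem mem_int_closedDisc {z : ℂ} (hz : ‖z‖ < δ) : z ∈ interior (closedDisc hδ).carrier :=
  Metric.ball_subset_interior_closedBall (mem_ball_zero_iff.2 hz)

theorem mem_int_interval {y : ℝ} (hy : |y| < δ) : y ∈ interior (interval hδ).carrier := by
  rw [show (interval hδ).carrier = Set.Icc (-δ) δ from rfl, interior_Icc]
  exact abs_lt.1 hy

theorem mem_int_discInterval {z : ℂ} {y : ℝ} (hz : ‖z‖ < δ) (hy : |y| < δ) :
    (z, y) ∈ interior (discInterval hδ).carrier := by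
  rw [show (discInterval hδ).carrier = (closedDisc hδ).carrier ×ˢ (interval hδ).carrier from rfl,
    interior_prod_eq]
  exact ⟨mem_int_closedDisc hz, mem_int_interval hy⟩

theorem HasWirtinger.comp_disc (χ : CM (m + 1) (closedDisc hδ) ℂ) {p : ℂ × ℂ} (hp : ‖p.1‖ < δ) :
    HasWirtinger (fun q => χ q.1) p (wirtZ (CM.D χ p.1)) 0 := by
  refine of_hasFDerivAt ((χ.hasFDerivAt (mem_int_closedDisc hp)).comp p
    (hasFDerivAt_fst (𝕜 := ℝ) (p := p))) ?_ ?_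
  · rw [wirtZ_apply]
    rfl
  · simp

theorem HasWirtinger.comp_discInterval (χ : CM (m + 1) (discInterval hδ) ℂ) {p : ℂ × ℂ}
    (hp : ‖p.1‖ < δ) (hp' : |p.2.im| < δ) :
    HasWirtinger (fun q => χ (q.1, q.2.im)) p (wirtZ (restrFst (CM.D χ (p.1, p.2.im))))
      (-(Complex.I / 2) * derivY (CM.D χ (p.1, p.2.im))) := by
  have h1 : HasFDerivAt (fun q : ℂ × ℂ => (q.1, q.2.im)) ((ContinuousLinearMap.fst ℝ ℂ ℂ).prod
      (Complex.imCLM.comp (ContinuousLinearMap.snd ℝ ℂ ℂ))) p :=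
    ((ContinuousLinearMap.fst ℝ ℂ ℂ).prod
      (Complex.imCLM.comp (ContinuousLinearMap.snd ℝ ℂ ℂ))).hasFDerivAt
  refine of_hasFDerivAt ((χ.hasFDerivAt (mem_int_discInterval hp hp')).comp p h1) ?_ ?_
  · rw [wirtZ_apply, restrFst_apply, restrFst_apply]
    simp
  · have h0 : (CM.D χ (p.1, p.2.im)) ((0 : ℂ), (0 : ℝ)) = 0 := map_zero _
    rw [derivY_apply]
    simp only [ContinuousLinearMap.comp_apply, ContinuousLinearMap.prod_apply,
      ContinuousLinearMap.coe_fst', ContinuousLinearMap.coe_snd', Complex.imCLM_apply,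
      Complex.one_im, Complex.I_im, h0]
    ring

theorem HasWirtinger.comp_interval (χ : CM (m + 1) (interval hδ) ℝ) {p : ℂ × ℂ}
    (hp' : |p.2.im| < δ) :
    HasWirtinger (fun q => (χ q.2.im : ℂ)) p 0 (-(Complex.I / 2) * derivOne (CM.D χ p.2.im)) := by
  refine of_hasFDerivAt (Complex.ofRealCLM.hasFDerivAt.comp p
    ((χ.hasFDerivAt (mem_int_interval hp')).comp p ((Complex.imCLM.hasFDerivAt (x := p.2)).comp p
      (hasFDerivAt_snd (𝕜 := ℝ) (p := p))))) ?_ ?_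
  · simp
  · rw [derivOne_apply]
    simp only [ContinuousLinearMap.comp_apply, ContinuousLinearMap.coe_snd', Complex.imCLM_apply,
      Complex.one_im, Complex.I_im, map_zero, Complex.ofRealCLM_apply]
    ring

/-- `∂θ/∂z`. -/
def thetaZ (e : Coeffs d (m + 1) hδ) (p : ℂ × ℝ) : ℂ :=
  (∑ q : Index0 d, (q.1.1 * p.1 ^ (q.1.1 - 1) * conj p.1 ^ q.1.2 * e.1 q p.1 +
      p.1 ^ q.1.1 * conj p.1 ^ q.1.2 * wirtZ (CM.D (e.1 q) p.1))) +
    ∑ q : Index1 d, (q.1.1 * p.1 ^ (q.1.1 - 1) * conj p.1 ^ q.1.2.1 * (p.2 : ℂ) ^ q.1.2.2 *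
        e.2.1 q p +
      p.1 ^ q.1.1 * conj p.1 ^ q.1.2.1 * (p.2 : ℂ) ^ q.1.2.2 *
        wirtZ (restrFst (CM.D (e.2.1 q) p)))

/-- `∂θ/∂y`. -/
def thetaY (e : Coeffs d (m + 1) hδ) (p : ℂ × ℝ) : ℂ :=
  (∑ q : Index1 d, (p.1 ^ q.1.1 * conj p.1 ^ q.1.2.1 *
      (q.1.2.2 * (p.2 : ℂ) ^ (q.1.2.2 - 1)) * e.2.1 q p +
    p.1 ^ q.1.1 * conj p.1 ^ q.1.2.1 * (p.2 : ℂ) ^ q.1.2.2 * derivY (CM.D (e.2.1 q) p))) +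
    derivOne (CM.D e.2.2 p.2)

theorem hasWirtinger_theta (e : Coeffs d (m + 1) hδ) {p : ℂ × ℂ} (hp : ‖p.1‖ < δ)
    (hp' : |p.2.im| < δ) :
    HasWirtinger (fun q => theta e (q.1, q.2.im)) p (thetaZ e (p.1, p.2.im))
      (-(Complex.I / 2) * thetaY e (p.1, p.2.im)) := by
  have h0 : ∀ q ∈ (Finset.univ : Finset (Index0 d)), HasWirtinger
      (fun x : ℂ × ℂ => x.1 ^ q.1.1 * conj x.1 ^ q.1.2 * e.1 q x.1) p _ _ := fun q _ =>
    ((HasWirtinger.fst.pow q.1.1).mul (HasWirtinger.conj_fst.pow q.1.2)).mul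
      (HasWirtinger.comp_disc (e.1 q) hp)
  have h1 : ∀ q ∈ (Finset.univ : Finset (Index1 d)), HasWirtinger
      (fun x : ℂ × ℂ => x.1 ^ q.1.1 * conj x.1 ^ q.1.2.1 * (x.2.im : ℂ) ^ q.1.2.2 *
        e.2.1 q (x.1, x.2.im)) p _ _ := fun q _ =>
    (((HasWirtinger.fst.pow q.1.1).mul (HasWirtinger.conj_fst.pow q.1.2.1)).mul
      (HasWirtinger.im_snd.pow q.1.2.2)).mul (HasWirtinger.comp_discInterval (e.2.1 q) hp hp')
  refine (((HasWirtinger.sum h0).add (HasWirtinger.sum h1)).add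
    (HasWirtinger.comp_interval e.2.2 hp')).cast ?_ ?_
  · rw [thetaZ, add_zero]
    congr 1 <;> refine Finset.sum_congr rfl fun q _ => ?_ <;> ring
  · rw [thetaY, mul_add, Finset.mul_sum]
    congr 1
    rw [Finset.sum_eq_zero (s := (Finset.univ : Finset (Index0 d))), zero_add]
    · refine Finset.sum_congr rfl fun q _ => ?_
      ring
    · intro q _
      ring

/-- `∂P/∂z`. -/
def modelPolyZ (d k₀ : ℕ) (a : ℕ → ℂ) (z : ℂ) : ℂ :=
  ∑ j ∈ Finset.Icc (d - k₀) k₀, a j * (j * z ^ (j - 1)) * conj z ^ (d - j)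

theorem hasWirtinger_modelPoly (d k₀ : ℕ) (a : ℕ → ℂ) (p : ℂ × ℂ) :
    HasWirtinger (fun q => modelPoly d k₀ a q.1) p (modelPolyZ d k₀ a p.1) 0 := by
  refine (HasWirtinger.sum (s := Finset.Icc (d - k₀) k₀)
    (F := fun j q => a j * q.1 ^ j * conj q.1 ^ (d - j)) (p := p) fun j _ =>
    ((HasWirtinger.const (a j)).mul (HasWirtinger.fst.pow j)).mul
      (HasWirtinger.conj_fst.pow (d - j))).cast ?_ ?_
  · refine Finset.sum_congr rfl fun j _ => ?_
    ring
  · rw [Finset.sum_eq_zero]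
    intro j _
    ring

theorem modelPoly_im {k₀ : ℕ} {a : ℕ → ℂ} (h : IsModel d k₀ a) (z : ℂ) :
    (modelPoly d k₀ a z).im = 0 := by
  rw [← Complex.conj_eq_iff_im, modelPoly, map_sum]
  have hlt := h.lt
  refine Finset.sum_nbij' (fun j => d - j) (fun j => d - j) ?_ ?_ ?_ ?_ ?_
  · intro j hj
    rw [Finset.mem_Icc] at hj ⊢
    omega
  · intro j hj
    rw [Finset.mem_Icc] at hj ⊢
    omega
  · intro j hj
    rw [Finset.mem_Icc] at hj
    omega
  · intro j hj
    rw [Finset.mem_Icc] at hj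
    omega
  · intro j hj
    have h1 := h.symm j hj
    rw [Finset.mem_Icc] at hj
    rw [h1, map_mul, map_mul, Complex.conj_conj, map_pow, map_pow, Complex.conj_conj,
      show d - (d - j) = j by omega]
    ring

theorem ofReal_modelPoly_re {k₀ : ℕ} {a : ℕ → ℂ} (h : IsModel d k₀ a) (z : ℂ) :
    ((modelPoly d k₀ a z).re : ℂ) = modelPoly d k₀ a z :=
  Complex.ext rfl (modelPoly_im h z).symm

/-- The perturbation given by an admissible family of coefficients. -/
def mkPerturbation : ↥(admissible d m hδ) →L[ℝ] Perturbation d m hδ :=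
  (LinearMap.ker (thetaFun d m hδ)).mkQL

theorem exists_mkPerturbation (x : Perturbation d m hδ) :
    ∃ e, mkPerturbation e = x ∧ ‖e‖ ≤ 2 * ‖x‖ := by
  rcases eq_or_ne x 0 with rfl | hx
  · exact ⟨0, map_zero _, by simp⟩
  · have hx' : 0 < ‖x‖ := norm_pos_iff.2 hx
    obtain ⟨e, he, hle⟩ := Submodule.Quotient.norm_mk_lt (S := LinearMap.ker (thetaFun d m hδ)) x hx'
    exact ⟨e, he, hle.le.trans_eq (two_mul _).symm⟩

theorem toFun_mkPerturbation (e : ↥(admissible d m hδ)) {p : ℂ × ℝ}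
    (hp : p ∈ (discInterval hδ).carrier) : ((mkPerturbation e).toFun p : ℂ) = theta e.1 p := by
  have h1 : (mkPerturbation e).toFun p = (theta e.1 p).re := if_pos hp
  rw [h1]
  exact Complex.ext rfl (e.2.2 p hp).symm

theorem mem_bidisc {p : ℂ × ℂ} : p ∈ bidisc δ ↔ ‖p.1‖ < δ ∧ ‖p.2‖ < δ := by
  rw [bidisc, Set.mem_prod, mem_ball_zero_iff, mem_ball_zero_iff]

theorem isOpen_bidisc : IsOpen (bidisc δ) := Metric.isOpen_ball.prod Metric.isOpen_ball

theorem mem_discInterval_of_bidisc {p : ℂ × ℂ} (hp : p ∈ bidisc δ) :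
    (p.1, p.2.im) ∈ interior (discInterval hδ).carrier := by
  rw [mem_bidisc] at hp
  exact mem_int_discInterval hp.1 ((Complex.abs_im_le_norm _).trans_lt hp.2)

theorem ofReal_defFun {k₀ : ℕ} {a : ℕ → ℂ} (h : IsModel d k₀ a) (e : ↥(admissible d m hδ))
    {p : ℂ × ℂ} (hp : p ∈ bidisc δ) : (defFun k₀ a (mkPerturbation e) p : ℂ) =
      -1 * (p.2.re : ℂ) + modelPoly d k₀ a p.1 + theta e.1 (p.1, p.2.im) := by
  rw [defFun, rho, Complex.ofReal_add,
    toFun_mkPerturbation e (interior_subset (mem_discInterval_of_bidisc hp)), Complex.ofReal_add,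
    ofReal_modelPoly_re h]
  push_cast
  ring

theorem hasWirtinger_defFun {k₀ : ℕ} {a : ℕ → ℂ} (h : IsModel d k₀ a)
    (e : ↥(admissible d (m + 1) hδ)) {p : ℂ × ℂ} (hp : p ∈ bidisc δ) :
    HasWirtinger (fun q => (defFun k₀ a (mkPerturbation e) q : ℂ)) p
      (modelPolyZ d k₀ a p.1 + thetaZ e.1 (p.1, p.2.im))
      (-(1 / 2) * (1 + Complex.I * thetaY e.1 (p.1, p.2.im))) := by
  have hp' := mem_bidisc.1 hp
  have h1 := (((HasWirtinger.const (-1)).mul HasWirtinger.re_snd).add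
    (hasWirtinger_modelPoly d k₀ a p)).add
    (hasWirtinger_theta e.1 hp'.1 ((Complex.abs_im_le_norm _).trans_lt hp'.2))
  have h2 := h1.congr (g := fun q => (defFun k₀ a (mkPerturbation e) q : ℂ)) (by
    filter_upwards [isOpen_bidisc.mem_nhds hp] with q hq
    exact ofReal_defFun h e hq)
  refine h2.cast ?_ ?_ <;> ring

end Theta

end KStat

end

noncomputable section

namespace KStat

open Real Filter Topology ComplexConjugate

section Components

variable {k : ℕ} {α : ℝ} [Exponent α]

namespace Hol

/-- The exponential `e^{int}` as an element of `C^{k,α}`. -/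
def E (n : ℤ) : Hol k α ℂ := mk (ex n) (isHol_of_contDiff (periodic_ex n) (contDiff_ex n))

@[simp] theorem E_apply (n : ℤ) (t : ℝ) : (E n : Hol k α ℂ) t = ex n t := rfl

/-- Complex conjugation. -/
def cj : Hol k α ℂ →L[ℝ] Hol k α ℂ := mapL Complex.conjCLE.toContinuousLinearMap

@[simp] theorem cj_apply (u : Hol k α ℂ) (t : ℝ) : cj u t = conj (u t) := rfl

/-- Real functions as complex functions. -/
def ofR : Hol k α ℝ →L[ℝ] Hol k α ℂ := mapL Complex.ofRealCLM

@[simp] theorem ofR_apply (u : Hol k α ℝ) (t : ℝ) : ofR u t = (u t : ℂ) := rfl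

@[simp] theorem natCast_apply (n : ℕ) (t : ℝ) : (n : Hol k α ℂ) t = n := map_natCast (evalR t) n

/-- The function `1 - ζ`. -/
def sg : Hol k α ℂ := 1 - E 1

@[simp] theorem sg_apply (t : ℝ) : (sg : Hol k α ℂ) t = 1 - ex 1 t := rfl

theorem conj_sg_apply (t : ℝ) : conj ((sg : Hol k α ℂ) t) = -ex (-1) t * (sg : Hol k α ℂ) t := by
  rw [sg_apply, map_sub, map_one, conj_ex]
  linear_combination -ex_neg_mul 1 t

theorem fc_sg_mul (u : Hol k α ℂ) (n : ℤ) :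
    fc (sg * u : Hol k α ℂ) n = fc u n - fc u (n - 1) := by
  have h : (sg * u : Hol k α ℂ) = u - E 1 * u := by rw [sg, sub_mul, one_mul]
  rw [h, fc_sub]
  congr 1
  exact fc_ex_mul 1 u n

theorem isHolo_sg_mul {u : Hol k α ℂ} : IsHolo (sg * u) ↔ IsHolo u := by
  constructor
  · intro h n hn
    refine fc_eq_zero_of_const u.isHol.continuous (fun m hm => ?_) hn
    have h1 := h m hm
    rw [fc_sg_mul] at h1
    exact sub_eq_zero.1 h1
  · intro h n hn
    rw [fc_sg_mul, h n hn, h (n - 1) (by omega), sub_zero]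

theorem isHolo_sg_pow_mul {u : Hol k α ℂ} (n : ℕ) : IsHolo (sg ^ n * u) ↔ IsHolo u := by
  induction n with
  | zero => rw [pow_zero, one_mul]
  | succ n ih => rw [pow_succ', mul_assoc, isHolo_sg_mul, ih]

theorem eq_zero_of_sg_mul {u : Hol k α ℂ} (h : sg * u = 0) : u = 0 := by
  have h1 : ∀ n, fc u n = fc u (n - 1) := fun n => by
    have h2 := fc_sg_mul u n
    rw [h] at h2
    exact sub_eq_zero.1 (h2.symm.trans (fc_zero n))
  have h2 : ∀ n < (0 : ℤ), fc u n = 0 := fun n hn =>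
    fc_eq_zero_of_const u.isHol.continuous (fun m _ => h1 m) hn
  have h3 : ∀ m : ℕ, fc u m = 0 := by
    intro m
    induction m with
    | zero =>
      rw [h1]
      exact h2 _ (by simp)
    | succ m ih =>
      rw [h1]
      push_cast
      rw [add_sub_cancel_right]
      exact ih
  refine eq_of_fc fun n => ?_
  have h4 : fc (0 : Hol k α ℂ) n = 0 := fc_zero n
  rw [h4]
  rcases lt_or_ge n 0 with hn | hn
  · exact h2 n hn
  · obtain ⟨m, rfl⟩ := Int.eq_ofNat_of_zero_le hn
    exact h3 m

theorem sg_pow_mul_cancel {u v : Hol k α ℂ} (n : ℕ) (h : sg ^ n * u = sg ^ n * v) : u = v := by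
  induction n with
  | zero => rwa [pow_zero, one_mul, one_mul] at h
  | succ n ih =>
    refine ih ?_
    rw [pow_succ', mul_assoc, mul_assoc, ← sub_eq_zero, ← mul_sub] at h
    exact sub_eq_zero.1 (eq_zero_of_sg_mul h)

end Hol

open Hol

/-- The factor `h̃` of the first component. -/
def projH : Vec k α →L[ℝ] Hol k α ℂ :=
  (holo k α).subtypeL.comp ((ContinuousLinearMap.fst ℝ _ _).comp (ContinuousLinearMap.snd ℝ _ _))

/-- The factor `g̃` of the second component. -/
def projG : Vec k α →L[ℝ] Hol k α ℂ :=
  (holo k α).subtypeL.comp ((ContinuousLinearMap.snd ℝ _ _).comp (ContinuousLinearMap.snd ℝ _ _))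

/-- The function `c` as a complex function. -/
def projC : Vec k α →L[ℝ] Hol k α ℂ := ofR.comp (ContinuousLinearMap.fst ℝ _ _)

theorem projH_apply (v : Vec k α) : projH v = v.2.1.1 := rfl

theorem projG_apply (v : Vec k α) : projG v = v.2.2.1 := rfl

theorem projC_apply (v : Vec k α) : projC v = ofR v.1 := rfl

/-- The first component `h = (1 - ζ) h̃`. -/
def compH : Vec k α →L[ℝ] Hol k α ℂ := (ContinuousLinearMap.mul ℝ (Hol k α ℂ) sg).comp projH

/-- The second component `g = (1 - ζ) g̃`. -/
def compG : Vec k α →L[ℝ] Hol k α ℂ := (ContinuousLinearMap.mul ℝ (Hol k α ℂ) sg).comp projG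

/-- The function `h̄ / (1 - ζ)`. -/
def barH : Vec k α →L[ℝ] Hol k α ℂ :=
  (ContinuousLinearMap.mul ℝ (Hol k α ℂ) (-E (-1))).comp (cj.comp projH)

/-- The function `Im g`. -/
def imG : Vec k α →L[ℝ] Hol k α ℝ := (mapL Complex.imCLM).comp compG

/-- The function `Im g / (1 - ζ)`. -/
def imG' : Vec k α →L[ℝ] Hol k α ℂ :=
  (ContinuousLinearMap.mul ℝ (Hol k α ℂ) (const (-(Complex.I / 2)))).comp
    (projG + (ContinuousLinearMap.mul ℝ (Hol k α ℂ) (E (-1))).comp (cj.comp projG))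

/-- The curve `(h, Im g)`. -/
def curve : Vec k α →L[ℝ] Hol k α (ℂ × ℝ) :=
  (mapL (ContinuousLinearMap.inl ℝ ℂ ℝ)).comp compH +
    (mapL (ContinuousLinearMap.inr ℝ ℂ ℝ)).comp imG

variable (v : Vec k α) (t : ℝ)

theorem compH_apply : compH v t = (sg : Hol k α ℂ) t * projH v t := rfl

theorem compG_apply : compG v t = (sg : Hol k α ℂ) t * projG v t := rfl

theorem imG_apply : imG v t = (compG v t).im := rfl

theorem curve_apply : curve v t = (compH v t, imG v t) := by
  change ((compH v t, (0 : ℝ)) + ((0 : ℂ), imG v t)) = _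
  simp

theorem conj_compH : conj (compH v t) = (sg : Hol k α ℂ) t * barH v t := by
  have h : barH v t = -ex (-1) t * conj (projH v t) := rfl
  rw [compH_apply, map_mul, conj_sg_apply, h]
  ring

theorem ofReal_imG : (imG v t : ℂ) = (sg : Hol k α ℂ) t * imG' v t := by
  have h : imG' v t = -(Complex.I / 2) * (projG v t + ex (-1) t * conj (projG v t)) := rfl
  have h2 := Complex.sub_conj (compG v t)
  have h3 : (imG v t : ℂ) = (compG v t - conj (compG v t)) * (-(Complex.I / 2)) := by
    rw [h2, imG_apply]
    push_cast
    linear_combination ((compG v t).im : ℂ) * Complex.I_mul_I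
  rw [h3, compG_apply, map_mul, conj_sg_apply, h]
  ring

theorem discOf_exp : discOf (toY v) (Circle.exp t) = (compH v t, compG v t) := by
  have h1 : (sg : Hol k α ℂ) t = 1 - (Circle.exp t : ℂ) := by
    rw [sg_apply, ex_eq_zpow, zpow_one]
  rw [compH_apply, compG_apply, h1, projH_apply, projG_apply, ← toTied_factor, ← toTied_factor]
  rfl

/-- The domain of the equations. -/
def domain (k : ℕ) (α δ : ℝ) [Exponent α] : Set (Vec k α) :=
  {v | (∀ t, (compH v t, compG v t) ∈ bidisc δ) ∧ ∀ t, v.1 t ≠ 0}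

theorem isOpen_domain (δ : ℝ) : IsOpen (domain k α δ) := by
  have h1 : IsOpen {v : Vec k α | ∀ t, compH v t ∈ Metric.ball (0 : ℂ) δ} :=
    (isOpen_setOf_forall_mem (k := k) (α := α) Metric.isOpen_ball).preimage compH.continuous
  have h2 : IsOpen {v : Vec k α | ∀ t, compG v t ∈ Metric.ball (0 : ℂ) δ} :=
    (isOpen_setOf_forall_mem (k := k) (α := α) Metric.isOpen_ball).preimage compG.continuous
  have h3 : IsOpen {v : Vec k α | ∀ t, v.1 t ∈ ({0}ᶜ : Set ℝ)} :=
    (isOpen_setOf_forall_mem (k := k) (α := α) isOpen_compl_singleton).preimage continuous_fst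
  have h4 : domain k α δ = {v : Vec k α | ∀ t, compH v t ∈ Metric.ball (0 : ℂ) δ} ∩
      {v : Vec k α | ∀ t, compG v t ∈ Metric.ball (0 : ℂ) δ} ∩
      {v : Vec k α | ∀ t, v.1 t ∈ ({0}ᶜ : Set ℝ)} := by
    ext v
    exact ⟨fun h => ⟨⟨fun t => (h.1 t).1, fun t => (h.1 t).2⟩, h.2⟩,
      fun h => ⟨fun t => ⟨h.1.1 t, h.1.2 t⟩, h.2⟩⟩
  rw [h4]
  exact (h1.inter h2).inter h3

variable {d : ℕ} {δ : ℝ} {hδ : 0 < δ} {v}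

theorem compH_mem (hv : v ∈ domain k α δ) : compH v ∈ curvesInt k α (closedDisc hδ) := fun t =>
  mem_int_closedDisc (mem_bidisc.1 (hv.1 t)).1

theorem imG_mem (hv : v ∈ domain k α δ) : imG v ∈ curvesInt k α (interval hδ) := fun t =>
  mem_int_interval ((Complex.abs_im_le_norm _).trans_lt (mem_bidisc.1 (hv.1 t)).2)

theorem curve_mem (hv : v ∈ domain k α δ) : curve v ∈ curvesInt k α (discInterval hδ) := fun t => by
  rw [curve_apply]
  exact mem_discInterval_of_bidisc (hv.1 t)

/-- `P(h) / (1 - ζ)`. -/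
def modelW (d k₀ : ℕ) (a : ℕ → ℂ) (v : Vec k α) : Hol k α ℂ :=
  sg ^ (d - 1) * ∑ j ∈ Finset.Icc (d - k₀) k₀, const (a j) * projH v ^ j * barH v ^ (d - j)

/-- `P_z(h) / (1 - ζ)^{d - 1}`. -/
def modelB (d k₀ : ℕ) (a : ℕ → ℂ) (v : Vec k α) : Hol k α ℂ :=
  ∑ j ∈ Finset.Icc (d - k₀) k₀, const (a j) * ((j : Hol k α ℂ) * projH v ^ (j - 1)) * barH v ^ (d - j)

/-- `θ(h, Im g) / (1 - ζ)`. -/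
def pertW (e : Coeffs d (k + 3) hδ) (v : Vec k α) : Hol k α ℂ :=
  (∑ q : Index0 d, sg ^ d * projH v ^ q.1.1 * barH v ^ q.1.2 *
      comp (CM.J (CM.J (e.1 q))) (compH v)) +
    (∑ q : Index1 d, sg ^ (d - 1) * projH v ^ q.1.1 * barH v ^ q.1.2.1 * imG' v ^ q.1.2.2 *
      comp (CM.J (CM.J (e.2.1 q))) (curve v)) +
    imG' v * mapL derivOne (quot e.2.2 (imG v))

/-- `θ_z(h, Im g) / (1 - ζ)^{d - 1}`. -/
def pertB (e : Coeffs d (k + 3) hδ) (v : Vec k α) : Hol k α ℂ :=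
  (∑ q : Index0 d, (sg * ((q.1.1 : Hol k α ℂ) * projH v ^ (q.1.1 - 1)) * barH v ^ q.1.2 *
      comp (CM.J (CM.J (e.1 q))) (compH v) +
    sg ^ 2 * projH v ^ q.1.1 * barH v ^ q.1.2 *
      mapL wirtZ (comp (CM.J (CM.D (e.1 q))) (compH v)))) +
    ∑ q : Index1 d, (((q.1.1 : Hol k α ℂ) * projH v ^ (q.1.1 - 1)) * barH v ^ q.1.2.1 * imG' v ^ q.1.2.2 *
      comp (CM.J (CM.J (e.2.1 q))) (curve v) +
    sg * projH v ^ q.1.1 * barH v ^ q.1.2.1 * imG' v ^ q.1.2.2 *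
      mapL (wirtZ.comp restrFst) (comp (CM.J (CM.D (e.2.1 q))) (curve v)))

/-- `θ_y(h, Im g)`. -/
def pertY (e : Coeffs d (k + 3) hδ) (v : Vec k α) : Hol k α ℂ :=
  (∑ q : Index1 d, (compH v ^ q.1.1 * cj (compH v) ^ q.1.2.1 *
      ((q.1.2.2 : Hol k α ℂ) * ofR (imG v) ^ (q.1.2.2 - 1)) * comp (CM.J (CM.J (e.2.1 q))) (curve v) +
    compH v ^ q.1.1 * cj (compH v) ^ q.1.2.1 * ofR (imG v) ^ q.1.2.2 *
      mapL derivY (comp (CM.J (CM.D (e.2.1 q))) (curve v)))) +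
    mapL derivOne (comp (CM.J (CM.D e.2.2)) (imG v))

theorem sg_mul_modelW (d k₀ : ℕ) (a : ℕ → ℂ) (hd : k₀ < d) (v : Vec k α) (t : ℝ) :
    (sg : Hol k α ℂ) t * modelW d k₀ a v t = modelPoly d k₀ a (compH v t) := by
  simp only [modelW, modelPoly, Hol.mul_apply, Hol.pow_apply, Hol.sum_apply, Hol.const_apply]
  rw [← mul_assoc, ← pow_succ', Nat.sub_add_cancel (by omega), Finset.mul_sum]
  refine Finset.sum_congr rfl fun j hj => ?_
  rw [Finset.mem_Icc] at hj
  rw [conj_compH, compH_apply]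
  nth_rewrite 1 [show d = j + (d - j) by omega]
  rw [pow_add]
  ring

theorem sg_mul_modelB (d k₀ : ℕ) (a : ℕ → ℂ) (hd : k₀ < d) (v : Vec k α) (t : ℝ) :
    (sg : Hol k α ℂ) t ^ (d - 1) * modelB d k₀ a v t = modelPolyZ d k₀ a (compH v t) := by
  simp only [modelB, modelPolyZ, Hol.mul_apply, Hol.pow_apply, Hol.sum_apply, Hol.const_apply, Hol.natCast_apply]
  rw [Finset.mul_sum]
  refine Finset.sum_congr rfl fun j hj => ?_
  rw [Finset.mem_Icc] at hj
  rw [conj_compH, compH_apply]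
  nth_rewrite 1 [show d - 1 = (j - 1) + (d - j) by omega]
  rw [pow_add]
  ring

theorem sg_mul_pertW (e : Coeffs d (k + 3) hδ) (h0 : e.2.2 0 = 0) (hd : 0 < d)
    (hv : v ∈ domain k α δ) (t : ℝ) :
    (sg : Hol k α ℂ) t * pertW e v t = theta e (compH v t, imG v t) := by
  have hH := curvesInt_subset (compH_mem (hδ := hδ) hv)
  have hC := curvesInt_subset (curve_mem (hδ := hδ) hv)
  have hI := curvesInt_subset (imG_mem (hδ := hδ) hv)
  simp only [pertW, theta, Hol.mul_apply, Hol.pow_apply, Hol.sum_apply, Hol.add_apply, mapL_apply,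
    comp_apply convex_closedDisc _ hH, comp_apply convex_discInterval _ hC, CM.J_apply, curve_apply]
  rw [mul_add, mul_add, Finset.mul_sum, Finset.mul_sum]
  congr 1
  · congr 1
    · refine Finset.sum_congr rfl fun q _ => ?_
      have hq := (Finset.mem_filter.1 q.2).2
      rw [conj_compH, compH_apply]
      have h1 : (sg : Hol k α ℂ) t * (sg : Hol k α ℂ) t ^ d =
          (sg : Hol k α ℂ) t ^ q.1.1 * (sg : Hol k α ℂ) t ^ q.1.2 := by
        rw [← pow_succ', ← pow_add, hq]
      linear_combination (projH v t ^ q.1.1 * barH v t ^ q.1.2 *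
        e.1 q ((sg : Hol k α ℂ) t * projH v t)) * h1
    · refine Finset.sum_congr rfl fun q _ => ?_
      have hq := (Finset.mem_filter.1 q.2).2
      rw [conj_compH, ofReal_imG, compH_apply]
      have h1 : (sg : Hol k α ℂ) t * (sg : Hol k α ℂ) t ^ (d - 1) =
          (sg : Hol k α ℂ) t ^ q.1.1 * (sg : Hol k α ℂ) t ^ q.1.2.1 *
            (sg : Hol k α ℂ) t ^ q.1.2.2 := by
        rw [← pow_succ', Nat.sub_add_cancel hd, ← pow_add, ← pow_add, hq]
      linear_combination (projH v t ^ q.1.1 * barH v t ^ q.1.2.1 * imG' v t ^ q.1.2.2 *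
        e.2.1 q ((sg : Hol k α ℂ) t * projH v t, imG v t)) * h1
  · rw [← mul_assoc, ← ofReal_imG, derivOne_apply, ← Complex.ofReal_mul]
    have h1 := quot_apply convex_interval (mem_int_interval (by simpa using hδ)) e.2.2 hI t
    rw [h0, sub_zero] at h1
    rw [← h1, ← smul_eq_mul, ← map_smul, smul_eq_mul, mul_one]

theorem pertY_apply (e : Coeffs d (k + 3) hδ) (hv : v ∈ domain k α δ) (t : ℝ) :
    pertY e v t = thetaY e (compH v t, imG v t) := by
  have hC := curvesInt_subset (curve_mem (hδ := hδ) hv)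
  have hI := curvesInt_subset (imG_mem (hδ := hδ) hv)
  simp only [pertY, thetaY, Hol.mul_apply, Hol.pow_apply, Hol.sum_apply, Hol.add_apply, mapL_apply, Hol.natCast_apply,
    comp_apply convex_discInterval _ hC, comp_apply convex_interval _ hI, CM.J_apply, curve_apply,
    cj_apply, ofR_apply]

theorem sg_mul_pertB (e : Coeffs d (k + 3) hδ) (hd : 0 < d) (hv : v ∈ domain k α δ) (t : ℝ) :
    (sg : Hol k α ℂ) t ^ (d - 1) * pertB e v t = thetaZ e (compH v t, imG v t) := by
  have hH := curvesInt_subset (compH_mem (hδ := hδ) hv)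
  have hC := curvesInt_subset (curve_mem (hδ := hδ) hv)
  simp only [pertB, thetaZ, Hol.mul_apply, Hol.pow_apply, Hol.sum_apply, Hol.add_apply, mapL_apply, Hol.natCast_apply,
    comp_apply convex_closedDisc _ hH, comp_apply convex_discInterval _ hC, CM.J_apply, curve_apply,
    ContinuousLinearMap.comp_apply]
  obtain ⟨s, hs⟩ : ∃ s, s = (sg : Hol k α ℂ) t := ⟨_, rfl⟩
  rw [mul_add, Finset.mul_sum, Finset.mul_sum]
  congr 1
  · refine Finset.sum_congr rfl fun q _ => ?_
    have hq := (Finset.mem_filter.1 q.2).2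
    rw [conj_compH, compH_apply, ← hs]
    have h1 : s ^ (d - 1) * s ^ 2 = s ^ q.1.1 * s ^ q.1.2 := by
      rw [← pow_add, ← pow_add]
      congr 1
      omega
    have h2 : (q.1.1 : ℂ) * (s ^ (d - 1) * s) = q.1.1 * (s ^ (q.1.1 - 1) * s ^ q.1.2) := by
      rcases Nat.eq_zero_or_pos q.1.1 with h | h
      · rw [h]
        simp
      · rw [← pow_succ, ← pow_add]
        congr 2
        omega
    linear_combination (projH v t ^ q.1.1 * barH v t ^ q.1.2 *
      wirtZ (CM.D (e.1 q) (s * projH v t))) * h1 +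
      (projH v t ^ (q.1.1 - 1) * barH v t ^ q.1.2 * e.1 q (s * projH v t)) * h2
  · refine Finset.sum_congr rfl fun q _ => ?_
    have hq := (Finset.mem_filter.1 q.2).2
    rw [conj_compH, ofReal_imG, compH_apply, ← hs]
    have h1 : s ^ (d - 1) * s = s ^ q.1.1 * s ^ q.1.2.1 * s ^ q.1.2.2 := by
      rw [← pow_succ, Nat.sub_add_cancel hd, ← pow_add, ← pow_add, hq]
    have h2 : (q.1.1 : ℂ) * s ^ (d - 1) =
        q.1.1 * (s ^ (q.1.1 - 1) * s ^ q.1.2.1 * s ^ q.1.2.2) := by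
      rcases Nat.eq_zero_or_pos q.1.1 with h | h
      · rw [h]
        simp
      · rw [← pow_add, ← pow_add]
        congr 2
        omega
    linear_combination (projH v t ^ q.1.1 * barH v t ^ q.1.2.1 * imG' v t ^ q.1.2.2 *
      wirtZ (restrFst (CM.D (e.2.1 q) (s * projH v t, imG v t)))) * h1 +
      (projH v t ^ (q.1.1 - 1) * barH v t ^ q.1.2.1 * imG' v t ^ q.1.2.2 *
        e.2.1 q (s * projH v t, imG v t)) * h2

end Components

section Smooth

open Hol

variable {k : ℕ} {α : ℝ} [Exponent α] {d : ℕ} {δ : ℝ} {hδ : 0 < δ}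

theorem contDiffOn_superpose {E F : Type} [NormedAddCommGroup E] [NormedSpace ℝ E]
    [NormedAddCommGroup F] [NormedSpace ℝ F] [CompleteSpace F] {K : CompactDomain E}
    (hK : Convex ℝ K.carrier) {B : Type*} [NormedAddCommGroup B] [NormedSpace ℝ B]
    (L : B →L[ℝ] CM (k + 2) K F) (p : Vec k α →L[ℝ] Hol k α E) {O : Set (Vec k α)}
    (hp : ∀ v ∈ O, p v ∈ curvesInt k α K) :
    ContDiffOn ℝ 1 (fun x : B × Vec k α => comp (CM.J (L x.1)) (p x.2)) (Set.univ ×ˢ O) :=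
  (contDiffOn_comp hK).comp (f := fun x : B × Vec k α => (L x.1, p x.2))
    ((L.prodMap p).contDiff.contDiffOn) fun x hx => hp x.2 hx.2

theorem contDiffOn_quot_comp {E F : Type} [NormedAddCommGroup E] [NormedSpace ℝ E]
    [NormedAddCommGroup F] [NormedSpace ℝ F] [CompleteSpace F] {K : CompactDomain E}
    (hK : Convex ℝ K.carrier) (h0 : 0 ∈ interior K.carrier) {B : Type*} [NormedAddCommGroup B]
    [NormedSpace ℝ B] (L : B →L[ℝ] CM (k + 3) K F) (p : Vec k α →L[ℝ] Hol k α E)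
    {O : Set (Vec k α)} (hp : ∀ v ∈ O, p v ∈ curvesInt k α K) :
    ContDiffOn ℝ 1 (fun x : B × Vec k α => quot (L x.1) (p x.2)) (Set.univ ×ˢ O) :=
  (contDiffOn_quot hK h0).comp (f := fun x : B × Vec k α => (L x.1, p x.2))
    ((L.prodMap p).contDiff.contDiffOn) fun x hx => hp x.2 hx.2

/-- The coefficient `r_{ij0}`. -/
def coeff0 (q : Index0 d) : Coeffs d (k + 3) hδ →L[ℝ] CM (k + 3) (closedDisc hδ) ℂ :=
  (ContinuousLinearMap.proj q).comp (ContinuousLinearMap.fst ℝ _ _)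

/-- The coefficient `r_{ijl}`. -/
def coeff1 (q : Index1 d) : Coeffs d (k + 3) hδ →L[ℝ] CM (k + 3) (discInterval hδ) ℂ :=
  (ContinuousLinearMap.proj q).comp
    ((ContinuousLinearMap.fst ℝ _ _).comp (ContinuousLinearMap.snd ℝ _ _))

/-- The coefficient `θ₁`. -/
def coeff2 : Coeffs d (k + 3) hδ →L[ℝ] CM (k + 3) (interval hδ) ℝ :=
  (ContinuousLinearMap.snd ℝ _ _).comp (ContinuousLinearMap.snd ℝ _ _)

theorem contDiff_clm_snd {B F : Type*} [NormedAddCommGroup B] [NormedSpace ℝ B]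
    [NormedAddCommGroup F] [NormedSpace ℝ F] (p : Vec k α →L[ℝ] F) {s : Set (B × Vec k α)} :
    ContDiffOn ℝ 1 (fun x : B × Vec k α => p x.2) s :=
  (p.contDiff.comp contDiff_snd).contDiffOn

theorem contDiffOn_comp0 (q : Index0 d) : ContDiffOn ℝ 1
    (fun x : Coeffs d (k + 3) hδ × Vec k α => comp (CM.J (CM.J (x.1.1 q))) (compH x.2))
    (Set.univ ×ˢ domain k α δ) :=
  contDiffOn_superpose convex_closedDisc (CM.J.comp (coeff0 q)) compH fun _ hv => compH_mem hv

theorem contDiffOn_comp1 (q : Index1 d) : ContDiffOn ℝ 1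
    (fun x : Coeffs d (k + 3) hδ × Vec k α => comp (CM.J (CM.J (x.1.2.1 q))) (curve x.2))
    (Set.univ ×ˢ domain k α δ) :=
  contDiffOn_superpose convex_discInterval (CM.J.comp (coeff1 q)) curve fun _ hv => curve_mem hv

theorem contDiffOn_modelW (d k₀ : ℕ) (a : ℕ → ℂ) {s : Set (Coeffs d (k + 3) hδ × Vec k α)} :
    ContDiffOn ℝ 1 (fun x : Coeffs d (k + 3) hδ × Vec k α => modelW d k₀ a x.2) s :=
  contDiffOn_const.mul (ContDiffOn.sum fun j _ => (contDiffOn_const.mul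
    ((contDiff_clm_snd projH).pow j)).mul ((contDiff_clm_snd barH).pow (d - j)))

theorem contDiffOn_modelB (d k₀ : ℕ) (a : ℕ → ℂ) {s : Set (Coeffs d (k + 3) hδ × Vec k α)} :
    ContDiffOn ℝ 1 (fun x : Coeffs d (k + 3) hδ × Vec k α => modelB d k₀ a x.2) s :=
  ContDiffOn.sum fun j _ => (contDiffOn_const.mul (contDiffOn_const.mul
    ((contDiff_clm_snd projH).pow (j - 1)))).mul ((contDiff_clm_snd barH).pow (d - j))

theorem contDiffOn_pertW : ContDiffOn ℝ 1
    (fun x : Coeffs d (k + 3) hδ × Vec k α => pertW x.1 x.2) (Set.univ ×ˢ domain k α δ) := by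
  refine ((ContDiffOn.sum fun q _ => ?_).add (ContDiffOn.sum fun q _ => ?_)).add ?_
  · exact ((contDiffOn_const.mul ((contDiff_clm_snd projH).pow _)).mul
      ((contDiff_clm_snd barH).pow _)).mul (contDiffOn_comp0 q)
  · exact (((contDiffOn_const.mul ((contDiff_clm_snd projH).pow _)).mul
      ((contDiff_clm_snd barH).pow _)).mul ((contDiff_clm_snd imG').pow _)).mul (contDiffOn_comp1 q)
  · refine (contDiff_clm_snd imG').mul ((mapL derivOne).contDiff.comp_contDiffOn ?_)
    exact contDiffOn_quot_comp convex_interval (mem_int_interval (by simpa using hδ)) coeff2 imG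
      fun _ hv => imG_mem hv

theorem contDiffOn_pertB : ContDiffOn ℝ 1
    (fun x : Coeffs d (k + 3) hδ × Vec k α => pertB x.1 x.2) (Set.univ ×ˢ domain k α δ) := by
  refine (ContDiffOn.sum fun q _ => ?_).add (ContDiffOn.sum fun q _ => ?_)
  · refine ((((contDiffOn_const.mul (contDiffOn_const.mul ((contDiff_clm_snd projH).pow _))).mul
      ((contDiff_clm_snd barH).pow _)).mul (contDiffOn_comp0 q))).add
      (((contDiffOn_const.mul ((contDiff_clm_snd projH).pow _)).mul
      ((contDiff_clm_snd barH).pow _)).mul ((mapL wirtZ).contDiff.comp_contDiffOn ?_))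
    exact contDiffOn_superpose convex_closedDisc (CM.D.comp (coeff0 q)) compH
      fun _ hv => compH_mem hv
  · refine (((((contDiffOn_const.mul ((contDiff_clm_snd projH).pow _))).mul
      ((contDiff_clm_snd barH).pow _)).mul ((contDiff_clm_snd imG').pow _)).mul
      (contDiffOn_comp1 q)).add
      ((((contDiffOn_const.mul ((contDiff_clm_snd projH).pow _)).mul
      ((contDiff_clm_snd barH).pow _)).mul ((contDiff_clm_snd imG').pow _)).mul
      ((mapL (wirtZ.comp restrFst)).contDiff.comp_contDiffOn ?_))
    exact contDiffOn_superpose convex_discInterval (CM.D.comp (coeff1 q)) curve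
      fun _ hv => curve_mem hv

theorem contDiffOn_pertY : ContDiffOn ℝ 1
    (fun x : Coeffs d (k + 3) hδ × Vec k α => pertY x.1 x.2) (Set.univ ×ˢ domain k α δ) := by
  have hb : ∀ n, ContDiffOn ℝ 1
      (fun x : Coeffs d (k + 3) hδ × Vec k α => cj (compH x.2) ^ n) (Set.univ ×ˢ domain k α δ) :=
    fun n => (contDiff_clm_snd (cj.comp compH)).pow n
  have hy : ∀ n, ContDiffOn ℝ 1
      (fun x : Coeffs d (k + 3) hδ × Vec k α => ofR (imG x.2) ^ n) (Set.univ ×ˢ domain k α δ) :=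
    fun n => (contDiff_clm_snd (ofR.comp imG)).pow n
  refine (ContDiffOn.sum fun q _ => ?_).add ?_
  · refine (((((contDiff_clm_snd compH).pow _).mul (hb _)).mul (contDiffOn_const.mul (hy _))).mul
      (contDiffOn_comp1 q)).add (((((contDiff_clm_snd compH).pow _).mul (hb _)).mul (hy _)).mul
      ((mapL derivY).contDiff.comp_contDiffOn ?_))
    exact contDiffOn_superpose convex_discInterval (CM.D.comp (coeff1 q)) curve
      fun _ hv => curve_mem hv
  · refine (mapL derivOne).contDiff.comp_contDiffOn ?_
    exact contDiffOn_superpose convex_interval (CM.D.comp coeff2) imG fun _ hv => imG_mem hv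

end Smooth

end KStat

end

noncomputable section

namespace KStat

open Real Filter Topology ComplexConjugate

section Equations

open Hol

variable {k : ℕ} {α : ℝ} [Exponent α]

namespace Hol

theorem fc_E_mul (m : ℤ) (u : Hol k α ℂ) (n : ℤ) : fc (E m * u : Hol k α ℂ) n = fc u (n - m) :=
  fc_ex_mul m u n

theorem fc_cj (u : Hol k α ℂ) (n : ℤ) : fc (cj u) n = conj (fc u (-n)) := fc_conj u n

theorem isHolo_smul {c : ℝ} (hc : c ≠ 0) {u : Hol k α ℂ} : IsHolo (c • u) ↔ IsHolo u := by
  have hc' : (c : ℂ) ≠ 0 := by exact_mod_cast hc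
  refine forall_congr' fun n => forall_congr' fun _ => ?_
  rw [fc_smul, mul_eq_zero, or_iff_right hc']

/-- Riemann-Hilbert problem for a real right hand side. -/
theorem re_sg_mul_eq_iff {g W : Hol k α ℂ} (hg : IsHolo g)
    (hW : ∀ t, ((sg : Hol k α ℂ) t * W t).im = 0) :
    (∀ t, (((sg : Hol k α ℂ) t * g t).re : ℂ) = (sg : Hol k α ℂ) t * W t) ↔
      g = (2 : ℝ) • szego W := by
  have h1 : E (-1) * cj W = -W := by
    rw [eq_neg_iff_add_eq_zero, add_comm]
    refine eq_zero_of_sg_mul ?_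
    ext t
    have h2 := Complex.conj_eq_iff_im.2 (hW t)
    rw [map_mul, conj_sg_apply] at h2
    rw [Hol.mul_apply, Hol.add_apply, Hol.mul_apply, E_apply, cj_apply, Hol.zero_apply]
    linear_combination -h2
  have hWn : ∀ n, conj (fc W (-(n + 1))) = -fc W n := by
    intro n
    have h2 := fc_E_mul (-1) (cj W) n
    rw [h1, fc_cj, sub_neg_eq_add] at h2
    rw [← h2]
    exact fc_neg W n
  have h3 : (∀ t, (((sg : Hol k α ℂ) t * g t).re : ℂ) = (sg : Hol k α ℂ) t * W t) ↔
      g - E (-1) * cj g = (2 : ℝ) • W := by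
    have h4 : ∀ t, (((sg : Hol k α ℂ) t * g t).re : ℂ) =
        (sg : Hol k α ℂ) t * (g t - ex (-1) t * conj (g t)) / 2 := by
      intro t
      rw [Complex.re_eq_add_conj, map_mul, conj_sg_apply]
      ring
    constructor
    · intro h
      refine sg_pow_mul_cancel 1 ?_
      ext t
      have h5 := h t
      rw [h4] at h5
      rw [pow_one, Hol.mul_apply, Hol.mul_apply, Hol.sub_apply, Hol.mul_apply, E_apply, cj_apply,
        Hol.smul_apply, Complex.real_smul, Complex.ofReal_ofNat]
      linear_combination 2 * h5
    · intro h t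
      have h5 := congrArg (fun u : Hol k α ℂ => u t) h
      simp only [Hol.sub_apply, Hol.mul_apply, E_apply, cj_apply, Hol.smul_apply,
        Complex.real_smul, Complex.ofReal_ofNat] at h5
      rw [h4, h5]
      ring
  rw [h3]
  have hfc : ∀ n, fc (g - E (-1) * cj g : Hol k α ℂ) n = fc g n - conj (fc g (-(n + 1))) := by
    intro n
    rw [fc_sub, fc_E_mul, fc_cj, sub_neg_eq_add]
  constructor
  · intro h
    refine eq_of_fc fun n => ?_
    have h4 := hfc n
    rw [h, fc_smul] at h4
    rw [fc_smul, fc_szego]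
    split_ifs with hn
    · rw [hg (-(n + 1)) (by omega), map_zero, sub_zero] at h4
      exact h4.symm
    · rw [hg n (by omega), mul_zero]
  · intro h
    have hgn : ∀ n, 0 ≤ n → fc g n = 2 * fc W n := by
      intro n hn
      rw [h, fc_smul, fc_szego, if_pos hn, Complex.ofReal_ofNat]
    refine eq_of_fc fun n => ?_
    rw [hfc, fc_smul, Complex.ofReal_ofNat]
    rcases lt_or_ge n 0 with hn | hn
    · rw [hg n hn, hgn _ (by omega), map_mul, hWn, Complex.conj_ofNat]
      ring
    · rw [hg (-(n + 1)) (by omega), map_zero, sub_zero, hgn n hn]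

end Hol

theorem isDisc_iff_isHolo {u : Circle → ℂ} {v : Hol k α ℂ} (h : ∀ t, v t = u (Circle.exp t)) :
    IsDisc k α u ↔ IsHolo v := by
  rw [isDisc_iff]
  constructor
  · rintro ⟨w, hw, hwu⟩
    have e : v = w := by
      ext t
      rw [h, hwu]
    rwa [e]
  · intro hv
    exact ⟨v, hv, h⟩

theorem continuous_toHolder (v : Hol k α ℝ) : Continuous (toHolder v : Circle → ℝ) := by
  have h : IsQuotientMap Circle.exp := isLocalHomeomorph_circleExp.isOpenMap.isQuotientMap
    Circle.exp.continuous fun ζ => ⟨_, Circle.exp_arg ζ⟩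
  rw [h.continuous_iff]
  have e : (toHolder v : Circle → ℝ) ∘ Circle.exp = v := funext (toHolder_apply v)
  rw [e]
  exact v.isHol.continuous

theorem forall_circle {p : Circle → Prop} : (∀ ζ, p ζ) ↔ ∀ t : ℝ, p (Circle.exp t) :=
  ⟨fun h t => h _, fun h ζ => by rw [← Circle.exp_arg ζ]; exact h _⟩

variable {d : ℕ} {δ : ℝ} {hδ : 0 < δ} {k₀ : ℕ} {a : ℕ → ℂ}

/-- `(P + θ)(h, Im g) / (1 - ζ)`. -/
def totW (k₀ : ℕ) (a : ℕ → ℂ) (e : Coeffs d (k + 3) hδ) (v : Vec k α) : Hol k α ℂ :=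
  modelW d k₀ a v + pertW e v

/-- `(P_z + θ_z)(h, Im g) / (1 - ζ)^{d - 1}`. -/
def totB (k₀ : ℕ) (a : ℕ → ℂ) (e : Coeffs d (k + 3) hδ) (v : Vec k α) : Hol k α ℂ :=
  modelB d k₀ a v + pertB e v

theorem admissible_zero (e : ↥(admissible d (k + 3) hδ)) : e.1.2.2 0 = 0 := by
  have h := e.2.1.eq_zero_imp.self_of_nhds
  exact h (by simp)

theorem sg_mul_totW (h : IsModel d k₀ a) (e : ↥(admissible d (k + 3) hδ)) {v : Vec k α}
    (hv : v ∈ domain k α δ) (t : ℝ) : (sg : Hol k α ℂ) t * totW k₀ a e.1 v t =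
      ((defFun k₀ a (mkPerturbation e) (compH v t, compG v t) + (compG v t).re : ℝ) : ℂ) := by
  rw [Complex.ofReal_add, ofReal_defFun h e (hv.1 t), totW, Hol.add_apply, mul_add,
    sg_mul_modelW d k₀ a h.lt, sg_mul_pertW e.1 (admissible_zero e) (by have := h.lt; omega) hv,
    imG_apply]
  ring

theorem sg_mul_totB (h : IsModel d k₀ a) (e : ↥(admissible d (k + 3) hδ)) {v : Vec k α}
    (hv : v ∈ domain k α δ) (t : ℝ) : (sg : Hol k α ℂ) t ^ (d - 1) * totB k₀ a e.1 v t =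
      wirtinger (fun p => (defFun k₀ a (mkPerturbation e) p : ℂ)) (compH v t, compG v t) (1, 0) := by
  rw [(hasWirtinger_defFun h e (hv.1 t)).2.1, totB, Hol.add_apply, mul_add,
    sg_mul_modelB d k₀ a h.lt, sg_mul_pertB e.1 (by have := h.lt; omega) hv, imG_apply]

theorem one_add_pertY (h : IsModel d k₀ a) (e : ↥(admissible d (k + 3) hδ)) {v : Vec k α}
    (hv : v ∈ domain k α δ) (t : ℝ) : -(1 / 2) * (1 + Complex.I * pertY e.1 v t) =
      wirtinger (fun p => (defFun k₀ a (mkPerturbation e) p : ℂ)) (compH v t, compG v t) (0, 1) := by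
  rw [(hasWirtinger_defFun h e (hv.1 t)).2.2, pertY_apply e.1 hv, imG_apply]

/-- The lifts of stationary discs as the solutions of three equations. -/
theorem mem_tiedLifts_iff (h : IsModel d k₀ a) (e : ↥(admissible d (k + 3) hδ)) {v : Vec k α}
    (hv : v ∈ domain k α δ) :
    toY v ∈ tiedLifts k α k₀ (bidisc δ) (defFun k₀ a (mkPerturbation e)) ↔
      projG v = (2 : ℝ) • szego (totW k₀ a e.1 v) ∧
      IsHolo (E k₀ * projC v * (1 + const Complex.I * pertY e.1 v)) ∧
      IsHolo (E k₀ * projC v * totB k₀ a e.1 v) := by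
  obtain ⟨r, hr⟩ : ∃ r, r = defFun k₀ a (mkPerturbation e) := ⟨_, rfl⟩
  have hc : ∀ t, (toY v).1 (Circle.exp t) = v.1 t := toHolder_apply v.1
  have e1 : (∀ ζ, discOf (toY v) ζ ∈ bidisc δ ∧ r (discOf (toY v) ζ) = 0) ↔
      projG v = (2 : ℝ) • szego (totW k₀ a e.1 v) := by
    rw [← re_sg_mul_eq_iff (g := projG v) (mem_holo.1 v.2.2.2) fun t => by
      rw [sg_mul_totW h e hv, Complex.ofReal_im], forall_circle]
    refine forall_congr' fun t => ?_
    rw [discOf_exp, and_iff_right (hv.1 t), sg_mul_totW h e hv, Complex.ofReal_inj, ← compG_apply,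
      ← hr]
    constructor
    · intro h1
      rw [h1, zero_add]
    · intro h1
      linarith
  have e2 : IsDisc k α (fun ζ => (ζ : ℂ) ^ k₀ * ((toY v).1 ζ : ℂ) *
      wirtinger (fun p => (r p : ℂ)) (discOf (toY v) ζ) (1, 0)) ↔
      IsHolo (E k₀ * projC v * totB k₀ a e.1 v) := by
    rw [← isHolo_sg_pow_mul (d - 1)]
    refine isDisc_iff_isHolo fun t => ?_
    rw [hc, discOf_exp, hr, ← sg_mul_totB h e hv]
    simp only [Hol.mul_apply, Hol.pow_apply, E_apply, projC_apply, ofR_apply, ex_natCast]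
    ring
  have e3 : IsDisc k α (fun ζ => (ζ : ℂ) ^ k₀ * ((toY v).1 ζ : ℂ) *
      wirtinger (fun p => (r p : ℂ)) (discOf (toY v) ζ) (0, 1)) ↔
      IsHolo (E k₀ * projC v * (1 + const Complex.I * pertY e.1 v)) := by
    rw [← isHolo_smul (c := -(1 / 2)) (by norm_num)]
    refine isDisc_iff_isHolo fun t => ?_
    rw [hc, discOf_exp, hr, ← one_add_pertY h e hv]
    simp only [Hol.mul_apply, Hol.smul_apply, Hol.add_apply, Hol.one_apply, Hol.const_apply, E_apply,
      projC_apply, ofR_apply, ex_natCast, Complex.real_smul]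
    push_cast
    ring
  rw [← hr]
  constructor
  · rintro ⟨⟨-, -, h1, -, -, h2, h3⟩, -⟩
    exact ⟨e1.1 h1, e3.1 h3, e2.1 h2⟩
  · rintro ⟨h1, h2, h3⟩
    refine ⟨⟨?_, ?_, e1.2 h1, continuous_toHolder v.1, ?_, e2.2 h3, e3.2 h2⟩, ?_⟩
    · refine (isDisc_iff_isHolo (v := compH v) fun t => by rw [discOf_exp]).2 ?_
      exact isHolo_sg_mul.2 (mem_holo.1 v.2.1.2)
    · refine (isDisc_iff_isHolo (v := compG v) fun t => by rw [discOf_exp]).2 ?_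
      exact isHolo_sg_mul.2 (mem_holo.1 v.2.2.2)
    · rw [forall_circle]
      intro t
      rw [hc]
      exact hv.2 t
    · simp [discOf, TiedDisc.toFun]

theorem congr_of_mkPerturbation (h : IsModel d k₀ a) {e e' : ↥(admissible d (k + 3) hδ)}
    (he : mkPerturbation e = mkPerturbation e') {v : Vec k α} (hv : v ∈ domain k α δ) :
    totW k₀ a e.1 v = totW k₀ a e'.1 v ∧ totB k₀ a e.1 v = totB k₀ a e'.1 v ∧
      pertY e.1 v = pertY e'.1 v := by
  refine ⟨sg_pow_mul_cancel 1 ?_, sg_pow_mul_cancel (d - 1) ?_, ?_⟩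
  · ext t
    rw [pow_one, Hol.mul_apply, Hol.mul_apply, sg_mul_totW h e hv, sg_mul_totW h e' hv, he]
  · ext t
    rw [Hol.mul_apply, Hol.mul_apply, Hol.pow_apply, sg_mul_totB h e hv, sg_mul_totB h e' hv, he]
  · ext t
    have h1 := (one_add_pertY h e hv t).trans (he ▸ (one_add_pertY h e' hv t).symm)
    have h2 : Complex.I * pertY e.1 v t = Complex.I * pertY e'.1 v t := by
      linear_combination (-2 : ℂ) * h1
    exact mul_left_cancel₀ Complex.I_ne_zero h2

end Equations

section Inclusion

open Hol

variable {k : ℕ} {α β : ℝ} [Exponent α] [Exponent β] {d : ℕ} {δ : ℝ} {hδ : 0 < δ} {k₀ : ℕ}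
  {a : ℕ → ℂ}

theorem inclVec_mem_domain (hαβ : α ≤ β) {v : Vec k β} :
    inclVec hαβ v ∈ domain k α δ ↔ v ∈ domain k β δ := Iff.rfl

theorem incl_tot (hαβ : α ≤ β) (h : IsModel d k₀ a) (e : ↥(admissible d (k + 3) hδ)) {v : Vec k β}
    (hv : v ∈ domain k β δ) :
    totW k₀ a e.1 (inclVec hαβ v) = incl hαβ (totW k₀ a e.1 v) ∧
      totB k₀ a e.1 (inclVec hαβ v) = incl hαβ (totB k₀ a e.1 v) ∧
      pertY e.1 (inclVec hαβ v) = incl hαβ (pertY e.1 v) := by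
  have hv' : inclVec hαβ v ∈ domain k α δ := (inclVec_mem_domain hαβ).2 hv
  refine ⟨sg_pow_mul_cancel 1 ?_, sg_pow_mul_cancel (d - 1) ?_, ?_⟩
  · ext t
    rw [pow_one, Hol.mul_apply, Hol.mul_apply, sg_mul_totW h e hv']
    exact (sg_mul_totW h e hv t).symm
  · ext t
    rw [Hol.mul_apply, Hol.mul_apply, Hol.pow_apply, sg_mul_totB h e hv']
    exact (sg_mul_totB h e hv t).symm
  · ext t
    rw [pertY_apply e.1 hv']
    exact (pertY_apply e.1 hv t).symm

end Inclusion

end KStat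

end

noncomputable section

namespace KStat

open Real Filter Topology ComplexConjugate

section Levi

variable {d k₀ : ℕ} {a : ℕ → ℂ}

/-- The real linear map `v ↦ A v + B v̄`. -/
def conjLin (A B : ℂ) : ℂ →L[ℝ] ℂ :=
  ContinuousLinearMap.mul ℝ ℂ A +
    (ContinuousLinearMap.mul ℝ ℂ B).comp Complex.conjCLE.toContinuousLinearMap

theorem conjLin_apply (A B v : ℂ) : conjLin A B v = A * v + B * conj v := rfl

theorem wirtinger_of_conjLin {f : ℂ → ℂ} {z A B : ℂ} (h : HasFDerivAt f (conjLin A B) z) :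
    wirtinger f z 1 = A ∧ wirtingerBar f z 1 = B := by
  rw [wirtinger, wirtingerBar, h.fderiv]
  simp only [conjLin_apply, smul_eq_mul, mul_one, map_one, Complex.conj_I]
  constructor
  · linear_combination (B / 2 - A / 2) * Complex.I_mul_I
  · linear_combination (A / 2 - B / 2) * Complex.I_mul_I

theorem hasFDerivAt_sum_monomial (s : Finset ℕ) (c : ℕ → ℂ) (m n : ℕ → ℕ) (z : ℂ) :
    HasFDerivAt (fun z => ∑ j ∈ s, c j * z ^ m j * conj z ^ n j)
      (conjLin (∑ j ∈ s, c j * (m j * z ^ (m j - 1)) * conj z ^ n j)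
        (∑ j ∈ s, c j * z ^ m j * (n j * conj z ^ (n j - 1)))) z := by
  have h : ∀ j ∈ s, HasFDerivAt (fun z => c j * z ^ m j * conj z ^ n j)
      (conjLin (c j * (m j * z ^ (m j - 1)) * conj z ^ n j)
        (c j * z ^ m j * (n j * conj z ^ (n j - 1)))) z := by
    intro j _
    have h1 : HasFDerivAt (fun z : ℂ => z) (ContinuousLinearMap.id ℝ ℂ) z := hasFDerivAt_id z
    have h2 : HasFDerivAt (fun z : ℂ => conj z) Complex.conjCLE.toContinuousLinearMap z :=
      Complex.conjCLE.toContinuousLinearMap.hasFDerivAt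
    refine (((h1.pow (m j)).const_mul (c j)).mul (h2.pow (n j))).congr_fderiv ?_
    ext
    simp [conjLin_apply]
    ring
  refine (HasFDerivAt.fun_sum h).congr_fderiv ?_
  ext
  simp [conjLin_apply, Finset.sum_add_distrib, Finset.sum_mul]

/-- The Levi form `P_{z z̄}`. -/
def leviPoly (d k₀ : ℕ) (a : ℕ → ℂ) (z : ℂ) : ℂ :=
  ∑ j ∈ Finset.Icc (d - k₀) k₀,
    a j * (j * z ^ (j - 1)) * (((d - j : ℕ) : ℂ) * conj z ^ (d - j - 1))

theorem leviPoly_ne_zero (h : IsModel d k₀ a) {z : ℂ} (hz : z ≠ 0) : leviPoly d k₀ a z ≠ 0 := by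
  have e1 : (fun z => wirtinger (modelPoly d k₀ a) z 1) = fun z =>
      ∑ j ∈ Finset.Icc (d - k₀) k₀, (a j * j) * z ^ (j - 1) * conj z ^ (d - j) := by
    funext z
    refine (wirtinger_of_conjLin (hasFDerivAt_sum_monomial _ a (fun j => j) (fun j => d - j) z)).1.trans
      (Finset.sum_congr rfl fun j _ => ?_)
    ring
  intro h0
  refine hz (h.levi z ?_)
  rw [e1]
  refine (wirtinger_of_conjLin (hasFDerivAt_sum_monomial _ _ _ _ z)).2.trans ?_
  rw [← h0]
  refine Finset.sum_congr rfl fun j _ => ?_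
  ring

theorem conj_leviPoly (h : IsModel d k₀ a) (z : ℂ) :
    conj (leviPoly d k₀ a z) = leviPoly d k₀ a z := by
  rw [leviPoly, map_sum]
  have hlt := h.lt
  refine Finset.sum_nbij' (fun j => d - j) (fun j => d - j) ?_ ?_ ?_ ?_ ?_
  · intro j hj
    rw [Finset.mem_Icc] at hj ⊢
    omega
  · intro j hj
    rw [Finset.mem_Icc] at hj ⊢
    omega
  · intro j hj
    rw [Finset.mem_Icc] at hj
    omega
  · intro j hj
    rw [Finset.mem_Icc] at hj
    omega
  · intro j hj
    have hs := h.symm j hj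
    rw [Finset.mem_Icc] at hj
    rw [hs, Nat.sub_sub_self (by omega : j ≤ d)]
    simp only [map_mul, map_pow, map_natCast, Complex.conj_conj]
    ring

theorem leviPoly_neg (h : IsModel d k₀ a) (z : ℂ) :
    leviPoly d k₀ a (-z) = (-1) ^ d * leviPoly d k₀ a z := by
  have hlt := h.lt
  rw [leviPoly, leviPoly, Finset.mul_sum]
  refine Finset.sum_congr rfl fun j hj => ?_
  rw [Finset.mem_Icc] at hj
  have e : (-1 : ℂ) ^ d = (-1) ^ (j - 1) * (-1) ^ (d - j - 1) := by
    rw [← pow_add]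
    have e2 : d = (j - 1 + (d - j - 1)) + 2 := by omega
    nth_rewrite 1 [e2]
    rw [pow_add]
    norm_num
  rw [map_neg, neg_pow z, neg_pow (conj z), e]
  ring

theorem continuous_leviPoly : Continuous (leviPoly d k₀ a) := by
  unfold leviPoly
  fun_prop

theorem sign_of_ne_zero {f : ℝ → ℝ} (hf : Continuous f) (h : ∀ t, f t ≠ 0) :
    ∃ κ : ℝ, κ * κ = 1 ∧ ∀ t, 0 < κ * f t := by
  rcases (h 0).lt_or_gt with h0 | h0
  · refine ⟨-1, by norm_num, fun t => ?_⟩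
    by_contra ht
    obtain ⟨s, hs⟩ := mem_range_of_exists_le_of_exists_ge hf ⟨0, h0.le⟩ ⟨t, by linarith⟩
    exact h s hs
  · refine ⟨1, by norm_num, fun t => ?_⟩
    by_contra ht
    obtain ⟨s, hs⟩ := mem_range_of_exists_le_of_exists_ge hf ⟨t, by linarith⟩ ⟨0, h0.le⟩
    exact h s hs

theorem even_degree (h : IsModel d k₀ a) : Even d := by
  by_contra hd
  rw [Nat.not_even_iff_odd] at hd
  have hne : ∀ t, (leviPoly d k₀ a (ex 1 t)).re ≠ 0 := by
    intro t ht
    refine leviPoly_ne_zero h (ex_ne_zero 1 t) (Complex.ext ht ?_)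
    exact Complex.conj_eq_iff_im.1 (conj_leviPoly h _)
  obtain ⟨κ, -, hκ⟩ := sign_of_ne_zero
    (Complex.continuous_re.comp (continuous_leviPoly.comp (continuous_ex 1))) hne
  have h1 := hκ 0
  have h2 := hκ π
  have e : ex 1 π = -ex 1 0 := by
    rw [ex_at_zero, ex]
    simp
  simp only [Function.comp_apply] at h1 h2
  rw [e, leviPoly_neg h, hd.neg_one_pow, neg_one_mul, Complex.neg_re] at h2
  linarith

theorem ex_two_mul_half (n : ℤ) (t : ℝ) : ex (2 * n) (t / 2) = ex n t := by
  rw [ex, ex]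
  congr 1
  push_cast
  ring

/-- The Levi form along the boundary of the disc `1 - ζ`, up to a power of `ζ` and a positive
factor. -/
def leviCircle (d k₀ : ℕ) (a : ℕ → ℂ) (t : ℝ) : ℂ :=
  ∑ j ∈ Finset.Icc (d - k₀) k₀,
    a j * j * ((d - j : ℕ) : ℂ) * (-1) ^ (d - j) * ex ((j : ℤ) - (d / 2 : ℕ)) t

theorem leviCircle_eq (h : IsModel d k₀ a) (t : ℝ) : leviCircle d k₀ a t =
    (-1) ^ (d / 2) * leviPoly d k₀ a (Complex.I * ex 1 (t / 2)) := by
  have hlt := h.lt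
  obtain ⟨m, hm⟩ := even_degree h
  have hm2 : d / 2 = m := by omega
  rw [leviCircle, leviPoly, Finset.mul_sum, hm2]
  refine Finset.sum_congr rfl fun j hj => ?_
  rw [Finset.mem_Icc] at hj
  have e1 : ex ((j : ℤ) - m) t = ex 1 (t / 2) ^ (j - 1) * conj (ex 1 (t / 2)) ^ (d - j - 1) := by
    rw [← map_pow, ex_pow, ex_pow, conj_ex, ← ex_add, ← ex_two_mul_half]
    congr 1
    omega
  have e2 : ((-1 : ℂ)) ^ (d - j) = (-1) ^ m * (Complex.I ^ (j - 1) * (-Complex.I) ^ (d - j - 1)) := by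
    rw [neg_pow Complex.I]
    have e3 : Complex.I ^ (j - 1) * ((-1) ^ (d - j - 1) * Complex.I ^ (d - j - 1)) =
        (-1) ^ (d - j - 1) * (-1) ^ (m - 1) := by
      rw [mul_left_comm, ← pow_add, show j - 1 + (d - j - 1) = 2 * (m - 1) by omega, pow_mul,
        Complex.I_sq]
    rw [e3, ← pow_add, ← pow_add]
    have e4 : m + (d - j - 1 + (m - 1)) = (d - j) + 2 * (m - 1) := by omega
    rw [e4, pow_add, pow_mul]
    norm_num
  rw [e1, e2, map_mul, Complex.conj_I, mul_pow, mul_pow]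
  ring

theorem contDiff_leviCircle {n : WithTop ℕ∞} : ContDiff ℝ n (leviCircle d k₀ a) :=
  ContDiff.sum fun _ _ => contDiff_const.mul (contDiff_ex _)

theorem periodic_leviCircle : Function.Periodic (leviCircle d k₀ a) (2 * π) := fun t =>
  Finset.sum_congr rfl fun j _ => by rw [periodic_ex _ t]

theorem leviCircle_im (h : IsModel d k₀ a) (t : ℝ) : (leviCircle d k₀ a t).im = 0 := by
  rw [← Complex.conj_eq_iff_im, leviCircle_eq h, map_mul, conj_leviPoly h, map_pow, map_neg, map_one]

theorem leviCircle_re_ne_zero (h : IsModel d k₀ a) (t : ℝ) : (leviCircle d k₀ a t).re ≠ 0 := by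
  intro h0
  have h1 : leviCircle d k₀ a t = 0 := Complex.ext h0 (leviCircle_im h t)
  rw [leviCircle_eq h] at h1
  rcases mul_eq_zero.1 h1 with h2 | h2
  · exact absurd h2 (pow_ne_zero _ (by norm_num))
  · exact leviPoly_ne_zero h (mul_ne_zero Complex.I_ne_zero (ex_ne_zero _ _)) h2

end Levi

section Factorization

open Hol

theorem Hol.contDiff {k : ℕ} {α : ℝ} [Exponent α] (u : Hol k α ℂ) : ContDiff ℝ k u := by
  have h1 := ((isHol_iff_contDiff u.isHol.re.periodic).1 u.isHol.re).1
  have h2 := ((isHol_iff_contDiff u.isHol.im.periodic).1 u.isHol.im).1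
  have e : (u : ℝ → ℂ) = fun t => ((u t).re : ℂ) + ((u t).im : ℂ) * Complex.I :=
    funext fun t => (Complex.re_add_im _).symm
  rw [e]
  exact (Complex.ofRealCLM.contDiff.comp h1).add
    ((Complex.ofRealCLM.contDiff.comp h2).mul contDiff_const)

/-- A positive smooth function on the circle is `|q|²` with `q` holomorphic without zeros. -/
theorem exists_sq_factor (k : ℕ) {f : ℝ → ℝ} (hp : Function.Periodic f (2 * π))
    (hf : ContDiff ℝ (k + 1 : ℕ) f) (h0 : ∀ t, 0 < f t) :
    ∃ g : ℝ → ℂ, Function.Periodic g (2 * π) ∧ ContDiff ℝ k g ∧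
      (∀ t, (f t : ℂ) = Complex.exp (g t) * conj (Complex.exp (g t))) ∧
      ∃ G : ℂ → ℂ, DiffContOnCl ℂ G (Metric.ball 0 1) ∧ ∀ t : ℝ, G (Circle.exp t) = g t := by
  have : Exponent (1 / 2 : ℝ) := ⟨by norm_num, by norm_num⟩
  have hl : IsHol k (1 / 2) (fun t => Real.log (f t)) :=
    isHol_of_contDiff (fun t => by simp only [hp t]) (hf.log fun t => (h0 t).ne')
  obtain ⟨w, hw⟩ : ∃ w : Hol k (1 / 2) ℂ, w = ofR (mk _ hl) := ⟨_, rfl⟩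
  obtain ⟨g, hg⟩ : ∃ g : Hol k (1 / 2) ℂ,
    g = (1 / 2 : ℝ) • (szego w + E 1 * szego (E (-1) * w)) := ⟨_, rfl⟩
  have hfc : ∀ n, fc g n = (1 / 2) * ((if 0 ≤ n then fc w n else 0) +
      if 1 ≤ n then fc w n else 0) := by
    intro n
    rw [hg, Hol.fc_smul, Hol.fc_add, Hol.fc_szego, fc_E_mul, Hol.fc_szego, fc_E_mul,
      sub_neg_eq_add, sub_add_cancel]
    simp only [sub_nonneg]
    push_cast
    rfl
  have hcw : cj w = w := by
    ext t
    rw [hw, cj_apply, ofR_apply, Complex.conj_ofReal]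
  have hgw : g + cj g = w := by
    refine Hol.eq_of_fc fun n => ?_
    have h1 : conj (fc w (-n)) = fc w n := by rw [← fc_cj, hcw]
    rw [Hol.fc_add, fc_cj, hfc, hfc, map_mul, map_add, apply_ite (starRingEnd ℂ),
      apply_ite (starRingEnd ℂ), h1, map_zero, map_div₀, map_one, Complex.conj_ofNat]
    rcases lt_trichotomy n 0 with hn | hn | hn
    · rw [if_neg (by omega), if_neg (by omega), if_pos (by omega), if_pos (by omega)]
      ring
    · rw [if_pos (by omega), if_neg (by omega), if_pos (by omega), if_neg (by omega)]
      ring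
    · rw [if_pos (by omega), if_pos (by omega), if_neg (by omega), if_neg (by omega)]
      ring
  have hholo : IsHolo g := fun n hn => by
    rw [hfc, if_neg (by omega), if_neg (by omega)]
    ring
  refine ⟨g, g.isHol.periodic, g.contDiff, fun t => ?_, isHolo_iff.1 hholo⟩
  have h1 := congrArg (fun u : Hol k (1 / 2) ℂ => u t) hgw
  rw [← Complex.exp_conj, ← Complex.exp_add]
  simp only [Hol.add_apply, cj_apply] at h1
  rw [h1, hw, ofR_apply, mk_apply, ← Complex.ofReal_exp, Real.exp_log (h0 t)]

/-- A factorization of the Levi form along the boundary of the disc `1 - ζ`. -/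
structure LeviFactor (d k₀ : ℕ) (a : ℕ → ℂ) (k : ℕ) where
  /-- the factor -/
  q : ℝ → ℂ
  /-- its inverse -/
  r : ℝ → ℂ
  /-- the sign -/
  κ : ℝ
  sign : κ * κ = 1
  periodic_q : Function.Periodic q (2 * π)
  periodic_r : Function.Periodic r (2 * π)
  contDiff_q : ContDiff ℝ (k + 1 : ℕ) q
  contDiff_r : ContDiff ℝ (k + 1 : ℕ) r
  fc_q : ∀ n < (0 : ℤ), fc q n = 0
  fc_r : ∀ n < (0 : ℤ), fc r n = 0
  mul_eq_one : ∀ t, r t * q t = 1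
  eq : ∀ t, leviCircle d k₀ a t = κ * (q t * conj (q t))

theorem exists_leviFactor {d k₀ : ℕ} {a : ℕ → ℂ} (h : IsModel d k₀ a) (k : ℕ) :
    Nonempty (LeviFactor d k₀ a k) := by
  obtain ⟨κ, hκ, hpos⟩ := sign_of_ne_zero
    (Complex.continuous_re.comp (contDiff_leviCircle (n := 0)).continuous) (leviCircle_re_ne_zero h)
  obtain ⟨g, hp, hg, hfg, G, hG, hGg⟩ := exists_sq_factor (k + 1)
    (f := fun t => κ * (leviCircle d k₀ a t).re) (fun t => by simp only [periodic_leviCircle t])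
    (contDiff_const.mul (Complex.reCLM.contDiff.comp contDiff_leviCircle)) hpos
  have hfc : ∀ (c : ℂ), ∀ n < (0 : ℤ), fc (fun t => Complex.exp (c * g t)) n = 0 := by
    intro c n hn
    have h1 : DiffContOnCl ℂ (fun z => Complex.exp (c * z)) Set.univ :=
      Differentiable.diffContOnCl (by fun_prop)
    have h2 := fc_eq_zero_of_diffContOnCl (h1.comp hG (Set.mapsTo_univ _ _)) hn
    simp only [Function.comp_apply, hGg] at h2
    exact h2
  refine ⟨⟨fun t => Complex.exp (g t), fun t => Complex.exp (-g t), κ, hκ, fun t => by simp only [hp t],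
    fun t => by simp only [hp t], hg.cexp, hg.neg.cexp, ?_, ?_, fun t => ?_, fun t => ?_⟩⟩
  · simpa using hfc 1
  · simpa using hfc (-1)
  · rw [← Complex.exp_add, neg_add_cancel, Complex.exp_zero]
  · have h1 := hfg t
    have h2 : leviCircle d k₀ a t = ((leviCircle d k₀ a t).re : ℂ) :=
      Complex.ext rfl (leviCircle_im h t)
    rw [← h1, h2, Complex.ofReal_re, ← Complex.ofReal_mul, ← mul_assoc, hκ, one_mul]

end Factorization

end KStat

end

noncomputable section

namespace KStat

open Real Filter Topology ComplexConjugate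

section Defect

open Hol

variable {k : ℕ} {α : ℝ} [Exponent α]

namespace Hol

theorem IsHolo.mul {u v : Hol k α ℂ} (hu : IsHolo u) (hv : IsHolo v) : IsHolo (u * v) := by
  obtain ⟨G, hG, hGu⟩ := isHolo_iff.1 hu
  obtain ⟨H, hH, hHv⟩ := isHolo_iff.1 hv
  refine isHolo_iff.2 ⟨fun z => G z * H z, hG.smul hH, fun t => ?_⟩
  exact congrArg₂ (· * ·) (hGu t) (hHv t)

theorem IsHolo.add {u v : Hol k α ℂ} (hu : IsHolo u) (hv : IsHolo v) : IsHolo (u + v) :=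
  fun n hn => by rw [Hol.fc_add, hu n hn, hv n hn, add_zero]

theorem fc_const_mul (c : ℂ) (u : Hol k α ℂ) (n : ℤ) :
    fc (const c * u : Hol k α ℂ) n = c * fc u n := KStat.fc_const_mul c u n

theorem fc_E (m n : ℤ) : fc (E m : Hol k α ℂ) n = if n = m then 1 else 0 := fc_ex m n

theorem fc_zero' (n : ℤ) : fc (0 : Hol k α ℂ) n = 0 := fc_zero n

theorem fc_sum {ι : Type*} (s : Finset ι) (u : ι → Hol k α ℂ) (n : ℤ) :
    fc (∑ i ∈ s, u i : Hol k α ℂ) n = ∑ i ∈ s, fc (u i) n := by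
  classical
  induction s using Finset.induction_on with
  | empty => exact fc_zero' n
  | insert i s hi ih => rw [Finset.sum_insert hi, Finset.sum_insert hi, Hol.fc_add, ih]

theorem IsHolo.sum {ι : Type*} {s : Finset ι} {u : ι → Hol k α ℂ} (h : ∀ i ∈ s, IsHolo (u i)) :
    IsHolo (∑ i ∈ s, u i) := fun n hn => by
  rw [fc_sum]
  exact Finset.sum_eq_zero fun i hi => h i hi n hn

theorem isHolo_const_mul_E (c : ℂ) {m : ℤ} (hm : 0 ≤ m) : IsHolo (const c * E m : Hol k α ℂ) :=
  fun n hn => by rw [fc_const_mul, fc_E, if_neg (by omega), mul_zero]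

/-- The part of the Fourier series with negative frequencies. -/
def anti : Hol k α ℂ →L[ℝ] Hol k α ℂ := ContinuousLinearMap.id ℝ _ - szego

theorem anti_apply (u : Hol k α ℂ) : anti u = u - szego u := rfl

theorem fc_anti (u : Hol k α ℂ) (n : ℤ) : fc (anti u) n = if 0 ≤ n then 0 else fc u n := by
  rw [anti_apply, Hol.fc_sub, fc_szego]
  split_ifs <;> simp

theorem anti_eq_zero_iff {u : Hol k α ℂ} : anti u = 0 ↔ IsHolo u := by
  rw [anti_apply, sub_eq_zero, ← szego_eq_self_iff, eq_comm]

/-- The part of the Fourier series with frequencies at most `M`. -/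
def trunc (M : ℤ) : Hol k α ℂ →L[ℝ] Hol k α ℂ :=
  ContinuousLinearMap.id ℝ _ - (ContinuousLinearMap.mul ℝ (Hol k α ℂ) (E (M + 1))).comp
    (szego.comp (ContinuousLinearMap.mul ℝ (Hol k α ℂ) (E (-(M + 1)))))

theorem trunc_apply (M : ℤ) (u : Hol k α ℂ) :
    trunc M u = u - E (M + 1) * szego (E (-(M + 1)) * u) := rfl

theorem fc_trunc (M : ℤ) (u : Hol k α ℂ) (n : ℤ) :
    fc (trunc M u) n = if n ≤ M then fc u n else 0 := by
  rw [trunc_apply, Hol.fc_sub, fc_E_mul, fc_szego, fc_E_mul]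
  rw [show n - (M + 1) - -(M + 1) = n by ring]
  by_cases h : n ≤ M
  · rw [if_pos h, if_neg (by omega), sub_zero]
  · rw [if_neg h, if_pos (by omega), sub_self]

theorem isHolo_trunc (M : ℤ) {u : Hol k α ℂ} (hu : IsHolo u) : IsHolo (trunc M u) := fun n hn => by
  rw [fc_trunc, hu n hn, ite_self]

/-- The Szegő projection as a map to the holomorphic functions. -/
def szegoHolo : Hol k α ℂ →L[ℝ] holo k α :=
  szego.codRestrict (holo k α) fun u => mem_holo.2 (isHolo_szego u)

theorem coe_szegoHolo (u : Hol k α ℂ) : (szegoHolo u : Hol k α ℂ) = szego u := rfl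

theorem szegoHolo_eq_iff {u : Hol k α ℂ} (hu : IsHolo u) {w : holo k α} :
    szegoHolo u = w ↔ u = w := by
  rw [← Subtype.coe_inj, coe_szegoHolo, szego_eq_self_iff.2 hu]

end Hol

variable {d k₀ : ℕ} {a : ℕ → ℂ} {δ : ℝ} {hδ : 0 < δ}

/-- The first component of the defect. -/
def defectC (k₀ : ℕ) (e : Coeffs d (k + 3) hδ) (v : Vec k α) : Hol k α ℝ :=
  v.1 + mapL Complex.reCLM ((2 : ℝ) • (E (-k₀) *
    anti (E k₀ * projC v * (const Complex.I * pertY e v))))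

theorem fc_defectC (e : Coeffs d (k + 3) hδ) (v : Vec k α) {n : ℤ} (hn : (k₀ : ℤ) < n) :
    fc (ofR (defectC k₀ e v)) n =
      conj (fc (E k₀ * projC v * (1 + const Complex.I * pertY e v) : Hol k α ℂ) (k₀ - n)) := by
  obtain ⟨w, hw⟩ : ∃ w, w = E k₀ * projC v * (const Complex.I * pertY e v) := ⟨_, rfl⟩
  have h1 : ofR (defectC k₀ e v) = projC v + (E (-k₀) * anti w + cj (E (-k₀) * anti w)) := by
    rw [defectC, ← hw]
    ext t
    simp only [ofR_apply, Hol.add_apply, mapL_apply, projC_apply, cj_apply]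
    rw [Complex.ofReal_add, Complex.add_conj, Hol.smul_apply, Complex.reCLM_apply, Complex.real_smul,
      Complex.re_ofReal_mul]
  have h2 : fc (projC v) n = conj (fc (projC v) (-n)) := by
    have h3 : projC v = cj (projC v) := by
      ext t
      rw [cj_apply, projC_apply, ofR_apply, Complex.conj_ofReal]
    nth_rewrite 1 [h3]
    exact fc_cj _ n
  rw [h1, mul_add, mul_one, ← hw, Hol.fc_add, Hol.fc_add, Hol.fc_add, fc_cj, fc_E_mul, fc_E_mul,
    fc_E_mul, fc_anti, fc_anti, if_pos (by omega), if_neg (by omega), h2, map_add, zero_add,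
    show (k₀ : ℤ) - n - k₀ = -n by ring, show -n - -(k₀ : ℤ) = k₀ - n by ring]

theorem fc_defectC_eq_zero_iff (e : Coeffs d (k + 3) hδ) (v : Vec k α) :
    (∀ n : ℤ, k₀ < n → fc (ofR (defectC k₀ e v)) n = 0) ↔
      IsHolo (E k₀ * projC v * (1 + const Complex.I * pertY e v)) := by
  constructor
  · intro h n hn
    have h1 := h (k₀ - n) (by omega)
    rw [fc_defectC _ _ (by omega), sub_sub_cancel, map_eq_zero] at h1
    exact h1
  · intro h n hn
    rw [fc_defectC _ _ hn, h _ (by omega), map_zero]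

namespace LeviFactor

/-- The factor as a function of class `C^{k,α}`. -/
def qH (f : LeviFactor d k₀ a k) : Hol k α ℂ := Hol.mk f.q (isHol_of_contDiff f.periodic_q f.contDiff_q)

/-- The inverse of the factor as a function of class `C^{k,α}`. -/
def rH (f : LeviFactor d k₀ a k) : Hol k α ℂ := Hol.mk f.r (isHol_of_contDiff f.periodic_r f.contDiff_r)

variable (f : LeviFactor d k₀ a k)

theorem isHolo_qH : IsHolo (f.qH : Hol k α ℂ) := f.fc_q

theorem isHolo_rH : IsHolo (f.rH : Hol k α ℂ) := f.fc_r

theorem rH_mul_qH : (f.rH : Hol k α ℂ) * f.qH = 1 := by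
  ext t
  exact f.mul_eq_one t

theorem isHolo_rH_mul {u : Hol k α ℂ} : IsHolo (f.rH * u) ↔ IsHolo u := by
  refine ⟨fun h => ?_, fun h => f.isHolo_rH.mul h⟩
  have h1 := f.isHolo_qH.mul h
  rwa [← mul_assoc, mul_comm f.qH, rH_mul_qH, one_mul] at h1

/-- The second component of the defect, multiplied by the factor. -/
def defectQ (e : Coeffs d (k + 3) hδ) (v : Vec k α) : Hol k α ℂ :=
  f.κ • (E ((k₀ : ℤ) - (d / 2 : ℕ)) * cj (anti (f.rH * (E k₀ * projC v * totB k₀ a e v)))) +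
    trunc ((k₀ : ℤ) - (d / 2 : ℕ)) (f.qH * (projH v - 1))

/-- The equations of the lifts of stationary discs. -/
def defect (e : Coeffs d (k + 3) hδ) (v : Vec k α) : Vec k α :=
  (defectC k₀ e v, szegoHolo (f.rH * f.defectQ e v),
    szegoHolo (projG v - (2 : ℝ) • szego (totW k₀ a e v)))

theorem isHolo_defectQ (hd : d ≤ 2 * k₀) (e : Coeffs d (k + 3) hδ) (v : Vec k α) :
    IsHolo (f.defectQ e v) := by
  refine IsHolo.add (fun n hn => ?_) (isHolo_trunc _ (f.isHolo_qH.mul ?_))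
  · rw [fc_smul, fc_E_mul, fc_cj, fc_anti, if_pos (by omega), map_zero, mul_zero]
  · intro n hn
    have h1 : fc (1 : Hol k α ℂ) n = 0 := by
      have h2 : (1 : Hol k α ℂ) = E 0 := by
        ext t
        exact (ex_zero t).symm
      rw [h2, fc_E, if_neg (by omega)]
    rw [Hol.fc_sub, h1, sub_zero]
    exact mem_holo.1 v.2.1.2 n hn

theorem fc_defectQ (e : Coeffs d (k + 3) hδ) (v : Vec k α) {n : ℤ}
    (hn : (k₀ : ℤ) - (d / 2 : ℕ) < n) : fc (f.defectQ e v) n =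
      f.κ * conj (fc (f.rH * (E k₀ * projC v * totB k₀ a e v) : Hol k α ℂ)
        ((k₀ : ℤ) - (d / 2 : ℕ) - n)) := by
  rw [defectQ, Hol.fc_add, fc_smul, fc_E_mul, fc_cj, fc_anti, fc_trunc, if_neg (by omega),
    if_neg (by omega), add_zero, neg_sub]

theorem fc_defectQ_eq_zero_iff (e : Coeffs d (k + 3) hδ) (v : Vec k α) :
    (∀ n, (k₀ : ℤ) - (d / 2 : ℕ) < n → fc (f.defectQ e v) n = 0) ↔
      IsHolo (E k₀ * projC v * totB k₀ a e v) := by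
  have hκ : (f.κ : ℂ) ≠ 0 := by
    have h1 := f.sign
    rw [Complex.ofReal_ne_zero]
    rintro h
    rw [h] at h1
    norm_num at h1
  rw [← f.isHolo_rH_mul]
  constructor
  · intro h n hn
    have h1 := h ((k₀ : ℤ) - (d / 2 : ℕ) - n) (by omega)
    rw [fc_defectQ _ _ _ (by omega), sub_sub_cancel, mul_eq_zero, or_iff_right hκ,
      map_eq_zero] at h1
    exact h1
  · intro h n hn
    rw [fc_defectQ _ _ _ hn, h _ (by omega), map_zero, mul_zero]

theorem contDiffOn_defect : ContDiffOn ℝ 1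
    (fun x : Coeffs d (k + 3) hδ × Vec k α => f.defect x.1 x.2) (Set.univ ×ˢ domain k α δ) := by
  have hB : ContDiffOn ℝ 1 (fun x : Coeffs d (k + 3) hδ × Vec k α => totB k₀ a x.1 x.2)
      (Set.univ ×ˢ domain k α δ) := (contDiffOn_modelB d k₀ a).add contDiffOn_pertB
  have hW : ContDiffOn ℝ 1 (fun x : Coeffs d (k + 3) hδ × Vec k α => totW k₀ a x.1 x.2)
      (Set.univ ×ˢ domain k α δ) := (contDiffOn_modelW d k₀ a).add contDiffOn_pertW
  have hC : ContDiffOn ℝ 1 (fun x : Coeffs d (k + 3) hδ × Vec k α => (E k₀ : Hol k α ℂ) * projC x.2)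
      (Set.univ ×ˢ domain k α δ) := contDiffOn_const.mul (contDiff_clm_snd projC)
  have h1 : ContDiffOn ℝ 1 (fun x : Coeffs d (k + 3) hδ × Vec k α => defectC k₀ x.1 x.2)
      (Set.univ ×ˢ domain k α δ) := by
    have h2 : ContDiffOn ℝ 1 (fun x : Coeffs d (k + 3) hδ × Vec k α =>
        (E k₀ : Hol k α ℂ) * projC x.2 * (const Complex.I * pertY x.1 x.2))
        (Set.univ ×ˢ domain k α δ) := hC.mul (contDiffOn_const.mul contDiffOn_pertY)
    exact (contDiff_clm_snd (ContinuousLinearMap.fst ℝ _ _)).add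
      (((mapL Complex.reCLM).comp ((2 : ℝ) • (ContinuousLinearMap.mul ℝ (Hol k α ℂ) (E (-k₀))).comp
        anti)).contDiff.comp_contDiffOn h2)
  have h2 : ContDiffOn ℝ 1 (fun x : Coeffs d (k + 3) hδ × Vec k α => f.defectQ x.1 x.2)
      (Set.univ ×ˢ domain k α δ) := by
    have h3 : ContDiffOn ℝ 1 (fun x : Coeffs d (k + 3) hδ × Vec k α =>
        (f.rH : Hol k α ℂ) * (E k₀ * projC x.2 * totB k₀ a x.1 x.2))
        (Set.univ ×ˢ domain k α δ) := contDiffOn_const.mul (hC.mul hB)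
    have h4 : ContDiffOn ℝ 1 (fun x : Coeffs d (k + 3) hδ × Vec k α =>
        (f.qH : Hol k α ℂ) * (projH x.2 - 1)) (Set.univ ×ˢ domain k α δ) :=
      contDiffOn_const.mul ((contDiff_clm_snd projH).sub contDiffOn_const)
    exact ((f.κ • (ContinuousLinearMap.mul ℝ (Hol k α ℂ) (E ((k₀ : ℤ) - (d / 2 : ℕ)))).comp
      (cj.comp anti)).contDiff.comp_contDiffOn h3).add ((trunc _).contDiff.comp_contDiffOn h4)
  have h3 : ContDiffOn ℝ 1 (fun x : Coeffs d (k + 3) hδ × Vec k α =>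
      projG x.2 - (2 : ℝ) • szego (totW k₀ a x.1 x.2)) (Set.univ ×ˢ domain k α δ) :=
    (contDiff_clm_snd projG).sub (((2 : ℝ) • szego).contDiff.comp_contDiffOn hW)
  have h4 : ContDiffOn ℝ 1 (fun x : Coeffs d (k + 3) hδ × Vec k α =>
      szegoHolo (f.rH * f.defectQ x.1 x.2)) (Set.univ ×ˢ domain k α δ) :=
    (szegoHolo.comp (ContinuousLinearMap.mul ℝ (Hol k α ℂ) f.rH)).contDiff.comp_contDiffOn h2
  have h5 : ContDiffOn ℝ 1 (fun x : Coeffs d (k + 3) hδ × Vec k α =>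
      szegoHolo (projG x.2 - (2 : ℝ) • szego (totW k₀ a x.1 x.2))) (Set.univ ×ˢ domain k α δ) :=
    (szegoHolo (k := k) (α := α)).contDiff.comp_contDiffOn h3
  exact h1.prodMk (h4.prodMk h5)

end LeviFactor

/-- The parameters of the solutions. -/
abbrev Param (k₀ M : ℕ) : Type := (ℝ × (Fin k₀ → ℂ)) × (Fin (M + 1) → ℂ)

/-- Constants as a continuous linear map. -/
def constL : ℂ →L[ℝ] Hol k α ℂ :=
  LinearMap.toContinuousLinearMap
    { toFun := fun c => const c
      map_add' := fun _ _ => rfl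
      map_smul' := fun _ _ => rfl }

/-- The real trigonometric polynomials. -/
def trigPoly (k₀ : ℕ) : (ℝ × (Fin k₀ → ℂ)) →L[ℝ] Hol k α ℝ :=
  (mapL Complex.reCLM).comp (constL.comp (Complex.ofRealCLM.comp (ContinuousLinearMap.fst ℝ _ _)) +
    ∑ j : Fin k₀, (2 : ℝ) • (((ContinuousLinearMap.mul ℝ (Hol k α ℂ)).flip (E (j + 1))).comp
      (constL.comp ((ContinuousLinearMap.proj j).comp (ContinuousLinearMap.snd ℝ _ _)))))

/-- The polynomials of degree at most `M`. -/
def polyL (M : ℕ) : (Fin (M + 1) → ℂ) →L[ℝ] Hol k α ℂ :=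
  ∑ j : Fin (M + 1), ((ContinuousLinearMap.mul ℝ (Hol k α ℂ)).flip (E j)).comp
      (constL.comp (ContinuousLinearMap.proj j))

theorem polyL_apply (M : ℕ) (p : Fin (M + 1) → ℂ) :
    (polyL M p : Hol k α ℂ) = ∑ j : Fin (M + 1), const (p j) * E j := by
  simp only [polyL, _root_.sum_apply]
  rfl

theorem ofR_trigPoly (p : ℝ × (Fin k₀ → ℂ)) : ofR (trigPoly k₀ p : Hol k α ℝ) =
    const (p.1 : ℂ) * E 0 + ∑ j : Fin k₀, (const (p.2 j) * E (j + 1) + cj (const (p.2 j) * E (j + 1))) := by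
  have h1 : (trigPoly k₀ p : Hol k α ℝ) = mapL Complex.reCLM (const (p.1 : ℂ) +
      ∑ j : Fin k₀, (2 : ℝ) • (const (p.2 j) * E (j + 1))) := by
    simp only [trigPoly, ContinuousLinearMap.comp_apply, _root_.add_apply, _root_.sum_apply]
    rfl
  ext t
  rw [h1]
  simp only [ofR_apply, mapL_apply, Hol.add_apply, Hol.sum_apply, Hol.smul_apply, Hol.mul_apply,
    Hol.const_apply, E_apply, ex_zero, mul_one, cj_apply, Complex.reCLM_apply, Complex.add_re,
    Complex.re_sum, Complex.ofReal_re, Complex.add_conj, Complex.smul_re]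
  push_cast
  simp

theorem fc_polyL (M : ℕ) (p : Fin (M + 1) → ℂ) (j : Fin (M + 1)) :
    fc (polyL M p : Hol k α ℂ) (j : ℕ) = p j := by
  rw [polyL_apply, Hol.fc_sum, Finset.sum_eq_single j]
  · rw [Hol.fc_const_mul, fc_E, if_pos rfl, mul_one]
  · intro i _ hi
    rw [Hol.fc_const_mul, fc_E, if_neg, mul_zero]
    intro h
    exact hi (Fin.ext (by exact_mod_cast h.symm))
  · simp

theorem fc_polyL_eq_zero (M : ℕ) (p : Fin (M + 1) → ℂ) {n : ℤ} (hn : n < 0 ∨ M < n) :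
    fc (polyL M p : Hol k α ℂ) n = 0 := by
  rw [polyL_apply, Hol.fc_sum]
  refine Finset.sum_eq_zero fun j _ => ?_
  rw [Hol.fc_const_mul, fc_E, if_neg (by omega), mul_zero]

theorem isHolo_polyL (M : ℕ) (p : Fin (M + 1) → ℂ) : IsHolo (polyL M p : Hol k α ℂ) :=
  fun _ hn => fc_polyL_eq_zero M p (Or.inl hn)

theorem exists_polyL_iff {M : ℕ} {u : Hol k α ℂ} (hu : IsHolo u) :
    (∃ p, u = polyL M p) ↔ ∀ n, (M : ℤ) < n → fc u n = 0 := by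
  constructor
  · rintro ⟨p, rfl⟩ n hn
    exact fc_polyL_eq_zero M p (Or.inr hn)
  · intro h
    refine ⟨fun j => fc u (j : ℕ), Hol.eq_of_fc fun n => ?_⟩
    by_cases hn : n < 0 ∨ M < n
    · rw [fc_polyL_eq_zero M _ hn]
      rcases hn with hn | hn
      · exact hu n hn
      · exact h n hn
    · obtain ⟨m, rfl⟩ := Int.eq_ofNat_of_zero_le (by omega : 0 ≤ n)
      exact (fc_polyL M (fun j => fc u (j : ℕ)) ⟨m, by omega⟩).symm

theorem fc_trigPoly_zero (p : ℝ × (Fin k₀ → ℂ)) : fc (ofR (trigPoly k₀ p : Hol k α ℝ)) 0 = p.1 := by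
  rw [ofR_trigPoly, Hol.fc_add, Hol.fc_sum, Hol.fc_const_mul, fc_E, if_pos rfl, mul_one,
    Finset.sum_eq_zero, add_zero]
  intro j _
  rw [Hol.fc_add, fc_cj, Hol.fc_const_mul, Hol.fc_const_mul, fc_E, fc_E, if_neg (by omega),
    if_neg (by omega), mul_zero, map_zero, add_zero]

theorem fc_trigPoly (p : ℝ × (Fin k₀ → ℂ)) (j : Fin k₀) :
    fc (ofR (trigPoly k₀ p : Hol k α ℝ)) (j + 1 : ℕ) = p.2 j := by
  rw [ofR_trigPoly, Hol.fc_add, Hol.fc_sum, Hol.fc_const_mul, fc_E, if_neg (by omega), mul_zero,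
    zero_add, Finset.sum_eq_single j]
  · rw [Hol.fc_add, fc_cj, Hol.fc_const_mul, Hol.fc_const_mul, fc_E, fc_E, if_pos (by push_cast; rfl),
      if_neg (by omega), mul_zero, map_zero, add_zero, mul_one]
  · intro i _ hi
    have hi' : (i : ℕ) ≠ j := fun h => hi (Fin.ext h)
    rw [Hol.fc_add, fc_cj, Hol.fc_const_mul, Hol.fc_const_mul, fc_E, fc_E, if_neg (by omega),
      if_neg (by omega), mul_zero, map_zero, add_zero]
  · simp

theorem fc_trigPoly_eq_zero (p : ℝ × (Fin k₀ → ℂ)) {n : ℤ} (hn : (k₀ : ℤ) < n) :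
    fc (ofR (trigPoly k₀ p : Hol k α ℝ)) n = 0 := by
  rw [ofR_trigPoly, Hol.fc_add, Hol.fc_sum, Hol.fc_const_mul, fc_E, if_neg (by omega), mul_zero,
    zero_add]
  refine Finset.sum_eq_zero fun j _ => ?_
  rw [Hol.fc_add, fc_cj, Hol.fc_const_mul, Hol.fc_const_mul, fc_E, fc_E, if_neg (by omega),
    if_neg (by omega), mul_zero, map_zero, add_zero]

theorem conj_fc_ofR (u : Hol k α ℝ) (n : ℤ) : conj (fc (ofR u) n) = fc (ofR u) (-n) := by
  have h1 : ofR u = cj (ofR u) := by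
    ext t
    rw [cj_apply, ofR_apply, Complex.conj_ofReal]
  rw [h1, fc_cj, Complex.conj_conj, ← h1]

theorem eq_of_fc_ofR {u v : Hol k α ℝ} (h : ∀ n, 0 ≤ n → fc (ofR u) n = fc (ofR v) n) : u = v := by
  have h1 : ofR u = ofR v := Hol.eq_of_fc fun n => by
    rcases le_or_gt 0 n with hn | hn
    · exact h n hn
    · rw [← neg_neg n, ← conj_fc_ofR u, ← conj_fc_ofR v, h (-n) (by omega)]
  ext t
  have h2 := congrArg (fun w : Hol k α ℂ => w t) h1
  exact Complex.ofReal_injective h2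

theorem exists_trigPoly_iff {u : Hol k α ℝ} :
    (∃ p, u = trigPoly k₀ p) ↔ ∀ n : ℤ, (k₀ : ℤ) < n → fc (ofR u) n = 0 := by
  constructor
  · rintro ⟨p, rfl⟩ n hn
    exact fc_trigPoly_eq_zero p hn
  · intro h
    refine ⟨((fc (ofR u) 0).re, fun j => fc (ofR u) (j + 1 : ℕ)), eq_of_fc_ofR fun n hn => ?_⟩
    obtain ⟨m, rfl⟩ := Int.eq_ofNat_of_zero_le hn
    rcases m with _ | m
    · refine Eq.trans ?_ (fc_trigPoly_zero _).symm
      have h1 : conj (fc (ofR u) 0) = fc (ofR u) 0 := conj_fc_ofR u 0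
      exact (Complex.conj_eq_iff_re.1 h1).symm
    · rcases lt_or_ge m k₀ with hm | hm
      · exact (fc_trigPoly (k := k) (α := α)
          ((fc (ofR u) 0).re, fun j : Fin k₀ => fc (ofR u) (j + 1 : ℕ)) ⟨m, hm⟩).symm
      · rw [fc_trigPoly_eq_zero _ (by omega), h _ (by omega)]

namespace LeviFactor

variable (f : LeviFactor d k₀ a k)

/-- The space of solutions, up to the choice of coordinates. -/
def solution (M : ℕ) : Param k₀ M →L[ℝ] Vec k α :=
  ((trigPoly k₀).comp (ContinuousLinearMap.fst ℝ _ _)).prod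
    ((szegoHolo.comp ((ContinuousLinearMap.mul ℝ (Hol k α ℂ) f.rH).comp
      ((polyL M).comp (ContinuousLinearMap.snd ℝ _ _)))).prod 0)

theorem solution_apply (M : ℕ) (p : Param k₀ M) : (f.solution M p : Vec k α) =
    (trigPoly k₀ p.1, szegoHolo (f.rH * polyL M p.2), 0) := rfl

theorem rH_mul_inj (f : LeviFactor d k₀ a k) {u v : Hol k α ℂ} : f.rH * u = f.rH * v ↔ u = v := by
  refine ⟨fun h => ?_, fun h => by rw [h]⟩
  have h1 := congrArg (fun w => f.qH * w) h
  simp only [← mul_assoc] at h1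
  rwa [mul_comm f.qH, rH_mul_qH, one_mul, one_mul] at h1

theorem szegoHolo_rH_inj {u v : Hol k α ℂ} (hu : IsHolo u) (hv : IsHolo v) :
    szegoHolo (f.rH * u) = szegoHolo (f.rH * v) ↔ u = v := by
  rw [szegoHolo_eq_iff (f.isHolo_rH.mul hu), coe_szegoHolo,
    szego_eq_self_iff.2 (f.isHolo_rH.mul hv), rH_mul_inj]

theorem solution_injective (M : ℕ) : Function.Injective (f.solution M : Param k₀ M → Vec k α) := by
  intro p p' h
  rw [solution_apply, solution_apply, Prod.mk.injEq, Prod.mk.injEq,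
    f.szegoHolo_rH_inj (isHolo_polyL _ _) (isHolo_polyL _ _)] at h
  obtain ⟨h1, h2, -⟩ := h
  refine Prod.ext (Prod.ext ?_ (funext fun j => ?_)) (funext fun j => ?_)
  · have h3 := fc_trigPoly_zero (k := k) (α := α) p.1
    rw [h1, fc_trigPoly_zero] at h3
    exact_mod_cast h3.symm
  · rw [← fc_trigPoly (k := k) (α := α) p.1, h1, fc_trigPoly]
  · rw [← fc_polyL (k := k) (α := α) M p.2, h2, fc_polyL]

theorem mem_tiedLifts_iff_defect (h : IsModel d k₀ a) {M : ℕ} (hM : (M : ℤ) = k₀ - (d / 2 : ℕ))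
    (e : ↥(admissible d (k + 3) hδ)) {v : Vec k α} (hv : v ∈ domain k α δ) :
    toY v ∈ tiedLifts k α k₀ (bidisc δ) (defFun k₀ a (mkPerturbation e)) ↔
      ∃ p, f.defect e.1 v = (f.solution M (((1 : ℝ), 0), 0) + f.solution M p : Vec k α) := by
  have h1 : (∃ p, f.defect e.1 v = f.solution M (((1 : ℝ), 0), 0) + f.solution M p) ↔
      ∃ p, f.defect e.1 v = f.solution M p := by
    constructor
    · rintro ⟨p, hp⟩
      exact ⟨_, hp.trans (map_add _ _ _).symm⟩
    · rintro ⟨p, hp⟩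
      exact ⟨p - (((1 : ℝ), 0), 0), by rw [hp, ← map_add, add_sub_cancel]⟩
  have hG : projG v = (2 : ℝ) • szego (totW k₀ a e.1 v) ↔
      szegoHolo (projG v - (2 : ℝ) • szego (totW k₀ a e.1 v)) = 0 := by
    rw [szegoHolo_eq_iff, ZeroMemClass.coe_zero, sub_eq_zero]
    intro n hn
    rw [Hol.fc_sub, fc_smul, isHolo_szego _ n hn, mul_zero, sub_zero]
    exact mem_holo.1 v.2.2.2 n hn
  rw [mem_tiedLifts_iff h e hv, h1, hG, ← fc_defectC_eq_zero_iff, ← f.fc_defectQ_eq_zero_iff, ← hM,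
    ← exists_trigPoly_iff, ← exists_polyL_iff (f.isHolo_defectQ h.half_le e.1 v)]
  constructor
  · rintro ⟨h2, ⟨p, hp⟩, p', hp'⟩
    refine ⟨(p, p'), ?_⟩
    rw [defect, h2, hp, hp', solution_apply]
  · rintro ⟨p, hp⟩
    rw [defect, solution_apply, Prod.mk.injEq, Prod.mk.injEq,
      f.szegoHolo_rH_inj (f.isHolo_defectQ h.half_le e.1 v) (isHolo_polyL _ _)] at hp
    exact ⟨hp.2.2, ⟨_, hp.1⟩, _, hp.2.1⟩

end LeviFactor

end Defect

end KStat

end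

noncomputable section

namespace KStat

open Real Filter Topology ComplexConjugate

section InclDefect

open Hol

variable {k : ℕ} {α β : ℝ} [Exponent α] [Exponent β] {d : ℕ} {δ : ℝ} {hδ : 0 < δ} {k₀ : ℕ}
  {a : ℕ → ℂ}

theorem Hol.incl_anti (hαβ : α ≤ β) (u : Hol k β ℂ) : incl hαβ (anti u) = anti (incl hαβ u) := by
  rw [anti_apply, anti_apply, map_sub, incl_szego]

theorem Hol.incl_trunc (hαβ : α ≤ β) (M : ℤ) (u : Hol k β ℂ) :
    incl hαβ (trunc M u) = trunc M (incl hαβ u) := by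
  rw [trunc_apply, trunc_apply, map_sub, incl_mul, incl_szego, incl_mul]
  rfl

theorem incl_szegoHolo (hαβ : α ≤ β) {u : Hol k β ℂ} {v : Hol k α ℂ} (h : incl hαβ u = v) :
    szegoHolo v = inclHolo hαβ (szegoHolo u) := by
  apply Subtype.ext
  rw [coe_szegoHolo, ← h, ← incl_szego]
  rfl

theorem incl_trigPoly (hαβ : α ≤ β) (p : ℝ × (Fin k₀ → ℂ)) :
    incl hαβ (trigPoly k₀ p : Hol k β ℝ) = trigPoly k₀ p := by
  ext t
  have h1 := congrArg (fun u : Hol k α ℂ => u t) (ofR_trigPoly (k := k) (α := α) p)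
  have h2 := congrArg (fun u : Hol k β ℂ => u t) (ofR_trigPoly (k := k) (α := β) p)
  simp only [ofR_apply, Hol.add_apply, Hol.sum_apply, Hol.mul_apply, Hol.const_apply, E_apply,
    cj_apply] at h1 h2
  exact Complex.ofReal_injective (h2.trans h1.symm)

theorem incl_polyL (hαβ : α ≤ β) (M : ℕ) (p : Fin (M + 1) → ℂ) :
    incl hαβ (polyL M p : Hol k β ℂ) = polyL M p := by
  rw [polyL_apply, polyL_apply, map_sum]
  rfl

namespace LeviFactor

variable (f : LeviFactor d k₀ a k)

theorem incl_solution (hαβ : α ≤ β) (M : ℕ) (p : Param k₀ M) :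
    inclVec hαβ (f.solution M p) = f.solution M p := by
  have h1 : inclHolo hαβ (szegoHolo (f.rH * polyL M p.2)) = szegoHolo (f.rH * polyL M p.2) := by
    refine (incl_szegoHolo hαβ ?_).symm
    rw [incl_mul, incl_polyL]
    rfl
  rw [solution_apply, solution_apply, ← h1, ← incl_trigPoly hαβ]
  exact Prod.ext rfl (Prod.ext rfl (map_zero (inclHolo hαβ)))

theorem incl_defect (hαβ : α ≤ β) (h : IsModel d k₀ a) (e : ↥(admissible d (k + 3) hδ)) {v : Vec k β}
    (hv : v ∈ domain k β δ) : f.defect e.1 (inclVec hαβ v) = inclVec hαβ (f.defect e.1 v) := by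
  obtain ⟨hW, hB, hY⟩ := incl_tot hαβ h e hv
  have hC : projC (inclVec hαβ v) = incl hαβ (projC v) := rfl
  have hE : ∀ n, (E n : Hol k α ℂ) = incl hαβ (E n) := fun _ => rfl
  have hI : (const Complex.I : Hol k α ℂ) = incl hαβ (const Complex.I) := rfl
  refine Prod.ext ?_ (Prod.ext ?_ ?_)
  · change defectC k₀ e.1 (inclVec hαβ v) = incl hαβ (defectC k₀ e.1 v)
    rw [defectC, hY, hC, hE k₀, hI, ← incl_mul, ← incl_mul, ← incl_mul, ← incl_anti]
    rfl
  · refine incl_szegoHolo hαβ ?_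
    have hr : (f.rH : Hol k α ℂ) = incl hαβ f.rH := rfl
    have hq : (f.qH : Hol k α ℂ) * (projH (inclVec hαβ v) - 1) =
      incl hαβ (f.qH * (projH v - 1)) := rfl
    rw [defectQ, defectQ, hB, hC, hr, hE k₀, hq, ← incl_mul, ← incl_mul, ← incl_mul, ← incl_anti,
      ← incl_trunc]
    rfl
  · refine incl_szegoHolo hαβ ?_
    rw [hW, ← incl_szego]
    rfl

end LeviFactor

end InclDefect

section Base

open Hol

variable {k : ℕ} {α : ℝ} [Exponent α] {d : ℕ} {δ : ℝ} {hδ : 0 < δ} {k₀ : ℕ} {a : ℕ → ℂ}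

/-- Polynomials as holomorphic functions. -/
def polyHolo (p : Polynomial ℂ) : holo k α :=
  ⟨Hol.mk (fun t => p.eval (Circle.exp t : ℂ)) (isHol_of_contDiff
    (fun t => by simp only [Circle.exp_add_two_pi]) (by
      have h : ContDiff ℝ (k + 1 : ℕ) fun t : ℝ => (Circle.exp t : ℂ) := by
        simp only [Circle.coe_exp]
        exact (Complex.ofRealCLM.contDiff.mul contDiff_const).cexp
      have h2 : ContDiff ℝ (k + 1 : ℕ) (fun z : ℂ => p.eval z) := by
        simp only [Polynomial.eval_eq_sum_range]
        fun_prop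
      exact h2.comp h)),
    mem_holo.2 fun n hn => (fc_poly p n).trans (if_neg (not_le.2 hn))⟩

/-- The initial lift. -/
def baseVec (d k₀ : ℕ) (a : ℕ → ℂ) (k : ℕ) (α : ℝ) [Exponent α] : Vec k α :=
  (const 1, polyHolo 1, polyHolo (gZeroFactor d k₀ a))

theorem toY_baseVec (hα : α ≤ 1) : toY (baseVec d k₀ a k α) = baseLift d k₀ a k hα := by
  have h : ∀ p : Polynomial ℂ, toTied (polyHolo p : holo k α) = TiedDisc.ofPoly k hα p := by
    intro p
    refine Subtype.ext (funext (forall_circle.2 fun t => ?_))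
    exact toTied_factor _ t
  refine Prod.ext (Subtype.ext (funext (forall_circle.2 fun t => ?_))) (Prod.ext (h _) (h _))
  exact toHolder_apply _ t

theorem projH_baseVec : projH (baseVec d k₀ a k α) = 1 := by
  ext t
  exact Polynomial.eval_one

theorem projC_baseVec : projC (baseVec d k₀ a k α) = 1 := by
  ext t
  exact Complex.ofReal_one

theorem compH_baseVec (t : ℝ) : compH (baseVec d k₀ a k α) t = 1 - (Circle.exp t : ℂ) := by
  rw [compH_apply, projH_baseVec, Hol.one_apply, mul_one, sg_apply, ex_eq_zpow, zpow_one]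

theorem compG_baseVec (t : ℝ) :
    compG (baseVec d k₀ a k α) t = gZero d k₀ a (Circle.exp t : ℂ) := by
  rw [compG_apply, sg_apply, ex_eq_zpow, zpow_one, ← gZeroFactor_spec]
  rfl

theorem baseVec_mem_domain
    (hf₀ : ∀ ζ : ℂ, ‖ζ‖ ≤ 1 → (1 - ζ, gZero d k₀ a ζ) ∈ bidisc δ) :
    baseVec d k₀ a k α ∈ domain k α δ := by
  refine ⟨fun t => ?_, fun t => one_ne_zero⟩
  rw [compH_baseVec, compG_baseVec]
  exact hf₀ _ (Circle.norm_coe _).le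

theorem pert_zero (hd : 0 < d) {v : Vec k α} (hv : v ∈ domain k α δ) :
    pertW (0 : Coeffs d (k + 3) hδ) v = 0 ∧ pertB (0 : Coeffs d (k + 3) hδ) v = 0 ∧
      pertY (0 : Coeffs d (k + 3) hδ) v = 0 := by
  have h0 : ∀ q z, (0 : Coeffs d (k + 3) hδ).1 q z = 0 := fun _ _ => rfl
  have h1 : ∀ q z, (0 : Coeffs d (k + 3) hδ).2.1 q z = 0 := fun _ _ => rfl
  have h2 : ∀ y, (0 : Coeffs d (k + 3) hδ).2.2 y = 0 := fun _ => rfl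
  have h3 : ∀ q z, CM.D ((0 : Coeffs d (k + 3) hδ).1 q) z = 0 := fun q z => by
    rw [show (0 : Coeffs d (k + 3) hδ).1 q = 0 from rfl, map_zero]
    rfl
  have h4 : ∀ q z, CM.D ((0 : Coeffs d (k + 3) hδ).2.1 q) z = 0 := fun q z => by
    rw [show (0 : Coeffs d (k + 3) hδ).2.1 q = 0 from rfl, map_zero]
    rfl
  have h5 : ∀ z, CM.D ((0 : Coeffs d (k + 3) hδ).2.2) z = 0 := fun z => by
    rw [show (0 : Coeffs d (k + 3) hδ).2.2 = 0 from rfl, map_zero]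
    rfl
  refine ⟨sg_pow_mul_cancel 1 ?_, sg_pow_mul_cancel (d - 1) ?_, ?_⟩
  · ext t
    rw [pow_one, mul_zero, Hol.mul_apply, sg_mul_pertW _ rfl hd hv, theta]
    simp only [h0, h1, h2, mul_zero, Finset.sum_const_zero, Complex.ofReal_zero, add_zero]
    rfl
  · ext t
    rw [mul_zero, Hol.mul_apply, Hol.pow_apply, sg_mul_pertB _ hd hv, thetaZ]
    simp only [h0, h1, h3, h4, map_zero, mul_zero, Finset.sum_const_zero, add_zero]
    rfl
  · ext t
    rw [pertY_apply _ hv, thetaY]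
    simp only [h1, h4, h5, map_zero, mul_zero, Finset.sum_const_zero, add_zero]
    rfl

end Base

end KStat

end

noncomputable section

namespace KStat

open Real Filter Topology ComplexConjugate

section Unipotent

/-- A unipotent triangular map is invertible. -/
theorem exists_equiv_of_unipotent {Y₁ Y₂ Y₃ : Type*} [NormedAddCommGroup Y₁] [NormedSpace ℝ Y₁]
    [NormedAddCommGroup Y₂] [NormedSpace ℝ Y₂] [NormedAddCommGroup Y₃] [NormedSpace ℝ Y₃]
    (D : Y₁ × Y₂ × Y₃ →L[ℝ] Y₁ × Y₂ × Y₃) (h1 : ∀ v, (D v).1 = v.1)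
    (h2 : ∀ v, v.1 = 0 → (D v).2.1 = v.2.1) (h3 : ∀ v, v.1 = 0 → v.2.1 = 0 → D v = v) :
    ∃ A : (Y₁ × Y₂ × Y₃) ≃L[ℝ] (Y₁ × Y₂ × Y₃), ∀ v, D v = A v := by
  obtain ⟨N, hN⟩ : ∃ N, N = D - ContinuousLinearMap.id ℝ _ := ⟨_, rfl⟩
  have hNv : ∀ v, N v = D v - v := fun v => by
    rw [hN]
    rfl
  have hDv : ∀ v, D v = v + N v := fun v => by rw [hNv, add_sub_cancel]
  have e1 : ∀ v, (N v).1 = 0 := fun v => by rw [hNv, Prod.fst_sub, h1, sub_self]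
  have e2 : ∀ v, (N (N v)).2.1 = 0 := fun v => by
    rw [hNv (N v), Prod.snd_sub, Prod.fst_sub, h2 _ (e1 v), sub_self]
  have e3 : ∀ v, N (N (N v)) = 0 := fun v => by
    rw [hNv (N (N v)), h3 _ (e1 _) (e2 v), sub_self]
  refine ⟨ContinuousLinearEquiv.equivOfInverse D (ContinuousLinearMap.id ℝ _ - N + N.comp N)
    (fun v => ?_) (fun v => ?_), fun v => rfl⟩
  · change D v - N (D v) + N (N (D v)) = v
    rw [hDv, map_add, map_add, e3]
    abel
  · change D (v - N v + N (N v)) = v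
    rw [hDv, map_add, map_sub, e3]
    abel

end Unipotent

section Derivative

open Hol

variable {k : ℕ} {α : ℝ} [Exponent α] {d : ℕ} {δ : ℝ} {hδ : 0 < δ} {k₀ : ℕ} {a : ℕ → ℂ}

theorem Hol.E_mul_E (m n : ℤ) : (E m * E n : Hol k α ℂ) = E (m + n) := by
  ext t
  exact (ex_add m n t).symm

theorem Hol.neg_E_pow (n : ℕ) : ((-E (-1)) ^ n : Hol k α ℂ) = const ((-1) ^ n) * E (-n) := by
  ext t
  rw [Hol.pow_apply, Hol.neg_apply, neg_pow, Hol.mul_apply, E_apply, E_apply, Hol.const_apply,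
    ← conj_ex, ← map_pow, ex_pow, conj_ex]

theorem barH_apply (v : Vec k α) : barH v = -E (-1) * cj (projH v) := rfl

theorem barH_baseVec : barH (baseVec d k₀ a k α) = -E (-1) := by
  rw [barH_apply, projH_baseVec]
  ext t
  simp

theorem isHolo_modelB_baseVec (hlt : k₀ < d) :
    IsHolo (E k₀ * modelB d k₀ a (baseVec d k₀ a k α)) := by
  rw [modelB, projH_baseVec, barH_baseVec, Finset.mul_sum]
  refine IsHolo.sum fun j hj => ?_
  rw [Finset.mem_Icc] at hj
  have e : (E k₀ * (const (a j) * ((j : Hol k α ℂ) * 1 ^ (j - 1)) * (-E (-1)) ^ (d - j)) : Hol k α ℂ) =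
      const (a j * j * (-1) ^ (d - j)) * E (k₀ + -(d - j : ℕ)) := by
    rw [neg_E_pow, ← E_mul_E]
    ext t
    simp only [Hol.mul_apply, Hol.const_apply, Hol.natCast_apply,
      one_pow, mul_one]
    ring
  rw [e]
  exact isHolo_const_mul_E _ (by omega)

/-- The holomorphic coefficient of the linearization of `P_z`. -/
def linCoeff (d k₀ : ℕ) (a : ℕ → ℂ) (k : ℕ) (α : ℝ) [Exponent α] : Hol k α ℂ :=
  ∑ j ∈ Finset.Icc (d - k₀) k₀, const (a j * j * (j - 1 : ℕ) * (-1) ^ (d - j)) * E (k₀ + -(d - j : ℕ))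

theorem isHolo_linCoeff (hlt : k₀ < d) : IsHolo (linCoeff d k₀ a k α) := by
  refine IsHolo.sum fun j hj => isHolo_const_mul_E _ ?_
  rw [Finset.mem_Icc] at hj
  omega

theorem hasDerivAt_modelB (f : LeviFactor d k₀ a k) (h : IsModel d k₀ a) (v : Vec k α) :
    HasDerivAt (fun s : ℝ => E k₀ * modelB d k₀ a (baseVec d k₀ a k α + s • v))
      (linCoeff d k₀ a k α * projH v + f.κ • (E ((k₀ : ℤ) - (d / 2 : ℕ)) * (f.qH * cj (f.qH * projH v)))) 0 := by
  have h1 : HasDerivAt (fun s : ℝ => projH (baseVec d k₀ a k α + s • v)) (projH v) 0 := by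
    have e : (fun s : ℝ => projH (baseVec d k₀ a k α + s • v)) = fun s : ℝ => 1 + s • projH v := by
      funext s
      rw [map_add, map_smul, projH_baseVec]
    rw [e]
    simpa using ((hasDerivAt_id (0 : ℝ)).smul_const (projH v)).const_add 1
  have h2 : HasDerivAt (fun s : ℝ => barH (baseVec d k₀ a k α + s • v)) (barH v) 0 := by
    have e : (fun s : ℝ => barH (baseVec d k₀ a k α + s • v)) = fun s : ℝ => -E (-1) + s • barH v := by
      funext s
      rw [map_add, map_smul, barH_baseVec]
    rw [e]
    simpa using ((hasDerivAt_id (0 : ℝ)).smul_const (barH v)).const_add (-E (-1))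
  have h3 : HasDerivAt (fun s : ℝ => E k₀ * modelB d k₀ a (baseVec d k₀ a k α + s • v))
      (E k₀ * ∑ j ∈ Finset.Icc (d - k₀) k₀,
        (const (a j) * ((j : Hol k α ℂ) * (((j - 1 : ℕ) : Hol k α ℂ) * 1 ^ (j - 1 - 1) * projH v)) *
          (-E (-1)) ^ (d - j) + const (a j) * ((j : Hol k α ℂ) * 1 ^ (j - 1)) *
          (((d - j : ℕ) : Hol k α ℂ) * (-E (-1)) ^ (d - j - 1) * barH v))) 0 := by
    refine HasDerivAt.const_mul _ (HasDerivAt.fun_sum fun j _ => ?_)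
    have h4 := (((h1.pow (j - 1)).const_mul (j : Hol k α ℂ)).const_mul (const (a j))).mul
      (h2.pow (d - j))
    simp only [zero_smul, add_zero, projH_baseVec, barH_baseVec, Pi.pow_apply] at h4
    exact h4
  refine h3.congr_deriv ?_
  have hlt := h.lt
  have e1 : ∀ t, f.κ * (f.q t * conj (f.q t)) = leviCircle d k₀ a t := fun t => (f.eq t).symm
  ext t
  simp only [linCoeff, Hol.mul_apply, Hol.sum_apply, Hol.add_apply, Hol.smul_apply, Hol.const_apply, E_apply,
    Hol.natCast_apply, one_pow, mul_one, cj_apply, Complex.real_smul,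
    neg_E_pow, barH_apply, Hol.neg_apply]
  have e2 : (f.κ : ℂ) * (ex ((k₀ : ℤ) - (d / 2 : ℕ)) t * ((f.qH : Hol k α ℂ) t *
      conj ((f.qH : Hol k α ℂ) t * projH v t))) =
      leviCircle d k₀ a t * (ex ((k₀ : ℤ) - (d / 2 : ℕ)) t * conj (projH v t)) := by
    rw [← e1, map_mul]
    change (f.κ : ℂ) * (_ * (f.q t * (conj (f.q t) * _))) = _
    ring
  rw [e2, leviCircle, Finset.sum_mul, Finset.sum_mul, Finset.mul_sum, ← Finset.sum_add_distrib]
  refine Finset.sum_congr rfl fun j hj => ?_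
  rw [Finset.mem_Icc] at hj
  have e3 : ex ((k₀ : ℤ) + -(d - j : ℕ)) t = ex k₀ t * ex (-(d - j : ℕ)) t := ex_add _ _ t
  have e4 : ex ((j : ℤ) - (d / 2 : ℕ)) t * ex ((k₀ : ℤ) - (d / 2 : ℕ)) t =
      ex k₀ t * (ex (-(d - j - 1 : ℕ)) t * ex (-1) t) := by
    obtain ⟨m, hm⟩ := even_degree h
    rw [← ex_add, ← ex_add, ← ex_add]
    congr 1
    omega
  have e5 : (-1 : ℂ) ^ (d - j) = -(-1) ^ (d - j - 1) := by
    rw [show d - j = d - j - 1 + 1 by omega, pow_succ, Nat.add_sub_cancel]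
    ring
  rw [e3]
  linear_combination (-(a j * j * (d - j : ℕ) * conj (projH v t))) *
    ((-1) ^ (d - j) * e4 + ex k₀ t * (ex (-(d - j - 1 : ℕ)) t * ex (-1) t) * e5)

namespace LeviFactor

variable (f : LeviFactor d k₀ a k)

/-- The second component of the defect of the model. -/
def modelDefectQ (v : Vec k α) : Hol k α ℂ :=
  f.κ • (E ((k₀ : ℤ) - (d / 2 : ℕ)) * cj (anti (f.rH * (E k₀ * projC v * modelB d k₀ a v)))) +
    trunc ((k₀ : ℤ) - (d / 2 : ℕ)) (f.qH * (projH v - 1))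

theorem defect_zero (hd : 0 < d) {v : Vec k α} (hv : v ∈ domain k α δ) :
    f.defect (0 : Coeffs d (k + 3) hδ) v = (v.1, szegoHolo (f.rH * f.modelDefectQ v),
      szegoHolo (projG v - (2 : ℝ) • szego (modelW d k₀ a v))) := by
  obtain ⟨hW, hB, hY⟩ := pert_zero (hδ := hδ) hd hv
  have h1 : defectC k₀ (0 : Coeffs d (k + 3) hδ) v = v.1 := by
    rw [defectC, hY, mul_zero, mul_zero, map_zero, mul_zero, smul_zero, map_zero, add_zero]
  rw [defect, h1, defectQ, totB, totW, hB, hW, add_zero, add_zero, modelDefectQ]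

theorem linear_identity {A u : Hol k α ℂ} (hA : IsHolo A) (hu : IsHolo u) :
    f.rH * (f.κ • (E ((k₀ : ℤ) - (d / 2 : ℕ)) * cj (anti (f.rH * (A * u +
      f.κ • (E ((k₀ : ℤ) - (d / 2 : ℕ)) * (f.qH * cj (f.qH * u))))))) +
        trunc ((k₀ : ℤ) - (d / 2 : ℕ)) (f.qH * u)) = u := by
  obtain ⟨M, hM⟩ : ∃ M : ℤ, M = (k₀ : ℤ) - (d / 2 : ℕ) := ⟨_, rfl⟩
  obtain ⟨w, hw⟩ : ∃ w, w = f.qH * u := ⟨_, rfl⟩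
  rw [← hM, ← hw]
  have hwh : IsHolo w := hw ▸ f.isHolo_qH.mul hu
  have h1 : f.rH * (A * u + f.κ • (E M * (f.qH * cj w))) = f.rH * (A * u) + f.κ • (E M * cj w) := by
    rw [mul_add, mul_smul_comm, mul_left_comm f.rH (E M), ← mul_assoc f.rH f.qH, rH_mul_qH, one_mul]
  have h2 : anti (f.rH * (A * u)) = 0 := anti_eq_zero_iff.2 (f.isHolo_rH.mul (hA.mul hu))
  have h3 : f.κ • (E M * cj (f.κ • anti (E M * cj w))) + trunc M w = w := by
    rw [map_smul, mul_smul_comm, smul_smul, f.sign, one_smul]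
    refine Hol.eq_of_fc fun n => ?_
    rw [Hol.fc_add, fc_E_mul, fc_cj, fc_anti, fc_trunc, fc_E_mul, fc_cj]
    rw [show -(-(n - M) - M) = n by ring]
    by_cases hn : n ≤ M
    · rw [if_pos (by omega), if_pos hn, map_zero, zero_add]
    · rw [if_neg (by omega), if_neg hn, add_zero, Complex.conj_conj]
  rw [h1, map_add, h2, zero_add, map_smul, h3, hw, ← mul_assoc, rH_mul_qH, one_mul]

theorem hasDerivAt_modelDefectQ (h : IsModel d k₀ a) {v : Vec k α} (hv : v.1 = 0) :
    HasDerivAt (fun s : ℝ => szego (f.rH * f.modelDefectQ (baseVec d k₀ a k α + s • v)))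
      (projH v) 0 := by
  obtain ⟨L, hL⟩ : ∃ L : Hol k α ℂ →L[ℝ] Hol k α ℂ,
      ∀ w, L w = f.rH * (f.κ • (E ((k₀ : ℤ) - (d / 2 : ℕ)) * cj (anti (f.rH * w)))) :=
    ⟨(ContinuousLinearMap.mul ℝ (Hol k α ℂ) f.rH).comp
      (f.κ • (ContinuousLinearMap.mul ℝ (Hol k α ℂ) (E ((k₀ : ℤ) - (d / 2 : ℕ)))).comp
        (cj.comp (anti.comp (ContinuousLinearMap.mul ℝ (Hol k α ℂ) f.rH)))), fun _ => rfl⟩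
  obtain ⟨L', hL'⟩ : ∃ L' : Hol k α ℂ →L[ℝ] Hol k α ℂ,
      ∀ w, L' w = f.rH * trunc ((k₀ : ℤ) - (d / 2 : ℕ)) (f.qH * w) :=
    ⟨(ContinuousLinearMap.mul ℝ (Hol k α ℂ) f.rH).comp ((trunc _).comp
      (ContinuousLinearMap.mul ℝ (Hol k α ℂ) f.qH)), fun _ => rfl⟩
  have hc : ∀ s : ℝ, projC (baseVec d k₀ a k α + s • v) = 1 := by
    intro s
    rw [map_add, map_smul, projC_baseVec, projC_apply v, hv, map_zero, smul_zero, add_zero]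
  have e : (fun s : ℝ => szego (f.rH * f.modelDefectQ (baseVec d k₀ a k α + s • v))) = fun s : ℝ =>
      szego (L (E k₀ * modelB d k₀ a (baseVec d k₀ a k α + s • v)) + s • L' (projH v)) := by
    funext s
    rw [modelDefectQ, hc, mul_one, mul_add, hL, map_add projH, map_smul projH, projH_baseVec,
      add_sub_cancel_left, ← map_smul L', hL']
  rw [e]
  have h1 := L.hasFDerivAt.comp_hasDerivAt (0 : ℝ) (hasDerivAt_modelB f h v)
  have h2 : HasDerivAt (fun s : ℝ => s • L' (projH v)) (L' (projH v)) 0 := by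
    simpa using (hasDerivAt_id (0 : ℝ)).smul_const (L' (projH v))
  refine (szego.hasFDerivAt.comp_hasDerivAt (0 : ℝ) (h1.add h2)).congr_deriv ?_
  have hu : IsHolo (projH v) := mem_holo.1 v.2.1.2
  rw [hL, hL', ← mul_add, f.linear_identity (isHolo_linCoeff h.lt) hu, szego_eq_self_iff]
  exact hu

theorem projG_baseVec (h : IsModel d k₀ a) : projG (baseVec d k₀ a k α) =
    (2 : ℝ) • szego (modelW d k₀ a (baseVec d k₀ a k α)) := by
  have hW : ∀ t, (sg : Hol k α ℂ) t * modelW d k₀ a (baseVec d k₀ a k α) t =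
      modelPoly d k₀ a (1 - (Circle.exp t : ℂ)) := fun t => by
    rw [sg_mul_modelW d k₀ a h.lt, compH_baseVec]
  refine (re_sg_mul_eq_iff (mem_holo.1 (baseVec d k₀ a k α).2.2.2) fun t => ?_).1 fun t => ?_
  · rw [hW, modelPoly_im h]
  · rw [hW, ← ofReal_modelPoly_re h, ← gZero_re h, ← compG_baseVec (k := k) (α := α)]
    rfl

theorem defect_baseVec (h : IsModel d k₀ a) (M : ℕ)
    (hf₀ : ∀ ζ : ℂ, ‖ζ‖ ≤ 1 → (1 - ζ, gZero d k₀ a ζ) ∈ bidisc δ) :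
    f.defect (0 : Coeffs d (k + 3) hδ) (baseVec d k₀ a k α) = f.solution M ((1, 0), 0) := by
  have h1 : (trigPoly k₀ (1, 0) : Hol k α ℝ) = const 1 := by
    ext t
    have h2 := congrArg (fun u : Hol k α ℂ => u t) (ofR_trigPoly (k := k) (α := α) (k₀ := k₀) (1, 0))
    simp only [ofR_apply, Hol.add_apply, Hol.sum_apply, Hol.mul_apply, Hol.const_apply, E_apply,
      cj_apply, ex_zero, mul_one, Pi.zero_apply, zero_mul, map_zero, add_zero,
      Finset.sum_const_zero] at h2
    exact Complex.ofReal_injective h2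
  have h3 : f.modelDefectQ (baseVec d k₀ a k α) = 0 := by
    have h4 : anti (f.rH * (E k₀ * modelB d k₀ a (baseVec d k₀ a k α))) = 0 :=
      anti_eq_zero_iff.2 (f.isHolo_rH.mul (isHolo_modelB_baseVec h.lt))
    rw [modelDefectQ, projC_baseVec, mul_one, h4, projH_baseVec, sub_self, mul_zero, map_zero,
      map_zero, mul_zero, smul_zero, add_zero]
  have hd : 0 < d := by have := h.lt; omega
  rw [f.defect_zero hd (baseVec_mem_domain hf₀), h3, solution_apply, h1, projG_baseVec h, sub_self,
    mul_zero, map_zero, map_zero, mul_zero, map_zero]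
  rfl

/-- The linearization of the equations at the initial lift is invertible. -/
theorem exists_equiv_fderiv (h : IsModel d k₀ a) {Φ : Vec k α → Vec k α} {D : Vec k α →L[ℝ] Vec k α}
    (hD : HasFDerivAt Φ D (baseVec d k₀ a k α))
    (hΦ : Φ =ᶠ[𝓝 (baseVec d k₀ a k α)] fun v => (v.1, szegoHolo (f.rH * f.modelDefectQ v),
      szegoHolo (projG v - (2 : ℝ) • szego (modelW d k₀ a v)))) :
    ∃ A : Vec k α ≃L[ℝ] Vec k α, ∀ v, D v = A v := by
  have hline : ∀ v : Vec k α, HasDerivAt (fun s : ℝ => baseVec d k₀ a k α + s • v) v 0 := fun v => by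
    simpa using ((hasDerivAt_id (0 : ℝ)).smul_const v).const_add (baseVec d k₀ a k α)
  have hDv : ∀ v : Vec k α, HasDerivAt (fun s : ℝ =>
      (((baseVec d k₀ a k α + s • v).1, szegoHolo (f.rH * f.modelDefectQ (baseVec d k₀ a k α + s • v)),
      szegoHolo (projG (baseVec d k₀ a k α + s • v) -
        (2 : ℝ) • szego (modelW d k₀ a (baseVec d k₀ a k α + s • v)))) : Vec k α)) (D v) 0 := by
    intro v
    have h1 := hD.congr_of_eventuallyEq hΦ.symm
    exact h1.comp_hasDerivAt_of_eq (0 : ℝ) (hline v) (by rw [zero_smul, add_zero])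
  refine exists_equiv_of_unipotent D (fun v => ?_) (fun v hv => ?_) (fun v hv hv' => ?_)
  · have h1 := (ContinuousLinearMap.fst ℝ (Hol k α ℝ) (holo k α × holo k α)).hasFDerivAt.comp_hasDerivAt
      (0 : ℝ) (hDv v)
    have h2 := (ContinuousLinearMap.fst ℝ (Hol k α ℝ) (holo k α × holo k α)).hasFDerivAt.comp_hasDerivAt
      (0 : ℝ) (hline v)
    exact h1.unique h2
  · have h1 := (projH (k := k) (α := α)).hasFDerivAt.comp_hasDerivAt (0 : ℝ) (hDv v)
    exact Subtype.ext (h1.unique (f.hasDerivAt_modelDefectQ h hv))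
  · have h1 := (projH (k := k) (α := α)).hasFDerivAt.comp_hasDerivAt (0 : ℝ) (hDv v)
    have h2 := (ContinuousLinearMap.fst ℝ (Hol k α ℝ) (holo k α × holo k α)).hasFDerivAt.comp_hasDerivAt
      (0 : ℝ) (hDv v)
    have h3 := (ContinuousLinearMap.fst ℝ (Hol k α ℝ) (holo k α × holo k α)).hasFDerivAt.comp_hasDerivAt
      (0 : ℝ) (hline v)
    have h4 := (projG (k := k) (α := α)).hasFDerivAt.comp_hasDerivAt (0 : ℝ) (hDv v)
    have hH : ∀ s : ℝ, projH (baseVec d k₀ a k α + s • v) = projH (baseVec d k₀ a k α) := fun s => by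
      rw [map_add, map_smul, projH_apply v, hv', ZeroMemClass.coe_zero, smul_zero, add_zero]
    have h5 : HasDerivAt (fun s : ℝ => szego (projG (baseVec d k₀ a k α + s • v) -
        (2 : ℝ) • szego (modelW d k₀ a (baseVec d k₀ a k α + s • v)))) (projG v) 0 := by
      have e : ∀ s : ℝ, modelW d k₀ a (baseVec d k₀ a k α + s • v) =
          modelW d k₀ a (baseVec d k₀ a k α) := fun s => by
        simp only [modelW, barH_apply, hH]
      simp only [e]
      refine (szego.hasFDerivAt.comp_hasDerivAt (0 : ℝ) ((projG.hasFDerivAt.comp_hasDerivAt (0 : ℝ)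
        (hline v)).sub_const _)).congr_deriv ?_
      exact szego_eq_self_iff.2 (mem_holo.1 v.2.2.2)
    refine Prod.ext (h2.unique h3) (Prod.ext ?_ (Subtype.ext (h4.unique h5)))
    exact Subtype.ext (h1.unique (f.hasDerivAt_modelDefectQ h hv))

end LeviFactor

end Derivative

end KStat

end

noncomputable section

namespace KStat

open Real Filter Topology ComplexConjugate

section Abstract

variable {A B X Y Z : Type*} [NormedAddCommGroup A] [NormedSpace ℝ A] [NormedAddCommGroup B]
  [NormedSpace ℝ B] [NormedAddCommGroup X] [NormedSpace ℝ X] [NormedAddCommGroup Y]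
  [NormedSpace ℝ Y] [NormedAddCommGroup Z] [NormedSpace ℝ Z]

theorem contDiffOn_of_lift (S : A →L[ℝ] B) (pr : A →L[ℝ] X) {C : ℝ} (hC : 1 ≤ C)
    (hpr : ∀ x, ∃ a, pr a = x ∧ ‖a‖ ≤ C * ‖x‖) {O : Set Y} (hO : IsOpen O) {F : X × Y → Z}
    {G : B × Y → Z} (hG : ContDiffOn ℝ 1 G (Set.univ ×ˢ O))
    (h : ∀ a, ∀ y ∈ O, F (pr a, y) = G (S a, y)) : ContDiffOn ℝ 1 F (Set.univ ×ˢ O) := by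
  refine contDiffOn_of_comp_quotient pr hC hpr hO ?_
  have h1 : ContDiffOn ℝ 1 (fun p : A × Y => G (S p.1, p.2)) (Set.univ ×ˢ O) :=
    hG.comp (f := fun p : A × Y => (S p.1, p.2))
      (S.prodMap (ContinuousLinearMap.id ℝ Y)).contDiff.contDiffOn fun p hp => ⟨trivial, hp.2⟩
  exact h1.congr fun p hp => h _ _ hp.2

theorem hasFDerivAt_partial {O : Set Y} (hO : IsOpen O) {F : X × Y → Z}
    (hF : ContDiffOn ℝ 1 F (Set.univ ×ˢ O)) (x : X) {y : Y} (hy : y ∈ O) :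
    HasFDerivAt (fun y => F (x, y)) ((fderiv ℝ F (x, y)).comp (ContinuousLinearMap.inr ℝ X Y)) y :=
  ((hF.contDiffAt ((isOpen_univ.prod hO).mem_nhds ⟨trivial, hy⟩)).differentiableAt
      one_ne_zero).hasFDerivAt.comp y (hasFDerivAt_prodMk_right x y)

end Abstract

section Family

open Hol

variable {k : ℕ} {α : ℝ} [Exponent α] {d : ℕ} {δ : ℝ} {hδ : 0 < δ} {k₀ : ℕ} {a : ℕ → ℂ}

/-- An admissible family of coefficients of a perturbation. -/
def coeffs (x : Perturbation d (k + 3) hδ) : ↥(admissible d (k + 3) hδ) :=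
  (exists_mkPerturbation x).choose

theorem mkPerturbation_coeffs (x : Perturbation d (k + 3) hδ) : mkPerturbation (coeffs x) = x :=
  (exists_mkPerturbation x).choose_spec.1

theorem coeffs_zero : coeffs (0 : Perturbation d (k + 3) hδ) = 0 := by
  have h : ‖coeffs (0 : Perturbation d (k + 3) hδ)‖ ≤ 2 * ‖(0 : Perturbation d (k + 3) hδ)‖ :=
    (exists_mkPerturbation (0 : Perturbation d (k + 3) hδ)).choose_spec.2
  rw [norm_zero, mul_zero] at h
  exact norm_le_zero_iff.1 h

namespace LeviFactor

variable (f : LeviFactor d k₀ a k)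

theorem defect_congr (h : IsModel d k₀ a) {e e' : ↥(admissible d (k + 3) hδ)}
    (he : mkPerturbation e = mkPerturbation e') {v : Vec k α} (hv : v ∈ domain k α δ) :
    f.defect e.1 v = f.defect e'.1 v := by
  obtain ⟨hW, hB, hY⟩ := congr_of_mkPerturbation h he hv
  rw [defect, defect, defectC, defectC, defectQ, defectQ, hW, hB, hY]

/-- The defect as a function of the perturbation. -/
def defectX (p : Perturbation d (k + 3) hδ × Vec k α) : Vec k α := f.defect (coeffs p.1).1 p.2

theorem contDiffOn_defectX (h : IsModel d k₀ a) : ContDiffOn ℝ 1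
    (f.defectX : Perturbation d (k + 3) hδ × Vec k α → Vec k α) (Set.univ ×ˢ domain k α δ) :=
  contDiffOn_of_lift (admissible d (k + 3) hδ).subtypeL mkPerturbation one_le_two
    exists_mkPerturbation (isOpen_domain δ) f.contDiffOn_defect
    fun _ _ hv => f.defect_congr h (mkPerturbation_coeffs _) hv

theorem defectX_zero (h : IsModel d k₀ a) {v : Vec k α} (hv : v ∈ domain k α δ) :
    f.defectX ((0 : Perturbation d (k + 3) hδ), v) = (v.1, szegoHolo (f.rH * f.modelDefectQ v),
      szegoHolo (projG v - (2 : ℝ) • szego (modelW d k₀ a v))) := by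
  have hd : 0 < d := by have := h.lt; omega
  rw [defectX, coeffs_zero]
  exact f.defect_zero hd hv

theorem exists_equiv_defectX (h : IsModel d k₀ a)
    (hf₀ : ∀ ζ : ℂ, ‖ζ‖ ≤ 1 → (1 - ζ, gZero d k₀ a ζ) ∈ bidisc δ) :
    ∃ A : Vec k α ≃L[ℝ] Vec k α, ∀ v, fderiv ℝ
      (f.defectX : Perturbation d (k + 3) hδ × Vec k α → Vec k α) (0, baseVec d k₀ a k α) (0, v) = A v := by
  have hmem := baseVec_mem_domain (k := k) (α := α) hf₀
  obtain ⟨A, hA⟩ := f.exists_equiv_fderiv h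
    (hasFDerivAt_partial (isOpen_domain δ) (f.contDiffOn_defectX (hδ := hδ) h) 0 hmem) (by
      filter_upwards [(isOpen_domain δ).mem_nhds hmem] with v hv
      exact f.defectX_zero h hv)
  exact ⟨A, hA⟩

end LeviFactor

instance : Nontrivial (Vec k α) := by
  have h : (const 1 : Hol k α ℝ) ≠ 0 := fun h => by
    have h1 := congrArg (fun u : Hol k α ℝ => u 0) h
    exact one_ne_zero h1
  have : Nontrivial (Hol k α ℝ) := ⟨⟨_, _, h⟩⟩
  infer_instance

theorem finrank_param (k₀ M : ℕ) : Module.finrank ℝ (Param k₀ M) = 1 + k₀ * 2 + (M + 1) * 2 := by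
  simp [Module.finrank_prod, Module.finrank_pi_fintype, Complex.finrank_real_complex]

/-- The family of lifts of stationary discs. -/
theorem exists_lift_family (h : IsModel d k₀ a)
    (hf₀ : ∀ ζ : ℂ, ‖ζ‖ ≤ 1 → (1 - ζ, gZero d k₀ a ζ) ∈ bidisc δ) :
    ∃ (V : Set (Perturbation d (k + 3) hδ)) (η : ℝ)
      (F : Perturbation d (k + 3) hδ × EuclideanSpace ℝ (Fin (4 * k₀ - d + 3)) → Vec k α),
      IsOpen V ∧ 0 ∈ V ∧ 0 < η ∧ ContDiffOn ℝ 1 F (V ×ˢ Set.univ) ∧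
      F (0, 0) = baseVec d k₀ a k α ∧
      ∀ x ∈ V, Set.BijOn (fun t => F (x, t)) Set.univ
        {v | toY v ∈ tiedLifts k α k₀ (bidisc δ) (defFun k₀ a x) ∧
          normVec k α (v - baseVec d k₀ a k α) < η} := by
  obtain ⟨f⟩ := exists_leviFactor h k
  have hlt := h.lt
  have hle := h.half_le
  obtain ⟨m, hm⟩ := even_degree h
  obtain ⟨M, hM⟩ : ∃ M : ℕ, M = k₀ - d / 2 := ⟨_, rfl⟩
  have hM' : (M : ℤ) = k₀ - (d / 2 : ℕ) := by omega
  obtain ⟨β, hβ⟩ : ∃ β, β = (1 + α) / 2 := ⟨_, rfl⟩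
  have hα₁ := Exponent.lt_one (α := α)
  have hα₀ := Exponent.pos (α := α)
  have hαβ : α < β := by linarith
  have : Exponent β := ⟨by linarith, by linarith⟩
  have hdim : Module.finrank ℝ (EuclideanSpace ℝ (Fin (4 * k₀ - d + 3))) =
      Module.finrank ℝ (Param k₀ M) := by
    rw [finrank_param, finrank_euclideanSpace_fin]
    omega
  obtain ⟨A, hA⟩ := f.exists_equiv_defectX (α := α) (hδ := hδ) h hf₀
  obtain ⟨A', hA'⟩ := f.exists_equiv_defectX (α := β) (hδ := hδ) h hf₀
  have hτ : Function.Injective ((f.solution M : Param k₀ M →L[ℝ] Vec k β).comp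
      (ContinuousLinearEquiv.ofFinrankEq hdim).toContinuousLinearMap) :=
    (f.solution_injective M).comp (ContinuousLinearEquiv.ofFinrankEq hdim).injective
  refine exists_family (normVec k α) continuous_normVec exists_norming
    (c := (15 ^ k : ℝ)⁻¹) (by positivity) norm_le_normVec (inclVec hαβ.le)
    (inclVec_injective hαβ.le) (totallyBounded_inclVec hαβ) (isOpen_domain δ) (isOpen_domain δ)
    (f.contDiffOn_defectX h) (f.contDiffOn_defectX h)
    (fun x v hv => f.incl_defect hαβ.le h (coeffs x) hv)
    (y₀ := baseVec d k₀ a k β) (z₀ := f.solution M ((1, 0), 0)) (baseVec_mem_domain hf₀)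
    (baseVec_mem_domain hf₀) ?_ A hA A' hA' _ hτ
    (S := fun x => {v | toY v ∈ tiedLifts k α k₀ (bidisc δ) (defFun k₀ a x)}) ?_
  · rw [LeviFactor.defectX, coeffs_zero]
    exact f.defect_baseVec h M hf₀
  · intro x v hv
    have h1 := f.mem_tiedLifts_iff_defect h hM' (coeffs x) hv
    rw [mkPerturbation_coeffs] at h1
    refine h1.trans ?_
    constructor
    · rintro ⟨p, hp⟩
      refine ⟨(ContinuousLinearEquiv.ofFinrankEq hdim).symm p, ?_⟩
      rw [map_add, f.incl_solution]
      refine hp.trans (congrArg _ ?_)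
      refine (f.incl_solution hαβ.le M p).symm.trans (congrArg _ ?_)
      exact congrArg _ ((ContinuousLinearEquiv.ofFinrankEq hdim).apply_symm_apply p).symm
    · rintro ⟨t, ht⟩
      refine ⟨ContinuousLinearEquiv.ofFinrankEq hdim t, ?_⟩
      rw [map_add, f.incl_solution] at ht
      exact ht.trans (congrArg _ (f.incl_solution hαβ.le M _))

end Family

end KStat

end

theorem theorem3p1 (d k₀ : ℕ) (a : ℕ → ℂ) (hP : IsModel d k₀ a)
    (δ : ℝ) (hδ : 0 < δ)
    (hf₀ : ∀ ζ : ℂ, ‖ζ‖ ≤ 1 → (1 - ζ, gZero d k₀ a ζ) ∈ bidisc δ)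
    (k : ℕ) (α : ℝ) (hα₀ : 0 < α) (hα₁ : α < 1) :
    ∃ (V : Set (Perturbation d (k + 3) hδ))
      (U : Set (EuclideanSpace ℝ (Fin (4 * k₀ - d + 3))))
      (η : ℝ)
      (F : Perturbation d (k + 3) hδ × EuclideanSpace ℝ (Fin (4 * k₀ - d + 3)) → Y k α),
      IsOpen V ∧ 0 ∈ V ∧ IsOpen U ∧ 0 ∈ U ∧ 0 < η ∧
      ContDiffOn ℝ 1 F (V ×ˢ U) ∧
      F (0, 0) = baseLift d k₀ a k hα₁.le ∧
      ∀ x ∈ V, Set.BijOn (fun t => F (x, t)) U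
        {y : Y k α | y ∈ tiedLifts k α k₀ (bidisc δ) (defFun k₀ a x) ∧
          normY (y - baseLift d k₀ a k hα₁.le) < η} := by
  have : Exponent α := ⟨hα₀, hα₁⟩
  obtain ⟨V, η, F, hV, h0V, hη, hF, hF0, hbij⟩ := exists_lift_family (k := k) (α := α) (hδ := hδ) hP hf₀
  refine ⟨V, Set.univ, η, fun p => toY (F p), hV, h0V, isOpen_univ, trivial, hη,
    (toY (k := k) (α := α)).contDiff.comp_contDiffOn hF, ?_, fun x hx => ?_⟩
  · exact (congrArg toY hF0).trans (toY_baseVec hα₁.le)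
  · have h1 : Set.BijOn toY {v : Vec k α | toY v ∈ tiedLifts k α k₀ (bidisc δ) (defFun k₀ a x) ∧
        normVec k α (v - baseVec d k₀ a k α) < η}
        {y : Y k α | y ∈ tiedLifts k α k₀ (bidisc δ) (defFun k₀ a x) ∧
          normY (y - baseLift d k₀ a k hα₁.le) < η} := by
      have hn : ∀ v : Vec k α, normVec k α (v - baseVec d k₀ a k α) =
          normY (toY v - baseLift d k₀ a k hα₁.le) := fun v => by
        rw [normVec_apply, map_sub, toY_baseVec hα₁.le]
      refine ⟨fun v hv => ⟨hv.1, (hn v).symm.trans_lt hv.2⟩, toY_injective.injOn, fun y hy => ?_⟩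
      obtain ⟨v, rfl⟩ := toY_surjective y
      exact ⟨v, ⟨hy.1, (hn v).trans_lt hy.2⟩, rfl⟩
    exact h1.comp (hbij x hx)
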